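/- **Setting.** Let $\kappa,\lambda\in\mathbb R\setminus\{0\}$ and $T>0$. Put $\omega=\sqrt{1+\kappa^2}$, $c_g=\kappa/\omega$ and $\vartheta=\kappa c_g-\omega=-1/\omega$. Let $a_0,b_0:\mathbb R\to\mathbb C$ be smooth and supported in $[-R,R]$. Let $a^\pm:[0,T]\times\mathbb R\to\mathbb C$ solve $$\pm 2i\omega\,\partial_t a^\pm=-(1-c_g^2)\,\partial_\xi^2a^\pm+\lambda|a^\pm|^2a^\pm,\qquad a^\pm(0,\xi)=\tfrac12\bigl(a_0(\xi)\pm i\,b_0(\xi)/\omega\bigr).$$ For $0<\varepsilon\le1$ and $\tau,h>0$ put $\alpha=\vartheta\tau/\varepsilon^2$ and $\beta=\kappa h/\varepsilon$, and take the grid $t_n=n\tau$, $\xi_j=\xi_*+jh$ ($j\in\mathbb Z$) with an arbitrary offset $\xi_*\in\mathbb R$. The *weighted leapfrog scheme* for $p_j^n$ is $$\begin{aligned}&\varepsilon^2\frac{e^{-i\alpha}(1+i\alpha)p_j^{n+1}-2p_j^n+e^{i\alpha}(1-i\alpha)p_j^{n-1}}{\tau^2}-(1-c_g^2)\frac{e^{-i\beta}(1+i\beta)p_{j+1}^n-2p_j^n+e^{i\beta}(1-i\beta)p_{j-1}^n}{h^2}\\&-2\varepsilon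 c_g\Bigl(\frac{e^{-i\alpha}(e^{-i\beta}p_{j+1}^{n+1}-e^{i\beta}p_{j-1}^{n+1})-e^{i\alpha}(e^{-i\beta}p_{j+1}^{n-1}-e^{i\beta}p_{j-1}^{n-1})}{4\tau h}+\frac{i\beta(e^{-i\alpha}p_j^{n+1}-e^{i\alpha}p_j^{n-1})}{2\tau h}+\frac{i\alpha(e^{-i\beta}p_{j+1}^n-e^{i\beta}p_{j-1}^n)}{2\tau h}\Bigr)+\lambda|p_j^n|^2p_j^n=0,\end{aligned}$$ with $p^0_j=a^+(0,\xi_j)e^{i\kappa\xi_j/\varepsilon}$ and the weighted Euler starting step $$\Bigl(\frac{2\varepsilon^2}{\tau}-2i\omega\Bigr)\frac{e^{-i\alpha}p_j^1-p_j^0}{\tau}-(1-c_g^2)\frac{e^{-i\beta}p_{j+1}^0-2p_j^0+e^{i\beta}p_{j-1}^0}{h^2}+\lambda|p_j^0|^2p_j^0=0.$$ The *weighted Crank–Nicolson scheme* is obtained from it as follows. With $\breve p_j^n=\tfrac12(e^{-i\alpha}p_j^{n+1}+e^{i\alpha}p_j^{n-1})$, replace $p^n$ by $\breve p^n$ in the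 second fraction and in the $i\alpha$-fraction, and replace the nonlinear term by $\tfrac{\lambda}{2}(|p_j^{n+1}|^2+|p_j^{n-1}|^2)\breve p_j^n$. The initial values and the starting step are the same. The schemes for $q_j^n$ arise by replacing $\omega$ by $-\omega$ (hence $c_g,\vartheta,\alpha$ by their negatives) and $a^+$ by $a^-$. A *numerical solution* is a solution for $0\le n\tau\le T$ each of whose time levels is a bounded function of $j\in\mathbb Z$. The *stability condition* is $$2\kappa^2|\alpha|\le\beta^2\ \text{ if }|\beta|\ge1,\qquad |\kappa||\alpha|\le|\beta|\ \text{ if }|\beta|<1.$$ **Theorem.** There is an integer $N\ge2$ such that, for all $\kappa,\lambda,T,M,R$ as above, there is $\varepsilon_0\in(0,1]$ for which the following holds for all $a_0,b_0,a^\pm$ as above such that $a^\pm\in C^N$ with all derivatives of order $\le N$ bounded by $M$ on $[0,T]\times\mathbb R$. Write $$p_j^n=a^+(t,\xi)\,e^{i\kappa\xi/\varepsilon}e^{i\vartheta t/\varepsilon^2}+R^+(t,\xi),\qquad q_j^n=a^-(t,\xi)\,e^{i\kappa\xi/\varepsilon}e^{-i\vartheta t/\varepsilon^2}+R^-(t,\xi)\qquad(t=n\tau,\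 \xi=\xi_j).$$ 1. (Leapfrog.) If $0<\varepsilon\le\varepsilon_0$ and $\tau,h>0$ satisfy the stability condition, then numerical solutions $p_j^n$ and $q_j^n$ exist, and all of them satisfy $$|R^\pm(n\tau,\xi_j)|\le C(\tau^2+h^2+\varepsilon)\qquad(0\le n\tau\le T,\ j\in\mathbb Z).$$ 2. (Crank–Nicolson.) There are $K$ and $\tau_0>0$ such that for $0<\varepsilon\le\varepsilon_0$, $0<\tau\le\tau_0$ and every $h>0$ there are numerical solutions $p_j^n$ and $q_j^n$ with modulus at most $K$. Moreover, for every $K$ there is a constant $C$ such that, for all $0<\varepsilon\le1$ and all $\tau,h>0$ (no stability condition), all numerical solutions with modulus at most $K$ satisfy the same bound on $R^\pm$. The constants $\varepsilon_0,K,\tau_0$ and $C$ depend only on $\kappa,\lambda,T,M,R$ (and $C$ in part 2 also on $K$), but not on $\varepsilon,\tau,h,n,j,\xi_*$. -/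

import Mathlib

open Set

noncomputable section

/-- The frequency `ω = √(1 + κ²)`. The schemes and equations below take a signed frequency
`w`, which is `ω` for the quantities with superscript `+` and `-ω` for those with
superscript `-`. -/
def freq (κ : ℝ) : ℝ := Real.sqrt (1 + κ ^ 2)

/-- Group velocity `c_g = κ / w`. -/
def groupVel (κ w : ℝ) : ℝ := κ / w

/-- `ϑ = κ c_g - w`. -/
def vartheta (κ w : ℝ) : ℝ := κ * groupVel κ w - w

/-- `α = ϑ τ / ε²`. -/
def alphaPar (κ w ε τ : ℝ) : ℝ := vartheta κ w * τ / ε ^ 2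

/-- `β = κ h / ε`. -/
def betaPar (κ ε h : ℝ) : ℝ := κ * h / ε

/-- The CFL-type stability condition: `2κ²|α| ≤ β²` if `|β| ≥ 1`, and `|κ||α| ≤ |β|`
if `|β| < 1`. -/
def StabilityCondition (κ ε τ h : ℝ) : Prop :=
  (1 ≤ |betaPar κ ε h| →
    2 * κ ^ 2 * |alphaPar κ (freq κ) ε τ| ≤ betaPar κ ε h ^ 2) ∧
  (|betaPar κ ε h| < 1 →
    |κ| * |alphaPar κ (freq κ) ε τ| ≤ |betaPar κ ε h|)

/-- The initial profile `(a₀ + i b₀ / w) / 2`. -/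
def profile (w : ℝ) (a₀ b₀ : ℝ → ℂ) (ξ : ℝ) : ℂ :=
  (a₀ ξ + Complex.I * b₀ ξ / (w : ℂ)) / 2

/-- `a` solves `2 i w ∂ₜ a = -(1 - c_g²) ∂_ξ² a + λ |a|² a` on `[0,T] × ℝ`,
`a(0, ·) = (a₀ + i b₀ / w) / 2`. -/
structure IsNLSSolution (κ lam w T : ℝ) (a₀ b₀ : ℝ → ℂ) (a : ℝ → ℝ → ℂ) : Prop where
  init : ∀ ξ, a 0 ξ = profile w a₀ b₀ ξ
  eqn : ∀ t ∈ Icc (0 : ℝ) T, ∀ ξ : ℝ,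
    2 * Complex.I * (w : ℂ) * derivWithin (fun s => a s ξ) (Icc 0 T) t =
      -((1 - groupVel κ w ^ 2 : ℝ) : ℂ) * iteratedDeriv 2 (a t) ξ
        + (lam : ℂ) * ((‖a t ξ‖ ^ 2 : ℝ) : ℂ) * a t ξ

/-- `a` is `N` times continuously differentiable on `[0,T] × ℝ` and all its derivatives of
order at most `N` are bounded by `M` there. -/
def HasBoundedDerivs (N : ℕ) (M T : ℝ) (a : ℝ → ℝ → ℂ) : Prop :=
  ContDiffOn ℝ N (fun z : ℝ × ℝ => a z.1 z.2) (Icc 0 T ×ˢ univ) ∧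
  ∀ k : ℕ, k ≤ N → ∀ z ∈ Icc (0 : ℝ) T ×ˢ (univ : Set ℝ),
    ‖iteratedFDerivWithin ℝ k (fun z : ℝ × ℝ => a z.1 z.2) (Icc 0 T ×ˢ univ) z‖ ≤ M

/-- The assumptions on the data: smooth profiles `a₀`, `b₀` supported in `[-R, R]`, and the
solutions `a⁺`, `a⁻` of the two nonlinear Schrödinger initial value problems, with
derivatives up to order `N` bounded by `M`. -/
structure IsData (κ lam T : ℝ) (N : ℕ) (M R : ℝ) (a₀ b₀ : ℝ → ℂ)
    (aplus aminus : ℝ → ℝ → ℂ) : Prop where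
  smooth_a : ContDiff ℝ (⊤ : ℕ∞) a₀
  smooth_b : ContDiff ℝ (⊤ : ℕ∞) b₀
  supp_a : Function.support a₀ ⊆ Icc (-R) R
  supp_b : Function.support b₀ ⊆ Icc (-R) R
  nls_plus : IsNLSSolution κ lam (freq κ) T a₀ b₀ aplus
  nls_minus : IsNLSSolution κ lam (-freq κ) T a₀ b₀ aminus
  bdd_plus : HasBoundedDerivs N M T aplus
  bdd_minus : HasBoundedDerivs N M T aminus

/-- `e^{i x}`. -/
def cis (x : ℝ) : ℂ := Complex.exp (Complex.I * (x : ℂ))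

/-- Weighted second difference in time,
`(e^{-iα}(1+iα) p^{n+1} - 2 p^n + e^{iα}(1-iα) p^{n-1}) / τ²`;
arguments `pm, p, pp` stand for the values at the time levels `n-1, n, n+1`. -/
def timeDiff2 (α τ : ℝ) (pm p pp : ℂ) : ℂ :=
  (cis (-α) * (1 + Complex.I * (α : ℂ)) * pp - 2 * p
    + cis α * (1 - Complex.I * (α : ℂ)) * pm) / (τ : ℂ) ^ 2

/-- Weighted second difference in space,
`(e^{-iβ}(1+iβ) p_{j+1} - 2 p_j + e^{iβ}(1-iβ) p_{j-1}) / h²`. -/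
def spaceDiff2 (β h : ℝ) (p : ℤ → ℂ) (j : ℤ) : ℂ :=
  (cis (-β) * (1 + Complex.I * (β : ℂ)) * p (j + 1) - 2 * p j
    + cis β * (1 - Complex.I * (β : ℂ)) * p (j - 1)) / (h : ℂ) ^ 2

/-- Weighted mixed difference; `p` is the grid function entering the term with the
factor `iα`. -/
def mixedDiff (α β τ h : ℝ) (pm p pp : ℤ → ℂ) (j : ℤ) : ℂ :=
  (cis (-α) * (cis (-β) * pp (j + 1) - cis β * pp (j - 1))
      - cis α * (cis (-β) * pm (j + 1) - cis β * pm (j - 1))) / (4 * (τ : ℂ) * (h : ℂ))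
    + Complex.I * (β : ℂ) * (cis (-α) * pp j - cis α * pm j) / (2 * (τ : ℂ) * (h : ℂ))
    + Complex.I * (α : ℂ) * (cis (-β) * p (j + 1) - cis β * p (j - 1))
        / (2 * (τ : ℂ) * (h : ℂ))

/-- One step of the weighted leapfrog scheme. -/
def LeapfrogStep (κ lam w ε τ h : ℝ) (pm p pp : ℤ → ℂ) : Prop :=
  ∀ j : ℤ,
    (ε : ℂ) ^ 2 * timeDiff2 (alphaPar κ w ε τ) τ (pm j) (p j) (pp j)
      - ((1 - groupVel κ w ^ 2 : ℝ) : ℂ) * spaceDiff2 (betaPar κ ε h) h p j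
      - 2 * (ε : ℂ) * (groupVel κ w : ℂ)
          * mixedDiff (alphaPar κ w ε τ) (betaPar κ ε h) τ h pm p pp j
      + (lam : ℂ) * ((‖p j‖ ^ 2 : ℝ) : ℂ) * p j = 0

/-- The weighted time average `(e^{-iα} p^{n+1} + e^{iα} p^{n-1}) / 2`. -/
def timeAvg (α : ℝ) (pm pp : ℤ → ℂ) (j : ℤ) : ℂ :=
  (cis (-α) * pp j + cis α * pm j) / 2

/-- One step of the weighted Crank–Nicolson scheme. -/
def CrankNicolsonStep (κ lam w ε τ h : ℝ) (pm p pp : ℤ → ℂ) : Prop :=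
  ∀ j : ℤ,
    (ε : ℂ) ^ 2 * timeDiff2 (alphaPar κ w ε τ) τ (pm j) (p j) (pp j)
      - ((1 - groupVel κ w ^ 2 : ℝ) : ℂ)
          * spaceDiff2 (betaPar κ ε h) h (timeAvg (alphaPar κ w ε τ) pm pp) j
      - 2 * (ε : ℂ) * (groupVel κ w : ℂ)
          * mixedDiff (alphaPar κ w ε τ) (betaPar κ ε h) τ h pm
              (timeAvg (alphaPar κ w ε τ) pm pp) pp j
      + (lam : ℂ) * (((‖pp j‖ ^ 2 + ‖pm j‖ ^ 2) / 2 : ℝ) : ℂ)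
          * timeAvg (alphaPar κ w ε τ) pm pp j = 0

/-- The starting step, a weighted explicit Euler step (with `ν⁰ = 0`):
`(2ε²/τ - 2iw)(e^{-iα} p¹ - p⁰)/τ
  - (1-c_g²)(e^{-iβ} p⁰_{j+1} - 2 p⁰_j + e^{iβ} p⁰_{j-1})/h² + λ|p⁰|²p⁰ = 0`. -/
def StartingStep (κ lam w ε τ h : ℝ) (p0 p1 : ℤ → ℂ) : Prop :=
  ∀ j : ℤ,
    (2 * (ε : ℂ) ^ 2 / (τ : ℂ) - 2 * Complex.I * (w : ℂ))
        * ((cis (-alphaPar κ w ε τ) * p1 j - p0 j) / (τ : ℂ))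
      - ((1 - groupVel κ w ^ 2 : ℝ) : ℂ)
          * ((cis (-betaPar κ ε h) * p0 (j + 1) - 2 * p0 j
              + cis (betaPar κ ε h) * p0 (j - 1)) / (h : ℂ) ^ 2)
      + (lam : ℂ) * ((‖p0 j‖ ^ 2 : ℝ) : ℂ) * p0 j = 0

/-- `p n j` is a numerical solution up to time `T` on the grid `ξ_j = x₀ + j h` of the
two-step scheme given by `step`, with initial values `A(ξ_j) e^{iκξ_j/ε}` and the above
starting step. Each time level is a bounded grid function: the schemes couple the
unknowns of the new time level, so on the infinite grid they determine it only within a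
class of grid functions that excludes exponential growth in `j`. -/
structure IsNumericalSolution
    (step : ℝ → ℝ → ℝ → ℝ → ℝ → ℝ → (ℤ → ℂ) → (ℤ → ℂ) → (ℤ → ℂ) → Prop)
    (κ lam w T ε τ h x₀ : ℝ) (A : ℝ → ℂ) (p : ℕ → ℤ → ℂ) : Prop where
  init : ∀ j : ℤ, p 0 j = A (x₀ + j * h) * cis (κ * (x₀ + j * h) / ε)
  start : StartingStep κ lam w ε τ h (p 0) (p 1)
  steps : ∀ n : ℕ, ((n + 2 : ℕ) : ℝ) * τ ≤ T →
    step κ lam w ε τ h (p n) (p (n + 1)) (p (n + 2))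
  bounded : ∀ n : ℕ, (n : ℝ) * τ ≤ T → ∃ B : ℝ, ∀ j : ℤ, ‖p n j‖ ≤ B

/-- All values up to time `T` are at most `K` in modulus. -/
def BoundedBy (K T τ : ℝ) (p : ℕ → ℤ → ℂ) : Prop :=
  ∀ n : ℕ, (n : ℝ) * τ ≤ T → ∀ j : ℤ, ‖p n j‖ ≤ K

/-- The dominant term `a(t,ξ) e^{iκξ/ε} e^{iϑt/ε²}`. -/
def dominantTerm (κ θ ε : ℝ) (a : ℝ → ℝ → ℂ) (t ξ : ℝ) : ℂ :=
  a t ξ * cis (κ * ξ / ε) * cis (θ * t / ε ^ 2)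

/-- The remainder `p^n_j - a(t,ξ) e^{iκξ/ε} e^{iϑt/ε²}` at `t = nτ ≤ T`, `ξ = x₀ + jh` is
at most `C (τ² + h² + ε)` in modulus. -/
def RemainderBound (κ θ T ε τ h x₀ C : ℝ) (a : ℝ → ℝ → ℂ) (p : ℕ → ℤ → ℂ) : Prop :=
  ∀ n : ℕ, (n : ℝ) * τ ≤ T → ∀ j : ℤ,
    ‖p n j - dominantTerm κ θ ε a (n * τ) (x₀ + j * h)‖ ≤ C * (τ ^ 2 + h ^ 2 + ε)

end

/-! The weights are built so that the substitution p = u e^{iκξ/ε} e^{iϑt/ε²} removes the fast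
phases exactly. In the new unknown u the first-order space differences cancel (this is what the
group velocity is for), the first-order time differences combine to -2iω∂ₜ, and the scheme becomes a
three-level discretisation of the Schrödinger equation perturbed by ε²∂ₜ² - 2εc_g∂ₜ∂_ξ. Inserting
the smooth amplitude a leaves a defect O(τ² + h² + ε) without negative powers of ε. The real issue
is stability that is uniform in ε.

On ℓ²(ℤ) the scheme reads A uⁿ⁺¹ - b uⁿ + A* uⁿ⁻¹ + λG = 0, where A and b are translation invariant,
hence commute, and b is symmetric. The linear recursion conserves ‖Ax - by/2‖² + ‖Ay‖² - ‖by‖²/4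
(`TwoStepOps.energy_step`). This form controls m²‖x‖² and m²‖y‖² with m = |κ/ω|/τ (`Disc.coercive`),
because the decisive Fourier symbol is ω² + 2κy sin θ + y² sin²θ = 1 + (κ + y sin θ)² with y = ε/h;
the step-size condition only serves to absorb one negative term of the leapfrog scheme. A defect f
costs ‖f‖ in the energy and m is of order 1/τ, so T/τ steps accumulate only O(T sup‖f‖). The same
holds for difference quotients, and the discrete Sobolev inequality |x_j| ≤ √h(‖x‖ + ‖Dx‖) turns ℓ²
errors of size h^{-1/2}δ into sup errors of size δ (`Disc.energy₁_le`, `exists_error_bound`).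

The defect therefore has to be square summable, although only sup bounds of a are assumed and a(t)
need not have compact support. Here a local energy estimate helps: the energy of the derivatives of
a in an interval changes by lower-order terms and by a boundary flux, which is bounded through M
whatever the length of the interval. Since the data have compact support, all these energies are
bounded (`exists_integral_density_le`); a Sobolev inequality in t and ξ then gives an envelope on
the grid that is uniform in time (`JetFamily.exists_envelope`).

Existence on fine grids follows from a contraction around the amplitude together with a bootstrap of
the sup bound (`Disc.exists_solution_near`). On coarse grids, h ≥ h₀, the error bound only asks for
boundedness: for small τ the discrete mass Im⟨uⁿ, A uⁿ⁺¹⟩ is almost conserved and close to -ω‖uⁿ‖²/τ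
(`Disc.coarse_apriori`), and for larger τ the leapfrog scheme consists of boundedly many linear
solves. Finally, a cutoff argument shows that bounded solutions belong to ℓ²
(`Disc.exists_seq_of_bounded`), for Crank–Nicolson when τ is small enough for the given bound;
otherwise the error bound is trivial. So the ℓ² theory covers every numerical solution under
consideration. -/

open Set
open scoped ComplexConjugate InnerProductSpace


/-! ### Square-summable sequences and three-point operators -/

/-- Square-summable complex sequences indexed by `ℤ`. -/
noncomputable abbrev SeqSpace : Type := lp (fun _ : ℤ => ℂ) 2

namespace SeqSpace

lemma norm_sq_hasSum (x : SeqSpace) : HasSum (fun j => ‖x j‖ ^ 2) (‖x‖ ^ 2) := by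
  have := lp.hasSum_norm (p := 2) (by simp) x
  simpa using this

lemma sum_norm_sq_le (x : SeqSpace) (F : Finset ℤ) : ∑ j ∈ F, ‖x j‖ ^ 2 ≤ ‖x‖ ^ 2 :=
  sum_le_hasSum F (fun _ _ => by positivity) (norm_sq_hasSum x)

lemma norm_apply_le (x : SeqSpace) (j : ℤ) : ‖x j‖ ≤ ‖x‖ :=
  lp.norm_apply_le_norm (by simp) x j

lemma exists_of_sum_le {f : ℤ → ℂ} {B : ℝ} (hB : 0 ≤ B)
    (hf : ∀ F : Finset ℤ, ∑ j ∈ F, ‖f j‖ ^ 2 ≤ B ^ 2) :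
    ∃ x : SeqSpace, (∀ j, x j = f j) ∧ ‖x‖ ≤ B := by
  have hm : Memℓp f 2 := memℓp_gen' (C := B ^ 2) (fun s => by simpa using hf s)
  refine ⟨⟨f, hm⟩, fun j => rfl, ?_⟩
  refine lp.norm_le_of_forall_sum_le (by simp) hB (fun s => ?_)
  simpa using hf s

lemma exists_of_le {f : ℤ → ℂ} {B : ℝ} (hB : 0 ≤ B) (y : SeqSpace)
    (hf : ∀ j, ‖f j‖ ≤ B * ‖y j‖) :
    ∃ x : SeqSpace, (∀ j, x j = f j) ∧ ‖x‖ ≤ B * ‖y‖ := by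
  refine exists_of_sum_le (by positivity) (fun F => ?_)
  calc ∑ j ∈ F, ‖f j‖ ^ 2 ≤ ∑ j ∈ F, (B * ‖y j‖) ^ 2 :=
        Finset.sum_le_sum fun j _ => by gcongr; exact hf j
    _ = B ^ 2 * ∑ j ∈ F, ‖y j‖ ^ 2 := by simp_rw [mul_pow, Finset.mul_sum]
    _ ≤ B ^ 2 * ‖y‖ ^ 2 := by gcongr; exact sum_norm_sq_le y F
    _ = (B * ‖y‖) ^ 2 := by ring

lemma norm_le_of_le {B : ℝ} (hB : 0 ≤ B) {x y : SeqSpace} (hf : ∀ j, ‖x j‖ ≤ B * ‖y j‖) :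
    ‖x‖ ≤ B * ‖y‖ := by
  obtain ⟨z, hz, hz'⟩ := exists_of_le hB y hf
  have : x = z := by ext j; simp [hz]
  rwa [this]

lemma ext_apply {x y : SeqSpace} (h : ∀ j, x j = y j) : x = y := by
  ext j; exact h j

/-- The sequence of absolute values. -/
lemma exists_abs (x : SeqSpace) : ∃ y : SeqSpace, (∀ j, y j = (‖x j‖ : ℂ)) ∧ ‖y‖ = ‖x‖ := by
  obtain ⟨y, hy, h1⟩ := exists_of_le (f := fun j => (‖x j‖ : ℂ)) zero_le_one x (by simp)
  refine ⟨y, hy, le_antisymm (by simpa using h1) ?_⟩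
  simpa using norm_le_of_le zero_le_one (x := x) (y := y) (by simp [hy])

@[simp] lemma add_apply (x y : SeqSpace) (j : ℤ) : (x + y) j = x j + y j := by
  simp
@[simp] lemma sub_apply (x y : SeqSpace) (j : ℤ) : (x - y) j = x j - y j := by
  simp
@[simp] lemma smul_apply (a : ℂ) (x : SeqSpace) (j : ℤ) : (a • x) j = a * x j := by
  simp

/-- Domination by a finite combination of sequences. -/
lemma norm_le_of_le_sum {ι : Type*} (s : Finset ι) (c : ι → ℝ) (hc : ∀ i ∈ s, 0 ≤ c i)
    (y : ι → SeqSpace) (x : SeqSpace) (hx : ∀ j, ‖x j‖ ≤ ∑ i ∈ s, c i * ‖y i j‖) :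
    ‖x‖ ≤ ∑ i ∈ s, c i * ‖y i‖ := by
  choose z hz hz' using fun i => exists_abs (y i)
  have hcoe : ∀ j, (∑ i ∈ s, (c i : ℂ) • z i) j = ((∑ i ∈ s, c i * ‖y i j‖ : ℝ) : ℂ) := by
    intro j
    rw [lp.coeFn_sum, Finset.sum_apply]
    push_cast
    exact Finset.sum_congr rfl fun i _ => by rw [smul_apply, hz]
  have h1 : ‖x‖ ≤ 1 * ‖∑ i ∈ s, (c i : ℂ) • z i‖ := by
    refine norm_le_of_le zero_le_one (fun j => ?_)
    rw [hcoe, one_mul, Complex.norm_real]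
    exact (hx j).trans (le_abs_self _)
  rw [one_mul] at h1
  refine h1.trans ((norm_sum_le _ _).trans (Finset.sum_le_sum fun i hi => ?_))
  rw [norm_smul, Complex.norm_real, Real.norm_eq_abs, abs_of_nonneg (hc i hi), hz']

lemma exists_of_le_sum {ι : Type*} (s : Finset ι) (c : ι → ℝ)
    (y : ι → SeqSpace) (f : ℤ → ℂ) (hx : ∀ j, ‖f j‖ ≤ ∑ i ∈ s, c i * ‖y i j‖) :
    ∃ x : SeqSpace, ∀ j, x j = f j := by
  choose z hz hz' using fun i => exists_abs (y i)
  have hcoe : ∀ j, (∑ i ∈ s, (c i : ℂ) • z i) j = ((∑ i ∈ s, c i * ‖y i j‖ : ℝ) : ℂ) := by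
    intro j
    rw [lp.coeFn_sum, Finset.sum_apply]
    push_cast
    exact Finset.sum_congr rfl fun i _ => by rw [smul_apply, hz]
  obtain ⟨x, hx', -⟩ := exists_of_le (f := f) zero_le_one (∑ i ∈ s, (c i : ℂ) • z i) (fun j => by
    rw [hcoe, one_mul, Complex.norm_real]
    exact (hx j).trans (le_abs_self _))
  exact ⟨x, hx'⟩

lemma memℓp_comp (e : ℤ ≃ ℤ) (x : SeqSpace) : Memℓp (fun j => x (e j)) 2 := by
  refine (memℓp_gen_iff (by simp)).2 ?_
  have := (norm_sq_hasSum x).summable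
  simpa [Function.comp_def] using (e.summable_iff (f := fun j => ‖x j‖ ^ 2)).2 this

/-- Translation of sequences. -/
noncomputable def translate (e : ℤ ≃ ℤ) : SeqSpace ≃ₗᵢ[ℂ] SeqSpace where
  toFun x := ⟨fun j => x (e j), memℓp_comp e x⟩
  invFun x := ⟨fun j => x (e.symm j), memℓp_comp e.symm x⟩
  left_inv x := by ext j; simp
  right_inv x := by ext j; simp
  map_add' x y := by ext j; simp
  map_smul' c x := by ext j; simp
  norm_map' x := by
    have h1 := norm_sq_hasSum x
    have h2 := norm_sq_hasSum (⟨fun j => x (e j), memℓp_comp e x⟩ : SeqSpace)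
    have h3 := (e.hasSum_iff (f := fun j => ‖x j‖ ^ 2)).2 h1
    have := h2.unique h3
    exact (pow_left_inj₀ (norm_nonneg _) (norm_nonneg _) two_ne_zero).1 this

/-- The shift `x ↦ (x_{j+1})_j`. -/
noncomputable def shift : SeqSpace ≃ₗᵢ[ℂ] SeqSpace := translate (Equiv.addRight (1 : ℤ))

@[simp] lemma shift_apply (x : SeqSpace) (j : ℤ) : shift x j = x (j + 1) := rfl

@[simp] lemma shift_symm_apply (x : SeqSpace) (j : ℤ) : shift.symm x j = x (j - 1) := rfl

/-- The three-point operator `(a x_j + b x_{j+1} + c x_{j-1})_j`. -/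
noncomputable def tri (a b c : ℂ) : SeqSpace →L[ℂ] SeqSpace :=
  a • ContinuousLinearMap.id ℂ SeqSpace + b • (shift : SeqSpace →L[ℂ] SeqSpace)
    + c • (shift.symm : SeqSpace →L[ℂ] SeqSpace)

lemma tri_eq (a b c : ℂ) (x : SeqSpace) :
    tri a b c x = a • x + b • shift x + c • shift.symm x := rfl

@[simp] lemma tri_apply (a b c : ℂ) (x : SeqSpace) (j : ℤ) :
    tri a b c x j = a * x j + b * x (j + 1) + c * x (j - 1) := by
  rw [tri_eq]; simp

lemma tri_comm (a b c a' b' c' : ℂ) (x : SeqSpace) :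
    tri a b c (tri a' b' c' x) = tri a' b' c' (tri a b c x) := by
  refine ext_apply fun j => ?_
  simp only [tri_apply, sub_add_cancel, add_sub_cancel_right]
  ring

/-- The shift is unitary, so passing to the adjoint conjugates the coefficients and exchanges the
two neighbours. -/
lemma inner_tri (a b c : ℂ) (x y : SeqSpace) :
    ⟪tri a b c x, y⟫_ℂ = ⟪x, tri (conj a) (conj c) (conj b) y⟫_ℂ := by
  have h1 : ⟪shift x, y⟫_ℂ = ⟪x, shift.symm y⟫_ℂ := by
    conv_lhs => rw [← shift.apply_symm_apply y]
    exact shift.inner_map_map _ _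
  have h2 : ⟪shift.symm x, y⟫_ℂ = ⟪x, shift y⟫_ℂ := by
    conv_rhs => rw [← shift.apply_symm_apply x]
    exact (shift.inner_map_map _ _).symm
  simp only [tri_eq, inner_add_left, inner_add_right, inner_smul_left, inner_smul_right, h1, h2]
  ring

lemma norm_tri_le (a b c : ℂ) (x : SeqSpace) :
    ‖tri a b c x‖ ≤ (‖a‖ + ‖b‖ + ‖c‖) * ‖x‖ := by
  rw [tri_eq]
  refine (norm_add₃_le).trans (le_of_eq ?_)
  simp only [norm_smul, LinearIsometryEquiv.norm_map]
  ring

/-- A substitute for the Fourier symbol: the norm sees x only through ‖x‖² and its correlations at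
distance one and two. Comparing two such operators becomes an inequality between a few real numbers.
-/
lemma norm_tri_sq (ar ai b c : ℝ) (x : SeqSpace) :
    ‖tri (ar + ai * Complex.I) b c x‖ ^ 2 = (ar ^ 2 + ai ^ 2 + b ^ 2 + c ^ 2) * ‖x‖ ^ 2
      + 2 * ar * (b + c) * (⟪x, shift x⟫_ℂ).re + 2 * ai * (b - c) * (⟪x, shift x⟫_ℂ).im
      + 2 * b * c * (⟪shift.symm x, shift x⟫_ℂ).re := by
  have h2 : ⟪shift.symm x, x⟫_ℂ = ⟪x, shift x⟫_ℂ := by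
    conv_rhs => rw [← shift.apply_symm_apply x]
    rw [shift.inner_map_map, shift.apply_symm_apply]
  have h3 : ⟪x, shift.symm x⟫_ℂ = conj ⟪x, shift x⟫_ℂ := by
    rw [← h2, inner_conj_symm]
  have h4 : ⟪shift x, x⟫_ℂ = conj ⟪x, shift x⟫_ℂ := by
    rw [inner_conj_symm]
  have h5 : ⟪shift x, shift.symm x⟫_ℂ = conj ⟪shift.symm x, shift x⟫_ℂ := by
    rw [inner_conj_symm]
  have h6 : ⟪shift x, shift x⟫_ℂ = ⟪x, x⟫_ℂ := shift.inner_map_map _ _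
  have h7 : ⟪shift.symm x, shift.symm x⟫_ℂ = ⟪x, x⟫_ℂ := shift.symm.inner_map_map _ _
  have e1 : ‖tri (ar + ai * Complex.I) b c x‖ ^ 2
      = (⟪tri (ar + ai * Complex.I) b c x, tri (ar + ai * Complex.I) b c x⟫_ℂ).re := by
    rw [inner_self_eq_norm_sq_to_K]; norm_cast
  have e2 : (⟪x, x⟫_ℂ) = ((‖x‖ ^ 2 : ℝ) : ℂ) := by
    rw [inner_self_eq_norm_sq_to_K]; norm_cast
  rw [e1, tri_eq]
  simp only [inner_add_left, inner_add_right, inner_smul_left, inner_smul_right, h2, h3, h4, h5,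
    h6, h7, e2]
  generalize ⟪x, shift x⟫_ℂ = g
  generalize ⟪shift.symm x, shift x⟫_ℂ = k
  simp [Complex.mul_re, Complex.mul_im, -Complex.ofReal_pow]
  ring

/-- The discrete Sobolev inequality. -/
lemma norm_apply_sq_le (x : SeqSpace) (j : ℤ) : ‖x j‖ ^ 2 ≤ 2 * ‖x‖ * ‖shift x - x‖ := by
  -- Telescoping of |x|² from j to j + n. The sum is bounded by Cauchy–Schwarz, and the end value
  -- tends to zero by summability.
  have hstep : ∀ n : ℕ, ‖x j‖ ^ 2 ≤ ‖x (j + n)‖ ^ 2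
      + ∑ k ∈ Finset.range n, ‖(shift x - x) (j + k)‖ * (‖shift x (j + k)‖ + ‖x (j + k)‖) := by
    intro n
    induction n with
    | zero => simp
    | succ n ih =>
      rw [Finset.sum_range_succ]
      have h1 : (shift x) (j + n) = x (j + (n + 1 : ℕ)) := by
        rw [shift_apply]; push_cast; ring_nf
      rw [sub_apply, h1]
      have h2 := norm_sub_norm_le (x (j + n)) (x (j + (n + 1 : ℕ)))
      rw [norm_sub_rev] at h2
      nlinarith [norm_nonneg (x (j + n)), norm_nonneg (x (j + (n + 1 : ℕ)))]
  have hcs : ∀ n : ℕ, ∑ k ∈ Finset.range n,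
      ‖(shift x - x) (j + k)‖ * (‖shift x (j + k)‖ + ‖x (j + k)‖) ≤ 2 * ‖x‖ * ‖shift x - x‖ := by
    intro n
    have key : ∀ y z : SeqSpace, ∑ k ∈ Finset.range n, ‖y (j + k)‖ * ‖z (j + k)‖ ≤ ‖y‖ * ‖z‖ := by
      intro y z
      have hb : ∀ y : SeqSpace, ∑ k ∈ Finset.range n, ‖y (j + k)‖ ^ 2 ≤ ‖y‖ ^ 2 := by
        intro y
        have := sum_norm_sq_le y ((Finset.range n).map
          ⟨fun k : ℕ => j + (k : ℤ), fun a b h => by simpa using h⟩)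
        rw [Finset.sum_map] at this
        exact this
      refine (Real.sum_mul_le_sqrt_mul_sqrt _ _ _).trans ?_
      gcongr
      · exact (Real.sqrt_le_sqrt (hb y)).trans_eq (Real.sqrt_sq (norm_nonneg _))
      · exact (Real.sqrt_le_sqrt (hb z)).trans_eq (Real.sqrt_sq (norm_nonneg _))
    have h1 := key (shift x - x) (shift x)
    have h2 := key (shift x - x) x
    simp only [mul_add, Finset.sum_add_distrib]
    rw [shift.norm_map] at h1
    linarith
  have hlim : Filter.Tendsto (fun n : ℕ => ‖x (j + n)‖ ^ 2) Filter.atTop (nhds 0) := by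
    have h1 := (norm_sq_hasSum x).summable
    have h2 : Function.Injective (fun n : ℕ => j + (n : ℤ)) := fun a b h => by simpa using h
    exact (h1.comp_injective h2).tendsto_atTop_zero
  have hfin : ∀ n : ℕ, ‖x j‖ ^ 2 - 2 * ‖x‖ * ‖shift x - x‖ ≤ ‖x (j + n)‖ ^ 2 := fun n => by
    linarith [hstep n, hcs n]
  have := ge_of_tendsto' hlim hfin
  linarith

/-- A normal operator which is bounded below is surjective. -/
lemma surjective_of_bounded_below {A A' : SeqSpace →L[ℂ] SeqSpace}
    (hadj : ∀ x y, ⟪A x, y⟫_ℂ = ⟪x, A' y⟫_ℂ) (hnorm : ∀ x, ‖A' x‖ = ‖A x‖)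
    {m : ℝ} (hm : 0 < m) (hA : ∀ x, m * ‖x‖ ≤ ‖A x‖) : Function.Surjective A := by
  have hanti : AntilipschitzWith (Real.toNNReal m⁻¹) A := by
    refine AddMonoidHomClass.antilipschitz_of_bound A (fun x => ?_)
    rw [Real.coe_toNNReal _ (by positivity), ← div_eq_inv_mul, le_div_iff₀ hm, mul_comm]
    exact hA x
  have hclosed : IsClosed (Set.range A) := hanti.isClosed_range A.uniformContinuous
  -- A vector orthogonal to the range is annihilated by `A'`, and `A'` is injective because it has
  -- the same norms as `A`.
  have hperp : A.rangeᗮ = ⊥ := by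
    rw [Submodule.eq_bot_iff]
    intro y hy
    rw [Submodule.mem_orthogonal] at hy
    have h1 : A' y = 0 := by
      have := hy (A (A' y)) ⟨A' y, rfl⟩
      rw [hadj] at this
      exact inner_self_eq_zero.1 this
    have h2 := hA y
    rw [← hnorm, h1, norm_zero] at h2
    have : ‖y‖ ≤ 0 := by nlinarith [norm_nonneg y]
    simpa using this
  have htop : A.range.topologicalClosure = ⊤ := Submodule.topologicalClosure_eq_top_iff.2 hperp
  intro y
  have hy : y ∈ A.range.topologicalClosure := htop ▸ Submodule.mem_top
  have : y ∈ closure (Set.range A) := by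
    have := hy
    rwa [← SetLike.mem_coe, Submodule.topologicalClosure_coe] at this
  rw [hclosed.closure_eq] at this
  exact this

end SeqSpace


/-! ### Conserved energy of linear two-step recursions -/

section TwoStep

variable {V : Type*} [NormedAddCommGroup V] [InnerProductSpace ℂ V]

/-- The data of a linear two-step recursion `A x - b y + A' z = f` with commuting operators, where
`A'` is the adjoint of `A` and `b` is symmetric. -/
structure TwoStepOps (A A' b : V →L[ℂ] V) : Prop where
  adj : ∀ x y, ⟪A x, y⟫_ℂ = ⟪x, A' y⟫_ℂ
  symm : ∀ x y, ⟪b x, y⟫_ℂ = ⟪x, b y⟫_ℂ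
  comm_adj : ∀ x, A (A' x) = A' (A x)
  comm : ∀ x, A (b x) = b (A x)

/-- The energy norm of a pair of consecutive states of a two-step recursion. -/
noncomputable def pairEnergy (A b : V →L[ℂ] V) (x y : V) : ℝ :=
  Real.sqrt (‖A x - (1 / 2 : ℂ) • b y‖ ^ 2 + (‖A y‖ ^ 2 - ‖b y‖ ^ 2 / 4))

namespace TwoStepOps

variable {A A' b : V →L[ℂ] V}

lemma norm_adj (H : TwoStepOps A A' b) (x : V) : ‖A' x‖ = ‖A x‖ := by
  have h1 : ⟪A' x, A' x⟫_ℂ = ⟪A x, A x⟫_ℂ := by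
    rw [← H.adj, H.comm_adj, ← inner_conj_symm, ← H.adj, inner_conj_symm]
  rw [inner_self_eq_norm_sq_to_K, inner_self_eq_norm_sq_to_K] at h1
  have h2 : ‖A' x‖ ^ 2 = ‖A x‖ ^ 2 := by exact_mod_cast h1
  exact (pow_left_inj₀ (norm_nonneg _) (norm_nonneg _) two_ne_zero).1 h2

lemma form_eq (x y : V) : ‖A x - (1 / 2 : ℂ) • b y‖ ^ 2 + (‖A y‖ ^ 2 - ‖b y‖ ^ 2 / 4)
    = ‖A x‖ ^ 2 - (⟪A x, b y⟫_ℂ).re + ‖A y‖ ^ 2 := by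
  rw [@norm_sub_sq ℂ, inner_smul_right, norm_smul]
  have : ((1 / 2 : ℂ) * ⟪A x, b y⟫_ℂ).re = (⟪A x, b y⟫_ℂ).re / 2 := by
    rw [show (1 / 2 : ℂ) = ((1 / 2 : ℝ) : ℂ) by norm_num, Complex.re_ofReal_mul]; ring
  simp only [RCLike.re_eq_complex_re, this]
  norm_num
  ring

/-- By normality and commutation both sides equal ‖Ax‖² - Re⟨Ax, by⟩ + ‖Ay‖². The second form
completes the square around `A'`, which is the combination that the recursion provides for the older
pair of levels. -/
lemma form_swap (H : TwoStepOps A A' b) (x y : V) :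
    ‖A x - (1 / 2 : ℂ) • b y‖ ^ 2 + (‖A y‖ ^ 2 - ‖b y‖ ^ 2 / 4)
      = ‖(1 / 2 : ℂ) • b x - A' y‖ ^ 2 + (‖A x‖ ^ 2 - ‖b x‖ ^ 2 / 4) := by
  rw [form_eq, norm_sub_rev, @norm_sub_sq ℂ, inner_smul_right, norm_smul, H.norm_adj]
  have h1 : (⟪A x, b y⟫_ℂ).re = (⟪A' y, b x⟫_ℂ).re := by
    rw [← H.symm, ← H.comm, H.adj, ← inner_conj_symm, Complex.conj_re]
  have : ((1 / 2 : ℂ) * ⟪A' y, b x⟫_ℂ).re = (⟪A' y, b x⟫_ℂ).re / 2 := by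
    rw [show (1 / 2 : ℂ) = ((1 / 2 : ℝ) : ℂ) by norm_num, Complex.re_ofReal_mul]; ring
  simp only [RCLike.re_eq_complex_re, this, h1]
  norm_num
  ring

lemma norm_snd_le {m : ℝ}
    (hc : ∀ x, 4 * (m ^ 2 * ‖x‖ ^ 2) ≤ 4 * ‖A x‖ ^ 2 - ‖b x‖ ^ 2) (x y : V) :
    m * ‖y‖ ≤ pairEnergy A b x y := by
  refine Real.le_sqrt_of_sq_le ?_
  nlinarith [hc y, sq_nonneg ‖A x - (1 / 2 : ℂ) • b y‖]

lemma norm_fst_le (H : TwoStepOps A A' b) {m : ℝ}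
    (hc : ∀ x, 4 * (m ^ 2 * ‖x‖ ^ 2) ≤ 4 * ‖A x‖ ^ 2 - ‖b x‖ ^ 2) (x y : V) :
    m * ‖x‖ ≤ pairEnergy A b x y := by
  refine Real.le_sqrt_of_sq_le ?_
  rw [H.form_swap]
  nlinarith [hc x, sq_nonneg ‖(1 / 2 : ℂ) • b x - A' y‖]

/-- The recursion says that Ax - by/2 and by/2 - A'z differ by f, while the rest ‖Ay‖² - ‖by‖²/4 ≥ 0
is common to the energies of (x, y) and (y, z). Hence conservation for f = 0, and a triangle
inequality in general. -/
lemma energy_step (H : TwoStepOps A A' b)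
    (hc : ∀ x, 0 ≤ 4 * ‖A x‖ ^ 2 - ‖b x‖ ^ 2) {x y z f : V}
    (hstep : A x - b y + A' z = f) :
    pairEnergy A b x y ≤ pairEnergy A b y z + ‖f‖ := by
  have h1 : A x - (1 / 2 : ℂ) • b y = ((1 / 2 : ℂ) • b y - A' z) + f := by
    rw [← hstep]; module
  rw [pairEnergy, pairEnergy, H.form_swap y z, h1]
  set p := (1 / 2 : ℂ) • b y - A' z
  set q := ‖A y‖ ^ 2 - ‖b y‖ ^ 2 / 4
  have hq : 0 ≤ q := by have := hc y; simp only [q]; linarith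
  have hp : ‖p‖ ≤ Real.sqrt (‖p‖ ^ 2 + q) := Real.le_sqrt_of_sq_le (by linarith)
  have hs : Real.sqrt (‖p‖ ^ 2 + q) ^ 2 = ‖p‖ ^ 2 + q := Real.sq_sqrt (by positivity)
  refine Real.sqrt_le_iff.2 ⟨by positivity, ?_⟩
  have := norm_add_le p f
  nlinarith [norm_nonneg f, norm_nonneg p, norm_nonneg (p + f)]

lemma energy_zero_right (x : V) : pairEnergy A b x 0 = ‖A x‖ := by
  simp [pairEnergy]

lemma energy_le (x y : V) : pairEnergy A b x y ≤ ‖A x‖ + ‖b y‖ + ‖A y‖ := by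
  refine Real.sqrt_le_iff.2 ⟨by positivity, ?_⟩
  have h1 := norm_sub_le (A x) ((1 / 2 : ℂ) • b y)
  rw [norm_smul] at h1
  have : ‖(1 / 2 : ℂ)‖ = 1 / 2 := by norm_num
  rw [this] at h1
  have h2 : ‖A x - (1 / 2 : ℂ) • b y‖ ^ 2 ≤ (‖A x‖ + 1 / 2 * ‖b y‖) ^ 2 := by gcongr
  nlinarith [norm_nonneg (A x), norm_nonneg (b y), norm_nonneg (A y),
    mul_nonneg (norm_nonneg (A x)) (norm_nonneg (b y)),
    mul_nonneg (norm_nonneg (A x)) (norm_nonneg (A y)),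
    mul_nonneg (norm_nonneg (A y)) (norm_nonneg (b y))]

end TwoStepOps

end TwoStep

/-! ### The operators of the schemes and their coercivity -/

/-- Parameters of the weighted schemes: `σ = 0` is the leapfrog scheme, `σ = 1/2` the
Crank–Nicolson scheme; `w` is the signed frequency. -/
structure Disc where
  κ : ℝ
  w : ℝ
  ε : ℝ
  τ : ℝ
  h : ℝ
  σ : ℝ
  κ_ne : κ ≠ 0
  w_sq : w ^ 2 = 1 + κ ^ 2
  ε_pos : 0 < ε
  ε_le : ε ≤ 1
  τ_pos : 0 < τ
  h_pos : 0 < h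
  σ_cases : σ = 0 ∨ σ = 1 / 2

namespace Disc

open SeqSpace

variable (g : Disc)

lemma w_ne : g.w ≠ 0 := by
  have := g.w_sq
  intro h
  rw [h] at this
  nlinarith [sq_nonneg g.κ]

/-- The quotient `ε² / τ²`. -/
noncomputable def μ : ℝ := g.ε ^ 2 / g.τ ^ 2

/-- The weight of the second space difference. -/
noncomputable def s : ℝ := 1 / (g.w ^ 2 * g.h ^ 2)

/-- The weight of the mixed difference. -/
noncomputable def q : ℝ := g.ε * g.κ / (2 * g.w * g.τ * g.h)

/-- The coercivity constant of the schemes. -/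
noncomputable def m : ℝ := |g.κ / g.w| / g.τ

lemma m_pos : 0 < g.m := by
  have := g.κ_ne
  have := g.w_ne
  have := g.τ_pos
  unfold m; positivity

/-- The operator acting on the new time level. -/
noncomputable def A : SeqSpace →L[ℂ] SeqSpace :=
  tri ((g.μ + 2 * g.σ * g.s : ℝ) + (-(g.w / g.τ) : ℝ) * Complex.I)
    (-(g.σ * g.s) - g.q : ℝ) (-(g.σ * g.s) + g.q : ℝ)

/-- The adjoint operator, acting on the old time level. -/
noncomputable def A' : SeqSpace →L[ℂ] SeqSpace :=
  tri ((g.μ + 2 * g.σ * g.s : ℝ) + (g.w / g.τ : ℝ) * Complex.I)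
    (-(g.σ * g.s) + g.q : ℝ) (-(g.σ * g.s) - g.q : ℝ)

/-- The operator acting on the middle time level. -/
noncomputable def b : SeqSpace →L[ℂ] SeqSpace :=
  tri ((2 * g.μ - 2 * ((1 - 2 * g.σ) * g.s) : ℝ) + (0 : ℝ) * Complex.I)
    ((1 - 2 * g.σ) * g.s : ℝ) ((1 - 2 * g.σ) * g.s : ℝ)

lemma twoStepOps : TwoStepOps g.A g.A' g.b where
  adj x y := by
    rw [A, A', inner_tri]
    simp only [map_add, map_mul, Complex.conj_ofReal, Complex.conj_I]
    congr 3
    push_cast; ring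
  symm x y := by
    rw [b, inner_tri]
    simp only [map_add, map_mul, Complex.conj_ofReal, Complex.conj_I]
    congr 3
    push_cast; ring
  comm_adj x := tri_comm _ _ _ _ _ _ x
  comm x := tri_comm _ _ _ _ _ _ x

/-- The step-size restriction under which the scheme is linearly stable. -/
def CFL : Prop := g.σ = 1 / 2 ∨ g.τ ≤ |g.w| * g.ε * g.h ∨ 2 * g.τ ≤ |g.w| * g.h ^ 2

/-- The first bound is positivity of the squared central difference, the second is Cauchy–Schwarz
between x and that difference. The last two say that the squared second difference lies between 0
and 16‖x‖². -/
lemma shift_inner_bounds (x : SeqSpace) :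
    (⟪shift.symm x, shift x⟫_ℂ).re ≤ ‖x‖ ^ 2 ∧
    2 * (⟪x, shift x⟫_ℂ).im ^ 2 ≤ ‖x‖ ^ 2 * (‖x‖ ^ 2 - (⟪shift.symm x, shift x⟫_ℂ).re) ∧
    0 ≤ 6 * ‖x‖ ^ 2 + 2 * (⟪shift.symm x, shift x⟫_ℂ).re - 8 * (⟪x, shift x⟫_ℂ).re ∧
    6 * ‖x‖ ^ 2 + 2 * (⟪shift.symm x, shift x⟫_ℂ).re - 8 * (⟪x, shift x⟫_ℂ).re
      ≤ 16 * ‖x‖ ^ 2 := by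
  have h1 := norm_tri_sq 0 0 1 (-1) x
  have h2 := norm_tri_sq (-2) 0 1 1 x
  have h3 : ‖tri ((-2 : ℝ) + (0 : ℝ) * Complex.I) (1 : ℝ) (1 : ℝ) x‖ ≤ 4 * ‖x‖ := by
    refine (norm_tri_le _ _ _ x).trans (le_of_eq ?_)
    norm_num
  have h4 : (2 * (⟪x, shift x⟫_ℂ).im) ^ 2
      ≤ (‖x‖ * ‖tri ((0 : ℝ) + (0 : ℝ) * Complex.I) (1 : ℝ) (-1 : ℝ) x‖) ^ 2 := by
    have e : ⟪x, tri ((0 : ℝ) + (0 : ℝ) * Complex.I) (1 : ℝ) (-1 : ℝ) x⟫_ℂ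
        = 2 * (⟪x, shift x⟫_ℂ).im * Complex.I := by
      have h2 : ⟪x, shift.symm x⟫_ℂ = conj ⟪x, shift x⟫_ℂ := by
        rw [inner_conj_symm, ← shift.inner_map_map x (shift.symm x), shift.apply_symm_apply]
      simp only [tri_eq, inner_add_right, inner_smul_right, h2]
      generalize ⟪x, shift x⟫_ℂ = z
      apply Complex.ext
      · simp
      · simp; ring
    have := norm_inner_le_norm (𝕜 := ℂ) x
      (tri ((0 : ℝ) + (0 : ℝ) * Complex.I) (1 : ℝ) (-1 : ℝ) x)
    rw [e] at this
    rw [← sq_abs]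
    gcongr
    simpa using this
  have h5 : ‖tri ((-2 : ℝ) + (0 : ℝ) * Complex.I) (1 : ℝ) (1 : ℝ) x‖ ^ 2 ≤ (4 * ‖x‖) ^ 2 := by
    gcongr
  rw [mul_pow, mul_pow, h1] at h4
  rw [h2] at h5
  have h6 := sq_nonneg ‖tri ((0 : ℝ) + (0 : ℝ) * Complex.I) (1 : ℝ) (-1 : ℝ) x‖
  have h7 := sq_nonneg ‖tri ((-2 : ℝ) + (0 : ℝ) * Complex.I) (1 : ℝ) (1 : ℝ) x‖
  rw [h1] at h6
  rw [h2] at h7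
  refine ⟨by linarith, by linarith, by linarith, by linarith⟩

-- Times τ²/4, the right-hand side is the form with symbol 1 + (κ + y sin θ)², y = ε/h, plus
-- multiples of the squared second difference `Bq`. The form is at least ‖x‖². For Crank–Nicolson
-- the `Bq` terms are nonnegative. For leapfrog the term -τ²s²`Bq`/4 is absorbed by τ²μs`Bq`/4 if τ
-- ≤ |w|εh, and by the fraction 1/w² of ‖x‖² if 2τ ≤ |w|h². The last case leaves 1 - 1/w² = κ²/w² =
-- (mτ)², which dictates the value of `m`.
set_option maxHeartbeats 1000000 in
lemma coercive (hg : g.CFL) (x : SeqSpace) :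
    4 * (g.m ^ 2 * ‖x‖ ^ 2) ≤ 4 * ‖g.A x‖ ^ 2 - ‖g.b x‖ ^ 2 := by
  obtain ⟨h1, h2, h3, h4⟩ := shift_inner_bounds x
  rw [A, b, norm_tri_sq, norm_tri_sq]
  set U := ‖x‖ ^ 2 with hU
  set k := (⟪shift.symm x, shift x⟫_ℂ).re
  set r := (⟪x, shift x⟫_ℂ).re
  set n := (⟪x, shift x⟫_ℂ).im
  have hU0 : 0 ≤ U := by positivity
  have hτ := g.τ_pos
  have hh := g.h_pos
  have hε := g.ε_pos
  have hw := g.w_ne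
  have hw2 : 0 < g.w ^ 2 := by positivity
  have hwsq := g.w_sq
  obtain ⟨y, hy⟩ : ∃ y, y = g.ε / g.h := ⟨_, rfl⟩
  have hy0 : 0 < y := by rw [hy]; positivity
  -- the fundamental lower bound
  have key : U ≤ g.w ^ 2 * U + 2 * g.κ * y * n + y ^ 2 * (U - k) / 2 := by
    have hVn : 0 ≤ U - k := by linarith
    rcases hU0.eq_or_lt with h0 | h0
    · have : n = 0 := by
        have : n ^ 2 ≤ 0 := by rw [← h0] at h2; linarith
        nlinarith [sq_nonneg n]
      rw [this]; nlinarith [mul_nonneg (sq_nonneg y) hVn]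
    -- The product equals (κU + yn)² + y²(U(U - k)/2 - n²), and the second bracket is nonnegative by
    -- `h2`.
    · have : 0 ≤ U * (g.w ^ 2 * U + 2 * g.κ * y * n + y ^ 2 * (U - k) / 2 - U) := by
        rw [hwsq]
        nlinarith [sq_nonneg (g.κ * U + y * n), mul_nonneg (sq_nonneg y) (sub_nonneg.2 h2)]
      have := nonneg_of_mul_nonneg_right this h0
      linarith
  have hm2 : g.m ^ 2 * g.τ ^ 2 * g.w ^ 2 = g.κ ^ 2 := by
    unfold m; rw [div_pow, sq_abs]; field_simp
  have hμ : g.μ * g.τ ^ 2 = g.ε ^ 2 := by unfold μ; field_simp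
  have hs : g.s * g.ε ^ 2 * g.w ^ 2 = y ^ 2 := by unfold s; rw [hy]; field_simp
  have hsp : 0 < g.s := by unfold s; positivity
  have hq : 2 * g.q * g.τ * g.w = g.κ * y := by unfold q; rw [hy]; field_simp
  have hm' : g.m ^ 2 * g.τ ^ 2 ≤ 1 := by
    have : g.m ^ 2 * g.τ ^ 2 * g.w ^ 2 ≤ 1 * g.w ^ 2 := by rw [hm2, hwsq]; linarith
    exact le_of_mul_le_mul_right this hw2
  set Bq := 6 * U + 2 * k - 8 * r with hBq
  have e1 : g.τ ^ 2 * (g.w / g.τ) ^ 2 = g.w ^ 2 := by field_simp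
  have main : g.τ ^ 2 * (g.m ^ 2 * U) ≤ U + g.τ ^ 2 * (g.μ * g.s) * Bq / 4
      + (g.σ * 4 - 1) * (g.τ ^ 2 * g.s ^ 2) * Bq / 4 := by
    have hb0 : 0 ≤ g.τ ^ 2 * (g.μ * g.s) * Bq / 4 := by
      have : 0 ≤ g.μ := by unfold μ; positivity
      positivity
    have hmU : g.τ ^ 2 * (g.m ^ 2 * U) ≤ U := by
      have := mul_le_mul_of_nonneg_right hm' hU0
      linarith
    have hss : g.s * (g.w ^ 2 * g.h ^ 2) = 1 := by unfold s; field_simp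
    have hcn : g.σ = 1 / 2 → g.τ ^ 2 * (g.m ^ 2 * U) ≤ U + g.τ ^ 2 * (g.μ * g.s) * Bq / 4
      + (g.σ * 4 - 1) * (g.τ ^ 2 * g.s ^ 2) * Bq / 4 := by
      intro hσ
      rw [hσ]
      have : 0 ≤ (1 / 2 * 4 - 1) * (g.τ ^ 2 * g.s ^ 2) * Bq / 4 := by
        norm_num; positivity
      linarith
    rcases hg with hσ | hcfl
    · exact hcn hσ
    · rcases g.σ_cases with hσ | hσ
      swap
      · exact hcn hσ
      rw [hσ]
      rcases hcfl with hc | hc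
      · have h5 : g.τ ^ 2 ≤ g.w ^ 2 * g.ε ^ 2 * g.h ^ 2 := by
          have : g.τ ^ 2 ≤ (|g.w| * g.ε * g.h) ^ 2 := by gcongr
          simpa [mul_pow, sq_abs] using this
        have h6 : g.τ ^ 2 * g.s ^ 2 ≤ g.ε ^ 2 * g.s := by
          calc g.τ ^ 2 * g.s ^ 2 ≤ (g.w ^ 2 * g.ε ^ 2 * g.h ^ 2) * g.s ^ 2 := by gcongr
            _ = g.ε ^ 2 * g.s * (g.s * (g.w ^ 2 * g.h ^ 2)) := by ring
            _ = _ := by rw [hss, mul_one]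
        have h7 : g.τ ^ 2 * (g.μ * g.s) = g.ε ^ 2 * g.s := by rw [← hμ]; ring
        rw [h7]
        have := mul_le_mul_of_nonneg_right h6 h3
        linarith
      · have h5 : (2 * g.τ) ^ 2 ≤ g.w ^ 2 * g.h ^ 4 := by
          have : (2 * g.τ) ^ 2 ≤ (|g.w| * g.h ^ 2) ^ 2 := by gcongr
          rw [mul_pow |g.w|, sq_abs] at this
          linarith [show (g.h ^ 2) ^ 2 = g.h ^ 4 by ring]
        have h6 : 4 * (g.τ ^ 2 * g.s ^ 2) * g.w ^ 2 ≤ 1 := by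
          calc 4 * (g.τ ^ 2 * g.s ^ 2) * g.w ^ 2 = ((2 * g.τ) ^ 2) * (g.s ^ 2 * g.w ^ 2) := by ring
            _ ≤ (g.w ^ 2 * g.h ^ 4) * (g.s ^ 2 * g.w ^ 2) := by gcongr
            _ = (g.s * (g.w ^ 2 * g.h ^ 2)) ^ 2 := by ring
            _ = 1 := by rw [hss, one_pow]
        have h8 : 0 ≤ g.τ ^ 2 * g.s ^ 2 * g.w ^ 2 := by positivity
        have h10 := mul_le_mul_of_nonneg_left h4 h8
        have h11 := mul_le_mul_of_nonneg_right h6 hU0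
        have h9 : g.τ ^ 2 * (g.m ^ 2 * U) * g.w ^ 2
            ≤ (U + (0 * 4 - 1) * (g.τ ^ 2 * g.s ^ 2) * Bq / 4) * g.w ^ 2 := by
          have h12 : g.τ ^ 2 * (g.m ^ 2 * U) * g.w ^ 2 = g.κ ^ 2 * U := by rw [← hm2]; ring
          have h13 : (U + (0 * 4 - 1) * (g.τ ^ 2 * g.s ^ 2) * Bq / 4) * g.w ^ 2
            = U * g.w ^ 2 - (g.τ ^ 2 * g.s ^ 2 * g.w ^ 2 * Bq) / 4 := by ring
          rw [h12, h13, hwsq]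
          rw [hwsq] at h10 h11
          linarith
        have := le_of_mul_le_mul_right h9 hw2
        linarith
  have e2 : g.w / g.τ * g.q * (2 * g.τ ^ 2) = g.κ * y := by
    rw [← hq]; field_simp
  have e3 : 4 * g.q ^ 2 * g.τ ^ 2 * g.w ^ 2 = g.κ ^ 2 * y ^ 2 := by rw [← mul_pow g.κ, ← hq]; ring
  -- The mixed difference contributes κ²y²/w² and the second space difference y²/w²; they add up to
  -- y² since w² = 1 + κ².
  have e4 : g.τ ^ 2 * (4 * g.q ^ 2 + g.μ * g.s) = y ^ 2 := by
    have : g.τ ^ 2 * (4 * g.q ^ 2 + g.μ * g.s) * g.w ^ 2 = y ^ 2 * g.w ^ 2 := by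
      have : g.τ ^ 2 * (g.μ * g.s) * g.w ^ 2 = y ^ 2 := by rw [← hs, ← hμ]; ring
      calc _ = 4 * g.q ^ 2 * g.τ ^ 2 * g.w ^ 2 + g.τ ^ 2 * (g.μ * g.s) * g.w ^ 2 := by ring
        _ = _ := by rw [e3, this, hwsq]; ring
    exact mul_right_cancel₀ hw2.ne' this
  refine le_of_mul_le_mul_left ?_ (show 0 < g.τ ^ 2 / 4 by positivity)
  have fin : g.τ ^ 2 / 4 * (4 * (((g.μ + 2 * g.σ * g.s) ^ 2 + (-(g.w / g.τ)) ^ 2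
        + (-(g.σ * g.s) - g.q) ^ 2 + (-(g.σ * g.s) + g.q) ^ 2) * U
        + 2 * (g.μ + 2 * g.σ * g.s) * (-(g.σ * g.s) - g.q + (-(g.σ * g.s) + g.q)) * r
        + 2 * -(g.w / g.τ) * (-(g.σ * g.s) - g.q - (-(g.σ * g.s) + g.q)) * n
        + 2 * (-(g.σ * g.s) - g.q) * (-(g.σ * g.s) + g.q) * k)
      - (((2 * g.μ - 2 * ((1 - 2 * g.σ) * g.s)) ^ 2 + 0 ^ 2 + ((1 - 2 * g.σ) * g.s) ^ 2
        + ((1 - 2 * g.σ) * g.s) ^ 2) * U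
        + 2 * (2 * g.μ - 2 * ((1 - 2 * g.σ) * g.s)) *
          ((1 - 2 * g.σ) * g.s + (1 - 2 * g.σ) * g.s) * r
        + 2 * 0 * ((1 - 2 * g.σ) * g.s - (1 - 2 * g.σ) * g.s) * n
        + 2 * ((1 - 2 * g.σ) * g.s) * ((1 - 2 * g.σ) * g.s) * k))
      = (g.τ ^ 2 * (g.w / g.τ) ^ 2 * U + 2 * (g.w / g.τ * g.q * (2 * g.τ ^ 2)) * n
        + g.τ ^ 2 * (4 * g.q ^ 2 + g.μ * g.s) * (U - k) / 2)
      + g.τ ^ 2 * (g.μ * g.s) * Bq / 4 + (g.σ * 4 - 1) * (g.τ ^ 2 * g.s ^ 2) * Bq / 4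
 := by
    rcases g.σ_cases with h | h <;> rw [hBq, h] <;> ring
  rw [fin, e1, e2, e4]
  linarith

end Disc


/-! ### Pointwise estimates of the cubic nonlinearity -/

/-- The nonlinearity of the leapfrog (`σ = 0`) and the Crank–Nicolson (`σ = 1/2`) scheme; the
arguments are the values at the new, the middle and the old time level. -/
noncomputable def cubic (σ : ℝ) (x y z : ℂ) : ℂ :=
  ((1 - 2 * σ) * ‖y‖ ^ 2 : ℝ) * y + (σ * (‖x‖ ^ 2 + ‖z‖ ^ 2) : ℝ) * ((x + z) / 2)

namespace cubic

/-- The trilinear map behind the cubic nonlinearity. -/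
noncomputable def tril (u v w : ℂ) : ℂ := u * conj v * w

lemma norm_tril (u v w : ℂ) : ‖tril u v w‖ = ‖u‖ * ‖v‖ * ‖w‖ := by simp [tril]

lemma eq_tril (σ : ℝ) (x y z : ℂ) : cubic σ x y z = ((1 - 2 * σ : ℝ) : ℂ) * tril y y y
    + ((σ / 2 : ℝ) : ℂ) * (tril x x x + tril x x z + tril z z x + tril z z z) := by
  have h : ∀ u : ℂ, ((‖u‖ ^ 2 : ℝ) : ℂ) = u * conj u := fun u => by
    rw [Complex.mul_conj, Complex.normSq_eq_norm_sq]
  unfold cubic tril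
  push_cast [← h]
  have h' : ∀ u : ℂ, ((‖u‖ : ℂ)) ^ 2 = u * conj u := fun u => by rw [← h]; push_cast; rfl
  simp only [h']
  ring

lemma tril_sub_le {K : ℝ} {u v w u' v' w' : ℂ} (hv : ‖v‖ ≤ K) (hw : ‖w‖ ≤ K)
    (hu' : ‖u'‖ ≤ K) (hv' : ‖v'‖ ≤ K) :
    ‖tril u v w - tril u' v' w'‖ ≤ K ^ 2 * (‖u - u'‖ + ‖v - v'‖ + ‖w - w'‖) := by
  have hK : 0 ≤ K := (norm_nonneg v).trans hv
  have h : tril u v w - tril u' v' w'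
      = tril (u - u') v w + tril u' (v - v') w + tril u' v' (w - w') := by
    simp only [tril, map_sub]; ring
  rw [h]
  refine norm_add₃_le.trans ?_
  simp only [norm_tril]
  have h1 : ‖u - u'‖ * ‖v‖ * ‖w‖ ≤ ‖u - u'‖ * K * K := by gcongr
  have h2 : ‖u'‖ * ‖v - v'‖ * ‖w‖ ≤ K * ‖v - v'‖ * K := by gcongr
  have h3 : ‖u'‖ * ‖v'‖ * ‖w - w'‖ ≤ K * K * ‖w - w'‖ := by gcongr
  nlinarith

/-- Difference of two increments of the trilinear map. -/
lemma tril_second_sub_le {K δ : ℝ} {a b c a' b' c' e f g e' f' g' : ℂ}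
    (ha : ‖a‖ ≤ K) (hb : ‖b‖ ≤ K) (ha' : ‖a'‖ ≤ K) (hb' : ‖b'‖ ≤ K)
    (hf : ‖b + f‖ ≤ K) (hf' : ‖b' + f'‖ ≤ K) (hg' : ‖c' + g'‖ ≤ K)
    (hee : ‖e‖ ≤ 2 * K) (hff : ‖f‖ ≤ 2 * K)
    (hda : ‖a' - a‖ ≤ δ) (hdb : ‖b' - b‖ ≤ δ) (hdc : ‖c' - c‖ ≤ δ) :
    ‖(tril (a' + e') (b' + f') (c' + g') - tril a' b' c')
      - (tril (a + e) (b + f) (c + g) - tril a b c)‖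
      ≤ 5 * K ^ 2 * (‖e' - e‖ + ‖f' - f‖ + ‖g' - g‖) + 2 * K * δ * (‖e‖ + ‖f‖ + ‖g‖) := by
  have hK : 0 ≤ K := (norm_nonneg a).trans ha
  have hδ : 0 ≤ δ := (norm_nonneg _).trans hda
  -- The increment is tril e (b+f) (c+g) + tril a f (c+g) + tril a b g. Telescoping between primed
  -- and unprimed arguments leaves terms with one difference of perturbations, or with a base point
  -- difference times a perturbation. No term has two differences of perturbations, so the bound is
  -- linear in them.
  have h : (tril (a' + e') (b' + f') (c' + g') - tril a' b' c')
      - (tril (a + e) (b + f) (c + g) - tril a b c)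
      = (tril (e' - e) (b' + f') (c' + g') + tril e (b' - b) (c' + g') + tril e (f' - f) (c' + g')
        + tril e (b + f) (c' - c) + tril e (b + f) (g' - g))
      + (tril (a' - a) f (c' + g') + tril a' (f' - f) (c' + g')
        + tril a f (c' - c) + tril a f (g' - g))
      + (tril (a' - a) b g + tril a' (b' - b) g + tril a' b' (g' - g)) := by
    simp only [tril, map_sub, map_add]; ring
  rw [h]
  have h1 : ‖tril (e' - e) (b' + f') (c' + g')‖ ≤ ‖e' - e‖ * K * K := by rw [norm_tril]; gcongr
  have h2 : ‖tril e (b' - b) (c' + g')‖ ≤ ‖e‖ * δ * K := by rw [norm_tril]; gcongr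
  have h3 : ‖tril e (f' - f) (c' + g')‖ ≤ (2 * K) * ‖f' - f‖ * K := by rw [norm_tril]; gcongr
  have h4 : ‖tril e (b + f) (c' - c)‖ ≤ ‖e‖ * K * δ := by rw [norm_tril]; gcongr
  have h5 : ‖tril e (b + f) (g' - g)‖ ≤ (2 * K) * K * ‖g' - g‖ := by rw [norm_tril]; gcongr
  have h6 : ‖tril (a' - a) f (c' + g')‖ ≤ δ * ‖f‖ * K := by rw [norm_tril]; gcongr
  have h7 : ‖tril a' (f' - f) (c' + g')‖ ≤ K * ‖f' - f‖ * K := by rw [norm_tril]; gcongr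
  have h8 : ‖tril a f (c' - c)‖ ≤ K * ‖f‖ * δ := by rw [norm_tril]; gcongr
  have h9 : ‖tril a f (g' - g)‖ ≤ K * (2 * K) * ‖g' - g‖ := by rw [norm_tril]; gcongr
  have h10 : ‖tril (a' - a) b g‖ ≤ δ * K * ‖g‖ := by rw [norm_tril]; gcongr
  have h11 : ‖tril a' (b' - b) g‖ ≤ K * δ * ‖g‖ := by rw [norm_tril]; gcongr
  have h12 : ‖tril a' b' (g' - g)‖ ≤ K * K * ‖g' - g‖ := by rw [norm_tril]; gcongr
  have hp1 : 0 ≤ K * K * ‖e' - e‖ := by positivity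
  have hp2 : 0 ≤ K * K * ‖f' - f‖ := by positivity
  refine norm_add₃_le.trans ?_
  refine (add_le_add (add_le_add ((norm_add_le _ _).trans (add_le_add_left
    ((norm_add_le _ _).trans (add_le_add_left norm_add₃_le _)) _))
    ((norm_add_le _ _).trans (add_le_add_left norm_add₃_le _))) norm_add₃_le).trans ?_
  nlinarith

variable {σ K : ℝ}

lemma sub_le (hσ0 : 0 ≤ σ) (hσ1 : σ ≤ 1 / 2) {x y z x' y' z' : ℂ}
    (hx : ‖x‖ ≤ K) (hy : ‖y‖ ≤ K) (hz : ‖z‖ ≤ K)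
    (hx' : ‖x'‖ ≤ K) (hy' : ‖y'‖ ≤ K) (hz' : ‖z'‖ ≤ K) :
    ‖cubic σ x y z - cubic σ x' y' z'‖
      ≤ 3 * K ^ 2 * (‖x - x'‖ + ‖y - y'‖ + ‖z - z'‖) := by
  rw [eq_tril, eq_tril]
  have h1 := tril_sub_le (u := y) (w' := y') hy hy hy' hy'
  have h2 := tril_sub_le (u := x) (w' := x') hx hx hx' hx'
  have h3 := tril_sub_le (u := x) (w' := z') hx hz hx' hx'
  have h4 := tril_sub_le (u := z) (w' := x') hz hx hz' hz'
  have h5 := tril_sub_le (u := z) (w' := z') hz hz hz' hz'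
  have e : ((1 - 2 * σ : ℝ) : ℂ) * tril y y y
      + ((σ / 2 : ℝ) : ℂ) * (tril x x x + tril x x z + tril z z x + tril z z z)
      - (((1 - 2 * σ : ℝ) : ℂ) * tril y' y' y'
      + ((σ / 2 : ℝ) : ℂ) * (tril x' x' x' + tril x' x' z' + tril z' z' x' + tril z' z' z'))
      = ((1 - 2 * σ : ℝ) : ℂ) * (tril y y y - tril y' y' y')
      + ((σ / 2 : ℝ) : ℂ) * ((tril x x x - tril x' x' x') + (tril x x z - tril x' x' z')
        + (tril z z x - tril z' z' x') + (tril z z z - tril z' z' z')) := by ring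
  rw [e]
  refine (norm_add_le _ _).trans ?_
  rw [norm_mul, norm_mul, Complex.norm_real, Complex.norm_real, Real.norm_eq_abs,
    Real.norm_eq_abs, abs_of_nonneg (by linarith), abs_of_nonneg (by linarith)]
  have h6 := (norm_add_le ((tril x x x - tril x' x' x') + (tril x x z - tril x' x' z')
        + (tril z z x - tril z' z' x')) (tril z z z - tril z' z' z')).trans
        (add_le_add_left norm_add₃_le _)
  set X := ‖x - x'‖
  set Y := ‖y - y'‖
  set Z := ‖z - z'‖
  have hX : 0 ≤ X := norm_nonneg _
  have hY : 0 ≤ Y := norm_nonneg _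
  have hZ : 0 ≤ Z := norm_nonneg _
  have h7 : (1 - 2 * σ) * ‖tril y y y - tril y' y' y'‖ ≤ (1 - 2 * σ) * (K ^ 2 * (3 * (X + Y + Z))) := by
    refine mul_le_mul_of_nonneg_left (h1.trans ?_) (by linarith)
    gcongr; linarith
  have h8 : σ / 2 * ‖(tril x x x - tril x' x' x') + (tril x x z - tril x' x' z')
        + (tril z z x - tril z' z' x') + (tril z z z - tril z' z' z')‖
        ≤ σ / 2 * (4 * (K ^ 2 * (3 * (X + Y + Z)))) := by
    refine mul_le_mul_of_nonneg_left (h6.trans ?_) (by linarith)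
    have hK : 0 ≤ K ^ 2 := sq_nonneg K
    have : 0 ≤ K ^ 2 * X := by positivity
    have : 0 ≤ K ^ 2 * Y := by positivity
    have : 0 ≤ K ^ 2 * Z := by positivity
    linarith
  linarith

lemma zero (σ : ℝ) : cubic σ 0 0 0 = 0 := by simp [cubic]

lemma norm_le (hσ0 : 0 ≤ σ) (hσ1 : σ ≤ 1 / 2) {x y z : ℂ}
    (hx : ‖x‖ ≤ K) (hy : ‖y‖ ≤ K) (hz : ‖z‖ ≤ K) :
    ‖cubic σ x y z‖ ≤ 3 * K ^ 2 * (‖x‖ + ‖y‖ + ‖z‖) := by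
  have hK : 0 ≤ K := (norm_nonneg x).trans hx
  have := sub_le (x' := 0) (y' := 0) (z' := 0) hσ0 hσ1 hx hy hz (by simpa) (by simpa) (by simpa)
  simpa [zero] using this

/-- Meant for neighbouring grid points: primed quantities are values at j + 1, and δ is the
Lipschitz bound of the base sequences times h. -/
lemma second_sub_le {δ : ℝ} (hσ0 : 0 ≤ σ) (hσ1 : σ ≤ 1 / 2) {a b c a' b' c' e f g e' f' g' : ℂ}
    (ha : ‖a‖ ≤ K) (hb : ‖b‖ ≤ K) (hc : ‖c‖ ≤ K) (ha' : ‖a'‖ ≤ K) (hb' : ‖b'‖ ≤ K) (hc' : ‖c'‖ ≤ K)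
    (he : ‖a + e‖ ≤ K) (hf : ‖b + f‖ ≤ K) (hg : ‖c + g‖ ≤ K)
    (he' : ‖a' + e'‖ ≤ K) (hf' : ‖b' + f'‖ ≤ K) (hg' : ‖c' + g'‖ ≤ K)
    (hda : ‖a' - a‖ ≤ δ) (hdb : ‖b' - b‖ ≤ δ) (hdc : ‖c' - c‖ ≤ δ) :
    ‖(cubic σ (a' + e') (b' + f') (c' + g') - cubic σ a' b' c')
      - (cubic σ (a + e) (b + f) (c + g) - cubic σ a b c)‖
      ≤ 15 * K ^ 2 * (‖e' - e‖ + ‖f' - f‖ + ‖g' - g‖) + 6 * K * δ * (‖e‖ + ‖f‖ + ‖g‖) := by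
  have hK : 0 ≤ K := (norm_nonneg a).trans ha
  have hδ : 0 ≤ δ := (norm_nonneg _).trans hda
  have two : ∀ {u v : ℂ}, ‖u‖ ≤ K → ‖u + v‖ ≤ K → ‖v‖ ≤ 2 * K := fun {u v} h1 h2 => by
    have := norm_sub_le (u + v) u
    rw [add_sub_cancel_left] at this; linarith
  have hee := two ha he
  have hff := two hb hf
  have hgg := two hc hg
  simp only [eq_tril]
  have h1 := tril_second_sub_le (g := f) (e' := f') hb hb hb' hb' hf hf' hf' hff hff hdb hdb hdb
  have h2 := tril_second_sub_le (g := e) (e' := e') ha ha ha' ha' he he' he' hee hee hda hda hda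
  have h3 := tril_second_sub_le (g := g) (e' := e') ha ha ha' ha' he he' hg' hee hee hda hda hdc
  have h4 := tril_second_sub_le (g := e) (e' := g') hc hc hc' hc' hg hg' he' hgg hgg hdc hdc hda
  have h5 := tril_second_sub_le (g := g) (e' := g') hc hc hc' hc' hg hg' hg' hgg hgg hdc hdc hdc
  set t1 := (tril (b' + f') (b' + f') (b' + f') - tril b' b' b')
      - (tril (b + f) (b + f) (b + f) - tril b b b)
  set t2 := (tril (a' + e') (a' + e') (a' + e') - tril a' a' a')
      - (tril (a + e) (a + e) (a + e) - tril a a a)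
  set t3 := (tril (a' + e') (a' + e') (c' + g') - tril a' a' c')
      - (tril (a + e) (a + e) (c + g) - tril a a c)
  set t4 := (tril (c' + g') (c' + g') (a' + e') - tril c' c' a')
      - (tril (c + g) (c + g) (a + e) - tril c c a)
  set t5 := (tril (c' + g') (c' + g') (c' + g') - tril c' c' c')
      - (tril (c + g) (c + g) (c + g) - tril c c c)
  have hcomb : ∀ v w : ℂ, v = ((1 - 2 * σ : ℝ) : ℂ) * t1 + ((σ / 2 : ℝ) : ℂ) * (t2 + t3 + t4 + t5) →
      w = v → ‖w‖ ≤ (1 - 2 * σ) * ‖t1‖ + σ / 2 * (‖t2‖ + ‖t3‖ + ‖t4‖ + ‖t5‖) := by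
    intro v w hv hw
    rw [hw, hv]
    refine (norm_add_le _ _).trans ?_
    rw [norm_mul, norm_mul, Complex.norm_real, Complex.norm_real, Real.norm_eq_abs,
      Real.norm_eq_abs, abs_of_nonneg (by linarith), abs_of_nonneg (by linarith)]
    gcongr
    exact (norm_add_le _ _).trans (add_le_add_left norm_add₃_le _)
  refine (hcomb _ _ rfl ?_).trans ?_
  · simp only [t1, t2, t3, t4, t5]; ring
  set X := ‖e' - e‖
  set Y := ‖f' - f‖
  set Z := ‖g' - g‖
  have hX : 0 ≤ K ^ 2 * X := by positivity
  have hY : 0 ≤ K ^ 2 * Y := by positivity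
  have hZ : 0 ≤ K ^ 2 * Z := by positivity
  have hX' : 0 ≤ K * δ * ‖e‖ := by positivity
  have hY' : 0 ≤ K * δ * ‖f‖ := by positivity
  have hZ' : 0 ≤ K * δ * ‖g‖ := by positivity
  set B := 15 * K ^ 2 * (X + Y + Z) + 6 * K * δ * (‖e‖ + ‖f‖ + ‖g‖)
  have b1 : ‖t1‖ ≤ B := by simp only [B]; linarith
  have b2 : ‖t2‖ + ‖t3‖ + ‖t4‖ + ‖t5‖ ≤ 4 * B := by simp only [B]; linarith
  have c1 := mul_le_mul_of_nonneg_left b1 (show 0 ≤ 1 - 2 * σ by linarith)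
  have c2 := mul_le_mul_of_nonneg_left b2 (show 0 ≤ σ / 2 by linarith)
  linarith

end cubic

/-! ### Difference quotients and the nonlinearity on sequences -/

namespace SeqSpace

/-- The forward difference quotient. -/
noncomputable def fwd (h : ℝ) : SeqSpace →L[ℂ] SeqSpace :=
  tri (-(1 / h) : ℝ) (1 / h : ℝ) 0

lemma fwd_apply (h : ℝ) (x : SeqSpace) (j : ℤ) : fwd h x j = (x (j + 1) - x j) / h := by
  rw [fwd, tri_apply]; push_cast; ring

lemma norm_fwd_apply {h : ℝ} (hh : 0 < h) (x : SeqSpace) (j : ℤ) :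
    ‖fwd h x j‖ = 1 / h * ‖x (j + 1) - x j‖ := by
  rw [fwd_apply, norm_div, Complex.norm_real, Real.norm_eq_abs, abs_of_pos hh]; ring

lemma norm_shift_sub {h : ℝ} (hh : 0 < h) (x : SeqSpace) : ‖shift x - x‖ = h * ‖fwd h x‖ := by
  have : shift x - x = (h : ℂ) • fwd h x := by
    refine ext_apply fun j => ?_
    have : (h : ℂ) ≠ 0 := by exact_mod_cast hh.ne'
    rw [smul_apply, fwd_apply, sub_apply, shift_apply]; field_simp
  rw [this, norm_smul, Complex.norm_real, Real.norm_eq_abs, abs_of_pos hh]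

/-- The discrete Sobolev inequality. -/
lemma norm_apply_sq_le_fwd {h : ℝ} (hh : 0 < h) (x : SeqSpace) (j : ℤ) :
    ‖x j‖ ^ 2 ≤ 2 * h * (‖x‖ * ‖fwd h x‖) := by
  have := norm_apply_sq_le x j
  rw [norm_shift_sub hh] at this
  linarith

lemma memℓp_cubic {σ : ℝ} (hσ0 : 0 ≤ σ) (hσ1 : σ ≤ 1 / 2) (x y z : SeqSpace) :
    Memℓp (fun j => cubic σ (x j) (y j) (z j)) 2 := by
  set K := ‖x‖ + ‖y‖ + ‖z‖
  have hb : ∀ j, ‖cubic σ (x j) (y j) (z j)‖ ≤ ∑ i : Fin 3, 3 * K ^ 2 * ‖![x, y, z] i j‖ := by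
    intro j
    have := norm_nonneg x
    have := norm_nonneg y
    have := norm_nonneg z
    refine (cubic.norm_le (K := K) hσ0 hσ1 ?_ ?_ ?_).trans (le_of_eq ?_)
    · exact (norm_apply_le x j).trans (by simp only [K]; linarith)
    · exact (norm_apply_le y j).trans (by simp only [K]; linarith)
    · exact (norm_apply_le z j).trans (by simp only [K]; linarith)
    · simp [Fin.sum_univ_three]; ring
  obtain ⟨u, hu⟩ := exists_of_le_sum Finset.univ (fun _ : Fin 3 => 3 * K ^ 2) ![x, y, z]
    (fun j => cubic σ (x j) (y j) (z j)) hb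
  have : (fun j => cubic σ (x j) (y j) (z j)) = u := by ext j; rw [hu]
  rw [this]; exact lp.memℓp u

lemma norm_le_three {x y₁ y₂ y₃ : SeqSpace} {c : ℝ} (hc : 0 ≤ c)
    (hx : ∀ j, ‖x j‖ ≤ c * (‖y₁ j‖ + ‖y₂ j‖ + ‖y₃ j‖)) : ‖x‖ ≤ c * (‖y₁‖ + ‖y₂‖ + ‖y₃‖) := by
  have := norm_le_of_le_sum Finset.univ (fun _ : Fin 3 => c) (fun _ _ => hc) ![y₁, y₂, y₃] x
    (fun j => (hx j).trans (le_of_eq (by simp [Fin.sum_univ_three]; ring)))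
  refine this.trans (le_of_eq (by simp [Fin.sum_univ_three]; ring))

lemma norm_le_six {x y₁ y₂ y₃ z₁ z₂ z₃ : SeqSpace} {c d : ℝ} (hc : 0 ≤ c) (hd : 0 ≤ d)
    (hx : ∀ j, ‖x j‖ ≤ c * (‖y₁ j‖ + ‖y₂ j‖ + ‖y₃ j‖) + d * (‖z₁ j‖ + ‖z₂ j‖ + ‖z₃ j‖)) :
    ‖x‖ ≤ c * (‖y₁‖ + ‖y₂‖ + ‖y₃‖) + d * (‖z₁‖ + ‖z₂‖ + ‖z₃‖) := by
  have := norm_le_of_le_sum Finset.univ (![c, c, c, d, d, d] : Fin 6 → ℝ)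
    (by intro i _; fin_cases i <;> simpa) ![y₁, y₂, y₃, z₁, z₂, z₃] x
    (fun j => (hx j).trans (le_of_eq (by simp [Fin.sum_univ_succ]; ring)))
  refine this.trans (le_of_eq (by simp [Fin.sum_univ_succ]; ring))

end SeqSpace

namespace Disc

open SeqSpace

variable (g : Disc)

lemma σ_nonneg : 0 ≤ g.σ := by rcases g.σ_cases with h | h <;> rw [h]; norm_num

lemma σ_le : g.σ ≤ 1 / 2 := by rcases g.σ_cases with h | h <;> rw [h]; norm_num

/-- The cubic nonlinearity on sequences. -/
noncomputable def G (x y z : SeqSpace) : SeqSpace :=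
  ⟨fun j => cubic g.σ (x j) (y j) (z j), memℓp_cubic g.σ_nonneg g.σ_le x y z⟩

@[simp] lemma G_apply (x y z : SeqSpace) (j : ℤ) :
    g.G x y z j = cubic g.σ (x j) (y j) (z j) := rfl

variable {g} {K : ℝ}

lemma norm_G_sub_le {x y z x' y' z' : SeqSpace} (hx : ∀ j, ‖x j‖ ≤ K) (hy : ∀ j, ‖y j‖ ≤ K)
    (hz : ∀ j, ‖z j‖ ≤ K) (hx' : ∀ j, ‖x' j‖ ≤ K) (hy' : ∀ j, ‖y' j‖ ≤ K) (hz' : ∀ j, ‖z' j‖ ≤ K) :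
    ‖g.G x y z - g.G x' y' z'‖ ≤ 3 * K ^ 2 * (‖x - x'‖ + ‖y - y'‖ + ‖z - z'‖) := by
  refine norm_le_three (by positivity) (fun j => ?_)
  simp only [sub_apply, G_apply]
  exact cubic.sub_le g.σ_nonneg g.σ_le (hx j) (hy j) (hz j) (hx' j) (hy' j) (hz' j)

lemma norm_G_le {x y z : SeqSpace} (hx : ∀ j, ‖x j‖ ≤ K) (hy : ∀ j, ‖y j‖ ≤ K)
    (hz : ∀ j, ‖z j‖ ≤ K) : ‖g.G x y z‖ ≤ 3 * K ^ 2 * (‖x‖ + ‖y‖ + ‖z‖) := by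
  refine norm_le_three (by positivity) (fun j => ?_)
  exact cubic.norm_le g.σ_nonneg g.σ_le (hx j) (hy j) (hz j)

/-- Only the base sequences need be Lipschitz on the grid; the perturbations need no pointwise bound
of their quotients. They enter linearly through ℓ² norms, so a Gronwall argument closes in the
discrete H¹ norm. -/
lemma norm_fwd_G_sub_le {a b c e e' e'' : SeqSpace}
    (ha : ∀ j, ‖a j‖ ≤ K) (hb : ∀ j, ‖b j‖ ≤ K) (hc : ∀ j, ‖c j‖ ≤ K)
    (he : ∀ j, ‖a j + e j‖ ≤ K) (he' : ∀ j, ‖b j + e' j‖ ≤ K) (he'' : ∀ j, ‖c j + e'' j‖ ≤ K)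
    (hda : ∀ j, ‖a (j + 1) - a j‖ ≤ K * g.h) (hdb : ∀ j, ‖b (j + 1) - b j‖ ≤ K * g.h)
    (hdc : ∀ j, ‖c (j + 1) - c j‖ ≤ K * g.h) :
    ‖fwd g.h (g.G (a + e) (b + e') (c + e'') - g.G a b c)‖
      ≤ 15 * K ^ 2 * (‖fwd g.h e‖ + ‖fwd g.h e'‖ + ‖fwd g.h e''‖)
        + 6 * K ^ 2 * (‖e‖ + ‖e'‖ + ‖e''‖) := by
  have hh := g.h_pos
  refine norm_le_six (by positivity) (by positivity) (fun j => ?_)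
  simp only [norm_fwd_apply hh, sub_apply, G_apply, add_apply]
  have := cubic.second_sub_le g.σ_nonneg g.σ_le (ha j) (hb j) (hc j) (ha (j + 1)) (hb (j + 1))
    (hc (j + 1)) (he j) (he' j) (he'' j) (he (j + 1)) (he' (j + 1)) (he'' (j + 1))
    (hda j) (hdb j) (hdc j)
  have h1 : 1 / g.h * ‖(cubic g.σ (a (j + 1) + e (j + 1)) (b (j + 1) + e' (j + 1)) (c (j + 1) + e'' (j + 1))
      - cubic g.σ (a (j + 1)) (b (j + 1)) (c (j + 1)))
      - (cubic g.σ (a j + e j) (b j + e' j) (c j + e'' j) - cubic g.σ (a j) (b j) (c j))‖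
      ≤ 1 / g.h * (15 * K ^ 2 * (‖e (j + 1) - e j‖ + ‖e' (j + 1) - e' j‖ + ‖e'' (j + 1) - e'' j‖)
        + 6 * K * (K * g.h) * (‖e j‖ + ‖e' j‖ + ‖e'' j‖)) := by gcongr
  refine h1.trans (le_of_eq ?_)
  field_simp

lemma fwd_A (x : SeqSpace) : fwd g.h (g.A x) = g.A (fwd g.h x) := tri_comm _ _ _ _ _ _ x
lemma fwd_A' (x : SeqSpace) : fwd g.h (g.A' x) = g.A' (fwd g.h x) := tri_comm _ _ _ _ _ _ x
lemma fwd_b (x : SeqSpace) : fwd g.h (g.b x) = g.b (fwd g.h x) := tri_comm _ _ _ _ _ _ x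

lemma norm_A_ge (hg : g.CFL) (x : SeqSpace) : g.m * ‖x‖ ≤ ‖g.A x‖ := by
  have := g.coercive hg x
  have hm := g.m_pos
  refine abs_le_of_sq_le_sq' ?_ (norm_nonneg _) |>.2
  nlinarith [sq_nonneg ‖g.b x‖]

lemma surjective_A (hg : g.CFL) : Function.Surjective g.A :=
  surjective_of_bounded_below g.twoStepOps.adj g.twoStepOps.norm_adj g.m_pos (norm_A_ge hg)

lemma injective_A (hg : g.CFL) {x y : SeqSpace} (h : g.A x = g.A y) : x = y := by
  have h1 := norm_A_ge hg (x - y)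
  rw [map_sub, h, sub_self, norm_zero] at h1
  have := g.m_pos
  have h2 : ‖x - y‖ ≤ 0 := by nlinarith [norm_nonneg (x - y)]
  exact sub_eq_zero.1 (norm_le_zero_iff.1 h2)

/-- The pair energy of the scheme. -/
noncomputable def energy (g : Disc) (x y : SeqSpace) : ℝ := pairEnergy g.A g.b x y

lemma energy_step (hg : g.CFL) {x y z f : SeqSpace} (hstep : g.A x - g.b y + g.A' z = f) :
    g.energy x y ≤ g.energy y z + ‖f‖ := by
  refine g.twoStepOps.energy_step (fun u => ?_) hstep
  have := g.coercive hg u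
  have : 0 ≤ 4 * (g.m ^ 2 * ‖u‖ ^ 2) := by positivity
  linarith

lemma norm_fst_le (hg : g.CFL) (x y : SeqSpace) : g.m * ‖x‖ ≤ g.energy x y :=
  g.twoStepOps.norm_fst_le (g.coercive hg) x y

lemma norm_snd_le (hg : g.CFL) (x y : SeqSpace) : g.m * ‖y‖ ≤ g.energy x y :=
  TwoStepOps.norm_snd_le (g.coercive hg) x y

end Disc

/-! ### Solvability by contraction and a discrete Gronwall inequality -/

lemma exists_fixed_point_of_half_lipschitz {X : Type*} [MetricSpace X] [CompleteSpace X] {s : Set X}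
    (hs : IsClosed s) (hne : s.Nonempty) {f : X → X} (hf : MapsTo f s s)
    (hlip : ∀ x ∈ s, ∀ y ∈ s, dist (f x) (f y) ≤ 1 / 2 * dist x y) : ∃ x ∈ s, f x = x := by
  obtain ⟨x, hx⟩ := hne
  have hc : ContractingWith (1 / 2) (hf.restrict f s s) := by
    refine ⟨by rw [div_lt_one (by norm_num)]; norm_num, LipschitzWith.of_dist_le_mul ?_⟩
    rintro ⟨x, hx⟩ ⟨y, hy⟩
    have := hlip x hx y hy
    simp only [NNReal.coe_div, NNReal.coe_one, NNReal.coe_ofNat, Subtype.dist_eq]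
    exact this
  obtain ⟨y, hy, hy', -⟩ := hc.exists_fixedPoint' hs.isComplete hf hx (edist_ne_top _ _)
  exact ⟨y, hy, hy'⟩

namespace Disc

variable {g : Disc}

/-- Solvability of an implicit step by contraction. -/
lemma exists_implicit_step (hg : g.CFL) {s : Set SeqSpace} (hs : IsClosed s) (hne : s.Nonempty)
    {Φ : SeqSpace → SeqSpace} (hmaps : ∀ x ∈ s, ∀ v, g.A v = Φ x → v ∈ s)
    (hlip : ∀ x ∈ s, ∀ y ∈ s, ‖Φ x - Φ y‖ ≤ g.m / 2 * ‖x - y‖) : ∃ x ∈ s, g.A x = Φ x := by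
  -- The map x ↦ A⁻¹Φ(x) contracts by 1/2, because ‖A⁻¹‖ ≤ 1/m and Φ has Lipschitz constant m/2 on
  -- the set.
  choose f hf using fun x => surjective_A hg (Φ x)
  obtain ⟨x, hx, hfx⟩ := exists_fixed_point_of_half_lipschitz hs hne (f := f)
    (fun x hx => hmaps x hx _ (hf x)) (fun x hx y hy => by
      rw [dist_eq_norm, dist_eq_norm]
      have h1 := norm_A_ge hg (f x - f y)
      rw [map_sub, hf, hf] at h1
      have h2 := hlip x hx y hy
      have hm := g.m_pos
      refine le_of_mul_le_mul_left ?_ hm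
      linarith)
  refine ⟨x, hx, ?_⟩
  have := hf x
  rwa [hfx] at this

end Disc

/-- The new value appears on the right because the error estimate of a step involves the new level.
It is absorbed using (1 + θ)/(1 - θ) ≤ 1 + 4θ, which is where θ ≤ 1/2 is needed. -/
lemma le_exp_mul_of_two_sided_step {Z : ℕ → ℝ} {θ η : ℝ} {n : ℕ} (hZ : ∀ k, 0 ≤ Z k) (hθ : 0 ≤ θ)
    (hθ' : θ ≤ 1 / 2) (hη : 0 ≤ η)
    (hstep : ∀ k < n, Z (k + 1) ≤ Z k + θ * (Z (k + 1) + Z k) + η) :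
    Z n ≤ Real.exp (4 * θ * n) * (Z 0 + 2 * n * η) := by
  induction n with
  | zero => simp
  | succ n ih =>
    have ih := ih (fun k hk => hstep k (by omega))
    have h1 := hstep n (by omega)
    have h2 : Z (n + 1) ≤ (1 + 4 * θ) * Z n + 2 * η := by
      have hd : 0 < 1 - θ := by linarith
      refine le_of_mul_le_mul_left ?_ hd
      have := mul_nonneg (hZ n) (mul_nonneg hθ (show 0 ≤ 1 - 2 * θ by linarith))
      have := mul_nonneg hη (show 0 ≤ 1 - 2 * θ by linarith)
      nlinarith
    have h3 : 1 + 4 * θ ≤ Real.exp (4 * θ) := by linarith [Real.add_one_le_exp (4 * θ)]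
    have h4 : Real.exp (4 * θ * (n + 1 : ℕ)) = Real.exp (4 * θ) * Real.exp (4 * θ * n) := by
      rw [← Real.exp_add]; push_cast; ring_nf
    have h5 : 1 ≤ Real.exp (4 * θ) * Real.exp (4 * θ * n) := by
      rw [← Real.exp_add]; exact Real.one_le_exp (by positivity)
    have h6 : (1 + 4 * θ) * Z n ≤ Real.exp (4 * θ) * (Real.exp (4 * θ * n) * (Z 0 + 2 * n * η)) :=
      mul_le_mul h3 ih (hZ n) (by positivity)
    have h7 := mul_le_mul_of_nonneg_right h5 (show 0 ≤ 2 * η by linarith)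
    calc Z (n + 1) ≤ Real.exp (4 * θ) * (Real.exp (4 * θ * n) * (Z 0 + 2 * n * η))
          + (Real.exp (4 * θ) * Real.exp (4 * θ * n)) * (2 * η) := by linarith
      _ = _ := by rw [h4]; push_cast; ring


/-! ### Elimination of the oscillatory phase -/

lemma cis_add (a b : ℝ) : cis (a + b) = cis a * cis b := by
  rw [cis, cis, cis, ← Complex.exp_add]; push_cast; ring_nf

lemma norm_cis (a : ℝ) : ‖cis a‖ = 1 := by
  rw [cis, mul_comm]; exact Complex.norm_exp_ofReal_mul_I a

lemma cis_neg_mul (a : ℝ) : cis (-a) * cis a = 1 := by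
  rw [← cis_add, neg_add_cancel]; simp [cis]

namespace Disc

open SeqSpace

variable (g : Disc)

/-- The residual of the two-step scheme in slowly varying variables: new, middle and old level. -/
noncomputable def stepFn (lam : ℝ) (x y z : ℤ → ℂ) (j : ℤ) : ℂ :=
  g.μ * (x j - 2 * y j + z j) - Complex.I * (g.w / g.τ : ℝ) * (x j - z j)
    - g.s * ((g.σ * (x (j + 1) + z (j + 1)) + (1 - 2 * g.σ) * y (j + 1))
        - 2 * (g.σ * (x j + z j) + (1 - 2 * g.σ) * y j)
        + (g.σ * (x (j - 1) + z (j - 1)) + (1 - 2 * g.σ) * y (j - 1)))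
    - g.q * ((x (j + 1) - x (j - 1)) - (z (j + 1) - z (j - 1)))
    + lam * cubic g.σ (x j) (y j) (z j)

/-- The residual of the starting step in slowly varying variables. -/
noncomputable def startFn (lam : ℝ) (y x : ℤ → ℂ) (j : ℤ) : ℂ :=
  2 * (g.μ - Complex.I * (g.w / g.τ : ℝ)) * (x j - y j)
    - g.s * (y (j + 1) - 2 * y j + y (j - 1)) + lam * ((‖y j‖ ^ 2 : ℝ) : ℂ) * y j

lemma stepFn_eq (lam : ℝ) (x y z : SeqSpace) (j : ℤ) :
    g.stepFn lam x y z j = (g.A x - g.b y + g.A' z + (lam : ℂ) • g.G x y z) j := by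
  simp only [add_apply, sub_apply, smul_apply, A, A', b, tri_apply, stepFn, G_apply]
  push_cast
  ring

lemma one_sub_groupVel_sq : 1 - groupVel g.κ g.w ^ 2 = 1 / g.w ^ 2 := by
  have := g.w_ne
  have h := g.w_sq
  rw [groupVel]; field_simp; linarith

lemma s_eq : (1 - groupVel g.κ g.w ^ 2) / g.h ^ 2 = g.s := by
  rw [one_sub_groupVel_sq, s]
  have := g.w_ne
  have := g.h_pos
  field_simp

lemma q_eq : g.ε * groupVel g.κ g.w / (2 * g.τ * g.h) = g.q := by
  rw [q, groupVel]
  have := g.w_ne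
  have := g.h_pos
  have := g.τ_pos
  field_simp

/-- Coefficient identities behind the elimination of the oscillatory phase. -/
lemma time_coeff : g.ε ^ 2 * alphaPar g.κ g.w g.ε g.τ / g.τ ^ 2
    - 2 * g.ε * groupVel g.κ g.w * betaPar g.κ g.ε g.h / (2 * g.τ * g.h) = -(g.w / g.τ) := by
  have := g.w_ne
  have := g.h_pos
  have := g.τ_pos
  have := g.ε_pos
  rw [alphaPar, betaPar, vartheta]; field_simp; ring

/-- The first-order space differences arise from the weight iβ and from the iα-part of the mixed
difference. They cancel because κ(1 - c_g²) + c_gϑ = κ/w² - κ/w² = 0. -/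
lemma space_coeff : (1 - groupVel g.κ g.w ^ 2) * betaPar g.κ g.ε g.h / g.h ^ 2
    + 2 * g.ε * groupVel g.κ g.w * alphaPar g.κ g.w g.ε g.τ / (2 * g.τ * g.h) = 0 := by
  have := g.w_ne
  have := g.h_pos
  have := g.τ_pos
  have := g.ε_pos
  rw [alphaPar, betaPar, vartheta, groupVel]; field_simp; ring

variable {g} {lam : ℝ} {x y z P pm p pp : ℤ → ℂ}

/-- With P the phase at the middle level, the residual of the scheme is P times `stepFn`, and P
never vanishes. In the final combination `hα` and `hβ` cancel the weights against the phase shifts,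
and `hs` removes the first-order space difference. -/
lemma leapfrogStep_iff (hσ : g.σ = 0) (hP : ∀ j, ‖P j‖ = 1)
    (hPβ : ∀ j, P (j + 1) = P j * cis (betaPar g.κ g.ε g.h))
    (hpm : ∀ j, pm j = z j * (P j * cis (-alphaPar g.κ g.w g.ε g.τ)))
    (hp : ∀ j, p j = y j * P j)
    (hpp : ∀ j, pp j = x j * (P j * cis (alphaPar g.κ g.w g.ε g.τ))) :
    LeapfrogStep g.κ lam g.w g.ε g.τ g.h pm p pp ↔ ∀ j, g.stepFn lam x y z j = 0 := by
  have hP0 : ∀ j, P j ≠ 0 := fun j => by rw [← norm_ne_zero_iff, hP]; exact one_ne_zero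
  have hPm : ∀ j, P (j - 1) = P j * cis (-betaPar g.κ g.ε g.h) := fun j => by
    have := hPβ (j - 1)
    rw [sub_add_cancel] at this
    rw [this, mul_assoc, mul_comm (cis _), cis_neg_mul, mul_one]
  have hα := cis_neg_mul (alphaPar g.κ g.w g.ε g.τ)
  have hβ := cis_neg_mul (betaPar g.κ g.ε g.h)
  have ht := congrArg (fun r : ℝ => (r : ℂ)) g.time_coeff
  have hs := congrArg (fun r : ℝ => (r : ℂ)) g.space_coeff
  have hss := congrArg (fun r : ℝ => (r : ℂ)) g.s_eq
  have hq := congrArg (fun r : ℝ => (r : ℂ)) g.q_eq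
  unfold LeapfrogStep
  refine forall_congr' fun j => ?_
  have hnorm : ‖p j‖ = ‖y j‖ := by rw [hp, norm_mul, hP, mul_one]
  rw [← mul_eq_zero_iff_left (hP0 j) (b := g.stepFn lam x y z j)]
  refine Eq.congr_left ?_
  rw [hnorm]
  simp only [timeDiff2, spaceDiff2, mixedDiff, stepFn, hpm, hp, hpp, hPβ, hPm, hσ, cubic]
  push_cast at ht hs hss hq ⊢
  rw [← hss, ← hq, show (g.w : ℂ) / g.τ = -(-(g.w / g.τ)) by ring, ← ht]
  unfold μ
  push_cast
  generalize cis (alphaPar g.κ g.w g.ε g.τ) = a at *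
  generalize cis (-alphaPar g.κ g.w g.ε g.τ) = a' at *
  generalize cis (betaPar g.κ g.ε g.h) = b at *
  generalize cis (-betaPar g.κ g.ε g.h) = b' at *
  linear_combination (exp := 1) (-(y (j + 1) - y (j - 1)) * P j * Complex.I) * hs
    + (g.ε ^ 2 * ((1 + Complex.I * alphaPar g.κ g.w g.ε g.τ) * x j
        + (1 - Complex.I * alphaPar g.κ g.w g.ε g.τ) * z j) * P j / g.τ ^ 2
      - 2 * g.ε * groupVel g.κ g.w * (((x (j + 1) - x (j - 1)) - (z (j + 1) - z (j - 1)))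
          * (b' * b) * P j / (4 * g.τ * g.h)
        + Complex.I * betaPar g.κ g.ε g.h * (x j - z j) * P j / (2 * g.τ * g.h))) * hα
    + (-(1 - (groupVel g.κ g.w : ℂ) ^ 2) * ((1 + Complex.I * betaPar g.κ g.ε g.h) * y (j + 1)
        + (1 - Complex.I * betaPar g.κ g.ε g.h) * y (j - 1)) * P j / g.h ^ 2
      - 2 * g.ε * groupVel g.κ g.w * (((x (j + 1) - x (j - 1)) - (z (j + 1) - z (j - 1)))
          * P j / (4 * g.τ * g.h)
        + Complex.I * alphaPar g.κ g.w g.ε g.τ * (y (j + 1) - y (j - 1)) * P j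
          / (2 * g.τ * g.h))) * hβ

lemma crankNicolsonStep_iff (hσ : g.σ = 1 / 2) (hP : ∀ j, ‖P j‖ = 1)
    (hPβ : ∀ j, P (j + 1) = P j * cis (betaPar g.κ g.ε g.h))
    (hpm : ∀ j, pm j = z j * (P j * cis (-alphaPar g.κ g.w g.ε g.τ)))
    (hp : ∀ j, p j = y j * P j)
    (hpp : ∀ j, pp j = x j * (P j * cis (alphaPar g.κ g.w g.ε g.τ))) :
    CrankNicolsonStep g.κ lam g.w g.ε g.τ g.h pm p pp ↔ ∀ j, g.stepFn lam x y z j = 0 := by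
  have hP0 : ∀ j, P j ≠ 0 := fun j => by rw [← norm_ne_zero_iff, hP]; exact one_ne_zero
  have hPm : ∀ j, P (j - 1) = P j * cis (-betaPar g.κ g.ε g.h) := fun j => by
    have := hPβ (j - 1)
    rw [sub_add_cancel] at this
    rw [this, mul_assoc, mul_comm (cis _), cis_neg_mul, mul_one]
  have hα := cis_neg_mul (alphaPar g.κ g.w g.ε g.τ)
  have hβ := cis_neg_mul (betaPar g.κ g.ε g.h)
  have ht := congrArg (fun r : ℝ => (r : ℂ)) g.time_coeff
  have hs := congrArg (fun r : ℝ => (r : ℂ)) g.space_coeff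
  have hss := congrArg (fun r : ℝ => (r : ℂ)) g.s_eq
  have hq := congrArg (fun r : ℝ => (r : ℂ)) g.q_eq
  unfold CrankNicolsonStep
  refine forall_congr' fun j => ?_
  have hnorm : ‖pp j‖ = ‖x j‖ := by rw [hpp, norm_mul, norm_mul, hP, norm_cis]; ring
  have hnorm' : ‖pm j‖ = ‖z j‖ := by rw [hpm, norm_mul, norm_mul, hP, norm_cis]; ring
  rw [← mul_eq_zero_iff_left (hP0 j) (b := g.stepFn lam x y z j)]
  refine Eq.congr_left ?_
  rw [hnorm, hnorm']
  simp only [timeDiff2, spaceDiff2, mixedDiff, timeAvg, stepFn, hpm, hp, hpp, hPβ, hPm, hσ, cubic]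
  push_cast at ht hs hss hq ⊢
  rw [← hss, ← hq, show (g.w : ℂ) / g.τ = -(-(g.w / g.τ)) by ring, ← ht]
  unfold μ
  push_cast
  generalize cis (alphaPar g.κ g.w g.ε g.τ) = a at *
  generalize cis (-alphaPar g.κ g.w g.ε g.τ) = a' at *
  generalize cis (betaPar g.κ g.ε g.h) = b at *
  generalize cis (-betaPar g.κ g.ε g.h) = b' at *
  linear_combination (exp := 1)
    (-((x (j + 1) + z (j + 1)) / 2 - (x (j - 1) + z (j - 1)) / 2) * P j * Complex.I) * hs
    + (g.ε ^ 2 * ((1 + Complex.I * alphaPar g.κ g.w g.ε g.τ) * x j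
        + (1 - Complex.I * alphaPar g.κ g.w g.ε g.τ) * z j) * P j / g.τ ^ 2
      - (1 - (groupVel g.κ g.w : ℂ) ^ 2) * ((1 + Complex.I * betaPar g.κ g.ε g.h) * (b' * b)
          * ((x (j + 1) + z (j + 1)) / 2) - 2 * ((x j + z j) / 2)
        + (1 - Complex.I * betaPar g.κ g.ε g.h) * (b' * b) * ((x (j - 1) + z (j - 1)) / 2))
          * P j / g.h ^ 2
      - 2 * g.ε * groupVel g.κ g.w * (((x (j + 1) - x (j - 1)) - (z (j + 1) - z (j - 1)))
          * (b' * b) * P j / (4 * g.τ * g.h)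
        + Complex.I * betaPar g.κ g.ε g.h * (x j - z j) * P j / (2 * g.τ * g.h)
        + Complex.I * alphaPar g.κ g.w g.ε g.τ * ((x (j + 1) + z (j + 1)) / 2
            - (x (j - 1) + z (j - 1)) / 2) * (b' * b) * P j / (2 * g.τ * g.h))
      + lam * (((‖x j‖ : ℂ) ^ 2 + (‖z j‖ : ℂ) ^ 2) / 2) * ((x j + z j) / 2) * P j) * hα
    + (-(1 - (groupVel g.κ g.w : ℂ) ^ 2) * ((1 + Complex.I * betaPar g.κ g.ε g.h)
          * ((x (j + 1) + z (j + 1)) / 2)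
        + (1 - Complex.I * betaPar g.κ g.ε g.h) * ((x (j - 1) + z (j - 1)) / 2)) * P j / g.h ^ 2
      - 2 * g.ε * groupVel g.κ g.w * (((x (j + 1) - x (j - 1)) - (z (j + 1) - z (j - 1)))
          * P j / (4 * g.τ * g.h)
        + Complex.I * alphaPar g.κ g.w g.ε g.τ * ((x (j + 1) + z (j + 1)) / 2
            - (x (j - 1) + z (j - 1)) / 2) * P j / (2 * g.τ * g.h))) * hβ

lemma startingStep_iff (hP : ∀ j, ‖P j‖ = 1)
    (hPβ : ∀ j, P (j + 1) = P j * cis (betaPar g.κ g.ε g.h))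
    (hp : ∀ j, p j = y j * P j)
    (hpp : ∀ j, pp j = x j * (P j * cis (alphaPar g.κ g.w g.ε g.τ))) :
    StartingStep g.κ lam g.w g.ε g.τ g.h p pp ↔ ∀ j, g.startFn lam y x j = 0 := by
  have hP0 : ∀ j, P j ≠ 0 := fun j => by rw [← norm_ne_zero_iff, hP]; exact one_ne_zero
  have hPm : ∀ j, P (j - 1) = P j * cis (-betaPar g.κ g.ε g.h) := fun j => by
    have := hPβ (j - 1)
    rw [sub_add_cancel] at this
    rw [this, mul_assoc, mul_comm (cis _), cis_neg_mul, mul_one]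
  have hα := cis_neg_mul (alphaPar g.κ g.w g.ε g.τ)
  have hβ := cis_neg_mul (betaPar g.κ g.ε g.h)
  have hss := congrArg (fun r : ℝ => (r : ℂ)) g.s_eq
  unfold StartingStep
  refine forall_congr' fun j => ?_
  have hnorm : ‖p j‖ = ‖y j‖ := by rw [hp, norm_mul, hP, mul_one]
  rw [← mul_eq_zero_iff_left (hP0 j) (b := g.startFn lam y x j)]
  refine Eq.congr_left ?_
  rw [hnorm]
  simp only [startFn, hp, hpp, hPβ, hPm]
  push_cast at hss ⊢
  rw [← hss]
  unfold μ
  push_cast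
  generalize cis (alphaPar g.κ g.w g.ε g.τ) = a at *
  generalize cis (-alphaPar g.κ g.w g.ε g.τ) = a' at *
  generalize cis (betaPar g.κ g.ε g.h) = b at *
  generalize cis (-betaPar g.κ g.ε g.h) = b' at *
  linear_combination (exp := 1)
    ((2 * g.ε ^ 2 / g.τ - 2 * Complex.I * g.w) * x j * P j / g.τ) * hα
    - (1 - (groupVel g.κ g.w : ℂ) ^ 2) * (y (j + 1) + y (j - 1)) * P j / g.h ^ 2 * hβ

end Disc


/-! ### Propagation of errors and solutions near an approximate solution -/

namespace Disc

open SeqSpace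

/-- The residual of the two-step scheme on sequences: new, middle and old level. -/
noncomputable def resid (g : Disc) (lam : ℝ) (x y z : SeqSpace) : SeqSpace :=
  g.A x - g.b y + g.A' z + (lam : ℂ) • g.G x y z

/-- `u` satisfies the two-step recursion up to level `N`. -/
def Solves (g : Disc) (lam : ℝ) (N : ℕ) (u : ℕ → SeqSpace) : Prop :=
  ∀ k, k + 2 ≤ N → g.resid lam (u (k + 2)) (u (k + 1)) (u k) = 0

/-- `a` is a uniformly bounded and Lipschitz approximate solution with defect `η` up to level
`N`. -/
structure Approx (g : Disc) (lam M η : ℝ) (N : ℕ) (a : ℕ → SeqSpace) : Prop where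
  bound : ∀ n ≤ N, ∀ j, ‖a n j‖ ≤ M
  diff : ∀ n ≤ N, ∀ j, ‖a n (j + 1) - a n j‖ ≤ M * g.h
  res : ∀ k, k + 2 ≤ N → ‖g.resid lam (a (k + 2)) (a (k + 1)) (a k)‖ ≤ η
  res_fwd : ∀ k, k + 2 ≤ N → ‖fwd g.h (g.resid lam (a (k + 2)) (a (k + 1)) (a k))‖ ≤ η

/-- The energy of a pair of sequences and of their difference quotients. -/
noncomputable def energy₁ (g : Disc) (x y : SeqSpace) : ℝ :=
  g.energy x y + g.energy (fwd g.h x) (fwd g.h y)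

variable {g : Disc} {lam K : ℝ}

lemma energy_nonneg (x y : SeqSpace) : 0 ≤ g.energy x y := Real.sqrt_nonneg _

lemma energy₁_nonneg (x y : SeqSpace) : 0 ≤ g.energy₁ x y :=
  add_nonneg (energy_nonneg _ _) (energy_nonneg _ _)

lemma norm_add_fst_le (hg : g.CFL) (x y : SeqSpace) :
    g.m * (‖x‖ + ‖fwd g.h x‖) ≤ g.energy₁ x y := by
  rw [mul_add]; exact add_le_add (norm_fst_le hg _ _) (norm_fst_le hg _ _)

lemma norm_add_snd_le (hg : g.CFL) (x y : SeqSpace) :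
    g.m * (‖y‖ + ‖fwd g.h y‖) ≤ g.energy₁ x y := by
  rw [mul_add]; exact add_le_add (norm_snd_le hg _ _) (norm_snd_le hg _ _)

/-- The factor √h compensates the h^{-1/2} carried by ℓ² norms of grid samples. -/
lemma apply_le_of_norm_le {h r : ℝ} (hh : 0 < h) (hr : 0 ≤ r) {x : SeqSpace}
    (hx : ‖x‖ + ‖fwd h x‖ ≤ r) (j : ℤ) : ‖x j‖ ≤ Real.sqrt h * r := by
  have h1 := norm_apply_sq_le_fwd hh x j
  have h2 : 2 * h * (‖x‖ * ‖fwd h x‖) ≤ h * (‖x‖ + ‖fwd h x‖) ^ 2 := by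
    nlinarith [mul_nonneg hh.le (sq_nonneg ‖x‖), mul_nonneg hh.le (sq_nonneg ‖fwd h x‖)]
  have h3 : h * (‖x‖ + ‖fwd h x‖) ^ 2 ≤ h * r ^ 2 := by gcongr
  refine abs_le_of_sq_le_sq' ?_ (by positivity) |>.2
  rw [mul_pow, Real.sq_sqrt hh.le]
  linarith

/-- One step of the error recursion. -/
lemma energy₁_step (hg : g.CFL) {a a' a'' e e' e'' : SeqSpace} {η : ℝ}
    (ha : ∀ j, ‖a j‖ ≤ K) (ha' : ∀ j, ‖a' j‖ ≤ K) (ha'' : ∀ j, ‖a'' j‖ ≤ K)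
    (he : ∀ j, ‖a j + e j‖ ≤ K) (he' : ∀ j, ‖a' j + e' j‖ ≤ K) (he'' : ∀ j, ‖a'' j + e'' j‖ ≤ K)
    (hda : ∀ j, ‖a (j + 1) - a j‖ ≤ K * g.h) (hda' : ∀ j, ‖a' (j + 1) - a' j‖ ≤ K * g.h)
    (hda'' : ∀ j, ‖a'' (j + 1) - a'' j‖ ≤ K * g.h)
    (hres : ‖g.resid lam a a' a''‖ ≤ η) (hres' : ‖fwd g.h (g.resid lam a a' a'')‖ ≤ η)
    {v : SeqSpace} (hv : g.A v - g.b e' + g.A' e''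
      = -((lam : ℂ) • (g.G (a + e) (a' + e') (a'' + e'') - g.G a a' a'')) - g.resid lam a a' a'') :
    g.energy v e' ≤ g.energy e' e''
      + (|lam| * (3 * K ^ 2 * (‖e‖ + ‖e'‖ + ‖e''‖)) + η) ∧
    g.energy (fwd g.h v) (fwd g.h e') ≤ g.energy (fwd g.h e') (fwd g.h e'')
      + (|lam| * (15 * K ^ 2 * (‖fwd g.h e‖ + ‖fwd g.h e'‖ + ‖fwd g.h e''‖)
          + 6 * K ^ 2 * (‖e‖ + ‖e'‖ + ‖e''‖)) + η) := by
  constructor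
  · refine (energy_step hg hv).trans (add_le_add_right ?_ _)
    refine (norm_sub_le _ _).trans ?_
    rw [norm_neg, norm_smul, Complex.norm_real, Real.norm_eq_abs]
    gcongr
    have := norm_G_sub_le (g := g) (x := a + e) (y := a' + e') (z := a'' + e'') he he' he'' ha ha' ha''
    simpa using this
  · have hv' := congrArg (fwd g.h) hv
    rw [map_add, map_sub, fwd_A, fwd_b, fwd_A', map_sub, map_neg, map_smul] at hv'
    refine (energy_step hg hv').trans (add_le_add_right ?_ _)
    refine (norm_sub_le _ _).trans ?_
    rw [norm_neg, norm_smul, Complex.norm_real, Real.norm_eq_abs]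
    gcongr
    exact norm_fwd_G_sub_le ha ha' ha'' he he' he'' hda hda' hda''

lemma error_eq {a a' a'' e e' e'' : SeqSpace}
    (h : g.resid lam (a + e) (a' + e') (a'' + e'') = 0) : g.A e - g.b e' + g.A' e''
      = -((lam : ℂ) • (g.G (a + e) (a' + e') (a'' + e'') - g.G a a' a''))
        - g.resid lam a a' a'' := by
  unfold resid at h ⊢
  simp only [map_add] at h
  rw [← sub_eq_zero] at h ⊢
  rw [← h]
  module

lemma resid_eq_zero_of_error_eq {a a' a'' e e' e'' : SeqSpace}
    (h : g.A e - g.b e' + g.A' e''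
      = -((lam : ℂ) • (g.G (a + e) (a' + e') (a'' + e'') - g.G a a' a''))
        - g.resid lam a a' a'') : g.resid lam (a + e) (a' + e') (a'' + e'') = 0 := by
  unfold resid at h ⊢
  simp only [map_add]
  rw [← sub_eq_zero] at h
  rw [← h]
  module

/-- Error growth for solutions which are bounded by `K`. -/
lemma energy₁_le (hg : g.CFL) {N : ℕ} {η : ℝ} {u a : ℕ → SeqSpace} (hη : 0 ≤ η)
    (ha : g.Approx lam K η N a) (hu : g.Solves lam N u) (huK : ∀ n ≤ N, ∀ j, ‖u n j‖ ≤ K)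
    (hθ : 30 * |lam| * K ^ 2 ≤ g.m / 2) {n : ℕ} (hn : n + 1 ≤ N) :
    g.energy₁ (u (n + 1) - a (n + 1)) (u n - a n)
      ≤ Real.exp (120 * |lam| * K ^ 2 / g.m * n)
        * (g.energy₁ (u 1 - a 1) (u 0 - a 0) + 4 * n * η) := by
  have hm := g.m_pos
  set Z : ℕ → ℝ := fun k => g.energy₁ (u (k + 1) - a (k + 1)) (u k - a k) with hZ
  -- The two estimates of a step together cost at most 15|λ|K² times the H¹ norms of three levels.
  -- The two newer levels are bounded by Z (k+1)/m, the oldest by Z k/m, whence 30. The defect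
  -- enters once for the error and once for its quotient.
  have := le_exp_mul_of_two_sided_step (Z := Z) (θ := 30 * |lam| * K ^ 2 / g.m) (η := 2 * η)
    (n := n) (fun k => energy₁_nonneg _ _) (by positivity)
    (by rw [div_le_iff₀ hm]; linarith) (by positivity) ?_
  · refine this.trans (le_of_eq ?_)
    simp only [hZ]
    ring_nf
  intro k hk
  have hadd : ∀ i (j : ℤ), a i j + (u i - a i) j = u i j := fun i j => by rw [sub_apply]; ring
  have hsol := hu k (by omega)
  rw [show u (k + 2) = a (k + 2) + (u (k + 2) - a (k + 2)) by abel,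
    show u (k + 1) = a (k + 1) + (u (k + 1) - a (k + 1)) by abel,
    show u k = a k + (u k - a k) by abel] at hsol
  have heq := error_eq hsol
  obtain ⟨h1, h2⟩ := energy₁_step hg (ha.bound _ (by omega)) (ha.bound _ (by omega))
    (ha.bound _ (by omega)) (fun j => by rw [hadd]; exact huK _ (by omega) j)
    (fun j => by rw [hadd]; exact huK _ (by omega) j)
    (fun j => by rw [hadd]; exact huK _ (by omega) j)
    (ha.diff _ (by omega)) (ha.diff _ (by omega)) (ha.diff _ (by omega)) (ha.res k (by omega))
    (ha.res_fwd k (by omega)) heq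
  have b1 := norm_add_fst_le hg (u (k + 2) - a (k + 2)) (u (k + 1) - a (k + 1))
  have b2 := norm_add_snd_le hg (u (k + 2) - a (k + 2)) (u (k + 1) - a (k + 1))
  have b3 := norm_add_snd_le hg (u (k + 1) - a (k + 1)) (u k - a k)
  have hL : 0 ≤ |lam| * K ^ 2 := by positivity
  have c1 : |lam| * K ^ 2 * (‖u (k + 2) - a (k + 2)‖ + ‖fwd g.h (u (k + 2) - a (k + 2))‖)
      ≤ |lam| * K ^ 2 / g.m * Z (k + 1) := by
    rw [div_mul_eq_mul_div, le_div_iff₀ hm]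
    calc _ = |lam| * K ^ 2 * (g.m * (‖u (k + 2) - a (k + 2)‖
            + ‖fwd g.h (u (k + 2) - a (k + 2))‖)) := by ring
      _ ≤ _ := mul_le_mul_of_nonneg_left b1 hL
  have c2 : |lam| * K ^ 2 * (‖u (k + 1) - a (k + 1)‖ + ‖fwd g.h (u (k + 1) - a (k + 1))‖)
      ≤ |lam| * K ^ 2 / g.m * Z (k + 1) := by
    rw [div_mul_eq_mul_div, le_div_iff₀ hm]
    calc _ = |lam| * K ^ 2 * (g.m * (‖u (k + 1) - a (k + 1)‖
            + ‖fwd g.h (u (k + 1) - a (k + 1))‖)) := by ring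
      _ ≤ _ := mul_le_mul_of_nonneg_left b2 hL
  have c3 : |lam| * K ^ 2 * (‖u k - a k‖ + ‖fwd g.h (u k - a k)‖)
      ≤ |lam| * K ^ 2 / g.m * Z k := by
    rw [div_mul_eq_mul_div, le_div_iff₀ hm]
    calc _ = |lam| * K ^ 2 * (g.m * (‖u k - a k‖ + ‖fwd g.h (u k - a k)‖)) := by ring
      _ ≤ _ := mul_le_mul_of_nonneg_left b3 hL
  have hZk : 0 ≤ |lam| * K ^ 2 / g.m * Z k := by
    have : 0 ≤ Z k := energy₁_nonneg _ _
    positivity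
  have p1 : 0 ≤ |lam| * K ^ 2 * ‖u (k + 2) - a (k + 2)‖ := by positivity
  have p2 : 0 ≤ |lam| * K ^ 2 * ‖u (k + 1) - a (k + 1)‖ := by positivity
  have p3 : 0 ≤ |lam| * K ^ 2 * ‖u k - a k‖ := by positivity
  have e1 : Z (k + 1) = g.energy (u (k + 2) - a (k + 2)) (u (k + 1) - a (k + 1))
    + g.energy (fwd g.h (u (k + 2) - a (k + 2))) (fwd g.h (u (k + 1) - a (k + 1))) := rfl
  have e2 : Z k = g.energy (u (k + 1) - a (k + 1)) (u k - a k)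
    + g.energy (fwd g.h (u (k + 1) - a (k + 1))) (fwd g.h (u k - a k)) := rfl
  have e3 : 30 * |lam| * K ^ 2 / g.m * (Z (k + 1) + Z k)
    = 30 * (|lam| * K ^ 2 / g.m * Z (k + 1)) + 30 * (|lam| * K ^ 2 / g.m * Z k) := by ring
  rw [e3]
  nlinarith

/-- Existence of one step close to the approximate solution. -/
lemma exists_step_near (hg : g.CFL) {a a' a'' e' e'' : SeqSpace} {η M : ℝ}
    (ha : ∀ j, ‖a j‖ ≤ M) (ha' : ∀ j, ‖a' j‖ ≤ M + 1) (ha'' : ∀ j, ‖a'' j‖ ≤ M + 1)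
    (he' : ∀ j, ‖a' j + e' j‖ ≤ M + 1) (he'' : ∀ j, ‖a'' j + e'' j‖ ≤ M + 1)
    (hda : ∀ j, ‖a (j + 1) - a j‖ ≤ (M + 1) * g.h)
    (hda' : ∀ j, ‖a' (j + 1) - a' j‖ ≤ (M + 1) * g.h)
    (hda'' : ∀ j, ‖a'' (j + 1) - a'' j‖ ≤ (M + 1) * g.h)
    (hres : ‖g.resid lam a a' a''‖ ≤ η) (hres' : ‖fwd g.h (g.resid lam a a' a'')‖ ≤ η)
    (hθ : 30 * |lam| * (M + 1) ^ 2 ≤ g.m / 4) {ρ : ℝ} (hρ0 : 0 ≤ ρ)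
    (hρ : Real.sqrt g.h * (2 * ρ) ≤ 1)
    (hZ : g.energy₁ e' e'' ≤ g.m * ρ / 4) (hη : η ≤ g.m * ρ / 4) :
    ∃ e, (∀ j, ‖a j + e j‖ ≤ M + 1) ∧ g.resid lam (a + e) (a' + e') (a'' + e'') = 0 := by
  have hm := g.m_pos
  -- A ball of the discrete H¹ norm, closed in ℓ². On it |e_j| ≤ √h · 2ρ ≤ 1, which keeps `a + e`
  -- below M + 1. The contraction is needed in ℓ² only.
  set s : Set SeqSpace := {e | ‖e‖ ≤ ρ ∧ ‖fwd g.h e‖ ≤ ρ} with hs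
  have hsc : IsClosed s :=
    (isClosed_le continuous_norm continuous_const).inter
      (isClosed_le (fwd g.h).continuous.norm continuous_const)
  have hsne : s.Nonempty := ⟨0, by simp [hs, hρ0]⟩
  have hball : ∀ e ∈ s, ∀ j, ‖a j + e j‖ ≤ M + 1 := by
    intro e he j
    have h1 := apply_le_of_norm_le g.h_pos (by positivity) (x := e) (r := 2 * ρ)
      (by linarith [he.1, he.2]) j
    have := norm_add_le (a j) (e j)
    linarith [ha j]
  have hKa : ∀ j, ‖a j‖ ≤ M + 1 := fun j => (ha j).trans (by linarith)
  set Φ : SeqSpace → SeqSpace := fun e => g.b e' - g.A' e''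
    + (-((lam : ℂ) • (g.G (a + e) (a' + e') (a'' + e'') - g.G a a' a''))
        - g.resid lam a a' a'')
  have b1 := norm_add_fst_le hg e' e''
  have b2 := norm_add_snd_le hg e' e''
  have hex : ∃ x ∈ s, g.A x = Φ x := by
    refine exists_implicit_step hg hsc hsne ?_ ?_
    · intro e he v hv
      have hv' : g.A v - g.b e' + g.A' e''
        = -((lam : ℂ) • (g.G (a + e) (a' + e') (a'' + e'') - g.G a a' a''))
          - g.resid lam a a' a'' := by
        rw [hv]
        simp only [Φ]
        module
      obtain ⟨h1, h2⟩ := energy₁_step hg hKa ha' ha'' (hball e he) he' he'' hda hda' hda'' hres hres'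
        hv'
      have h3 := norm_fst_le hg v e'
      have h4 := norm_fst_le hg (fwd g.h v) (fwd g.h e')
      have hE : g.energy₁ e' e'' = g.energy e' e'' + g.energy (fwd g.h e') (fwd g.h e'') := rfl
      have hE1 := energy_nonneg (g := g) e' e''
      have hE2 := energy_nonneg (g := g) (fwd g.h e') (fwd g.h e'')
      set L := |lam| * (M + 1) ^ 2 with hL
      have hL0 : 0 ≤ L := by positivity
      have hθ' : 30 * L ≤ g.m / 4 := by rw [hL]; linarith
      have q1 := norm_nonneg e'
      have q2 := norm_nonneg e''
      have q3 := norm_nonneg (fwd g.h e')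
      have q4 := norm_nonneg (fwd g.h e'')
      -- Budget for the ball: mρ/4 for the old energy and mρ/4 for the defect. The nonlinear terms
      -- fit into the rest, since 30L ≤ m/4 and the H¹ norms of the old levels are at most ρ/4.
      have d1 : L * ‖e‖ ≤ L * ρ := mul_le_mul_of_nonneg_left he.1 hL0
      have d2 : L * ‖fwd g.h e‖ ≤ L * ρ := mul_le_mul_of_nonneg_left he.2 hL0
      have k0 : 30 * L * ρ ≤ g.m / 4 * ρ := mul_le_mul_of_nonneg_right hθ' hρ0
      have k1 : 30 * L * (‖e'‖ + ‖fwd g.h e'‖) ≤ g.m / 4 * (‖e'‖ + ‖fwd g.h e'‖) := by gcongr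
      have k2 : 30 * L * (‖e''‖ + ‖fwd g.h e''‖) ≤ g.m / 4 * (‖e''‖ + ‖fwd g.h e''‖) := by gcongr
      have p1 : 0 ≤ L * ‖e'‖ := by positivity
      have p2 : 0 ≤ L * ‖e''‖ := by positivity
      have p3 : 0 ≤ L * ‖fwd g.h e'‖ := by positivity
      have p4 : 0 ≤ L * ‖fwd g.h e''‖ := by positivity
      have p5 : 0 ≤ L * ρ := by positivity
      have f1 : |lam| * (3 * (M + 1) ^ 2 * (‖e‖ + ‖e'‖ + ‖e''‖))
        = 3 * (L * ‖e‖) + 3 * (L * ‖e'‖) + 3 * (L * ‖e''‖) := by rw [hL]; ring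
      have f2 : |lam| * (15 * (M + 1) ^ 2 * (‖fwd g.h e‖ + ‖fwd g.h e'‖ + ‖fwd g.h e''‖)
          + 6 * (M + 1) ^ 2 * (‖e‖ + ‖e'‖ + ‖e''‖))
        = 15 * (L * ‖fwd g.h e‖) + 15 * (L * ‖fwd g.h e'‖) + 15 * (L * ‖fwd g.h e''‖)
          + 6 * (L * ‖e‖) + 6 * (L * ‖e'‖) + 6 * (L * ‖e''‖) := by rw [hL]; ring
      rw [f1] at h1
      rw [f2] at h2
      have hmρ : 0 ≤ g.m * ρ := by positivity
      constructor
      · refine le_of_mul_le_mul_left ?_ hm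
        linarith
      · refine le_of_mul_le_mul_left ?_ hm
        linarith
    · intro x hx y hy
      have h1 : Φ x - Φ y = -((lam : ℂ) • (g.G (a + x) (a' + e') (a'' + e'')
          - g.G (a + y) (a' + e') (a'' + e''))) := by
        simp only [Φ]; module
      rw [h1, norm_neg, norm_smul, Complex.norm_real, Real.norm_eq_abs]
      have h2 := norm_G_sub_le (g := g) (x := a + x) (y := a' + e') (z := a'' + e'')
        (x' := a + y) (y' := a' + e') (z' := a'' + e'') (K := M + 1)
        (hball x hx) he' he'' (hball y hy) he' he''
      simp only [add_sub_add_left_eq_sub, sub_self, norm_zero, add_zero] at h2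
      calc |lam| * _ ≤ |lam| * (3 * (M + 1) ^ 2 * ‖x - y‖) := by gcongr
        _ = (3 * (|lam| * (M + 1) ^ 2)) * ‖x - y‖ := by ring
        _ ≤ g.m / 2 * ‖x - y‖ := by
          gcongr
          have : 0 ≤ |lam| * (M + 1) ^ 2 := by positivity
          linarith
  obtain ⟨e, he, hAe⟩ := hex
  refine ⟨e, hball e he, resid_eq_zero_of_error_eq ?_⟩
  rw [hAe]
  simp only [Φ]
  module

/-- Existence of numerical solutions near a sufficiently accurate approximate solution. -/
lemma exists_solution_near (hg : g.CFL) {N : ℕ} {η M B : ℝ} {a : ℕ → SeqSpace} (u₁ : SeqSpace)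
    (hη : 0 ≤ η) (ha : g.Approx lam M η N a)
    (hθ : 30 * |lam| * (M + 1) ^ 2 ≤ g.m / 4)
    (hB : Real.exp (120 * |lam| * (M + 1) ^ 2 / g.m * N)
        * (g.energy₁ (u₁ - a 1) 0 + 4 * N * η) ≤ B)
    {ρ : ℝ} (hρ : Real.sqrt g.h * (2 * ρ) ≤ 1)
    (hBρ : B ≤ g.m * ρ / 4) (hηρ : η ≤ g.m * ρ / 4) :
    ∃ u : ℕ → SeqSpace, u 0 = a 0 ∧ u 1 = u₁ ∧ g.Solves lam N u ∧
      ∀ n ≤ N, ∀ j, ‖u n j‖ ≤ M + 1 := by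
  have hm := g.m_pos
  have hh := g.h_pos
  have hρ0 : 0 ≤ ρ := by
    have : 0 ≤ g.m * ρ / 4 := hη.trans hηρ
    by_contra hc
    push Not at hc
    nlinarith
  have ha₁ : g.Approx lam (M + 1) η N a :=
    ⟨fun n hn j => (ha.bound n hn j).trans (by linarith),
      fun n hn j => (ha.diff n hn j).trans (by nlinarith), ha.res, ha.res_fwd⟩
  have hE0 : 0 ≤ g.energy₁ (u₁ - a 1) 0 := energy₁_nonneg _ _
  have key : ∀ n ≤ N, ∃ u : ℕ → SeqSpace, u 0 = a 0 ∧ u 1 = u₁ ∧ g.Solves lam n u ∧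
      ∀ k ≤ n, ∀ j, ‖u k j‖ ≤ M + 1 := by
    intro n
    induction n with
    | zero =>
      intro _
      refine ⟨fun k => if k = 0 then a 0 else u₁, by simp, by simp, fun k hk => by omega, ?_⟩
      intro k hk j
      have : k = 0 := by omega
      subst this
      simpa using ha₁.bound 0 (by omega) j
    | succ n ih =>
      intro hn
      obtain ⟨u, hu0, hu1, hsol, hbd⟩ := ih (by omega)
      -- Level 1 is prescribed, so its bound comes from the energy of the starting error and not
      -- from solving a step.
      rcases Nat.eq_zero_or_pos n with rfl | hpos
      · refine ⟨u, hu0, hu1, fun k hk => by omega, fun k hk j => ?_⟩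
        rcases Nat.le_one_iff_eq_zero_or_eq_one.1 hk with rfl | rfl
        · exact hbd 0 le_rfl j
        · have h1 : g.energy₁ (u₁ - a 1) 0 ≤ B := by
            refine le_trans ?_ hB
            have h2 : 1 ≤ Real.exp (120 * |lam| * (M + 1) ^ 2 / g.m * N) :=
              Real.one_le_exp (by positivity)
            have h3 : (0 : ℝ) ≤ 4 * N * η := by positivity
            nlinarith
          have h2 := norm_add_fst_le hg (u₁ - a 1) 0
          have h3 : ‖u₁ - a 1‖ + ‖fwd g.h (u₁ - a 1)‖ ≤ ρ := by
            refine le_of_mul_le_mul_left ?_ hm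
            have : 0 ≤ g.m * ρ := by positivity
            linarith
          have h4 := apply_le_of_norm_le hh hρ0 h3 j
          rw [hu1]
          have h5 : u₁ j = a 1 j + (u₁ - a 1) j := by rw [sub_apply]; ring
          rw [h5]
          have := norm_add_le (a 1 j) ((u₁ - a 1) j)
          have := ha.bound 1 (by omega) j
          have : 0 ≤ Real.sqrt g.h * ρ := by positivity
          linarith
      · obtain ⟨n, rfl⟩ : ∃ k, n = k + 1 := ⟨n - 1, by omega⟩
        have ha₂ : g.Approx lam (M + 1) η (n + 1) a :=
          ⟨fun k hk => ha₁.bound k (by omega), fun k hk => ha₁.diff k (by omega),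
            fun k hk => ha₁.res k (by omega), fun k hk => ha₁.res_fwd k (by omega)⟩
        -- Bootstrap: the sup bound M + 1 up to the present level makes the energy estimate
        -- available, and the latter is strong enough to find the next level with the same sup
        -- bound.
        have hZ := energy₁_le hg hη ha₂ hsol hbd (by linarith) le_rfl
        rw [hu0, hu1, sub_self] at hZ
        have hZB : g.energy₁ (u (n + 1) - a (n + 1)) (u n - a n) ≤ g.m * ρ / 4 := by
          refine (hZ.trans ?_).trans (hB.trans hBρ)
          have hnN : (n : ℝ) ≤ N := by exact_mod_cast (by omega : n ≤ N)
          gcongr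
        have hadd : ∀ i (j : ℤ), a i j + (u i - a i) j = u i j := fun i j => by
          rw [sub_apply]; ring
        obtain ⟨e, he, hstep⟩ := exists_step_near hg (ha.bound (n + 2) hn) (ha₁.bound (n + 1) (by omega))
          (ha₁.bound n (by omega)) (fun j => by rw [hadd]; exact hbd _ le_rfl j)
          (fun j => by rw [hadd]; exact hbd _ (by omega) j)
          (ha₁.diff (n + 2) hn) (ha₁.diff (n + 1) (by omega)) (ha₁.diff n (by omega))
          (ha₁.res n hn) (ha₁.res_fwd n hn) hθ hρ0 hρ hZB hηρ
        refine ⟨fun k => if k = n + 2 then a (n + 2) + e else u k, by simp [hu0], by simp [hu1],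
          ?_, ?_⟩
        · intro k hk
          rcases Nat.lt_or_ge k n with hkn | hkn
          · have := hsol k (by omega)
            simp only [show k + 2 ≠ n + 2 by omega, show k + 1 ≠ n + 2 by omega,
              show k ≠ n + 2 by omega, if_false]
            exact this
          · have : k = n := by omega
            subst this
            simp only [if_true, show k + 1 ≠ k + 2 by omega, show k ≠ k + 2 by omega, if_false]
            rw [← hstep]
            congr 1 <;> abel
        · intro k hk j
          by_cases hk2 : k = n + 2
          · subst hk2
            simp only [if_true, add_apply]
            exact he j
          · simp only [hk2, if_false]
            exact hbd k (by omega) j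
  exact key N le_rfl

end Disc


/-! ### Mixed partial derivatives within a plane set -/

section Jets

/-- Directional derivative within a plane set. -/
noncomputable def pd (S : Set (ℝ × ℝ)) (v : ℝ × ℝ) (f : ℝ × ℝ → ℂ) : ℝ × ℝ → ℂ :=
  fun z => fderivWithin ℝ f S z v

/-- The mixed partial derivative of order `i` in the first and `k` in the second variable. -/
noncomputable def jet (S : Set (ℝ × ℝ)) (i k : ℕ) (f : ℝ × ℝ → ℂ) : ℝ × ℝ → ℂ :=
  (pd S (1, 0))^[i] ((pd S (0, 1))^[k] f)

variable {S : Set (ℝ × ℝ)} {f g : ℝ × ℝ → ℂ} {n : ℕ} {v w : ℝ × ℝ}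

lemma pd_congr (h : EqOn f g S) : EqOn (pd S v f) (pd S v g) S := fun z hz => by
  simp only [pd]
  rw [fderivWithin_congr h (h hz)]

lemma pd_iterate_congr (h : EqOn f g S) (m : ℕ) : EqOn ((pd S v)^[m] f) ((pd S v)^[m] g) S := by
  induction m with
  | zero => exact h
  | succ m ih => rw [Function.iterate_succ_apply', Function.iterate_succ_apply']; exact pd_congr ih

lemma jet_congr (h : EqOn f g S) (i k : ℕ) : EqOn (jet S i k f) (jet S i k g) S :=
  pd_iterate_congr (pd_iterate_congr h k) i

lemma contDiffOn_pd (hS : UniqueDiffOn ℝ S) (hf : ContDiffOn ℝ (n + 1 : ℕ) f S) :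
    ContDiffOn ℝ n (pd S v f) S :=
  (hf.fderivWithin hS (by norm_cast)).clm_apply contDiffOn_const

lemma contDiffOn_pd_iterate (hS : UniqueDiffOn ℝ S) (m : ℕ) (hf : ContDiffOn ℝ (n + m : ℕ) f S) :
    ContDiffOn ℝ n ((pd S v)^[m] f) S := by
  induction m generalizing n with
  | zero => exact hf
  | succ m ih =>
    rw [Function.iterate_succ_apply']
    exact contDiffOn_pd hS (ih (by rwa [show n + 1 + m = n + (m + 1) by ring]))

lemma contDiffOn_jet (hS : UniqueDiffOn ℝ S) (i k : ℕ) (hf : ContDiffOn ℝ (n + i + k : ℕ) f S) :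
    ContDiffOn ℝ n (jet S i k f) S :=
  contDiffOn_pd_iterate hS i (contDiffOn_pd_iterate hS k hf)

/-- Symmetry of the second derivative extends to boundary points because the set lies in the closure
of its interior. -/
lemma pd_comm (hS : UniqueDiffOn ℝ S) (hSc : S ⊆ closure (interior S))
    (hf : ContDiffOn ℝ 2 f S) : EqOn (pd S v (pd S w f)) (pd S w (pd S v f)) S := by
  intro z hz
  have hsymm : IsSymmSndFDerivWithinAt ℝ f S z :=
    (hf z hz).isSymmSndFDerivWithinAt (by simp) hS (hSc hz) hz
  have hd : DifferentiableWithinAt ℝ (fderivWithin ℝ f S) S z :=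
    ((hf.fderivWithin hS (m := 1) (by norm_num)).differentiableOn (by simp)) z hz
  have key : ∀ u u' : ℝ × ℝ, pd S u (pd S u' f) z
      = fderivWithin ℝ (fderivWithin ℝ f S) S z u u' := by
    intro u u'
    show fderivWithin ℝ (fun y => fderivWithin ℝ f S y u') S z u = _
    rw [fderivWithin_clm_apply (hS z hz) hd (differentiableWithinAt_const _)]
    simp
  rw [key, key]
  exact hsymm v w

lemma pd_iterate_comm (hS : UniqueDiffOn ℝ S) (hSc : S ⊆ closure (interior S)) (m : ℕ)
    (hf : ContDiffOn ℝ (m + 1 : ℕ) f S) :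
    EqOn (pd S v ((pd S w)^[m] f)) ((pd S w)^[m] (pd S v f)) S := by
  induction m with
  | zero => exact fun _ _ => rfl
  | succ m ih =>
    rw [Function.iterate_succ_apply', Function.iterate_succ_apply']
    have h1 : ContDiffOn ℝ 2 ((pd S w)^[m] f) S :=
      contDiffOn_pd_iterate (n := 2) hS m (hf.of_le (by norm_cast; omega))
    exact (pd_comm hS hSc h1).trans (pd_congr (ih (hf.of_le (by norm_cast; omega))))

lemma pd_fst_jet (i k : ℕ) : pd S (1, 0) (jet S i k f) = jet S (i + 1) k f := by
  simp only [jet, Function.iterate_succ_apply']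

lemma pd_snd_jet (hS : UniqueDiffOn ℝ S) (hSc : S ⊆ closure (interior S)) (i k : ℕ)
    (hf : ContDiffOn ℝ (i + k + 1 : ℕ) f S) :
    EqOn (pd S (0, 1) (jet S i k f)) (jet S i (k + 1) f) S := by
  simp only [jet, Function.iterate_succ_apply']
  exact pd_iterate_comm hS hSc i (contDiffOn_pd_iterate hS k
    (hf.of_le (by norm_cast; omega)))

lemma jet_pd_fst (hS : UniqueDiffOn ℝ S) (hSc : S ⊆ closure (interior S)) (i k : ℕ)
    (hf : ContDiffOn ℝ (k + 1 : ℕ) f S) :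
    EqOn (jet S i k (pd S (1, 0) f)) (jet S (i + 1) k f) S := by
  simp only [jet, Function.iterate_succ_apply]
  exact pd_iterate_congr (pd_iterate_comm hS hSc k hf).symm i

lemma jet_pd_snd (i k : ℕ) : jet S i k (pd S (0, 1) f) = jet S i (k + 1) f := by
  simp only [jet, Function.iterate_succ_apply]

lemma pd_linear {a b : ℂ} (hS : UniqueDiffOn ℝ S) (hf : DifferentiableOn ℝ f S)
    (hg : DifferentiableOn ℝ g S) :
    EqOn (pd S v (fun z => a * f z + b * g z)) (fun z => a * pd S v f z + b * pd S v g z) S := by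
  intro z hz
  simp only [pd]
  have h1 : HasFDerivWithinAt (fun z => a * f z + b * g z)
      (a • fderivWithin ℝ f S z + b • fderivWithin ℝ g S z) S z :=
    ((hf z hz).hasFDerivWithinAt.const_mul a).add ((hg z hz).hasFDerivWithinAt.const_mul b)
  rw [h1.fderivWithin (hS z hz)]
  simp

lemma pd_iterate_linear {a b : ℂ} (hS : UniqueDiffOn ℝ S) (m : ℕ)
    (hf : ContDiffOn ℝ m f S) (hg : ContDiffOn ℝ m g S) :
    EqOn ((pd S v)^[m] (fun z => a * f z + b * g z))
      (fun z => a * (pd S v)^[m] f z + b * (pd S v)^[m] g z) S := by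
  induction m with
  | zero => exact fun _ _ => rfl
  | succ m ih =>
    simp only [Function.iterate_succ_apply']
    refine (pd_congr (ih (hf.of_le (by norm_cast; omega)) (hg.of_le (by norm_cast; omega)))).trans ?_
    exact pd_linear hS
      ((contDiffOn_pd_iterate (n := 1) hS m (by rwa [add_comm])).differentiableOn (by simp))
      ((contDiffOn_pd_iterate (n := 1) hS m (by rwa [add_comm])).differentiableOn (by simp))

lemma jet_linear {a b : ℂ} (hS : UniqueDiffOn ℝ S) (i k : ℕ)
    (hf : ContDiffOn ℝ (i + k : ℕ) f S) (hg : ContDiffOn ℝ (i + k : ℕ) g S) :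
    EqOn (jet S i k (fun z => a * f z + b * g z))
      (fun z => a * jet S i k f z + b * jet S i k g z) S := by
  refine (pd_iterate_congr (pd_iterate_linear hS k (hf.of_le (by norm_cast; omega))
    (hg.of_le (by norm_cast; omega))) i).trans ?_
  exact pd_iterate_linear hS i (contDiffOn_pd_iterate hS k hf) (contDiffOn_pd_iterate hS k hg)

lemma norm_iteratedFDerivWithin_pd_le (hS : UniqueDiffOn ℝ S)
    (hf : ContDiffOn ℝ (n + 1 : ℕ) f S) {z : ℝ × ℝ} (hz : z ∈ S) :
    ‖iteratedFDerivWithin ℝ n (pd S v f) S z‖ ≤ ‖v‖ * ‖iteratedFDerivWithin ℝ (n + 1) f S z‖ := by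
  rw [← norm_iteratedFDerivWithin_fderivWithin hS hz]
  exact norm_iteratedFDerivWithin_clm_apply_const
    ((hf.fderivWithin hS (m := n) (by norm_cast)) z hz) hS hz le_rfl

lemma norm_pd_iterate_le (hS : UniqueDiffOn ℝ S) (hv : ‖v‖ ≤ 1) (m : ℕ)
    (hf : ContDiffOn ℝ (n + m : ℕ) f S) {z : ℝ × ℝ} (hz : z ∈ S) :
    ‖iteratedFDerivWithin ℝ n ((pd S v)^[m] f) S z‖ ≤ ‖iteratedFDerivWithin ℝ (n + m) f S z‖ := by
  induction m generalizing n with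
  | zero => exact le_rfl
  | succ m ih =>
    rw [Function.iterate_succ_apply']
    have hf' : ContDiffOn ℝ (n + 1 + m : ℕ) f S := by rwa [show n + 1 + m = n + (m + 1) by ring]
    refine (norm_iteratedFDerivWithin_pd_le hS (contDiffOn_pd_iterate hS m hf') hz).trans ?_
    refine (mul_le_of_le_one_left (norm_nonneg _) hv).trans ((ih hf').trans (le_of_eq ?_))
    rw [show n + 1 + m = n + (m + 1) by ring]

lemma norm_jet_le (hS : UniqueDiffOn ℝ S) (i k : ℕ) (hf : ContDiffOn ℝ (i + k : ℕ) f S)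
    {z : ℝ × ℝ} (hz : z ∈ S) : ‖jet S i k f z‖ ≤ ‖iteratedFDerivWithin ℝ (i + k) f S z‖ := by
  have h1 := norm_pd_iterate_le (n := 0) (f := (pd S (0, 1))^[k] f) hS (v := (1, 0))
    (by simp [Prod.norm_def]) i (by simpa using contDiffOn_pd_iterate hS k hf) hz
  rw [norm_iteratedFDerivWithin_zero, zero_add] at h1
  exact h1.trans (norm_pd_iterate_le hS (by simp [Prod.norm_def]) k hf hz)

/-- The derivative splits along the two coordinate functionals, both of norm at most one. Iteration
produces the factor 2^l in the comparison with the jets. -/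
lemma norm_iteratedFDerivWithin_succ_le (hS : UniqueDiffOn ℝ S)
    (hf : ContDiffOn ℝ (n + 1 : ℕ) f S) {z : ℝ × ℝ} (hz : z ∈ S) :
    ‖iteratedFDerivWithin ℝ (n + 1) f S z‖ ≤ ‖iteratedFDerivWithin ℝ n (pd S (1, 0) f) S z‖
      + ‖iteratedFDerivWithin ℝ n (pd S (0, 1) f) S z‖ := by
  rw [← norm_iteratedFDerivWithin_fderivWithin hS hz]
  set L₁ : ℂ →L[ℝ] (ℝ × ℝ →L[ℝ] ℂ) :=
    ContinuousLinearMap.smulRightL ℝ (ℝ × ℝ) ℂ (ContinuousLinearMap.fst ℝ ℝ ℝ) with hL₁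
  set L₂ : ℂ →L[ℝ] (ℝ × ℝ →L[ℝ] ℂ) :=
    ContinuousLinearMap.smulRightL ℝ (ℝ × ℝ) ℂ (ContinuousLinearMap.snd ℝ ℝ ℝ) with hL₂
  have hn₁ : ‖L₁‖ ≤ 1 := by
    refine ContinuousLinearMap.opNorm_le_bound _ zero_le_one (fun c => ?_)
    have h : L₁ c = (ContinuousLinearMap.fst ℝ ℝ ℝ).smulRight c := rfl
    rw [h, ContinuousLinearMap.norm_smulRight_apply]
    gcongr
    exact ContinuousLinearMap.norm_fst_le _ _ _
  have hn₂ : ‖L₂‖ ≤ 1 := by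
    refine ContinuousLinearMap.opNorm_le_bound _ zero_le_one (fun c => ?_)
    have h : L₂ c = (ContinuousLinearMap.snd ℝ ℝ ℝ).smulRight c := rfl
    rw [h, ContinuousLinearMap.norm_smulRight_apply]
    gcongr
    exact ContinuousLinearMap.norm_snd_le _ _ _
  have hdec : fderivWithin ℝ f S = (L₁ ∘ pd S (1, 0) f) + (L₂ ∘ pd S (0, 1) f) := by
    ext z <;> simp [pd, hL₁, hL₂]
  have hc₁ : ContDiffOn ℝ n (pd S (1, 0) f) S := contDiffOn_pd hS hf
  have hc₂ : ContDiffOn ℝ n (pd S (0, 1) f) S := contDiffOn_pd hS hf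
  rw [hdec, iteratedFDerivWithin_add_apply
    (L₁.contDiff.comp_contDiffOn hc₁ z hz) (L₂.contDiff.comp_contDiffOn hc₂ z hz) hS hz]
  refine (norm_add_le _ _).trans (add_le_add ?_ ?_)
  · refine (L₁.norm_iteratedFDerivWithin_comp_left (hc₁ z hz) hS hz le_rfl).trans ?_
    exact mul_le_of_le_one_left (norm_nonneg _) hn₁
  · refine (L₂.norm_iteratedFDerivWithin_comp_left (hc₂ z hz) hS hz le_rfl).trans ?_
    exact mul_le_of_le_one_left (norm_nonneg _) hn₂

/-- The full derivative is controlled by the mixed partial derivatives. -/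
lemma norm_iteratedFDerivWithin_le_of_jet (hS : UniqueDiffOn ℝ S) (hSc : S ⊆ closure (interior S))
    {l : ℕ} (hf : ContDiffOn ℝ l f S) {z : ℝ × ℝ} (hz : z ∈ S) {B : ℝ}
    (hB : ∀ i k, i + k = l → ‖jet S i k f z‖ ≤ B) :
    ‖iteratedFDerivWithin ℝ l f S z‖ ≤ 2 ^ l * B := by
  induction l generalizing f with
  | zero => simpa [jet] using hB 0 0 rfl
  | succ l ih =>
    refine (norm_iteratedFDerivWithin_succ_le hS hf hz).trans ?_
    have h1 := ih (f := pd S (1, 0) f) (contDiffOn_pd hS hf) (fun i k hik => by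
      rw [jet_pd_fst hS hSc i k (hf.of_le (by norm_cast; omega)) hz]
      exact hB _ _ (by omega))
    have h2 := ih (f := pd S (0, 1) f) (contDiffOn_pd hS hf) (fun i k hik => by
      rw [jet_pd_snd]
      exact hB _ _ (by omega))
    rw [pow_succ]
    linarith

lemma norm_iteratedFDerivWithin_mul_le_of_le (hS : UniqueDiffOn ℝ S) {l : ℕ}
    (hf : ContDiffOn ℝ l f S) (hg : ContDiffOn ℝ l g S) {z : ℝ × ℝ} (hz : z ∈ S) {A B : ℝ}
    (hA : ∀ i ≤ l, ‖iteratedFDerivWithin ℝ i f S z‖ ≤ A)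
    (hB : ∀ i ≤ l, ‖iteratedFDerivWithin ℝ i g S z‖ ≤ B) :
    ‖iteratedFDerivWithin ℝ l (fun y => f y * g y) S z‖ ≤ 2 ^ l * (A * B) := by
  have hA0 : 0 ≤ A := (norm_nonneg _).trans (hA 0 (by omega))
  refine (norm_iteratedFDerivWithin_mul_le hf hg hS hz le_rfl).trans ?_
  calc _ ≤ ∑ i ∈ Finset.range (l + 1), (l.choose i : ℝ) * (A * B) := by
        refine Finset.sum_le_sum fun i hi => ?_
        have hi' : i ≤ l := by simpa [Nat.lt_succ_iff] using hi
        rw [mul_assoc]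
        gcongr
        · exact hA i hi'
        · exact hB (l - i) (by omega)
    _ = 2 ^ l * (A * B) := by
        rw [← Finset.sum_mul, ← Nat.cast_sum, Nat.sum_range_choose]; push_cast; rfl

/-- Bound for the derivatives of the cubic nonlinearity which is linear in the highest
derivatives. -/
lemma norm_jet_cubic_le (hS : UniqueDiffOn ℝ S) (hSc : S ⊆ closure (interior S)) (i k : ℕ)
    (hf : ContDiffOn ℝ (i + k : ℕ) f S) {z : ℝ × ℝ} (hz : z ∈ S) {M B : ℝ}
    (hM : ∀ l ≤ i + k, ‖iteratedFDerivWithin ℝ l f S z‖ ≤ M)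
    (hB : ∀ i' k', i' + k' ≤ i + k → ‖jet S i' k' f z‖ ≤ B) :
    ‖jet S i k (fun y => f y * conj (f y) * f y) z‖ ≤ 8 ^ (i + k) * (M * M) * B := by
  have hM0 : 0 ≤ M := (norm_nonneg _).trans (hM 0 (by omega))
  have hB0 : 0 ≤ B := (norm_nonneg _).trans (hB 0 0 (by omega))
  have hconj : ContDiffOn ℝ (i + k : ℕ) (fun y => conj (f y)) S :=
    Complex.conjCLE.contDiff.comp_contDiffOn hf
  have hnconj : ∀ l, ‖iteratedFDerivWithin ℝ l (fun y => conj (f y)) S z‖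
      = ‖iteratedFDerivWithin ℝ l f S z‖ := fun l =>
    Complex.conjLIE.norm_iteratedFDerivWithin_comp_left f hS hz l
  have h1 : ∀ l ≤ i + k, ‖iteratedFDerivWithin ℝ l (fun y => f y * conj (f y)) S z‖
      ≤ 2 ^ (i + k) * (M * M) := by
    intro l hl
    refine (norm_iteratedFDerivWithin_mul_le_of_le hS (hf.of_le (by exact_mod_cast hl))
      (hconj.of_le (by exact_mod_cast hl)) hz (fun m hm => hM m (by omega))
      (fun m hm => by rw [hnconj]; exact hM m (by omega))).trans ?_
    gcongr
    norm_num
  -- Two of the three factors are measured by M, only the third by the jets at the point, so the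
  -- result is linear in B as Gronwall requires. Two product rules and the passage from jets to full
  -- derivatives give 2 · 2 · 2 = 8 per order.
  have h2 : ∀ l ≤ i + k, ‖iteratedFDerivWithin ℝ l f S z‖ ≤ 2 ^ (i + k) * B := by
    intro l hl
    refine (norm_iteratedFDerivWithin_le_of_jet hS hSc (hf.of_le (by exact_mod_cast hl)) hz
      (fun i' k' h => hB i' k' (by omega))).trans ?_
    gcongr
    norm_num
  refine (norm_jet_le hS i k ((hf.mul hconj).mul hf) hz).trans ?_
  refine (norm_iteratedFDerivWithin_mul_le_of_le hS (hf.mul hconj) hf hz h1 h2).trans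
    (le_of_eq ?_)
  rw [show (8 : ℝ) = 2 * 2 * 2 by norm_num, mul_pow, mul_pow]
  ring

end Jets


/-! ### Derivatives of the amplitude on the strip -/

section Strip

/-- A family of functions on the strip `[0,T] × ℝ` behaving as the mixed partial derivatives of
order at most `n` of one function, all of them bounded by `M`. -/
structure JetFamily (T M : ℝ) (n : ℕ) (b : ℕ → ℕ → ℝ → ℝ → ℂ) : Prop where
  cont : ∀ i k, i + k ≤ n → ContinuousOn (fun z : ℝ × ℝ => b i k z.1 z.2) (Icc 0 T ×ˢ univ)
  dt : ∀ i k, i + k + 1 ≤ n → ∀ t ∈ Icc 0 T, ∀ ξ,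
    HasDerivWithinAt (fun s => b i k s ξ) (b (i + 1) k t ξ) (Icc 0 T) t
  dx : ∀ i k, i + k + 1 ≤ n → ∀ t ∈ Icc 0 T, ∀ ξ, HasDerivAt (b i k t) (b i (k + 1) t ξ) ξ
  bound : ∀ i k, i + k ≤ n → ∀ t ∈ Icc 0 T, ∀ ξ, ‖b i k t ξ‖ ≤ M

/-- The strip `[0,T] × ℝ`. -/
def strip (T : ℝ) : Set (ℝ × ℝ) := Icc 0 T ×ˢ univ

/-- The mixed partial derivatives of a function on the strip. -/
noncomputable def stripJet (T : ℝ) (a : ℝ → ℝ → ℂ) (i k : ℕ) (t ξ : ℝ) : ℂ :=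
  jet (strip T) i k (fun z => a z.1 z.2) (t, ξ)

lemma uniqueDiffOn_strip {T : ℝ} (hT : 0 < T) : UniqueDiffOn ℝ (strip T) :=
  (uniqueDiffOn_Icc hT).prod uniqueDiffOn_univ

lemma strip_subset_closure {T : ℝ} (hT : 0 < T) : strip T ⊆ closure (interior (strip T)) := by
  rw [strip, interior_prod_eq, interior_univ, interior_Icc, closure_prod_eq, closure_univ,
    closure_Ioo hT.ne]

variable {T M : ℝ} {N n : ℕ} {a : ℝ → ℝ → ℂ}

lemma norm_stripJet_le (hT : 0 < T) (ha : HasBoundedDerivs N M T a) {i k : ℕ} (hik : i + k ≤ N)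
    {t : ℝ} (ht : t ∈ Icc 0 T) (ξ : ℝ) : ‖stripJet T a i k t ξ‖ ≤ M :=
  (norm_jet_le (uniqueDiffOn_strip hT) i k (ha.1.of_le (by exact_mod_cast hik))
    (show (t, ξ) ∈ strip T from ⟨ht, mem_univ _⟩)).trans (ha.2 _ hik _ ⟨ht, mem_univ _⟩)

lemma stripJet_zero (t ξ : ℝ) : stripJet T a 0 0 t ξ = a t ξ := rfl

lemma jetFamily_stripJet (hT : 0 < T) (ha : HasBoundedDerivs N M T a) :
    JetFamily T M N (stripJet T a) := by
  have hS := uniqueDiffOn_strip hT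
  have hdiff : ∀ i k, i + k + 1 ≤ N → ∀ z ∈ strip T, DifferentiableWithinAt ℝ
      (jet (strip T) i k (fun z => a z.1 z.2)) (strip T) z := fun i k h z hz =>
    ((contDiffOn_jet (n := 1) hS i k (ha.1.of_le (by norm_cast; omega))).differentiableOn
      (by simp)) z hz
  refine ⟨fun i k h => ?_, fun i k h t ht ξ => ?_, fun i k h t ht ξ => ?_,
    fun i k h t ht ξ => norm_stripJet_le hT ha h ht ξ⟩
  · exact (contDiffOn_jet (n := 0) hS i k (ha.1.of_le (by norm_cast; omega))).continuousOn
  · have h1 := (hdiff i k h (t, ξ) ⟨ht, mem_univ _⟩).hasFDerivWithinAt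
    have h2 : HasDerivWithinAt (fun s : ℝ => (s, ξ)) ((1 : ℝ), (0 : ℝ)) (Icc 0 T) t :=
      (hasDerivWithinAt_id t _).prodMk (hasDerivWithinAt_const _ _ _)
    have h3 := h1.comp_hasDerivWithinAt t h2
      (show MapsTo _ _ (strip T) from fun s hs => ⟨hs, mem_univ _⟩)
    have h4 : stripJet T a (i + 1) k t ξ = pd (strip T) (1, 0)
        (jet (strip T) i k (fun z => a z.1 z.2)) (t, ξ) := by rw [pd_fst_jet]; rfl
    rw [h4]
    exact h3
  · have h1 := (hdiff i k h (t, ξ) ⟨ht, mem_univ _⟩).hasFDerivWithinAt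
    have h2 : HasDerivWithinAt (fun s : ℝ => (t, s)) ((0 : ℝ), (1 : ℝ)) univ ξ :=
      (hasDerivWithinAt_const _ _ _).prodMk (hasDerivWithinAt_id _ _)
    have h3 := h1.comp_hasDerivWithinAt ξ h2
      (show MapsTo _ _ (strip T) from fun s hs => ⟨ht, mem_univ _⟩)
    have h4 : stripJet T a i (k + 1) t ξ = pd (strip T) (0, 1)
        (jet (strip T) i k (fun z => a z.1 z.2)) (t, ξ) :=
      (pd_snd_jet hS (strip_subset_closure hT) i k (ha.1.of_le (by exact_mod_cast h))
        ⟨ht, mem_univ _⟩).symm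
    rw [h4, ← hasDerivWithinAt_univ]
    exact h3

/-- The equation `∂ₜ a = α ∂ξ² a + β |a|² a` for the first derivatives. -/
lemma stripJet_eqn (hT : 0 < T) (ha : HasBoundedDerivs N M T a) (hN : 2 ≤ N)
    {κ lam w : ℝ} {a₀ b₀ : ℝ → ℂ} (hs : IsNLSSolution κ lam w T a₀ b₀ a) {t : ℝ}
    (ht : t ∈ Icc 0 T) (ξ : ℝ) :
    2 * Complex.I * (w : ℂ) * stripJet T a 1 0 t ξ
      = -((1 - groupVel κ w ^ 2 : ℝ) : ℂ) * stripJet T a 0 2 t ξ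
        + (lam : ℂ) * ((‖a t ξ‖ ^ 2 : ℝ) : ℂ) * a t ξ := by
  have hJ := jetFamily_stripJet hT ha
  have h1 : derivWithin (fun s => a s ξ) (Icc 0 T) t = stripJet T a 1 0 t ξ :=
    (hJ.dt 0 0 (by omega) t ht ξ).derivWithin (uniqueDiffOn_Icc hT t ht)
  have h2 : iteratedDeriv 2 (a t) ξ = stripJet T a 0 2 t ξ := by
    have h3 : deriv (a t) = stripJet T a 0 1 t :=
      funext fun x => (hJ.dx 0 0 (by omega) t ht x).deriv
    rw [iteratedDeriv_succ, iteratedDeriv_one, h3]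
    exact (hJ.dx 0 1 (by omega) t ht ξ).deriv
  rw [← h1, ← h2]
  exact hs.eqn t ht ξ

/-- The coefficient `α` in `∂ₜ a = α ∂ξ² a + β |a|² a`. -/
noncomputable def nlsDisp (κ w : ℝ) : ℂ :=
  Complex.I * (((1 - groupVel κ w ^ 2) / (2 * w) : ℝ) : ℂ)

/-- Mixed derivatives commute up to the boundary, so every jet solves the same equation with the
corresponding jet of the cubic term as source. One time derivative is traded for two space
derivatives. -/
lemma jet_eqn (hT : 0 < T) (ha : HasBoundedDerivs N M T a)
    {κ lam w : ℝ} (hw : w ≠ 0) {a₀ b₀ : ℝ → ℂ} (hs : IsNLSSolution κ lam w T a₀ b₀ a)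
    {i k : ℕ} (hik : i + k + 2 ≤ N) {t : ℝ} (ht : t ∈ Icc 0 T) (ξ : ℝ) :
    stripJet T a (i + 1) k t ξ = nlsDisp κ w * stripJet T a i (k + 2) t ξ
      + (-Complex.I * ((lam / (2 * w) : ℝ) : ℂ))
        * jet (strip T) i k (fun z => a z.1 z.2 * conj (a z.1 z.2) * a z.1 z.2) (t, ξ) := by
  have hS := uniqueDiffOn_strip hT
  have hSc := strip_subset_closure hT
  set f : ℝ × ℝ → ℂ := fun z => a z.1 z.2 with hf
  have hz : (t, ξ) ∈ strip T := ⟨ht, mem_univ _⟩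
  have hfc : ∀ m : ℕ, m ≤ N → ContDiffOn ℝ m f (strip T) := fun m hm =>
    ha.1.of_le (by exact_mod_cast hm)
  have e1 : EqOn (pd (strip T) (1, 0) f) (fun z => nlsDisp κ w * (jet (strip T) 0 2 f) z
      + (-Complex.I * ((lam / (2 * w) : ℝ) : ℂ)) * (f z * conj (f z) * f z)) (strip T) := by
    rintro ⟨s, x⟩ ⟨hs', -⟩
    have h := stripJet_eqn hT ha (by omega) hs hs' x
    have hwc : (w : ℂ) ≠ 0 := by exact_mod_cast hw
    have h5 : pd (strip T) (1, 0) f (s, x) = stripJet T a 1 0 s x := rfl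
    have h6 : jet (strip T) 0 2 f (s, x) = stripJet T a 0 2 s x := rfl
    simp only [h5, h6, nlsDisp]
    have h7 : f (s, x) * conj (f (s, x)) = ((‖a s x‖ ^ 2 : ℝ) : ℂ) := by
      rw [Complex.mul_conj, Complex.normSq_eq_norm_sq]
    rw [h7]
    have h8 : stripJet T a 1 0 s x = (2 * Complex.I * (w : ℂ) * stripJet T a 1 0 s x)
        * (-Complex.I / (2 * w)) := by
      field_simp
      ring_nf
      rw [Complex.I_sq]; ring
    rw [h8, h, hf]
    push_cast
    field_simp
    ring
  have hconj : ContDiffOn ℝ (i + k : ℕ) (fun y => conj (f y)) (strip T) :=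
    Complex.conjCLE.contDiff.comp_contDiffOn (hfc _ (by omega))
  have h2 := jet_congr e1 i k hz
  rw [jet_pd_fst hS hSc i k (hfc _ (by omega)) hz] at h2
  have h3 := jet_linear (a := nlsDisp κ w) (b := -Complex.I * ((lam / (2 * w) : ℝ) : ℂ)) hS i k
    (contDiffOn_jet (n := i + k) hS 0 2 (hfc _ (by omega)))
    (((hfc _ (by omega)).mul hconj).mul (hfc _ (by omega))) hz
  have h4 : jet (strip T) i k (jet (strip T) 0 2 f) = jet (strip T) i (k + 2) f := by
    rw [show jet (strip T) 0 2 f = pd (strip T) (0, 1) (pd (strip T) (0, 1) f) from rfl,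
      jet_pd_snd, jet_pd_snd]
  exact h2.trans (h3.trans (by simp only [h4]; rfl))

/-- The cubic term in the equations for the derivatives is bounded by the derivatives of
no higher order. -/
lemma norm_jet_eqn_le (hT : 0 < T) (ha : HasBoundedDerivs N M T a)
    {κ lam w : ℝ} (hw : w ≠ 0) {a₀ b₀ : ℝ → ℂ} (hs : IsNLSSolution κ lam w T a₀ b₀ a)
    {i k : ℕ} (hik : i + k + 2 ≤ N) {t : ℝ} (ht : t ∈ Icc 0 T) (ξ : ℝ) {B : ℝ}
    (hB : ∀ i' k', i' + k' ≤ i + k → ‖stripJet T a i' k' t ξ‖ ≤ B) :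
    ‖stripJet T a (i + 1) k t ξ - nlsDisp κ w * stripJet T a i (k + 2) t ξ‖
      ≤ |lam / (2 * w)| * (8 ^ (i + k) * (M * M)) * B := by
  rw [jet_eqn hT ha hw hs hik ht ξ, add_sub_cancel_left, norm_mul, norm_mul, norm_neg,
    Complex.norm_I, one_mul, Complex.norm_real, Real.norm_eq_abs, mul_assoc]
  gcongr
  exact norm_jet_cubic_le (uniqueDiffOn_strip hT) (strip_subset_closure hT) i k
    (ha.1.of_le (by norm_cast; omega)) ⟨ht, mem_univ _⟩
    (fun l hl => ha.2 l (by omega) _ ⟨ht, mem_univ _⟩) hB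

/-- The derivatives at time zero vanish outside the support of the data. -/
lemma stripJet_init (hT : 0 < T) (ha : HasBoundedDerivs N M T a)
    {κ lam w R : ℝ} (hw : w ≠ 0) {a₀ b₀ : ℝ → ℂ} (hs : IsNLSSolution κ lam w T a₀ b₀ a)
    (ha₀ : Function.support a₀ ⊆ Icc (-R) R) (hb₀ : Function.support b₀ ⊆ Icc (-R) R)
    {i : ℕ} : ∀ {k : ℕ}, 2 * i + k ≤ N → ∀ {ξ : ℝ}, ξ ∉ Icc (-R) R → stripJet T a i k 0 ξ = 0 := by
  have hJ := jetFamily_stripJet hT ha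
  have h0 : (0 : ℝ) ∈ Icc 0 T := ⟨le_rfl, hT.le⟩
  have hopen : IsOpen (Icc (-R) R)ᶜ := isClosed_Icc.isOpen_compl
  have hder : ∀ i k : ℕ, i + k + 1 ≤ N → (∀ ξ ∉ Icc (-R) R, stripJet T a i k 0 ξ = 0) →
      ∀ ξ ∉ Icc (-R) R, stripJet T a i (k + 1) 0 ξ = 0 := by
    intro i k hik hz ξ hξ
    have h1 := hJ.dx i k hik 0 h0 ξ
    have h2 : stripJet T a i k 0 =ᶠ[nhds ξ] fun _ => 0 := by
      filter_upwards [hopen.mem_nhds hξ] with x hx using hz x hx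
    exact (h1.congr_of_eventuallyEq h2.symm).unique (hasDerivAt_const ξ (0 : ℂ))
  have hspan : ∀ i : ℕ, (∀ ξ ∉ Icc (-R) R, stripJet T a i 0 0 ξ = 0) →
      ∀ k, i + k ≤ N → ∀ ξ ∉ Icc (-R) R, stripJet T a i k 0 ξ = 0 := by
    intro i hi k
    induction k with
    | zero => exact fun _ => hi
    | succ k ih => exact fun h => hder i k (by omega) (ih (by omega))
  -- At time zero the equation expresses the jet of order (i+1, 0) by jets with fewer time
  -- derivatives and up to two more space derivatives; this explains 2i + k ≤ N. Space derivatives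
  -- inherit the vanishing since the complement of [-R, R] is open.
  induction i using Nat.strong_induction_on with
  | _ i ih =>
    intro k hik ξ hξ
    refine hspan i ?_ k (by omega) ξ hξ
    intro x hx
    rcases i with _ | i
    · rw [stripJet_zero, hs.init, profile]
      have e1 : a₀ x = 0 := by by_contra h; exact hx (ha₀ h)
      have e2 : b₀ x = 0 := by by_contra h; exact hx (hb₀ h)
      simp [e1, e2]
    · have h1 := norm_jet_eqn_le hT ha hw hs (i := i) (k := 0) (by omega) h0 x (B := 0)
        (fun i' k' h => by rw [ih i' (by omega) (by omega) hx, norm_zero])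
      rw [ih i (by omega) (k := 0 + 2) (by omega) hx, mul_zero, sub_zero, mul_zero] at h1
      exact norm_le_zero_iff.1 h1

end Strip


/-! ### Local energy estimates -/

section Decay

open MeasureTheory intervalIntegral

lemma continuousOn_integral_of_strip {T B : ℝ} {v : ℝ → ℝ → ℝ}
    (hv : ContinuousOn (fun z : ℝ × ℝ => v z.1 z.2) (Icc 0 T ×ˢ univ))
    (hB : ∀ t ∈ Icc 0 T, ∀ ξ, |v t ξ| ≤ B) (c d : ℝ) :
    ContinuousOn (fun t => ∫ x in c..d, v t x) (Icc 0 T) := by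
  have hx : ∀ t ∈ Icc 0 T, Continuous (v t) := fun t ht =>
    hv.comp_continuous (f := fun x : ℝ => (t, x)) (by fun_prop) (fun x => ⟨ht, mem_univ _⟩)
  have ht : ∀ x, ContinuousOn (fun t => v t x) (Icc 0 T) := fun x =>
    hv.comp (f := fun t : ℝ => (t, x)) (by fun_prop) (fun t ht => ⟨ht, mem_univ _⟩)
  intro t₀ ht₀
  refine continuousWithinAt_of_dominated_interval (bound := fun _ => B) ?_ ?_ ?_ ?_
  · filter_upwards [self_mem_nhdsWithin] with t ht using (hx t ht).aestronglyMeasurable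
  · filter_upwards [self_mem_nhdsWithin] with t ht
    filter_upwards with x _ using hB t ht x
  · exact intervalIntegrable_const
  · filter_upwards with x _ using ht x t₀ ht₀

lemma hasDerivAt_integral_of_strip {T B : ℝ} {v v' : ℝ → ℝ → ℝ}
    (hv : ContinuousOn (fun z : ℝ × ℝ => v z.1 z.2) (Icc 0 T ×ˢ univ))
    (hv' : ContinuousOn (fun z : ℝ × ℝ => v' z.1 z.2) (Icc 0 T ×ˢ univ))
    (hB : ∀ t ∈ Icc 0 T, ∀ ξ, |v' t ξ| ≤ B)
    (hd : ∀ t ∈ Icc 0 T, ∀ ξ, HasDerivWithinAt (fun s => v s ξ) (v' t ξ) (Icc 0 T) t)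
    (c d : ℝ) {t : ℝ} (ht : t ∈ Ioo 0 T) :
    HasDerivAt (fun t => ∫ x in c..d, v t x) (∫ x in c..d, v' t x) t := by
  have hx : ∀ t ∈ Icc 0 T, Continuous (v t) := fun t ht =>
    hv.comp_continuous (f := fun x : ℝ => (t, x)) (by fun_prop) (fun x => ⟨ht, mem_univ _⟩)
  have hx' : ∀ t ∈ Icc 0 T, Continuous (v' t) := fun t ht =>
    hv'.comp_continuous (f := fun x : ℝ => (t, x)) (by fun_prop) (fun x => ⟨ht, mem_univ _⟩)
  have hn : Ioo 0 T ∈ nhds t := isOpen_Ioo.mem_nhds ht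
  refine (intervalIntegral.hasDerivAt_integral_of_dominated_loc_of_deriv_le (bound := fun _ => B) hn
    ?_ ?_ ?_ ?_ ?_ ?_).2
  · filter_upwards [hn] with s hs using (hx s (Ioo_subset_Icc_self hs)).aestronglyMeasurable
  · exact (hx t (Ioo_subset_Icc_self ht)).intervalIntegrable _ _
  · exact (hx' t (Ioo_subset_Icc_self ht)).aestronglyMeasurable
  · filter_upwards with x _ s hs using hB s (Ioo_subset_Icc_self hs) x
  · exact intervalIntegrable_const
  · filter_upwards with x _ s hs
    exact (hd s (Ioo_subset_Icc_self hs) x).hasDerivAt (Icc_mem_nhds hs.1 hs.2)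

/-- Gronwall's inequality with an affine right-hand side. -/
lemma le_of_deriv_le_affine {T p q : ℝ} (hp : 0 ≤ p) (hq : 0 ≤ q) {f f' : ℝ → ℝ}
    (hc : ContinuousOn f (Icc 0 T)) (hd : ∀ t ∈ Ioo 0 T, HasDerivAt f (f' t) t)
    (hle : ∀ t ∈ Ioo 0 T, f' t ≤ p + q * f t) {t : ℝ} (ht : t ∈ Icc 0 T) :
    f t ≤ Real.exp (q * T) * (|f 0| + p * T) := by
  have hT : 0 ≤ T := ht.1.trans ht.2
  have hexp : ∀ s : ℝ, HasDerivAt (fun s => Real.exp (-(q * s))) (Real.exp (-(q * s)) * -q) s := by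
    intro s
    have h1 : HasDerivAt (fun s : ℝ => -(q * s)) (-q) s := by
      simpa [Pi.neg_def] using ((hasDerivAt_id s).const_mul q).neg
    exact h1.exp
  have hg : ∀ s ∈ Ioo 0 T, HasDerivAt (fun s => Real.exp (-(q * s)) * f s - p * s)
      (Real.exp (-(q * s)) * -q * f s + Real.exp (-(q * s)) * f' s - p) s := by
    intro s hs
    have h2 : HasDerivAt (fun s : ℝ => p * s) p s := by simpa using (hasDerivAt_id s).const_mul p
    exact ((hexp s).mul (hd s hs)).sub h2
  have hanti : AntitoneOn (fun s => Real.exp (-(q * s)) * f s - p * s) (Icc 0 T) := by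
    refine antitoneOn_of_deriv_nonpos (convex_Icc _ _) ?_ ?_ ?_
    · fun_prop
    · rw [interior_Icc]
      exact fun s hs => (hg s hs).differentiableAt.differentiableWithinAt
    · rw [interior_Icc]
      intro s hs
      rw [(hg s hs).deriv]
      have h1 : Real.exp (-(q * s)) ≤ 1 :=
        Real.exp_le_one_iff.2 (neg_nonpos.2 (mul_nonneg hq hs.1.le))
      have h2 := hle s hs
      have h3 := (Real.exp_pos (-(q * s))).le
      -- The two signs are treated separately: the integrating factor is at most one, which helps
      -- only where f' - qf is nonnegative.
      have h4 : Real.exp (-(q * s)) * (f' s - q * f s) ≤ 1 * p := by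
        rcases le_total 0 (f' s - q * f s) with h | h
        · exact mul_le_mul h1 (by linarith) h zero_le_one
        · exact (mul_nonpos_of_nonneg_of_nonpos h3 h).trans (by linarith)
      nlinarith
  have h5 := hanti (left_mem_Icc.2 hT) ht ht.1
  simp only [mul_zero, neg_zero, Real.exp_zero, one_mul, sub_zero] at h5
  have h6 : Real.exp (-(q * t)) * f t ≤ |f 0| + p * T := by
    have := le_abs_self (f 0)
    have := mul_le_mul_of_nonneg_left ht.2 hp
    linarith
  have h7 : f t = Real.exp (q * t) * (Real.exp (-(q * t)) * f t) := by
    rw [← mul_assoc, ← Real.exp_add, add_neg_cancel, Real.exp_zero, one_mul]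
  rw [h7]
  calc _ ≤ Real.exp (q * t) * (|f 0| + p * T) := by gcongr
    _ ≤ _ := by
      have : 0 ≤ |f 0| + p * T := by positivity
      gcongr
      exact ht.2

/-- One-dimensional Sobolev inequality. -/
lemma sobolev_sup_le {c d : ℝ} {v v' u : ℝ → ℝ} (hv : ContinuousOn v (Icc c d))
    (hd : ∀ x ∈ Ioo c d, HasDerivAt v (v' x) x) (hu : ContinuousOn u (Icc c d))
    (hu0 : ∀ x ∈ Icc c d, 0 ≤ u x) (hle : ∀ x ∈ Ioo c d, |v' x| ≤ u x) {x : ℝ}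
    (hx : x ∈ Icc c d) :
    (d - c) * v x ≤ (∫ y in c..d, v y) + (d - c) * ∫ y in c..d, u y := by
  have hcd : c ≤ d := hx.1.trans hx.2
  have hmono : ∀ y z, c ≤ y → y ≤ z → z ≤ d → ∫ s in y..z, u s ≤ ∫ s in c..d, u s := by
    intro y z hy hyz hz
    refine integral_mono_interval hy hyz hz ?_ ?_
    · filter_upwards [ae_restrict_mem measurableSet_Ioc] with s hs
      exact hu0 s (Ioc_subset_Icc_self hs)
    · exact hu.intervalIntegrable_of_Icc hcd
  -- The value at x is compared with the value at every y, and the comparison is then averaged over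
  -- y.
  have key : ∀ y ∈ Icc c d, v x ≤ v y + ∫ s in c..d, u s := by
    intro y hy
    rcases le_total y x with h | h
    · have h1 := sub_le_integral_of_hasDeriv_right_of_le (g := v) (g' := v') (φ := u) h
        (hv.mono (Icc_subset_Icc hy.1 hx.2))
        (fun s hs => (hd s ⟨hy.1.trans_lt hs.1, hs.2.trans_le hx.2⟩).hasDerivWithinAt)
        ((hu.mono (Icc_subset_Icc hy.1 hx.2)).integrableOn_Icc)
        (fun s hs => (le_abs_self _).trans (hle s ⟨hy.1.trans_lt hs.1, hs.2.trans_le hx.2⟩))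
      have h2 := hmono y x hy.1 h hx.2
      linarith
    · have h1 := sub_le_integral_of_hasDeriv_right_of_le (g := fun s => -v s)
        (g' := fun s => -v' s) (φ := u) h
        (hv.mono (Icc_subset_Icc hx.1 hy.2)).neg
        (fun s hs => (hd s ⟨hx.1.trans_lt hs.1, hs.2.trans_le hy.2⟩).neg.hasDerivWithinAt)
        ((hu.mono (Icc_subset_Icc hx.1 hy.2)).integrableOn_Icc)
        (fun s hs => (neg_le_abs _).trans (hle s ⟨hx.1.trans_lt hs.1, hs.2.trans_le hy.2⟩))
      have h2 := hmono x y hx.1 h hy.2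
      linarith
  have h3 : ∫ _ in c..d, v x ≤ ∫ y in c..d, (v y + ∫ s in c..d, u s) :=
    integral_mono_on hcd intervalIntegrable_const
      ((hv.intervalIntegrable_of_Icc hcd).add intervalIntegrable_const) key
  rw [intervalIntegral.integral_const, intervalIntegral.integral_add
    (hv.intervalIntegrable_of_Icc hcd) intervalIntegrable_const,
    intervalIntegral.integral_const] at h3
  simpa using h3

/-- The leading terms are exact x-derivatives, so they integrate to boundary values bounded by 2B
for each index, whatever the length of the interval. This takes the place of decay at infinity. -/
lemma integral_le_of_flux {ι : Type*} {c d : ℝ} (hcd : c ≤ d) (s : Finset ι) {Φ φ : ι → ℝ → ℝ}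
    {e g : ℝ → ℝ} {B K : ℝ} (hΦ : ∀ p ∈ s, ∀ x, HasDerivAt (Φ p) (φ p x) x)
    (hφ : ∀ p ∈ s, Continuous (φ p)) (he : Continuous e) (hg : Continuous g)
    (hB : ∀ p ∈ s, ∀ x, |Φ p x| ≤ B) (hle : ∀ x, g x ≤ ∑ p ∈ s, (φ p x + K * e x)) :
    ∫ x in c..d, g x ≤ s.card * (2 * B + K * ∫ x in c..d, e x) := by
  have hi : ∀ p ∈ s, IntervalIntegrable (fun x => φ p x + K * e x) volume c d := fun p hp =>
    ((hφ p hp).add (continuous_const.mul he)).intervalIntegrable _ _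
  calc ∫ x in c..d, g x
      ≤ ∫ x in c..d, ∑ p ∈ s, (φ p x + K * e x) :=
        integral_mono_on hcd (hg.intervalIntegrable _ _)
          ((continuous_finsetSum _ fun p hp => (hφ p hp).add
            (continuous_const.mul he)).intervalIntegrable _ _) (fun x _ => hle x)
    _ = ∑ p ∈ s, ((Φ p d - Φ p c) + K * ∫ x in c..d, e x) := by
        rw [intervalIntegral.integral_finsetSum hi]
        refine Finset.sum_congr rfl fun p hp => ?_
        rw [intervalIntegral.integral_add (g := fun x => K * e x)
          ((hφ p hp).intervalIntegrable _ _)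
          ((continuous_const.mul he).intervalIntegrable _ _), intervalIntegral.integral_const_mul,
          integral_eq_sub_of_hasDerivAt (fun x _ => hΦ p hp x) ((hφ p hp).intervalIntegrable _ _)]
    _ ≤ ∑ p ∈ s, (2 * B + K * ∫ x in c..d, e x) := by
        refine Finset.sum_le_sum fun p hp => ?_
        have h1 := (abs_le.1 (hB p hp d)).2
        have h2 := (abs_le.1 (hB p hp c)).1
        linarith
    _ = _ := by rw [Finset.sum_const, nsmul_eq_mul]

/-- Pairs of orders of derivatives of total order at most `m`. -/
def orderPairs (m : ℕ) : Finset (ℕ × ℕ) :=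
  (Finset.range (m + 1) ×ˢ Finset.range (m + 1)).filter fun p => p.1 + p.2 ≤ m

lemma mem_orderPairs {m : ℕ} {p : ℕ × ℕ} : p ∈ orderPairs m ↔ p.1 + p.2 ≤ m := by
  simp only [orderPairs, Finset.mem_filter, Finset.mem_product, Finset.mem_range]
  omega

/-- The sum of the squares of the derivatives up to order `m`. -/
noncomputable def density (b : ℕ → ℕ → ℝ → ℝ → ℂ) (m : ℕ) (t ξ : ℝ) : ℝ :=
  ∑ p ∈ orderPairs m, ‖b p.1 p.2 t ξ‖ ^ 2

variable {b : ℕ → ℕ → ℝ → ℝ → ℂ} {T M : ℝ} {n m : ℕ}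

lemma density_nonneg (t ξ : ℝ) : 0 ≤ density b m t ξ := Finset.sum_nonneg fun _ _ => sq_nonneg _

lemma sq_le_density {i k : ℕ} (h : i + k ≤ m) (t ξ : ℝ) : ‖b i k t ξ‖ ^ 2 ≤ density b m t ξ :=
  Finset.single_le_sum (f := fun p : ℕ × ℕ => ‖b p.1 p.2 t ξ‖ ^ 2) (fun _ _ => sq_nonneg _)
    (mem_orderPairs.2 (show (i, k).1 + (i, k).2 ≤ m from h))

lemma density_mono {m' : ℕ} (h : m ≤ m') (t ξ : ℝ) : density b m t ξ ≤ density b m' t ξ :=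
  Finset.sum_le_sum_of_subset_of_nonneg (fun _ hp => mem_orderPairs.2 ((mem_orderPairs.1 hp).trans h))
    (fun _ _ _ => sq_nonneg _)

lemma abs_two_inner_le (x y : ℂ) : |2 * (conj x * y).re| ≤ ‖x‖ ^ 2 + ‖y‖ ^ 2 := by
  have h1 : |(conj x * y).re| ≤ ‖x‖ * ‖y‖ := by
    simpa using Complex.abs_re_le_norm (conj x * y)
  rw [abs_mul, abs_two]
  nlinarith [sq_nonneg (‖x‖ - ‖y‖)]

lemma hasDerivWithinAt_norm_sq {f : ℝ → ℂ} {f' : ℂ} {s : Set ℝ} {t : ℝ}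
    (h : HasDerivWithinAt f f' s t) :
    HasDerivWithinAt (fun t => ‖f t‖ ^ 2) (2 * (conj (f t) * f').re) s t := by
  have h1 := h.norm_sq
  rw [Complex.inner] at h1
  rwa [mul_comm f'] at h1

/-- The time derivative of `density`. -/
noncomputable def densityDt (b : ℕ → ℕ → ℝ → ℝ → ℂ) (m : ℕ) (t ξ : ℝ) : ℝ :=
  ∑ p ∈ orderPairs m, 2 * (conj (b p.1 p.2 t ξ) * b (p.1 + 1) p.2 t ξ).re

/-- A time derivative shifts (i, k) to (i+1, k), which stays among the pairs of total order m + 1.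
-/
lemma abs_densityDt_le (t ξ : ℝ) : |densityDt b m t ξ| ≤ 2 * density b (m + 1) t ξ := by
  refine (Finset.abs_sum_le_sum_abs _ _).trans ?_
  calc _ ≤ ∑ p ∈ orderPairs m, (‖b p.1 p.2 t ξ‖ ^ 2 + ‖b (p.1 + 1) p.2 t ξ‖ ^ 2) :=
        Finset.sum_le_sum fun _ _ => abs_two_inner_le _ _
    _ = density b m t ξ + ∑ p ∈ orderPairs m, ‖b (p.1 + 1) p.2 t ξ‖ ^ 2 := Finset.sum_add_distrib
    _ ≤ density b (m + 1) t ξ + density b (m + 1) t ξ := by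
        refine add_le_add (density_mono (Nat.le_succ m) t ξ) ?_
        have hinj : Set.InjOn (fun p : ℕ × ℕ => (p.1 + 1, p.2)) (orderPairs m) := by
          rintro ⟨a, b⟩ - ⟨c, d⟩ - h
          simpa using h
        rw [← Finset.sum_image (f := fun p : ℕ × ℕ => ‖b p.1 p.2 t ξ‖ ^ 2) hinj]
        refine Finset.sum_le_sum_of_subset_of_nonneg ?_ (fun _ _ _ => sq_nonneg _)
        intro p hp
        obtain ⟨q, hq, rfl⟩ := Finset.mem_image.1 hp
        have := mem_orderPairs.1 hq
        exact mem_orderPairs.2 (by simp only; omega)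
    _ = _ := by ring

namespace JetFamily

variable (hb : JetFamily T M n b)
include hb

lemma continuousOn_density (h : m ≤ n) :
    ContinuousOn (fun z : ℝ × ℝ => density b m z.1 z.2) (Icc 0 T ×ˢ univ) :=
  continuousOn_finsetSum _ fun p hp =>
    (hb.cont p.1 p.2 ((mem_orderPairs.1 hp).trans h)).norm.pow 2

lemma continuousOn_densityDt (h : m + 1 ≤ n) :
    ContinuousOn (fun z : ℝ × ℝ => densityDt b m z.1 z.2) (Icc 0 T ×ˢ univ) := by
  refine continuousOn_finsetSum _ fun p hp => ?_
  have hp' := mem_orderPairs.1 hp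
  have h1 := hb.cont p.1 p.2 (by omega)
  have h2 := hb.cont (p.1 + 1) p.2 (by omega)
  exact continuousOn_const.mul (Complex.continuous_re.comp_continuousOn
    ((Complex.continuous_conj.comp_continuousOn h1).mul h2))

lemma hasDerivWithinAt_density (h : m + 1 ≤ n) {t : ℝ} (ht : t ∈ Icc 0 T) (ξ : ℝ) :
    HasDerivWithinAt (fun s => density b m s ξ) (densityDt b m t ξ) (Icc 0 T) t :=
  HasDerivWithinAt.fun_sum fun p hp => hasDerivWithinAt_norm_sq
    (hb.dt p.1 p.2 (by have := mem_orderPairs.1 hp; omega) t ht ξ)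

lemma density_le (h : m ≤ n) {t : ℝ} (ht : t ∈ Icc 0 T) (ξ : ℝ) :
    density b m t ξ ≤ (orderPairs m).card * M ^ 2 := by
  rw [← nsmul_eq_mul]
  refine Finset.sum_le_card_nsmul _ _ _ fun p hp => ?_
  have := hb.bound p.1 p.2 ((mem_orderPairs.1 hp).trans h) t ht ξ
  gcongr

lemma continuous_density (h : m ≤ n) {t : ℝ} (ht : t ∈ Icc 0 T) : Continuous (density b m t) :=
  (hb.continuousOn_density h).comp_continuous (f := fun x : ℝ => (t, x)) (by fun_prop)
    (fun _ => ⟨ht, mem_univ _⟩)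

/-- The local energy estimate: for an equation `∂ₜ b = α ∂ξ² b + (lower order)` with imaginary
`α`, the energy in an interval grows by the boundary flux only. -/
lemma integral_density_le (hm : m + 2 ≤ n) {α : ℂ} (hα : α.re = 0) {C : ℝ}
    (heq : ∀ i k, i + k ≤ m → ∀ t ∈ Icc 0 T, ∀ ξ B, (∀ i' k', i' + k' ≤ m → ‖b i' k' t ξ‖ ≤ B) →
      ‖b (i + 1) k t ξ - α * b i (k + 2) t ξ‖ ≤ C * B) (hC : 0 ≤ C)
    {t : ℝ} (ht : t ∈ Icc 0 T) {c d : ℝ} (hcd : c ≤ d) :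
    ∫ x in c..d, density b m t x ≤ Real.exp ((orderPairs m).card * (2 * C) * T)
      * (|∫ x in c..d, density b m 0 x| + (orderPairs m).card * (4 * (‖α‖ * M ^ 2)) * T) := by
  have hn1 : m + 1 ≤ n := by omega
  have hcont := hb.continuousOn_density (m := m) (by omega)
  refine le_of_deriv_le_affine (f' := fun t => ∫ x in c..d, densityDt b m t x) (by positivity)
    (by positivity)
    (continuousOn_integral_of_strip hcont (B := (orderPairs m).card * M ^ 2) (fun t ht ξ => by
      rw [abs_of_nonneg (density_nonneg _ _)]; exact hb.density_le (by omega) ht ξ) c d)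
    (fun t ht => hasDerivAt_integral_of_strip hcont (hb.continuousOn_densityDt hn1)
      (B := 2 * ((orderPairs (m + 1)).card * M ^ 2)) (fun t ht ξ => (abs_densityDt_le t ξ).trans
        (by have := hb.density_le hn1 ht ξ; linarith))
      (fun t ht ξ => hb.hasDerivWithinAt_density hn1 ht ξ) c d ht) ?_ ht
  intro s hs'
  have hs : s ∈ Icc 0 T := Ioo_subset_Icc_self hs'
  have hx : ∀ i k, i + k ≤ n → Continuous (b i k s) := fun i k h =>
    (hb.cont i k h).comp_continuous (f := fun x : ℝ => (s, x)) (by fun_prop)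
      (fun _ => ⟨hs, mem_univ _⟩)
  have hflux : ∀ p ∈ orderPairs m, ∀ x, HasDerivAt
      (fun x => 2 * (conj (b p.1 p.2 s x) * (α * b p.1 (p.2 + 1) s x)).re)
      (2 * (conj (b p.1 p.2 s x) * (α * b p.1 (p.2 + 2) s x)).re) x := by
    intro p hp x
    have hp' := mem_orderPairs.1 hp
    have h1 := hb.dx p.1 p.2 (by omega) s hs x
    have h2 := (hb.dx p.1 (p.2 + 1) (by omega) s hs x).const_mul α
    have h1' : HasDerivAt (fun x => conj (b p.1 p.2 s x)) (conj (b p.1 (p.2 + 1) s x)) x :=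
      h1.star
    have h3 := (Complex.reCLM.hasFDerivAt.comp_hasDerivAt x (h1'.mul h2)).const_mul 2
    refine h3.congr_deriv ?_
    simp only [Complex.reCLM_apply, Complex.add_re]
    -- The part of the flux derivative that is not a second derivative is Re α · |∂_ξ b|², and α is
    -- imaginary.
    have h4 : (conj (b p.1 (p.2 + 1) s x) * (α * b p.1 (p.2 + 1) s x)).re = 0 := by
      rw [show conj (b p.1 (p.2 + 1) s x) * (α * b p.1 (p.2 + 1) s x)
        = α * (b p.1 (p.2 + 1) s x * conj (b p.1 (p.2 + 1) s x)) by ring, Complex.mul_conj,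
        Complex.re_mul_ofReal, hα, zero_mul]
    rw [h4, zero_add]
  have hfluxcont : ∀ p ∈ orderPairs m, Continuous
      (fun x => 2 * (conj (b p.1 p.2 s x) * (α * b p.1 (p.2 + 2) s x)).re) := by
    intro p hp
    have hp' := mem_orderPairs.1 hp
    have h1 := hx p.1 p.2 (by omega)
    have h2 := hx p.1 (p.2 + 2) (by omega)
    exact continuous_const.mul (Complex.continuous_re.comp
      ((Complex.continuous_conj.comp h1).mul (continuous_const.mul h2)))
  have hJ : ∀ p ∈ orderPairs m, ∀ x,
      |2 * (conj (b p.1 p.2 s x) * (α * b p.1 (p.2 + 1) s x)).re| ≤ 2 * (‖α‖ * M ^ 2) := by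
    intro p hp x
    have hp' := mem_orderPairs.1 hp
    have h1 := hb.bound p.1 p.2 (by omega) s hs x
    have h2 := hb.bound p.1 (p.2 + 1) (by omega) s hs x
    rw [abs_mul, abs_two]
    refine mul_le_mul_of_nonneg_left ((Complex.abs_re_le_norm _).trans ?_) zero_le_two
    rw [norm_mul, norm_mul, RCLike.norm_conj]
    have : ‖b p.1 p.2 s x‖ * ‖b p.1 (p.2 + 1) s x‖ ≤ M * M :=
      mul_le_mul h1 h2 (norm_nonneg _) ((norm_nonneg _).trans h1)
    calc _ = ‖α‖ * (‖b p.1 p.2 s x‖ * ‖b p.1 (p.2 + 1) s x‖) := by ring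
      _ ≤ ‖α‖ * (M * M) := by gcongr
      _ = _ := by ring
  have hpt : ∀ x, densityDt b m s x
      ≤ ∑ p ∈ orderPairs m, (2 * (conj (b p.1 p.2 s x) * (α * b p.1 (p.2 + 2) s x)).re
        + 2 * C * density b m s x) := by
    intro x
    refine Finset.sum_le_sum fun p hp => ?_
    have hp' := mem_orderPairs.1 hp
    -- All jets at the point are at most √density, so the lower-order source is at most C√density,
    -- and paired with another jet at most C · density.
    have hsq : ∀ i' k', i' + k' ≤ m → ‖b i' k' s x‖ ≤ Real.sqrt (density b m s x) :=
      fun i' k' h => Real.le_sqrt_of_sq_le (sq_le_density h s x)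
    have h1 := heq p.1 p.2 hp' s hs x _ hsq
    have h2 : (conj (b p.1 p.2 s x) * b (p.1 + 1) p.2 s x).re
        = (conj (b p.1 p.2 s x) * (α * b p.1 (p.2 + 2) s x)).re
          + (conj (b p.1 p.2 s x) * (b (p.1 + 1) p.2 s x - α * b p.1 (p.2 + 2) s x)).re := by
      rw [← Complex.add_re]; ring_nf
    have h3 : (conj (b p.1 p.2 s x) * (b (p.1 + 1) p.2 s x - α * b p.1 (p.2 + 2) s x)).re
        ≤ C * density b m s x := by
      refine (Complex.re_le_norm _).trans ?_
      rw [norm_mul, RCLike.norm_conj]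
      calc _ ≤ Real.sqrt (density b m s x) * (C * Real.sqrt (density b m s x)) :=
            mul_le_mul (hsq _ _ hp') h1 (norm_nonneg _) (Real.sqrt_nonneg _)
        _ = C * (Real.sqrt (density b m s x) * Real.sqrt (density b m s x)) := by ring
        _ = _ := by rw [Real.mul_self_sqrt (density_nonneg _ _)]
    rw [h2]; linarith
  have hDtc : Continuous (densityDt b m s) :=
    (hb.continuousOn_densityDt hn1).comp_continuous (f := fun x : ℝ => (s, x)) (by fun_prop)
      (fun _ => ⟨hs, mem_univ _⟩)
  have hdc := hb.continuous_density (m := m) (by omega) hs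
  have h5 := integral_le_of_flux hcd (orderPairs m) hflux hfluxcont hdc hDtc hJ hpt
  refine h5.trans (le_of_eq ?_)
  ring

end JetFamily

end Decay


/-! ### A square-summable envelope on the grid -/

section Envelope

open MeasureTheory intervalIntegral

lemma integral_le_of_support {R B c d : ℝ} (hcd : c ≤ d) {f : ℝ → ℝ} (hf : Continuous f)
    (h0 : ∀ x ∉ Icc (-R) R, f x = 0) (hB : ∀ x, f x ≤ B) (hB0 : 0 ≤ B) :
    ∫ x in c..d, f x ≤ 2 * |R| * B := by
  have hfin : volume (Icc (-R) R) ≠ ⊤ := by simp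
  rw [integral_of_le hcd]
  calc ∫ x in Ioc c d, f x ≤ ∫ x in Ioc c d, (Icc (-R) R).indicator (fun _ => B) x := by
        refine integral_mono (hf.integrableOn_Ioc) ?_ (fun x => ?_)
        · exact ((integrableOn_const hfin).integrable_indicator measurableSet_Icc).integrableOn
        · by_cases hx : x ∈ Icc (-R) R
          · rw [indicator_of_mem hx]; exact hB x
          · rw [indicator_of_notMem hx, h0 x hx]
    _ ≤ ∫ x, (Icc (-R) R).indicator (fun _ => B) x := by
        refine setIntegral_le_integral
          ((integrableOn_const hfin).integrable_indicator measurableSet_Icc) ?_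
        exact Filter.Eventually.of_forall fun x => indicator_nonneg (fun _ _ => hB0) x
    _ = (volume (Icc (-R) R)).toReal * B := by
        rw [MeasureTheory.integral_indicator measurableSet_Icc, setIntegral_const]; rfl
    _ ≤ 2 * |R| * B := by
        gcongr
        rw [Real.volume_Icc, ENNReal.toReal_ofReal']
        have := le_abs_self R
        exact max_le (by linarith) (by positivity)

variable {b : ℕ → ℕ → ℝ → ℝ → ℂ} {T M : ℝ} {n m : ℕ}

/-- The cells of a grid. -/
lemma sum_integral_cells_le {x₀ h E : ℝ} (hh : 0 < h) {e : ℝ → ℝ} (he : Continuous e)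
    (he0 : ∀ x, 0 ≤ e x) (hE : ∀ c d, c ≤ d → ∫ x in c..d, e x ≤ E) (F : Finset ℤ) :
    ∑ j ∈ F, ∫ x in (x₀ + j * h)..(x₀ + (j + 1) * h), e x ≤ E := by
  obtain ⟨N, hN⟩ : ∃ N : ℕ, ∀ j ∈ F, j.natAbs ≤ N :=
    ⟨F.sup Int.natAbs, fun j hj => Finset.le_sup (f := Int.natAbs) hj⟩
  set φ : ℕ → ℤ := fun k => (k : ℤ) - N with hφ
  have hinj : Set.InjOn φ (Finset.range (2 * N + 1)) := by
    intro a _ b _ hab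
    simp only [hφ] at hab
    omega
  have hsub : F ⊆ (Finset.range (2 * N + 1)).image φ := by
    intro j hj
    have := hN j hj
    refine Finset.mem_image.2 ⟨(j + N).toNat, Finset.mem_range.2 (by omega), ?_⟩
    simp only [hφ]
    omega
  calc ∑ j ∈ F, ∫ x in (x₀ + j * h)..(x₀ + (j + 1) * h), e x
      ≤ ∑ j ∈ (Finset.range (2 * N + 1)).image φ, ∫ x in (x₀ + j * h)..(x₀ + (j + 1) * h), e x := by
        refine Finset.sum_le_sum_of_subset_of_nonneg hsub fun j _ _ => ?_
        exact integral_nonneg (by nlinarith) fun x _ => he0 x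
    _ = ∑ k ∈ Finset.range (2 * N + 1),
          ∫ x in (x₀ + ((k : ℝ) - N) * h)..(x₀ + (((k + 1 : ℕ) : ℝ) - N) * h), e x := by
        rw [Finset.sum_image hinj]
        refine Finset.sum_congr rfl fun k _ => ?_
        simp only [hφ]
        push_cast
        congr 2
        ring
    _ = ∫ x in (x₀ + (((0 : ℕ) : ℝ) - N) * h)..(x₀ + (((2 * N + 1 : ℕ) : ℝ) - N) * h), e x :=
        sum_integral_adjacent_intervals (a := fun k : ℕ => x₀ + ((k : ℝ) - N) * h)
          fun k _ => he.intervalIntegrable _ _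
    _ ≤ E := by
        refine hE _ _ ?_
        have : ((0 : ℕ) : ℝ) - N ≤ ((2 * N + 1 : ℕ) : ℝ) - N := by push_cast; linarith
        nlinarith

/-- A window of width 10h consists of ten cells, and each of the ten shifted families of cells tiles
the line. The width leaves room for all difference stencils of the defects. -/
lemma sum_integral_windows_le {x₀ h E : ℝ} (hh : 0 < h) {e : ℝ → ℝ} (he : Continuous e)
    (he0 : ∀ x, 0 ≤ e x) (hE : ∀ c d, c ≤ d → ∫ x in c..d, e x ≤ E) (F : Finset ℤ) :
    ∑ j ∈ F, ∫ x in (x₀ + (j - 5) * h)..(x₀ + (j + 5) * h), e x ≤ 10 * E := by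
  have h1 : ∀ j : ℤ, ∫ x in (x₀ + (j - 5) * h)..(x₀ + (j + 5) * h), e x
      = ∑ k ∈ Finset.range 10, ∫ x in ((x₀ + ((k : ℝ) - 5) * h) + j * h)..
          ((x₀ + ((k : ℝ) - 5) * h) + (j + 1) * h), e x := by
    intro j
    have := sum_integral_adjacent_intervals (μ := volume) (f := e)
      (a := fun k : ℕ => x₀ + ((k : ℝ) - 5 + j) * h) (n := 10)
      fun k _ => he.intervalIntegrable _ _
    push_cast at this
    rw [show x₀ + ((j : ℝ) - 5) * h = x₀ + (0 - 5 + j) * h by ring,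
      show x₀ + ((j : ℝ) + 5) * h = x₀ + (10 - 5 + j) * h by ring, ← this]
    refine Finset.sum_congr rfl fun k _ => ?_
    congr 1 <;> ring
  simp_rw [h1]
  rw [Finset.sum_comm]
  calc _ ≤ ∑ _k ∈ Finset.range 10, E :=
        Finset.sum_le_sum fun k _ => sum_integral_cells_le hh he he0 hE F
    _ = 10 * E := by simp

namespace JetFamily

variable (hb : JetFamily T M n b)
include hb

/-- Derivatives are controlled on an interval by the energies, uniformly in time. -/
lemma norm_sq_le_integral (hT : 0 < T) (hm : m + 2 ≤ n) {c d : ℝ} (hcd : c ≤ d) {i k : ℕ}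
    (hik : i + k ≤ m) {t : ℝ} (ht : t ∈ Icc 0 T) {ξ : ℝ} (hξ : ξ ∈ Icc c d) :
    T * ((d - c) * ‖b i k t ξ‖ ^ 2)
      ≤ (1 + 2 * (d - c)) * ((1 + 2 * T) * ∫ s in (0 : ℝ)..T, ∫ x in c..d, density b (m + 2) s x) := by
  have hc1 := hb.continuous_density (m := m + 1) (by omega) ht
  have hbc : Continuous (fun x => ‖b i k t x‖ ^ 2) :=
    ((hb.cont i k (by omega)).comp_continuous (f := fun x : ℝ => (t, x)) (by fun_prop)
      (fun _ => ⟨ht, mem_univ _⟩)).norm.pow 2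
  have h1 := sobolev_sup_le (c := c) (d := d) (v := fun x => ‖b i k t x‖ ^ 2)
    (v' := fun x => 2 * (conj (b i k t x) * b i (k + 1) t x).re)
    (u := fun x => 2 * density b (m + 1) t x) hbc.continuousOn
    (fun x _ => by
      have := hb.dx i k (by omega) t ht x
      rw [← hasDerivWithinAt_univ] at this ⊢
      exact hasDerivWithinAt_norm_sq this)
    (by fun_prop) (fun x _ => mul_nonneg zero_le_two (density_nonneg _ _))
    (fun x _ => (abs_two_inner_le _ _).trans (by
      have e1 := sq_le_density (b := b) (i := i) (k := k) (m := m + 1) (by omega) t x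
      have e2 := sq_le_density (b := b) (i := i) (k := k + 1) (m := m + 1) (by omega) t x
      linarith)) hξ
  have h2 : ∫ x in c..d, ‖b i k t x‖ ^ 2 ≤ ∫ x in c..d, density b (m + 1) t x :=
    integral_mono_on hcd (hbc.intervalIntegrable _ _) (hc1.intervalIntegrable _ _)
      fun x _ => sq_le_density (by omega) t x
  have hcont1 := hb.continuousOn_density (m := m + 1) (by omega)
  have hcont2 := hb.continuousOn_density (m := m + 2) (by omega)
  have hI := continuousOn_integral_of_strip hcont1 (B := (orderPairs (m + 1)).card * M ^ 2)
    (fun t ht ξ => by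
      rw [abs_of_nonneg (density_nonneg _ _)]; exact hb.density_le (by omega) ht ξ) c d
  have hJ := continuousOn_integral_of_strip hcont2 (B := (orderPairs (m + 2)).card * M ^ 2)
    (fun t ht ξ => by
      rw [abs_of_nonneg (density_nonneg _ _)]; exact hb.density_le (by omega) ht ξ) c d
  have hJ0 : ∀ s, 0 ≤ ∫ x in c..d, density b (m + 2) s x := fun s =>
    integral_nonneg hcd fun x _ => density_nonneg _ _
  have hIJ : ∀ s ∈ Icc 0 T, ∫ x in c..d, density b (m + 1) s x
      ≤ ∫ x in c..d, density b (m + 2) s x := fun s hs =>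
    integral_mono_on hcd ((hb.continuous_density (by omega) hs).intervalIntegrable _ _)
      ((hb.continuous_density (by omega) hs).intervalIntegrable _ _)
      fun x _ => density_mono (by omega) s x
  -- A second Sobolev inequality, now in time, for the integrals over the window. It costs one more
  -- order, but its right-hand side does not depend on t, so the resulting envelope is uniform in
  -- time.
  have h3 := sobolev_sup_le (c := 0) (d := T) (v := fun s => ∫ x in c..d, density b (m + 1) s x)
    (v' := fun s => ∫ x in c..d, densityDt b (m + 1) s x)
    (u := fun s => 2 * ∫ x in c..d, density b (m + 2) s x) hI
    (fun s hs => hasDerivAt_integral_of_strip hcont1 (hb.continuousOn_densityDt (by omega))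
      (B := 2 * ((orderPairs (m + 2)).card * M ^ 2)) (fun t ht ξ => (abs_densityDt_le t ξ).trans
        (by have := hb.density_le (m := m + 2) (by omega) ht ξ; linarith))
      (fun t ht ξ => hb.hasDerivWithinAt_density (by omega) ht ξ) c d hs)
    (continuousOn_const.mul hJ) (fun s _ => mul_nonneg zero_le_two (hJ0 s))
    (fun s hs => by
      have hs' := Ioo_subset_Icc_self hs
      have hc2 := hb.continuous_density (m := m + 2) (by omega) hs'
      have hcD : Continuous (densityDt b (m + 1) s) :=
        (hb.continuousOn_densityDt (by omega)).comp_continuous (f := fun x : ℝ => (s, x))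
          (by fun_prop) (fun _ => ⟨hs', mem_univ _⟩)
      refine (abs_integral_le_integral_abs hcd).trans ?_
      rw [← intervalIntegral.integral_const_mul]
      exact integral_mono_on hcd (hcD.abs.intervalIntegrable _ _)
        ((continuous_const.mul hc2).intervalIntegrable _ _) fun x _ => abs_densityDt_le s x) ht
  have h4 : ∫ s in (0 : ℝ)..T, ∫ x in c..d, density b (m + 1) s x
      ≤ ∫ s in (0 : ℝ)..T, ∫ x in c..d, density b (m + 2) s x :=
    integral_mono_on hT.le (hI.intervalIntegrable_of_Icc hT.le)
      (hJ.intervalIntegrable_of_Icc hT.le) hIJ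
  rw [intervalIntegral.integral_const_mul] at h1 h3
  rw [sub_zero] at h3
  set X := ∫ s in (0 : ℝ)..T, ∫ x in c..d, density b (m + 2) s x
  have hdc : 0 ≤ d - c := sub_nonneg.2 hcd
  have h5 : (d - c) * ‖b i k t ξ‖ ^ 2 ≤ (1 + 2 * (d - c)) * ∫ x in c..d, density b (m + 1) t x := by
    linarith
  calc T * ((d - c) * ‖b i k t ξ‖ ^ 2)
      ≤ T * ((1 + 2 * (d - c)) * ∫ x in c..d, density b (m + 1) t x) := by gcongr
    _ = (1 + 2 * (d - c)) * (T * ∫ x in c..d, density b (m + 1) t x) := by ring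
    _ ≤ (1 + 2 * (d - c)) * ((1 + 2 * T) * X) := by
        refine mul_le_mul_of_nonneg_left ?_ (by positivity)
        linarith

/-- A square summable envelope of the derivatives on a grid. -/
lemma exists_envelope (hT : 0 < T) (hm : m + 2 ≤ n) {E : ℝ}
    (hE : ∀ t ∈ Icc 0 T, ∀ c d, c ≤ d → ∫ x in c..d, density b (m + 2) t x ≤ E) (x₀ : ℝ) {h : ℝ}
    (hh : 0 < h) (hh1 : h ≤ 1) :
    ∃ Γ : ℤ → ℝ, (∀ j, 0 ≤ Γ j) ∧ (∀ F : Finset ℤ, h * ∑ j ∈ F, Γ j ^ 2 ≤ 21 * (1 + 2 * T) * E) ∧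
      ∀ i k, i + k ≤ m → ∀ t ∈ Icc 0 T, ∀ j : ℤ, ∀ ξ ∈ Icc (x₀ + (j - 5) * h) (x₀ + (j + 5) * h),
        ‖b i k t ξ‖ ≤ Γ j := by
  set X : ℤ → ℝ := fun j => ∫ s in (0 : ℝ)..T,
    ∫ x in (x₀ + (j - 5) * h)..(x₀ + (j + 5) * h), density b (m + 2) s x with hX
  have hcd : ∀ j : ℤ, x₀ + (j - 5) * h ≤ x₀ + (j + 5) * h := fun j => by nlinarith
  have hJ0 : ∀ (j : ℤ) (s : ℝ),
      0 ≤ ∫ x in (x₀ + (j - 5) * h)..(x₀ + (j + 5) * h), density b (m + 2) s x := fun j s =>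
    integral_nonneg (hcd j) fun x _ => density_nonneg _ _
  have hX0 : ∀ j, 0 ≤ X j := fun j => integral_nonneg hT.le fun s _ => hJ0 j s
  -- The factor from `norm_sq_le_integral` for a window of length 10h. Its 1/h cancels the h in
  -- front of the sum, and h ≤ 1 turns 1 + 20h into 21.
  set A : ℝ := (1 + 20 * h) * (1 + 2 * T) / (T * (10 * h)) with hA
  have hA0 : 0 ≤ A := by positivity
  have hcont2 := hb.continuousOn_density (m := m + 2) (by omega)
  have hJ : ∀ j : ℤ, ContinuousOn (fun s => ∫ x in (x₀ + (j - 5) * h)..(x₀ + (j + 5) * h),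
      density b (m + 2) s x) (Icc 0 T) := fun j =>
    continuousOn_integral_of_strip hcont2 (B := (orderPairs (m + 2)).card * M ^ 2)
      (fun t ht ξ => by
        rw [abs_of_nonneg (density_nonneg _ _)]; exact hb.density_le (by omega) ht ξ) _ _
  have hE0 : 0 ≤ E := by
    have := hE 0 ⟨le_rfl, hT.le⟩ 0 0 le_rfl
    rwa [integral_same] at this
  refine ⟨fun j => Real.sqrt (A * X j), fun j => Real.sqrt_nonneg _, fun F => ?_, ?_⟩
  · have h1 : ∑ j ∈ F, X j ≤ T * (10 * E) := by
      simp only [hX]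
      rw [← intervalIntegral.integral_finsetSum fun j _ => (hJ j).intervalIntegrable_of_Icc hT.le]
      calc _ ≤ ∫ _s in (0 : ℝ)..T, 10 * E := by
            refine integral_mono_on hT.le ?_ intervalIntegrable_const fun s hs => ?_
            · exact (continuousOn_finsetSum _ fun j _ => hJ j).intervalIntegrable_of_Icc hT.le
            · exact sum_integral_windows_le hh (hb.continuous_density (by omega) hs)
                (fun x => density_nonneg _ _) (hE s hs) F
        _ = _ := by rw [intervalIntegral.integral_const]; simp
    calc h * ∑ j ∈ F, Real.sqrt (A * X j) ^ 2 = h * A * ∑ j ∈ F, X j := by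
          rw [Finset.mul_sum, Finset.mul_sum]
          refine Finset.sum_congr rfl fun j _ => ?_
          rw [Real.sq_sqrt (mul_nonneg hA0 (hX0 j)), mul_assoc]
      _ ≤ h * A * (T * (10 * E)) := by gcongr
      _ = (1 + 20 * h) * (1 + 2 * T) * E := by rw [hA]; field_simp
      _ ≤ 21 * (1 + 2 * T) * E := by gcongr; linarith
  · intro i k hik t ht j ξ hξ
    refine Real.le_sqrt_of_sq_le ?_
    have h1 := hb.norm_sq_le_integral hT hm (hcd j) hik ht hξ
    rw [show x₀ + ((j : ℝ) + 5) * h - (x₀ + (j - 5) * h) = 10 * h by ring] at h1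
    have h2 : A * X j = ((1 + 2 * (10 * h)) * ((1 + 2 * T) * X j)) / (T * (10 * h)) := by
      rw [hA]; ring
    rw [h2, le_div_iff₀ (by positivity)]
    linarith

end JetFamily

/-- The energy of a solution of the cubic equation with compactly supported data is bounded
by a constant depending only on the parameters. -/
theorem exists_integral_density_le (κ lam w T M R : ℝ) (hw : w ≠ 0) (hT : 0 < T) (m N : ℕ)
    (hN : 2 * m + 2 ≤ N) :
    ∃ E : ℝ, ∀ (a₀ b₀ : ℝ → ℂ) (a : ℝ → ℝ → ℂ), Function.support a₀ ⊆ Icc (-R) R →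
      Function.support b₀ ⊆ Icc (-R) R → IsNLSSolution κ lam w T a₀ b₀ a →
      HasBoundedDerivs N M T a → ∀ t ∈ Icc 0 T, ∀ c d, c ≤ d →
        ∫ x in c..d, density (stripJet T a) m t x ≤ E := by
  set C : ℝ := |lam / (2 * w)| * (8 ^ m * (M * M)) with hC
  have hC0 : 0 ≤ C := by
    have := mul_self_nonneg M
    positivity
  -- The first term bounds the initial energy, whose density vanishes outside [-R, R]. The second is
  -- the flux through the two end points; neither depends on the interval.
  refine ⟨Real.exp ((orderPairs m).card * (2 * C) * T) * (2 * |R| * ((orderPairs m).card * M ^ 2)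
    + (orderPairs m).card * (4 * (‖nlsDisp κ w‖ * M ^ 2)) * T), ?_⟩
  intro a₀ b₀ a ha₀ hb₀ hs ha t ht c d hcd
  have hJ := jetFamily_stripJet hT ha
  have h0 : (0 : ℝ) ∈ Icc 0 T := ⟨le_rfl, hT.le⟩
  refine (hJ.integral_density_le (m := m) (by omega) (α := nlsDisp κ w) (C := C) ?_ ?_ hC0 ht
    hcd).trans ?_
  · rw [nlsDisp, Complex.re_mul_ofReal, Complex.I_re, zero_mul]
  · intro i k hik t ht ξ B hB
    have hB0 : 0 ≤ B := (norm_nonneg _).trans (hB 0 0 (by omega))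
    refine (norm_jet_eqn_le hT ha hw hs (i := i) (k := k) (by omega) ht ξ
      (fun i' k' h => hB i' k' (by omega))).trans ?_
    have := mul_self_nonneg M
    rw [hC]
    gcongr
    norm_num
  · gcongr
    rw [abs_of_nonneg (integral_nonneg hcd fun x _ => density_nonneg _ _)]
    refine integral_le_of_support hcd (hJ.continuous_density (by omega) h0) (fun x hx => ?_)
      (fun x => hJ.density_le (by omega) h0 x) (by positivity)
    refine Finset.sum_eq_zero fun p hp => ?_
    have := mem_orderPairs.1 hp
    rw [stripJet_init hT ha hw hs ha₀ hb₀ (by omega) hx]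
    simp

end Envelope


/-! ### Taylor's formula and difference quotients -/

section Taylor

variable {p q : ℝ}

lemma norm_sub_le_of_deriv_within {f f' : ℝ → ℂ} {C : ℝ}
    (hd : ∀ s ∈ Icc p q, HasDerivWithinAt f (f' s) (Icc p q) s) (hC : ∀ s ∈ Icc p q, ‖f' s‖ ≤ C)
    {c x : ℝ} (hc : c ∈ Icc p q) (hx : x ∈ Icc p q) : ‖f x - f c‖ ≤ C * |x - c| :=
  (convex_Icc p q).norm_image_sub_le_of_norm_hasDerivWithin_le hd hC hc hx

/-- Taylor's formula with a bound of the remainder. -/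
lemma norm_taylor_le {C : ℝ} {c : ℝ} (hc : c ∈ Icc p q) (n : ℕ) : ∀ {f : ℕ → ℝ → ℂ},
    (∀ k ≤ n, ∀ s ∈ Icc p q, HasDerivWithinAt (f k) (f (k + 1) s) (Icc p q) s) →
    (∀ s ∈ Icc p q, ‖f (n + 1) s‖ ≤ C) → ∀ {x : ℝ}, x ∈ Icc p q →
    ‖f 0 x - ∑ k ∈ Finset.range (n + 1), ((x - c : ℝ) : ℂ) ^ k / (k.factorial : ℂ) * f k c‖
      ≤ C * |x - c| ^ (n + 1) := by
  induction n with
  | zero =>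
    intro f hd hC x hx
    simpa using norm_sub_le_of_deriv_within (hd 0 le_rfl) hC hc hx
  | succ n ih =>
    intro f hd hC x hx
    have hC0 : 0 ≤ C := (norm_nonneg _).trans (hC c hc)
    have hsub : uIcc c x ⊆ Icc p q := uIcc_subset_Icc hc hx
    set P : ℝ → ℂ := fun s => f 0 s
      - ∑ k ∈ Finset.range (n + 2), ((s - c : ℝ) : ℂ) ^ k / (k.factorial : ℂ) * f k c with hP
    set Q : ℝ → ℂ := fun s => f 1 s
      - ∑ k ∈ Finset.range (n + 1), ((s - c : ℝ) : ℂ) ^ k / (k.factorial : ℂ) * f (k + 1) c with hQ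
    -- The derivative of the remainder is the remainder of one order less for the shifted family.
    -- Working on the segment from c to x lets the induction bound |s - c| by |x - c|.
    have hder : ∀ s ∈ uIcc c x, HasDerivWithinAt P (Q s) (uIcc c x) s := by
      intro s hs
      refine ((hd 0 (by omega) s (hsub hs)).mono hsub).sub ?_
      have hk : ∀ k : ℕ, HasDerivAt (fun s : ℝ => ((s - c : ℝ) : ℂ) ^ (k + 1) / ((k + 1).factorial : ℂ)
          * f (k + 1) c) (((s - c : ℝ) : ℂ) ^ k / (k.factorial : ℂ) * f (k + 1) c) s := by
        intro k
        have h1 : HasDerivAt (fun s : ℝ => ((s - c : ℝ) : ℂ)) 1 s := by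
          simpa using ((hasDerivAt_id s).sub_const c).ofReal_comp
        refine (((h1.pow (k + 1)).div_const _).mul_const _).congr_deriv ?_
        have : (k.factorial : ℂ) ≠ 0 := by exact_mod_cast k.factorial_ne_zero
        have : (k + 1 : ℂ) ≠ 0 := by exact_mod_cast k.succ_ne_zero
        rw [Nat.factorial_succ]
        push_cast
        field_simp
      have h2 : HasDerivAt (fun s : ℝ => ∑ k ∈ Finset.range (n + 2),
          ((s - c : ℝ) : ℂ) ^ k / (k.factorial : ℂ) * f k c)
          (∑ k ∈ Finset.range (n + 1), ((s - c : ℝ) : ℂ) ^ k / (k.factorial : ℂ) * f (k + 1) c) s := by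
        have h3 := (HasDerivAt.fun_sum (u := Finset.range (n + 1)) fun k _ => hk k).add_const
          (((s - c : ℝ) : ℂ) ^ 0 / ((Nat.factorial 0 : ℕ) : ℂ) * f 0 c)
        refine h3.congr_of_eventuallyEq (Filter.Eventually.of_forall fun y => ?_)
        simp only [Finset.sum_range_succ' _ (n + 1), pow_zero]
      exact h2.hasDerivWithinAt
    have hbd : ∀ s ∈ uIcc c x, ‖Q s‖ ≤ C * |x - c| ^ (n + 1) := by
      intro s hs
      refine (ih (f := fun k => f (k + 1)) (fun k hk => hd (k + 1) (by omega)) hC (hsub hs)).trans ?_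
      have : |s - c| ≤ |x - c| := abs_sub_left_of_mem_uIcc hs
      gcongr
    have h4 := norm_sub_le_of_deriv_within (p := c ⊓ x) (q := c ⊔ x) hder hbd left_mem_uIcc
      right_mem_uIcc
    have h5 : P c = 0 := by
      simp only [hP, sub_self, Finset.sum_range_succ' _ (n + 1)]
      simp
    rw [h5, sub_zero] at h4
    rw [pow_succ, ← mul_assoc]
    exact h4

variable {f : ℕ → ℝ → ℂ} {C c δ : ℝ}

lemma norm_sub_le_of_family {f : ℕ → ℝ → ℂ}
    (hd : ∀ s ∈ Icc p q, HasDerivWithinAt (f 0) (f 1 s) (Icc p q) s)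
    (hC : ∀ s ∈ Icc p q, ‖f 1 s‖ ≤ C) (hδ : 0 ≤ δ) (hl : c ∈ Icc p q) (hr : c + δ ∈ Icc p q) :
    ‖f 0 (c + δ) - f 0 c‖ ≤ C * δ := by
  have := norm_sub_le_of_deriv_within hd hC hl hr
  rwa [add_sub_cancel_left, abs_of_nonneg hδ] at this

/-- Error of the forward difference. -/
lemma norm_forward_sub_le (hd : ∀ k ≤ 1, ∀ s ∈ Icc p q, HasDerivWithinAt (f k) (f (k + 1) s) (Icc p q) s)
    (hC : ∀ s ∈ Icc p q, ‖f 2 s‖ ≤ C) (hδ : 0 < δ) (hl : c ∈ Icc p q) (hr : c + δ ∈ Icc p q) :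
    ‖(f 0 (c + δ) - f 0 c) / δ - f 1 c‖ ≤ C * δ := by
  have hδc : (δ : ℂ) ≠ 0 := by exact_mod_cast hδ.ne'
  have h1 := norm_taylor_le hl 1 hd hC hr
  simp only [Finset.sum_range_succ, Finset.sum_range_zero, add_sub_cancel_left, abs_of_pos hδ] at h1
  rw [show (f 0 (c + δ) - f 0 c) / δ - f 1 c = (f 0 (c + δ) - (0 + (δ : ℂ) ^ 0 / (Nat.factorial 0 : ℕ)
    * f 0 c + (δ : ℂ) ^ 1 / (Nat.factorial 1 : ℕ) * f 1 c)) / δ by simp; field_simp; ring]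
  rw [norm_div, Complex.norm_real, Real.norm_eq_abs, abs_of_pos hδ, div_le_iff₀ hδ]
  exact h1.trans (le_of_eq (by ring))

/-- Error of the central difference. -/
lemma norm_central_sub_le (hd : ∀ k ≤ 2, ∀ s ∈ Icc p q, HasDerivWithinAt (f k) (f (k + 1) s) (Icc p q) s)
    (hC : ∀ s ∈ Icc p q, ‖f 3 s‖ ≤ C) (hδ : 0 < δ) (hl : c - δ ∈ Icc p q) (hr : c + δ ∈ Icc p q) :
    ‖(f 0 (c + δ) - f 0 (c - δ)) / (2 * δ) - f 1 c‖ ≤ C * δ ^ 2 := by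
  have hδc : (δ : ℂ) ≠ 0 := by exact_mod_cast hδ.ne'
  have hc : c ∈ Icc p q := ⟨by linarith [hl.1], by linarith [hr.2]⟩
  have h1 := norm_taylor_le hc 2 hd hC hr
  have h2 := norm_taylor_le hc 2 hd hC hl
  rw [add_sub_cancel_left, abs_of_pos hδ] at h1
  rw [sub_sub_cancel_left, abs_neg, abs_of_pos hδ] at h2
  set X := f 0 (c + δ) - (f 0 c + (δ : ℂ) * f 1 c + ((δ : ℂ)) ^ 2 / 2 * f 2 c) with hX
  set Y := f 0 (c - δ) - (f 0 c + (-(δ : ℂ)) * f 1 c + ((-(δ : ℂ))) ^ 2 / 2 * f 2 c) with hY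
  have h1' : ‖X‖ ≤ C * δ ^ 3 := by
    convert h1 using 2
    simp [hX, Finset.sum_range_succ, Nat.factorial]
  have h2' : ‖Y‖ ≤ C * δ ^ 3 := by
    convert h2 using 2
    simp [hY, Finset.sum_range_succ, Nat.factorial]
  rw [show (f 0 (c + δ) - f 0 (c - δ)) / (2 * δ) - f 1 c = (X - Y) / (2 * δ) by
    simp only [hX, hY]; field_simp; ring]
  rw [norm_div, norm_mul, Complex.norm_real, Real.norm_eq_abs, abs_of_pos hδ, Complex.norm_two,
    div_le_iff₀ (by positivity)]
  exact (norm_sub_le _ _).trans ((add_le_add h1' h2').trans (le_of_eq (by ring)))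

/-- The second difference is controlled by the second derivative. -/
lemma norm_second_diff_le (hd : ∀ k ≤ 1, ∀ s ∈ Icc p q, HasDerivWithinAt (f k) (f (k + 1) s) (Icc p q) s)
    (hC : ∀ s ∈ Icc p q, ‖f 2 s‖ ≤ C) (hδ : 0 ≤ δ) (hl : c - δ ∈ Icc p q) (hr : c + δ ∈ Icc p q) :
    ‖f 0 (c + δ) - 2 * f 0 c + f 0 (c - δ)‖ ≤ 2 * C * δ ^ 2 := by
  have hc : c ∈ Icc p q := ⟨by linarith [hl.1], by linarith [hr.2]⟩
  have h1 := norm_taylor_le hc 1 hd hC hr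
  have h2 := norm_taylor_le hc 1 hd hC hl
  rw [add_sub_cancel_left, abs_of_nonneg hδ] at h1
  rw [sub_sub_cancel_left, abs_neg, abs_of_nonneg hδ] at h2
  set X := f 0 (c + δ) - (f 0 c + (δ : ℂ) * f 1 c) with hX
  set Y := f 0 (c - δ) - (f 0 c + (-(δ : ℂ)) * f 1 c) with hY
  have h1' : ‖X‖ ≤ C * δ ^ 2 := by
    convert h1 using 2
    simp [hX, Finset.sum_range_succ, Nat.factorial]
  have h2' : ‖Y‖ ≤ C * δ ^ 2 := by
    convert h2 using 2
    simp [hY, Finset.sum_range_succ, Nat.factorial]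
  rw [show f 0 (c + δ) - 2 * f 0 c + f 0 (c - δ) = X + Y by
    simp only [hX, hY]; ring]
  exact (norm_add_le _ _).trans ((add_le_add h1' h2').trans (le_of_eq (by ring)))

/-- Error of the second difference quotient. -/
lemma norm_second_quot_sub_le (hd : ∀ k ≤ 3, ∀ s ∈ Icc p q, HasDerivWithinAt (f k) (f (k + 1) s) (Icc p q) s)
    (hC : ∀ s ∈ Icc p q, ‖f 4 s‖ ≤ C) (hδ : 0 < δ) (hl : c - δ ∈ Icc p q) (hr : c + δ ∈ Icc p q) :
    ‖(f 0 (c + δ) - 2 * f 0 c + f 0 (c - δ)) / (δ : ℂ) ^ 2 - f 2 c‖ ≤ 2 * C * δ ^ 2 := by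
  have hδc : (δ : ℂ) ≠ 0 := by exact_mod_cast hδ.ne'
  have hc : c ∈ Icc p q := ⟨by linarith [hl.1], by linarith [hr.2]⟩
  have h1 := norm_taylor_le hc 3 hd hC hr
  have h2 := norm_taylor_le hc 3 hd hC hl
  rw [add_sub_cancel_left, abs_of_pos hδ] at h1
  rw [sub_sub_cancel_left, abs_neg, abs_of_pos hδ] at h2
  set X := f 0 (c + δ) - (f 0 c + (δ : ℂ) * f 1 c + ((δ : ℂ)) ^ 2 / 2 * f 2 c + ((δ : ℂ)) ^ 3 / 6 * f 3 c) with hX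
  set Y := f 0 (c - δ) - (f 0 c + (-(δ : ℂ)) * f 1 c + ((-(δ : ℂ))) ^ 2 / 2 * f 2 c + ((-(δ : ℂ))) ^ 3 / 6 * f 3 c) with hY
  have h1' : ‖X‖ ≤ C * δ ^ 4 := by
    convert h1 using 2
    simp [hX, Finset.sum_range_succ, Nat.factorial]
  have h2' : ‖Y‖ ≤ C * δ ^ 4 := by
    convert h2 using 2
    simp [hY, Finset.sum_range_succ, Nat.factorial]
  rw [show (f 0 (c + δ) - 2 * f 0 c + f 0 (c - δ)) / (δ : ℂ) ^ 2 - f 2 c = (X + Y) / (δ : ℂ) ^ 2 by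
    simp only [hX, hY]; field_simp; ring]
  rw [norm_div, norm_pow, Complex.norm_real, Real.norm_eq_abs, abs_of_pos hδ,
    div_le_iff₀ (by positivity)]
  exact (norm_add_le _ _).trans ((add_le_add h1' h2').trans (le_of_eq (by ring)))

end Taylor

/-! ### Calculus of functions bounded together with their derivative -/

/-- `f` and its derivative are bounded by `B` on `I`. -/
def BoundedC1 (I : Set ℝ) (f : ℝ → ℂ) (B : ℝ) : Prop :=
  ∃ f' : ℝ → ℂ, ∀ x ∈ I, HasDerivAt f (f' x) x ∧ ‖f x‖ ≤ B ∧ ‖f' x‖ ≤ B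

namespace BoundedC1

variable {I : Set ℝ} {f g u v w : ℝ → ℂ} {A B U V W : ℝ}

lemma mono (h : BoundedC1 I f A) (hAB : A ≤ B) : BoundedC1 I f B := by
  obtain ⟨f', hf⟩ := h
  exact ⟨f', fun x hx => ⟨(hf x hx).1, (hf x hx).2.1.trans hAB, (hf x hx).2.2.trans hAB⟩⟩

lemma add (hf : BoundedC1 I f A) (hg : BoundedC1 I g B) :
    BoundedC1 I (fun x => f x + g x) (A + B) := by
  obtain ⟨f', hf⟩ := hf
  obtain ⟨g', hg⟩ := hg
  refine ⟨fun x => f' x + g' x, fun x hx => ⟨(hf x hx).1.add (hg x hx).1, ?_, ?_⟩⟩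
  · exact (norm_add_le _ _).trans (add_le_add (hf x hx).2.1 (hg x hx).2.1)
  · exact (norm_add_le _ _).trans (add_le_add (hf x hx).2.2 (hg x hx).2.2)

lemma const_mul (hf : BoundedC1 I f A) (c : ℂ) : BoundedC1 I (fun x => c * f x) (‖c‖ * A) := by
  obtain ⟨f', hf⟩ := hf
  refine ⟨fun x => c * f' x, fun x hx => ⟨(hf x hx).1.const_mul c, ?_, ?_⟩⟩
  · rw [norm_mul]; gcongr; exact (hf x hx).2.1
  · rw [norm_mul]; gcongr; exact (hf x hx).2.2

lemma tril (hu : BoundedC1 I u U) (hv : BoundedC1 I v V) (hw : BoundedC1 I w W) :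
    BoundedC1 I (fun x => cubic.tril (u x) (v x) (w x)) (3 * (U * V * W)) := by
  obtain ⟨u', hu⟩ := hu
  obtain ⟨v', hv⟩ := hv
  obtain ⟨w', hw⟩ := hw
  have key : ∀ {a b c : ℂ}, ‖a‖ ≤ U → ‖b‖ ≤ V → ‖c‖ ≤ W → ‖cubic.tril a b c‖ ≤ U * V * W := by
    intro a b c ha hb hc
    rw [cubic.norm_tril]
    have := (norm_nonneg a).trans ha
    have := (norm_nonneg b).trans hb
    gcongr
  refine ⟨fun x => cubic.tril (u' x) (v x) (w x) + cubic.tril (u x) (v' x) (w x)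
    + cubic.tril (u x) (v x) (w' x), fun x hx => ⟨?_, ?_, ?_⟩⟩
  · have h1 : HasDerivAt (fun x => conj (v x)) (conj (v' x)) x := (hv x hx).1.star
    refine (((hu x hx).1.mul h1).mul (hw x hx).1).congr_deriv ?_
    simp only [cubic.tril, Pi.mul_apply]
    ring
  · have := key (hu x hx).2.1 (hv x hx).2.1 (hw x hx).2.1
    have := (norm_nonneg _).trans this
    linarith
  · have h1 := key (hu x hx).2.2 (hv x hx).2.1 (hw x hx).2.1
    have h2 := key (hu x hx).2.1 (hv x hx).2.2 (hw x hx).2.1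
    have h3 := key (hu x hx).2.1 (hv x hx).2.1 (hw x hx).2.2
    exact norm_add₃_le.trans (by linarith)

lemma norm_sub_le {p q : ℝ} (h : BoundedC1 (Icc p q) f B) (hpq : p ≤ q) : ‖f q - f p‖ ≤ B * (q - p) := by
  obtain ⟨f', hf⟩ := h
  have := norm_sub_le_of_deriv_within (fun s hs => (hf s hs).1.hasDerivWithinAt)
    (fun s hs => (hf s hs).2.2) (left_mem_Icc.2 hpq) (right_mem_Icc.2 hpq)
  rwa [abs_of_nonneg (sub_nonneg.2 hpq)] at this

end BoundedC1


/-! ### Consistency of the two-step scheme -/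

section Consistency

/-- Each term on the right contains half the second time difference or a product of two first
differences. For smooth functions both are O(τ²): the symmetric averaging has no first-order error.
-/
lemma cubic_sub_tril (σ : ℝ) (x y z : ℂ) : cubic σ x y z - cubic.tril y y y
    = ((2 * σ : ℝ) : ℂ) * (cubic.tril y y ((1 / 2) * (x - 2 * y + z))
      + cubic.tril ((1 / 2) * (x - 2 * y + z)) y ((1 / 2) * (x + z))
      + cubic.tril y ((1 / 2) * (x - 2 * y + z)) ((1 / 2) * (x + z))
      + (1 / 2) * (cubic.tril (x - y) (x - y) ((1 / 2) * (x + z))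
        + cubic.tril (y - z) (y - z) ((1 / 2) * (x + z)))) := by
  rw [cubic.eq_tril]
  simp only [cubic.tril, map_add, map_sub, map_mul, map_div₀, map_one, map_ofNat]
  push_cast
  ring

variable {b : ℕ → ℕ → ℝ → ℝ → ℂ} {T M : ℝ} {n : ℕ}

namespace JetFamily

variable (hb : JetFamily T M n b) {m : ℕ} {c d Γ : ℝ}
include hb

lemma nonneg_bound (hT : 0 ≤ T) : 0 ≤ M :=
  (norm_nonneg _).trans (hb.bound 0 0 (Nat.zero_le _) 0 ⟨le_rfl, hT⟩ 0)

lemma boundedC1_timeDiff (hn : 2 ≤ n) {t τ B : ℝ} (hτ : 0 ≤ τ)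
    (hB : ∀ k ≤ 1, ∀ t ∈ Icc 0 T, ∀ ξ ∈ Icc c d, ‖b 1 k t ξ‖ ≤ B) (ht : t ∈ Icc 0 T)
    (ht' : t + τ ∈ Icc 0 T) :
    BoundedC1 (Icc c d) (fun ξ => b 0 0 (t + τ) ξ - b 0 0 t ξ) (B * τ) := by
  refine ⟨fun ξ => b 0 1 (t + τ) ξ - b 0 1 t ξ, fun ξ hξ => ⟨?_, ?_, ?_⟩⟩
  · exact (hb.dx 0 0 (by omega) _ ht' ξ).sub (hb.dx 0 0 (by omega) _ ht ξ)
  · exact norm_sub_le_of_family (f := fun i s => b i 0 s ξ) (fun s hs => hb.dt 0 0 (by omega) s hs ξ)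
      (fun s hs => hB 0 (by omega) s hs ξ hξ) hτ ht ht'
  · exact norm_sub_le_of_family (f := fun i s => b i 1 s ξ) (fun s hs => hb.dt 0 1 (by omega) s hs ξ)
      (fun s hs => hB 1 le_rfl s hs ξ hξ) hτ ht ht'

lemma norm_timeDiff2_le {k : ℕ} (hn : k + 2 ≤ n) {t τ ξ : ℝ} (hτ : 0 ≤ τ)
    (hΓ : ∀ t ∈ Icc 0 T, ‖b 2 k t ξ‖ ≤ Γ) (ht : t - τ ∈ Icc 0 T) (ht' : t + τ ∈ Icc 0 T) :
    ‖b 0 k (t + τ) ξ - 2 * b 0 k t ξ + b 0 k (t - τ) ξ‖ ≤ 2 * Γ * τ ^ 2 :=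
  norm_second_diff_le (f := fun i s => b i k s ξ)
    (fun i hi s hs => hb.dt i k (by omega) s hs ξ) hΓ hτ ht ht'

lemma boundedC1_timeDiff2 (hn : 3 ≤ n) {t τ : ℝ} (hτ : 0 ≤ τ)
    (hΓ : ∀ i k, i + k ≤ 3 → ∀ t ∈ Icc 0 T, ∀ ξ ∈ Icc c d, ‖b i k t ξ‖ ≤ Γ)
    (ht : t - τ ∈ Icc 0 T) (ht' : t + τ ∈ Icc 0 T) :
    BoundedC1 (Icc c d) (fun ξ => (1 / 2) * (b 0 0 (t + τ) ξ - 2 * b 0 0 t ξ + b 0 0 (t - τ) ξ))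
      (Γ * τ ^ 2) := by
  have ht0 : t ∈ Icc 0 T := ⟨by linarith [ht.1], by linarith [ht'.2]⟩
  have key : ∀ k ≤ 1, ∀ ξ ∈ Icc c d,
      ‖(1 / 2 : ℂ) * (b 0 k (t + τ) ξ - 2 * b 0 k t ξ + b 0 k (t - τ) ξ)‖ ≤ Γ * τ ^ 2 := by
    intro k hk ξ hξ
    have := hb.norm_timeDiff2_le (k := k) (by omega) hτ (fun t ht => hΓ 2 k (by omega) t ht ξ hξ) ht ht'
    rw [norm_mul]
    norm_num
    linarith
  refine ⟨fun ξ => (1 / 2) * (b 0 1 (t + τ) ξ - 2 * b 0 1 t ξ + b 0 1 (t - τ) ξ),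
    fun ξ hξ => ⟨?_, key 0 (by omega) ξ hξ, key 1 le_rfl ξ hξ⟩⟩
  exact (((hb.dx 0 0 (by omega) _ ht' ξ).sub ((hb.dx 0 0 (by omega) _ ht0 ξ).const_mul 2)).add
    (hb.dx 0 0 (by omega) _ ht ξ)).const_mul _

/-- Consistency of the averaged nonlinearity. -/
lemma boundedC1_cubic (hn : 3 ≤ n) {t τ σ : ℝ} (hσ0 : 0 ≤ σ) (hσ1 : σ ≤ 1 / 2) (hτ : 0 ≤ τ)
    (hΓ : ∀ i k, i + k ≤ 3 → ∀ t ∈ Icc 0 T, ∀ ξ ∈ Icc c d, ‖b i k t ξ‖ ≤ Γ) (hΓ0 : 0 ≤ Γ)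
    (ht : t - τ ∈ Icc 0 T) (ht' : t + τ ∈ Icc 0 T) :
    BoundedC1 (Icc c d) (fun ξ => cubic σ (b 0 0 (t + τ) ξ) (b 0 0 t ξ) (b 0 0 (t - τ) ξ)
      - cubic.tril (b 0 0 t ξ) (b 0 0 t ξ) (b 0 0 t ξ)) (12 * M ^ 2 * τ ^ 2 * Γ) := by
  have ht0 : t ∈ Icc 0 T := ⟨by linarith [ht.1], by linarith [ht'.2]⟩
  have hM := hb.nonneg_bound (ht0.1.trans ht0.2)
  have hval : ∀ t ∈ Icc 0 T, BoundedC1 (Icc c d) (b 0 0 t) M := fun t ht =>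
    ⟨b 0 1 t, fun ξ _ => ⟨hb.dx 0 0 (by omega) t ht ξ, hb.bound 0 0 (by omega) t ht ξ,
      hb.bound 0 1 (by omega) t ht ξ⟩⟩
  have hA := hb.boundedC1_timeDiff2 hn hτ hΓ ht ht'
  have hm := ((hval _ ht').add (hval _ ht)).const_mul (1 / 2)
  have hm' := hm.mono (B := M) (by norm_num; linarith)
  -- In a product of two first differences, one factor is measured by the envelope Γ and the other
  -- by M, which keeps the bound linear in Γ.
  have hp1 := hb.boundedC1_timeDiff (by omega) hτ (fun k hk => hΓ 1 k (by omega)) ht0 ht'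
  have hp2 := hb.boundedC1_timeDiff (c := c) (d := d) (by omega) hτ
    (fun k hk t ht ξ _ => hb.bound 1 k (by omega) t ht ξ) ht0 ht'
  have hq1 := hb.boundedC1_timeDiff (by omega) hτ (fun k hk => hΓ 1 k (by omega)) ht
    (by rwa [sub_add_cancel])
  have hq2 := hb.boundedC1_timeDiff (c := c) (d := d) (by omega) hτ
    (fun k hk t ht ξ _ => hb.bound 1 k (by omega) t ht ξ) ht (by rwa [sub_add_cancel])
  simp only [sub_add_cancel] at hq1 hq2
  have hy := hval t ht0
  have := (((((hy.tril hy hA).add (hA.tril hy hm')).add (hy.tril hA hm')).add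
    (((hp1.tril hp2 hm').add (hq1.tril hq2 hm')).const_mul (1 / 2))).const_mul ((2 * σ : ℝ) : ℂ))
  simp only [cubic_sub_tril]
  refine this.mono ?_
  rw [Complex.norm_real, Real.norm_eq_abs, abs_of_nonneg (by linarith)]
  norm_num
  have h1 : 0 ≤ 12 * M ^ 2 * τ ^ 2 * Γ := by positivity
  have h2 : 2 * σ * (12 * M ^ 2 * τ ^ 2 * Γ) ≤ 1 * (12 * M ^ 2 * τ ^ 2 * Γ) :=
    mul_le_mul_of_nonneg_right (by linarith) h1
  linarith

end JetFamily

namespace Disc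

variable (g : Disc)

/-- The defect of the linear part of the scheme for the `k`th derivative. -/
noncomputable def linRes (b : ℕ → ℕ → ℝ → ℝ → ℂ) (k : ℕ) (t ξ : ℝ) : ℂ :=
  g.μ * (b 0 k (t + g.τ) ξ - 2 * b 0 k t ξ + b 0 k (t - g.τ) ξ)
    - Complex.I * (g.w / g.τ : ℝ) * (b 0 k (t + g.τ) ξ - b 0 k (t - g.τ) ξ)
    - g.s * ((g.σ * (b 0 k (t + g.τ) (ξ + g.h) + b 0 k (t - g.τ) (ξ + g.h))
            + (1 - 2 * g.σ) * b 0 k t (ξ + g.h))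
        - 2 * (g.σ * (b 0 k (t + g.τ) ξ + b 0 k (t - g.τ) ξ) + (1 - 2 * g.σ) * b 0 k t ξ)
        + (g.σ * (b 0 k (t + g.τ) (ξ - g.h) + b 0 k (t - g.τ) (ξ - g.h))
            + (1 - 2 * g.σ) * b 0 k t (ξ - g.h)))
    - g.q * ((b 0 k (t + g.τ) (ξ + g.h) - b 0 k (t + g.τ) (ξ - g.h))
        - (b 0 k (t - g.τ) (ξ + g.h) - b 0 k (t - g.τ) (ξ - g.h)))
    + (2 * Complex.I * (g.w : ℂ) * b 1 k t ξ + (1 / g.w ^ 2 : ℝ) * b 0 (k + 2) t ξ)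

variable {g}

lemma hasDerivAt_linRes (hb : JetFamily T M n b) {k : ℕ} (hk : k + 3 ≤ n) {t : ℝ}
    (ht : t - g.τ ∈ Icc 0 T) (ht' : t + g.τ ∈ Icc 0 T) (ξ : ℝ) :
    HasDerivAt (g.linRes b k t) (g.linRes b (k + 1) t ξ) ξ := by
  have hτ := g.τ_pos
  have ht0 : t ∈ Icc 0 T := ⟨by linarith [ht.1], by linarith [ht'.2]⟩
  have h0 : ∀ s ∈ Icc 0 T, HasDerivAt (b 0 k s) (b 0 (k + 1) s ξ) ξ := fun s hs =>
    hb.dx 0 k (by omega) s hs ξ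
  have hp : ∀ s ∈ Icc 0 T, HasDerivAt (fun x => b 0 k s (x + g.h)) (b 0 (k + 1) s (ξ + g.h)) ξ :=
    fun s hs => (hb.dx 0 k (by omega) s hs (ξ + g.h)).comp_add_const ξ g.h
  have hm : ∀ s ∈ Icc 0 T, HasDerivAt (fun x => b 0 k s (x - g.h)) (b 0 (k + 1) s (ξ - g.h)) ξ :=
    fun s hs => (hb.dx 0 k (by omega) s hs (ξ - g.h)).comp_sub_const ξ g.h
  have e1 := ((h0 _ ht').sub ((h0 _ ht0).const_mul 2)).add (h0 _ ht)
  have e2 := (h0 _ ht').sub (h0 _ ht)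
  have e3 := (((((hp _ ht').add (hp _ ht)).const_mul (g.σ : ℂ)).add
      ((hp _ ht0).const_mul (1 - 2 * g.σ : ℂ))).sub
    (((((h0 _ ht').add (h0 _ ht)).const_mul (g.σ : ℂ)).add
      ((h0 _ ht0).const_mul (1 - 2 * g.σ : ℂ))).const_mul 2)).add
    ((((hm _ ht').add (hm _ ht)).const_mul (g.σ : ℂ)).add
      ((hm _ ht0).const_mul (1 - 2 * g.σ : ℂ)))
  have e4 := ((hp _ ht').sub (hm _ ht')).sub ((hp _ ht).sub (hm _ ht))
  have e5 := ((hb.dx 1 k (by omega) t ht0 ξ).const_mul (2 * Complex.I * (g.w : ℂ))).add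
    ((hb.dx 0 (k + 2) (by omega) t ht0 ξ).const_mul ((1 / g.w ^ 2 : ℝ) : ℂ))
  exact ((((e1.const_mul (g.μ : ℂ)).sub (e2.const_mul (Complex.I * (g.w / g.τ : ℝ)))).sub
    (e3.const_mul (g.s : ℂ))).sub (e4.const_mul (g.q : ℂ))).add e5

lemma one_div_w_sq_le : 1 / g.w ^ 2 ≤ 1 := by
  have := sq_nonneg g.κ
  rw [g.w_sq, div_le_one (by positivity)]
  linarith

lemma abs_κ_div_w_le : |g.κ / g.w| ≤ 1 := by
  rw [abs_div, div_le_one (abs_pos.2 g.w_ne)]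
  exact sq_le_sq.1 (by rw [g.w_sq]; linarith)

/-- There are five contributions: the second time difference with factor ε², the errors of the
central time quotient (τ²) and of the second space quotient (h²), the time averaging of the space
difference (τ²), and the mixed difference with factor ε. The O(ε) parts are the terms ε²∂ₜ²a and
ε∂ₜ∂_ξ a absent from the Schrödinger equation. -/
lemma norm_linRes_le (hb : JetFamily T M n b) {k : ℕ} (hk : k + 5 ≤ n) {t : ℝ}
    (ht : t - g.τ ∈ Icc 0 T) (ht' : t + g.τ ∈ Icc 0 T) {c d Γ ξ : ℝ} (hl : ξ - g.h ∈ Icc c d)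
    (hr : ξ + g.h ∈ Icc c d)
    (hΓ : ∀ i l, i + l ≤ k + 4 → ∀ t ∈ Icc 0 T, ∀ ξ ∈ Icc c d, ‖b i l t ξ‖ ≤ Γ) :
    ‖g.linRes b k t ξ‖ ≤ (4 + 2 * |g.w|) * (g.τ ^ 2 + g.h ^ 2 + g.ε) * Γ := by
  have hτ := g.τ_pos
  have hh := g.h_pos
  have hε := g.ε_pos
  have hwne := g.w_ne
  have ht0 : t ∈ Icc 0 T := ⟨by linarith [ht.1], by linarith [ht'.2]⟩
  have hξ : ξ ∈ Icc c d := ⟨by linarith [hl.1], by linarith [hr.2]⟩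
  have hΓ0 : 0 ≤ Γ := (norm_nonneg _).trans (hΓ 0 0 (by omega) t ht0 ξ hξ)
  have d1 := hb.norm_timeDiff2_le (k := k) (Γ := Γ) (by omega) hτ.le
    (fun t ht => hΓ 2 k (by omega) t ht ξ hξ) ht ht'
  have d2 := norm_central_sub_le (f := fun i s => b i k s ξ)
    (fun i hi s hs => hb.dt i k (by omega) s hs ξ) (fun s hs => hΓ 3 k (by omega) s hs ξ hξ) hτ ht ht'
  have d3 := norm_second_quot_sub_le (f := fun l x => b 0 (k + l) t x)
    (fun l hl x hx => (hb.dx 0 (k + l) (by omega) t ht0 x).hasDerivWithinAt)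
    (fun x hx => hΓ 0 (k + 4) (by omega) t ht0 x hx) hh hl hr
  have d4 := norm_second_diff_le (f := fun i s => b i k s (ξ + g.h) - 2 * b i k s ξ + b i k s (ξ - g.h))
    (p := 0) (q := T) (C := 2 * Γ * g.h ^ 2)
    (fun i hi s hs => ((hb.dt i k (by omega) s hs _).sub
      ((hb.dt i k (by omega) s hs ξ).const_mul 2)).add (hb.dt i k (by omega) s hs _))
    (fun s hs => norm_second_diff_le (f := fun l x => b 2 (k + l) s x)
      (fun l hl x hx => (hb.dx 2 (k + l) (by omega) s hs x).hasDerivWithinAt)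
      (fun x hx => hΓ 2 (k + 2) (by omega) s hs x hx) hh.le hl hr) hτ.le ht ht'
  have d5 := norm_sub_le_of_family (f := fun i s => b i k s (ξ + g.h) - b i k s (ξ - g.h))
    (p := 0) (q := T) (C := Γ * (2 * g.h)) (c := t - g.τ) (δ := 2 * g.τ)
    (fun s hs => (hb.dt 0 k (by omega) s hs _).sub (hb.dt 0 k (by omega) s hs _))
    (fun s hs => by
      have := norm_sub_le_of_family (f := fun l x => b 1 (k + l) s x) (p := c) (q := d)
        (C := Γ) (c := ξ - g.h) (δ := 2 * g.h)
        (fun x hx => (hb.dx 1 k (by omega) s hs x).hasDerivWithinAt)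
        (fun x hx => hΓ 1 (k + 1) (by omega) s hs x hx) (by positivity) hl
        (by rwa [show ξ - g.h + 2 * g.h = ξ + g.h by ring])
      rwa [show ξ - g.h + 2 * g.h = ξ + g.h by ring] at this) (by positivity) ht
    (by rwa [show t - g.τ + 2 * g.τ = t + g.τ by ring])
  rw [show t - g.τ + 2 * g.τ = t + g.τ by ring] at d5
  simp only [add_zero] at d3
  have hτc : (g.τ : ℂ) ≠ 0 := by exact_mod_cast hτ.ne'
  have hhc : (g.h : ℂ) ≠ 0 := by exact_mod_cast hh.ne'
  have hwc : (g.w : ℂ) ≠ 0 := by exact_mod_cast hwne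
  set X1 := b 0 k (t + g.τ) ξ - 2 * b 0 k t ξ + b 0 k (t - g.τ) ξ with hX1
  set X2 := (b 0 k (t + g.τ) ξ - b 0 k (t - g.τ) ξ) / (2 * g.τ) - b 1 k t ξ with hX2
  set X3 := (b 0 k t (ξ + g.h) - 2 * b 0 k t ξ + b 0 k t (ξ - g.h)) / (g.h : ℂ) ^ 2
    - b 0 (k + 2) t ξ with hX3
  set X4 := (b 0 k (t + g.τ) (ξ + g.h) - 2 * b 0 k (t + g.τ) ξ + b 0 k (t + g.τ) (ξ - g.h))
    - 2 * (b 0 k t (ξ + g.h) - 2 * b 0 k t ξ + b 0 k t (ξ - g.h))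
    + (b 0 k (t - g.τ) (ξ + g.h) - 2 * b 0 k (t - g.τ) ξ + b 0 k (t - g.τ) (ξ - g.h)) with hX4
  set X5 := b 0 k (t + g.τ) (ξ + g.h) - b 0 k (t + g.τ) (ξ - g.h)
    - (b 0 k (t - g.τ) (ξ + g.h) - b 0 k (t - g.τ) (ξ - g.h)) with hX5
  have hdecomp : g.linRes b k t ξ = (g.μ : ℂ) * X1 - (2 * Complex.I * g.w) * X2
      - ((1 / g.w ^ 2 : ℝ) : ℂ) * X3 - ((g.s * g.σ : ℝ) : ℂ) * X4 - (g.q : ℂ) * X5 := by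
    simp only [linRes, hX1, hX2, hX3, hX4, hX5, μ, s, q]
    push_cast
    field_simp
    ring
  have n1 : ‖(g.μ : ℂ) * X1‖ ≤ 2 * g.ε * Γ := by
    rw [norm_mul, Complex.norm_real, Real.norm_eq_abs, μ, abs_of_nonneg (by positivity)]
    calc g.ε ^ 2 / g.τ ^ 2 * ‖X1‖ ≤ g.ε ^ 2 / g.τ ^ 2 * (2 * Γ * g.τ ^ 2) := by gcongr
      _ = 2 * (g.ε * g.ε) * Γ := by field_simp
      _ ≤ 2 * (1 * g.ε) * Γ := by gcongr; exact g.ε_le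
      _ = _ := by ring
  have n2 : ‖(2 * Complex.I * g.w) * X2‖ ≤ 2 * |g.w| * g.τ ^ 2 * Γ := by
    rw [norm_mul, norm_mul, norm_mul, Complex.norm_real, Real.norm_eq_abs, Complex.norm_I,
      Complex.norm_two]
    calc 2 * 1 * |g.w| * ‖X2‖ ≤ 2 * 1 * |g.w| * (Γ * g.τ ^ 2) := by gcongr
      _ = _ := by ring
  have n3 : ‖((1 / g.w ^ 2 : ℝ) : ℂ) * X3‖ ≤ 2 * g.h ^ 2 * Γ := by
    rw [norm_mul, Complex.norm_real, Real.norm_eq_abs, abs_of_nonneg (by positivity)]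
    calc 1 / g.w ^ 2 * ‖X3‖ ≤ 1 * (2 * Γ * g.h ^ 2) := by
          gcongr
          exact one_div_w_sq_le
      _ = _ := by ring
  have n4 : ‖((g.s * g.σ : ℝ) : ℂ) * X4‖ ≤ 2 * g.τ ^ 2 * Γ := by
    have := g.σ_nonneg
    rw [norm_mul, Complex.norm_real, Real.norm_eq_abs, s, abs_of_nonneg (by positivity)]
    calc 1 / (g.w ^ 2 * g.h ^ 2) * g.σ * ‖X4‖
        ≤ 1 / (g.w ^ 2 * g.h ^ 2) * (1 / 2) * (2 * (2 * Γ * g.h ^ 2) * g.τ ^ 2) := by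
          gcongr
          exact g.σ_le
      _ = (1 / g.w ^ 2) * (2 * g.τ ^ 2 * Γ) := by field_simp
      _ ≤ 1 * (2 * g.τ ^ 2 * Γ) := by gcongr; exact one_div_w_sq_le
      _ = _ := one_mul _
  have n5 : ‖(g.q : ℂ) * X5‖ ≤ 2 * g.ε * Γ := by
    rw [norm_mul, Complex.norm_real, Real.norm_eq_abs]
    have hq : |g.q| = |g.κ / g.w| * (g.ε / (2 * g.τ * g.h)) := by
      have h1 : (0 : ℝ) ≤ g.ε / (2 * g.τ * g.h) := by positivity
      rw [q, ← abs_of_nonneg h1, ← abs_mul]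
      congr 1
      field_simp
    rw [hq]
    calc |g.κ / g.w| * (g.ε / (2 * g.τ * g.h)) * ‖X5‖
        ≤ 1 * (g.ε / (2 * g.τ * g.h)) * (Γ * (2 * g.h) * (2 * g.τ)) := by
          gcongr
          exact abs_κ_div_w_le
      _ = _ := by field_simp
  rw [hdecomp]
  refine (norm_sub_le _ _).trans ?_
  have m1 := norm_sub_le ((g.μ : ℂ) * X1 - (2 * Complex.I * g.w) * X2
      - ((1 / g.w ^ 2 : ℝ) : ℂ) * X3) (((g.s * g.σ : ℝ) : ℂ) * X4)
  have m2 := norm_sub_le ((g.μ : ℂ) * X1 - (2 * Complex.I * g.w) * X2) (((1 / g.w ^ 2 : ℝ) : ℂ) * X3)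
  have m3 := norm_sub_le ((g.μ : ℂ) * X1) ((2 * Complex.I * g.w) * X2)
  have hw0 := abs_nonneg g.w
  have p1 : 0 ≤ |g.w| * g.h ^ 2 * Γ := by positivity
  have p2 : 0 ≤ |g.w| * g.ε * Γ := by positivity
  have p3 : 0 ≤ g.τ ^ 2 * Γ := by positivity
  have p4 : 0 ≤ g.h ^ 2 * Γ := by positivity
  linarith

end Disc

end Consistency


/-! ### ℓ² norms from envelopes, and consistency of the starting step -/

section Consistency

open SeqSpace

lemma SeqSpace.norm_le_of_envelope {Γ : ℤ → ℝ} {h C₀ D : ℝ} (hh : 0 < h) (hD : 0 ≤ D) (hC₀ : 0 ≤ C₀)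
    (hΓ : ∀ F : Finset ℤ, h * ∑ j ∈ F, Γ j ^ 2 ≤ C₀) {f : ℤ → ℂ} (hf : ∀ j, ‖f j‖ ≤ D * Γ j) :
    ∃ x : SeqSpace, (∀ j, x j = f j) ∧ ‖x‖ ≤ D * (Real.sqrt C₀ / Real.sqrt h) := by
  refine exists_of_sum_le (by positivity) fun F => ?_
  rw [mul_pow, div_pow, Real.sq_sqrt hC₀, Real.sq_sqrt hh.le]
  calc ∑ j ∈ F, ‖f j‖ ^ 2 ≤ ∑ j ∈ F, (D * Γ j) ^ 2 :=
        Finset.sum_le_sum fun j _ => by gcongr; exact hf j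
    _ = D ^ 2 * ∑ j ∈ F, Γ j ^ 2 := by rw [Finset.mul_sum]; simp_rw [mul_pow]
    _ ≤ D ^ 2 * (C₀ / h) := by
        gcongr
        rw [le_div_iff₀ hh]
        linarith [hΓ F]

/-- The mean value inequality on a cell converts the derivative bound into one for the difference
quotient. The envelope provides the factor h^{-1/2}. -/
lemma SeqSpace.norm_le_of_boundedC1 {Γ : ℤ → ℝ} {x₀ h C₀ D : ℝ} (hh : 0 < h) (hD : 0 ≤ D)
    (hC₀ : 0 ≤ C₀) (hΓ : ∀ F : Finset ℤ, h * ∑ j ∈ F, Γ j ^ 2 ≤ C₀) {x : SeqSpace} {f : ℝ → ℂ}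
    (hx : ∀ j, x j = f (x₀ + j * h))
    (hf : ∀ j : ℤ, BoundedC1 (Icc (x₀ + j * h) (x₀ + j * h + h)) f (D * Γ j)) :
    ‖x‖ ≤ D * (Real.sqrt C₀ / Real.sqrt h) ∧ ‖fwd h x‖ ≤ D * (Real.sqrt C₀ / Real.sqrt h) := by
  constructor
  · obtain ⟨y, hy, hy'⟩ := norm_le_of_envelope hh hD hC₀ hΓ (f := x) (fun j => by
      obtain ⟨f', hf'⟩ := hf j
      rw [hx]
      exact (hf' _ ⟨le_rfl, by linarith⟩).2.1)
    rwa [ext_apply hy] at hy'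
  · obtain ⟨y, hy, hy'⟩ := norm_le_of_envelope hh hD hC₀ hΓ (f := fwd h x) (fun j => by
      rw [norm_fwd_apply hh, hx, hx]
      have := (hf j).norm_sub_le (by linarith)
      rw [add_sub_cancel_left] at this
      push_cast
      rw [show x₀ + ((j : ℝ) + 1) * h = x₀ + j * h + h by ring, one_div_mul_eq_div, div_le_iff₀ hh]
      exact this)
    rwa [ext_apply hy] at hy'

namespace Disc

variable {b : ℕ → ℕ → ℝ → ℝ → ℂ} {T M : ℝ} {n : ℕ} (g : Disc)

/-- The defect of the starting step for the `k`th derivative. -/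
noncomputable def startRes (b : ℕ → ℕ → ℝ → ℝ → ℂ) (k : ℕ) (ξ : ℝ) : ℂ :=
  2 * (g.μ - Complex.I * (g.w / g.τ : ℝ)) * (b 0 k g.τ ξ - b 0 k 0 ξ)
    - g.s * (b 0 k 0 (ξ + g.h) - 2 * b 0 k 0 ξ + b 0 k 0 (ξ - g.h))
    + (2 * Complex.I * (g.w : ℂ) * b 1 k 0 ξ + (1 / g.w ^ 2 : ℝ) * b 0 (k + 2) 0 ξ)

variable {g}

lemma hasDerivAt_startRes (hb : JetFamily T M n b) {k : ℕ} (hk : k + 3 ≤ n)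
    (ht' : g.τ ∈ Icc 0 T) (ξ : ℝ) : HasDerivAt (g.startRes b k) (g.startRes b (k + 1) ξ) ξ := by
  have ht0 : (0 : ℝ) ∈ Icc 0 T := ⟨le_rfl, ht'.1.trans ht'.2⟩
  have h0 : ∀ s ∈ Icc 0 T, HasDerivAt (b 0 k s) (b 0 (k + 1) s ξ) ξ := fun s hs =>
    hb.dx 0 k (by omega) s hs ξ
  have hp := (hb.dx 0 k (by omega) 0 ht0 (ξ + g.h)).comp_add_const ξ g.h
  have hm := (hb.dx 0 k (by omega) 0 ht0 (ξ - g.h)).comp_sub_const ξ g.h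
  have e5 := ((hb.dx 1 k (by omega) 0 ht0 ξ).const_mul (2 * Complex.I * (g.w : ℂ))).add
    ((hb.dx 0 (k + 2) (by omega) 0 ht0 ξ).const_mul ((1 / g.w ^ 2 : ℝ) : ℂ))
  exact ((((h0 _ ht').sub (h0 _ ht0)).const_mul (2 * (g.μ - Complex.I * (g.w / g.τ : ℝ)) : ℂ)).sub
    (((hp.sub ((h0 _ ht0).const_mul 2)).add hm).const_mul (g.s : ℂ))).add e5

/-- The starting step is of first order only, with the term ε²/τ coming from its factor 2ε²/τ. This
suffices: the starting error enters the final bound with weight 1/m, of order τ, which turns the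
defect into ε² + τ² + τh². -/
lemma norm_startRes_le (hb : JetFamily T M n b) {k : ℕ} (hk : k + 5 ≤ n)
    (ht' : g.τ ∈ Icc 0 T) {c d Γ ξ : ℝ} (hl : ξ - g.h ∈ Icc c d) (hr : ξ + g.h ∈ Icc c d)
    (hΓ : ∀ i l, i + l ≤ k + 4 → ∀ t ∈ Icc 0 T, ∀ ξ ∈ Icc c d, ‖b i l t ξ‖ ≤ Γ) :
    ‖g.startRes b k ξ‖ ≤ (2 + 2 * |g.w|) * (g.ε ^ 2 / g.τ + g.τ + g.h ^ 2) * Γ := by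
  have hτ := g.τ_pos
  have hh := g.h_pos
  have hε := g.ε_pos
  have hwne := g.w_ne
  have ht0 : (0 : ℝ) ∈ Icc 0 T := ⟨le_rfl, ht'.1.trans ht'.2⟩
  have hξ : ξ ∈ Icc c d := ⟨by linarith [hl.1], by linarith [hr.2]⟩
  have hΓ0 : 0 ≤ Γ := (norm_nonneg _).trans (hΓ 0 0 (by omega) 0 ht0 ξ hξ)
  have d1 := norm_sub_le_of_family (f := fun i s => b i k s ξ) (p := 0) (q := T) (C := Γ) (c := 0)
    (δ := g.τ) (fun s hs => hb.dt 0 k (by omega) s hs ξ)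
    (fun s hs => hΓ 1 k (by omega) s hs ξ hξ) hτ.le ht0 (by rwa [zero_add])
  have d2 := norm_forward_sub_le (f := fun i s => b i k s ξ) (p := 0) (q := T) (C := Γ) (c := 0)
    (δ := g.τ) (fun i hi s hs => hb.dt i k (by omega) s hs ξ)
    (fun s hs => hΓ 2 k (by omega) s hs ξ hξ) hτ ht0 (by rwa [zero_add])
  have d3 := norm_second_quot_sub_le (f := fun l x => b 0 (k + l) 0 x)
    (fun l hl x hx => (hb.dx 0 (k + l) (by omega) 0 ht0 x).hasDerivWithinAt)
    (fun x hx => hΓ 0 (k + 4) (by omega) 0 ht0 x hx) hh hl hr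
  simp only [zero_add] at d1 d2
  simp only [add_zero] at d3
  have hτc : (g.τ : ℂ) ≠ 0 := by exact_mod_cast hτ.ne'
  have hhc : (g.h : ℂ) ≠ 0 := by exact_mod_cast hh.ne'
  have hwc : (g.w : ℂ) ≠ 0 := by exact_mod_cast hwne
  set X1 := b 0 k g.τ ξ - b 0 k 0 ξ with hX1
  set X2 := X1 / g.τ - b 1 k 0 ξ with hX2
  set X3 := (b 0 k 0 (ξ + g.h) - 2 * b 0 k 0 ξ + b 0 k 0 (ξ - g.h)) / (g.h : ℂ) ^ 2
    - b 0 (k + 2) 0 ξ with hX3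
  have hdecomp : g.startRes b k ξ = ((2 * g.μ : ℝ) : ℂ) * X1 - (2 * Complex.I * g.w) * X2
      - ((1 / g.w ^ 2 : ℝ) : ℂ) * X3 := by
    simp only [startRes, hX1, hX2, hX3, μ, s]
    push_cast
    field_simp
    ring
  have n1 : ‖((2 * g.μ : ℝ) : ℂ) * X1‖ ≤ 2 * (g.ε ^ 2 / g.τ) * Γ := by
    rw [norm_mul, Complex.norm_real, Real.norm_eq_abs, μ, abs_of_nonneg (by positivity)]
    calc 2 * (g.ε ^ 2 / g.τ ^ 2) * ‖X1‖ ≤ 2 * (g.ε ^ 2 / g.τ ^ 2) * (Γ * g.τ) := by gcongr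
      _ = _ := by field_simp
  have n2 : ‖(2 * Complex.I * g.w) * X2‖ ≤ 2 * |g.w| * g.τ * Γ := by
    rw [norm_mul, norm_mul, norm_mul, Complex.norm_real, Real.norm_eq_abs, Complex.norm_I,
      Complex.norm_two]
    calc 2 * 1 * |g.w| * ‖X2‖ ≤ 2 * 1 * |g.w| * (Γ * g.τ) := by gcongr
      _ = _ := by ring
  have n3 : ‖((1 / g.w ^ 2 : ℝ) : ℂ) * X3‖ ≤ 2 * g.h ^ 2 * Γ := by
    rw [norm_mul, Complex.norm_real, Real.norm_eq_abs, abs_of_nonneg (by positivity)]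
    calc 1 / g.w ^ 2 * ‖X3‖ ≤ 1 * (2 * Γ * g.h ^ 2) := by
          gcongr
          exact one_div_w_sq_le
      _ = _ := by ring
  rw [hdecomp]
  refine (norm_sub_le _ _).trans ?_
  have m3 := norm_sub_le (((2 * g.μ : ℝ) : ℂ) * X1) ((2 * Complex.I * g.w) * X2)
  have hw0 := abs_nonneg g.w
  have p1 : 0 ≤ |g.w| * g.h ^ 2 * Γ := by positivity
  have p2 : 0 ≤ |g.w| * (g.ε ^ 2 / g.τ) * Γ := by positivity
  have p3 : 0 ≤ g.τ * Γ := by positivity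
  linarith

lemma one_le_abs_w : 1 ≤ |g.w| := by
  have h := g.w_sq
  rw [← sq_abs] at h
  nlinarith [sq_nonneg g.κ, abs_nonneg g.w]

/-- The leading coefficient of the starting step. -/
noncomputable def startCoeff (g : Disc) : ℂ := g.μ - Complex.I * (g.w / g.τ : ℝ)

lemma abs_w_div_τ_le : |g.w| / g.τ ≤ ‖g.startCoeff‖ := by
  have h := Complex.abs_im_le_norm g.startCoeff
  have h2 : g.startCoeff.im = -(g.w / g.τ) := by simp [startCoeff, Complex.mul_im]
  rwa [h2, abs_neg, abs_div, abs_of_pos g.τ_pos] at h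

lemma startCoeff_ne_zero : g.startCoeff ≠ 0 := by
  have h : 0 < |g.w| / g.τ := div_pos (abs_pos.2 g.w_ne) g.τ_pos
  rw [← norm_pos_iff]
  exact h.trans_le abs_w_div_τ_le

/-- The imaginary part w/τ of the coefficient already gives the lower bound, uniformly in ε. -/
lemma norm_inv_startCoeff_le : ‖1 / (2 * g.startCoeff)‖ ≤ g.τ / 2 := by
  have hτ := g.τ_pos
  rw [norm_div, norm_one, norm_mul, Complex.norm_two]
  have h1 : 1 / g.τ ≤ ‖g.startCoeff‖ := by
    refine le_trans ?_ (abs_w_div_τ_le (g := g))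
    gcongr
    exact one_le_abs_w
  have h2 : 0 < 1 / g.τ := by positivity
  calc 1 / (2 * ‖g.startCoeff‖) ≤ 1 / (2 * (1 / g.τ)) := by gcongr
    _ = g.τ / 2 := by field_simp

/-- The image of the error of the starting step under the implicit operator. -/
lemma boundedC1_start (hb : JetFamily T M n b) (hn : 8 ≤ n)
    (ht' : g.τ ∈ Icc 0 T) {c d Γ p : ℝ} (hl : c ≤ p - 2 * g.h) (hr : p + 3 * g.h ≤ d)
    (hΓ : ∀ i l, i + l ≤ 7 → ∀ t ∈ Icc 0 T, ∀ ξ ∈ Icc c d, ‖b i l t ξ‖ ≤ Γ) :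
    BoundedC1 (Icc p (p + g.h)) (fun ξ => -(1 / 2) * g.startRes b 0 ξ + 1 / (2 * g.startCoeff)
      * (((g.σ * g.s : ℝ) : ℂ) * (g.startRes b 0 (ξ + g.h) - 2 * g.startRes b 0 ξ
          + g.startRes b 0 (ξ - g.h))
        + (g.q : ℂ) * (g.startRes b 0 (ξ + g.h) - g.startRes b 0 (ξ - g.h))))
      ((1 + g.τ) * ((2 + 2 * |g.w|) * (g.ε ^ 2 / g.τ + g.τ + g.h ^ 2) * Γ)) := by
  have hτ := g.τ_pos
  have hh := g.h_pos
  have hε := g.ε_pos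
  set B := (2 + 2 * |g.w|) * (g.ε ^ 2 / g.τ + g.τ + g.h ^ 2) * Γ with hB
  -- A second difference costs two derivatives of the defect and the C¹ bound one more. Order k of
  -- the defect uses jets of order k + 4, hence the order 7 in the hypothesis.
  have hbd : ∀ k ≤ 3, ∀ ξ ∈ Icc (p - g.h) (p + 2 * g.h), ‖g.startRes b k ξ‖ ≤ B := fun k hk ξ hξ =>
    norm_startRes_le hb (by omega) ht' (c := c) (d := d) ⟨by linarith [hξ.1], by linarith [hξ.2]⟩
      ⟨by linarith [hξ.1], by linarith [hξ.2]⟩ (fun i l hil => hΓ i l (by omega))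
  have hB0 : 0 ≤ B := (norm_nonneg _).trans (hbd 0 (by omega) p ⟨by linarith, by linarith⟩)
  have key : ∀ k ≤ 1, ∀ ξ ∈ Icc p (p + g.h),
      ‖-(1 / 2) * g.startRes b k ξ + 1 / (2 * g.startCoeff)
      * (((g.σ * g.s : ℝ) : ℂ) * (g.startRes b k (ξ + g.h) - 2 * g.startRes b k ξ
          + g.startRes b k (ξ - g.h))
        + (g.q : ℂ) * (g.startRes b k (ξ + g.h) - g.startRes b k (ξ - g.h)))‖ ≤ (1 + g.τ) * B := by
    intro k hk ξ hξ
    have hl' : ξ - g.h ∈ Icc (p - g.h) (p + 2 * g.h) := ⟨by linarith [hξ.1], by linarith [hξ.2]⟩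
    have hr' : ξ + g.h ∈ Icc (p - g.h) (p + 2 * g.h) := ⟨by linarith [hξ.1], by linarith [hξ.2]⟩
    have d1 := norm_second_diff_le (f := fun i x => g.startRes b (k + i) x)
      (fun i hi x _ => (hasDerivAt_startRes hb (k := k + i) (by omega) ht' x).hasDerivWithinAt)
      (fun x hx => hbd (k + 2) (by omega) x hx) hh.le hl' hr'
    have d2 := norm_sub_le_of_family (f := fun i x => g.startRes b (k + i) x) (δ := 2 * g.h)
      (fun x _ => (hasDerivAt_startRes hb (k := k) (by omega) ht' x).hasDerivWithinAt)
      (fun x hx => hbd (k + 1) (by omega) x hx) (by positivity) hl'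
      (by rwa [show ξ - g.h + 2 * g.h = ξ + g.h by ring])
    rw [show ξ - g.h + 2 * g.h = ξ + g.h by ring] at d2
    simp only [add_zero] at d1 d2
    have d3 := hbd k (by omega) ξ ⟨by linarith [hξ.1], by linarith [hξ.2]⟩
    have n1 : ‖((g.σ * g.s : ℝ) : ℂ) * (g.startRes b k (ξ + g.h) - 2 * g.startRes b k ξ
        + g.startRes b k (ξ - g.h))‖ ≤ B := by
      have := g.σ_nonneg
      have := g.w_ne
      rw [norm_mul, Complex.norm_real, Real.norm_eq_abs, s, abs_of_nonneg (by positivity)]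
      calc _ ≤ 1 / 2 * (1 / (g.w ^ 2 * g.h ^ 2)) * (2 * B * g.h ^ 2) := by
            gcongr
            exact g.σ_le
        _ = (1 / g.w ^ 2) * B := by field_simp
        _ ≤ 1 * B := by gcongr; exact one_div_w_sq_le
        _ = B := one_mul B
    -- The coefficient q is of order 1/(τh). The difference supplies h, and the remaining 1/τ is
    -- absorbed by the inverse of the starting coefficient.
    have n2 : ‖(g.q : ℂ) * (g.startRes b k (ξ + g.h) - g.startRes b k (ξ - g.h))‖
        ≤ B / g.τ := by
      rw [norm_mul, Complex.norm_real, Real.norm_eq_abs]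
      have hq : |g.q| = |g.κ / g.w| * (g.ε / (2 * g.τ * g.h)) := by
        have h1 : (0 : ℝ) ≤ g.ε / (2 * g.τ * g.h) := by positivity
        rw [q, ← abs_of_nonneg h1, ← abs_mul]
        congr 1
        field_simp
      rw [hq]
      calc _ ≤ 1 * (1 / (2 * g.τ * g.h)) * (B * (2 * g.h)) := by
            gcongr
            · exact abs_κ_div_w_le
            · exact g.ε_le
        _ = B / g.τ := by field_simp
    refine (norm_add_le _ _).trans ?_
    rw [norm_mul, norm_mul]
    have n3 := (norm_add_le (((g.σ * g.s : ℝ) : ℂ) * (g.startRes b k (ξ + g.h)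
      - 2 * g.startRes b k ξ + g.startRes b k (ξ - g.h))) ((g.q : ℂ) * (g.startRes b k (ξ + g.h)
      - g.startRes b k (ξ - g.h)))).trans (add_le_add n1 n2)
    calc _ ≤ 1 / 2 * B + g.τ / 2 * (B + B / g.τ) := by
          gcongr
          · norm_num
          · exact norm_inv_startCoeff_le
      _ = (1 + g.τ / 2) * B := by field_simp; ring
      _ ≤ (1 + g.τ) * B := by gcongr; linarith
  refine ⟨fun ξ => -(1 / 2) * g.startRes b 1 ξ + 1 / (2 * g.startCoeff)
      * (((g.σ * g.s : ℝ) : ℂ) * (g.startRes b 1 (ξ + g.h) - 2 * g.startRes b 1 ξ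
          + g.startRes b 1 (ξ - g.h))
        + (g.q : ℂ) * (g.startRes b 1 (ξ + g.h) - g.startRes b 1 (ξ - g.h))),
    fun ξ hξ => ⟨?_, key 0 (by omega) ξ hξ, key 1 le_rfl ξ hξ⟩⟩
  have h0 := hasDerivAt_startRes hb (k := 0) (by omega) ht' ξ
  have hp := (hasDerivAt_startRes hb (k := 0) (by omega) ht' (ξ + g.h)).comp_add_const ξ g.h
  have hm := (hasDerivAt_startRes hb (k := 0) (by omega) ht' (ξ - g.h)).comp_sub_const ξ g.h
  exact (h0.const_mul (-(1 / 2) : ℂ)).add (((((hp.sub (h0.const_mul 2)).add hm).const_mul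
    ((g.σ * g.s : ℝ) : ℂ)).add ((hp.sub hm).const_mul (g.q : ℂ))).const_mul
      (1 / (2 * g.startCoeff)))

lemma A_apply (x : SeqSpace) (j : ℤ) : g.A x j = g.startCoeff * x j
    - ((g.σ * g.s : ℝ) : ℂ) * (x (j + 1) - 2 * x j + x (j - 1))
    - (g.q : ℂ) * (x (j + 1) - x (j - 1)) := by
  rw [A, tri_apply, startCoeff]
  push_cast
  ring

end Disc

end Consistency


/-! ### The exact amplitude as an approximate solution -/

section Consistency

open SeqSpace

namespace Disc

variable {g : Disc} {κ lam w T M R : ℝ} {N : ℕ} {a₀ b₀ : ℝ → ℂ} {a : ℝ → ℝ → ℂ}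

lemma tril_self (y : ℂ) : cubic.tril y y y = ((‖y‖ ^ 2 : ℝ) : ℂ) * y := by
  rw [cubic.tril, Complex.mul_conj, Complex.normSq_eq_norm_sq]

lemma stripJet_eqn' (hT : 0 < T) (ha : HasBoundedDerivs N M T a) (hN : 2 ≤ N)
    (hs : IsNLSSolution g.κ lam g.w T a₀ b₀ a) {t : ℝ} (ht : t ∈ Icc 0 T) (ξ : ℝ) :
    2 * Complex.I * (g.w : ℂ) * stripJet T a 1 0 t ξ + ((1 / g.w ^ 2 : ℝ) : ℂ) * stripJet T a 0 2 t ξ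
      = (lam : ℂ) * cubic.tril (a t ξ) (a t ξ) (a t ξ) := by
  rw [stripJet_eqn hT ha hN hs ht ξ, tril_self, g.one_sub_groupVel_sq]
  ring

/-- The defect of the exact amplitude in the scheme. -/
lemma boundedC1_resid (hT : 0 < T) (ha : HasBoundedDerivs N M T a) (hN : 8 ≤ N)
    {t : ℝ} (ht : t - g.τ ∈ Icc 0 T) (ht' : t + g.τ ∈ Icc 0 T) {c d Γ p : ℝ} (hl : c ≤ p - g.h)
    (hr : p + 2 * g.h ≤ d)
    (hΓ : ∀ i l, i + l ≤ 7 → ∀ t ∈ Icc 0 T, ∀ ξ ∈ Icc c d, ‖stripJet T a i l t ξ‖ ≤ Γ) :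
    BoundedC1 (Icc p (p + g.h)) (fun ξ => g.linRes (stripJet T a) 0 t ξ
      + (lam : ℂ) * (cubic g.σ (a (t + g.τ) ξ) (a t ξ) (a (t - g.τ) ξ)
        - cubic.tril (a t ξ) (a t ξ) (a t ξ)))
      ((4 + 2 * |g.w| + 12 * |lam| * M ^ 2) * (g.τ ^ 2 + g.h ^ 2 + g.ε) * Γ) := by
  have hb := jetFamily_stripJet hT ha
  have hτ := g.τ_pos
  have hh := g.h_pos
  have hε := g.ε_pos
  have ht0 : t ∈ Icc 0 T := ⟨by linarith [ht.1], by linarith [ht'.2]⟩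
  have hsub : Icc p (p + g.h) ⊆ Icc c d := Icc_subset_Icc (by linarith) (by linarith)
  have hΓ0 : 0 ≤ Γ := (norm_nonneg _).trans (hΓ 0 0 (by omega) t ht0 p ⟨by linarith, by linarith⟩)
  have h1 : BoundedC1 (Icc p (p + g.h)) (g.linRes (stripJet T a) 0 t)
      ((4 + 2 * |g.w|) * (g.τ ^ 2 + g.h ^ 2 + g.ε) * Γ) := by
    have hbd : ∀ k ≤ 1, ∀ ξ ∈ Icc p (p + g.h), ‖g.linRes (stripJet T a) k t ξ‖
        ≤ (4 + 2 * |g.w|) * (g.τ ^ 2 + g.h ^ 2 + g.ε) * Γ := fun k hk ξ hξ =>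
      norm_linRes_le hb (by omega) ht ht' (c := c) (d := d)
        ⟨by linarith [hξ.1], by linarith [hξ.2]⟩ ⟨by linarith [hξ.1], by linarith [hξ.2]⟩
        (fun i l hil => hΓ i l (by omega))
    exact ⟨g.linRes (stripJet T a) 1 t, fun ξ hξ =>
      ⟨hasDerivAt_linRes hb (by omega) ht ht' ξ, hbd 0 (by omega) ξ hξ, hbd 1 le_rfl ξ hξ⟩⟩
  have h2 := (hb.boundedC1_cubic (c := p) (d := p + g.h) (Γ := Γ) (by omega) g.σ_nonneg g.σ_le hτ.le
    (fun i k hik t ht ξ hξ => hΓ i k (by omega) t ht ξ (hsub hξ)) hΓ0 ht ht').const_mul (lam : ℂ)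
  refine (h1.add h2).mono ?_
  rw [Complex.norm_real, Real.norm_eq_abs]
  have p1 : 0 ≤ |lam| * M ^ 2 * g.h ^ 2 * Γ := by positivity
  have p2 : 0 ≤ |lam| * M ^ 2 * g.ε * Γ := by positivity
  linarith

lemma stepFn_exact (hT : 0 < T) (ha : HasBoundedDerivs N M T a) (hN : 8 ≤ N)
    (hs : IsNLSSolution g.κ lam g.w T a₀ b₀ a) {t x₀ : ℝ} (ht : t ∈ Icc 0 T) {x y z : ℤ → ℂ}
    (hx : ∀ j : ℤ, x j = a (t + g.τ) (x₀ + j * g.h)) (hy : ∀ j : ℤ, y j = a t (x₀ + j * g.h))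
    (hz : ∀ j : ℤ, z j = a (t - g.τ) (x₀ + j * g.h)) (j : ℤ) :
    g.stepFn lam x y z j = g.linRes (stripJet T a) 0 t (x₀ + j * g.h)
      + (lam : ℂ) * (cubic g.σ (a (t + g.τ) (x₀ + j * g.h)) (a t (x₀ + j * g.h))
          (a (t - g.τ) (x₀ + j * g.h))
        - cubic.tril (a t (x₀ + j * g.h)) (a t (x₀ + j * g.h)) (a t (x₀ + j * g.h))) := by
  have h1 := stripJet_eqn' hT ha (by omega) hs ht (x₀ + j * g.h)
  rw [stepFn, linRes, zero_add, h1]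
  simp only [hx, hy, hz, stripJet_zero]
  push_cast
  rw [show x₀ + ((j : ℝ) + 1) * g.h = x₀ + j * g.h + g.h by ring,
    show x₀ + ((j : ℝ) - 1) * g.h = x₀ + j * g.h - g.h by ring]
  ring

lemma startFn_exact (hT : 0 < T) (ha : HasBoundedDerivs N M T a) (hN : 8 ≤ N)
    (hs : IsNLSSolution g.κ lam g.w T a₀ b₀ a) {x₀ : ℝ} {x y : ℤ → ℂ}
    (hx : ∀ j : ℤ, x j = a g.τ (x₀ + j * g.h)) (hy : ∀ j : ℤ, y j = a 0 (x₀ + j * g.h)) (j : ℤ) :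
    g.startFn lam y x j = g.startRes (stripJet T a) 0 (x₀ + j * g.h) := by
  have h1 := stripJet_eqn' hT ha (by omega) hs ⟨le_rfl, hT.le⟩ (x₀ + j * g.h)
  rw [startFn, startRes, zero_add, h1, tril_self]
  simp only [hx, hy, stripJet_zero]
  push_cast
  rw [show x₀ + ((j : ℝ) + 1) * g.h = x₀ + j * g.h + g.h by ring,
    show x₀ + ((j : ℝ) - 1) * g.h = x₀ + j * g.h - g.h by ring]
  ring

end Disc

/-- The exact amplitude is an approximate solution of the scheme, and the starting step is
consistent. -/
theorem exists_approx (κ lam w T M R : ℝ) (hw : w ≠ 0) (hT : 0 < T) :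
    ∃ C : ℝ, 0 ≤ C ∧ ∀ (a₀ b₀ : ℝ → ℂ) (a : ℝ → ℝ → ℂ), Function.support a₀ ⊆ Icc (-R) R →
      Function.support b₀ ⊆ Icc (-R) R → IsNLSSolution κ lam w T a₀ b₀ a →
      HasBoundedDerivs 20 M T a → ∀ g : Disc, g.κ = κ → g.w = w → g.h ≤ 1 → ∀ (x₀ : ℝ) (N : ℕ),
      N * g.τ ≤ T → ∃ s : ℕ → SeqSpace, (∀ n ≤ N, ∀ j : ℤ, s n j = a (n * g.τ) (x₀ + j * g.h)) ∧
        g.Approx lam M (C * (g.τ ^ 2 + g.h ^ 2 + g.ε) / Real.sqrt g.h) N s ∧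
        (1 ≤ N → ∀ u₁ : SeqSpace, (∀ j, g.startFn lam (s 0) u₁ j = 0) →
          g.τ * g.energy₁ (u₁ - s 1) 0 ≤ C * (g.τ ^ 2 + g.h ^ 2 + g.ε) / Real.sqrt g.h) := by
  -- The defects need an envelope for jets of order 7, the two Sobolev inequalities raise this to 9,
  -- and the energy bound at order 9 asks for 2 · 9 + 2 = 20 derivatives.
  obtain ⟨E, hE⟩ := exists_integral_density_le κ lam w T M R hw hT 9 20 (by norm_num)
  set C₀ : ℝ := 21 * (1 + 2 * T) * |E| with hC₀
  have hC₀0 : 0 ≤ C₀ := by positivity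
  set D₁ : ℝ := 4 + 2 * |w| + 12 * |lam| * M ^ 2 with hD₁
  set D₂ : ℝ := 2 * ((1 + T) ^ 2 * (2 + 2 * |w|)) with hD₂
  have hD₁0 : 0 ≤ D₁ := by positivity
  have hD₂0 : 0 ≤ D₂ := by positivity
  refine ⟨(D₁ + D₂) * Real.sqrt C₀, by positivity, ?_⟩
  intro a₀ b₀ a ha₀ hb₀ hs ha g hgκ hgw hh1 x₀ N hN
  subst hgκ hgw
  have hτ := g.τ_pos
  have hh := g.h_pos
  have hε := g.ε_pos
  have hb := jetFamily_stripJet hT ha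
  obtain ⟨Γ, hΓ0, hΓs, hΓ⟩ := hb.exists_envelope hT (m := 7) (by norm_num) (E := |E|)
    (fun t ht c d hcd => (hE a₀ b₀ a ha₀ hb₀ hs ha t ht c d hcd).trans (le_abs_self E)) x₀ hh hh1
  have hM : 0 ≤ M := hb.nonneg_bound hT.le
  have hmem : ∀ n ≤ N, (n : ℝ) * g.τ ∈ Icc 0 T := fun n hn => by
    have : (n : ℝ) ≤ N := by exact_mod_cast hn
    exact ⟨by positivity, by nlinarith⟩
  have hseq : ∀ n : ℕ, ∃ x : SeqSpace, n ≤ N → ∀ j : ℤ, x j = a (n * g.τ) (x₀ + j * g.h) := by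
    intro n
    by_cases hn : n ≤ N
    · obtain ⟨x, hx, -⟩ := norm_le_of_envelope hh zero_le_one hC₀0 hΓs
        (f := fun j => a (n * g.τ) (x₀ + j * g.h)) (fun j => by
          rw [one_mul]
          exact hΓ 0 0 (by omega) _ (hmem n hn) j _ ⟨by nlinarith, by nlinarith⟩)
      exact ⟨x, fun _ => hx⟩
    · exact ⟨0, fun h => absurd h hn⟩
  choose s hs' using hseq
  have hδ : 0 ≤ g.τ ^ 2 + g.h ^ 2 + g.ε := by positivity
  have hsqrt : 0 < Real.sqrt g.h := Real.sqrt_pos.2 hh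
  have hη : D₁ * (g.τ ^ 2 + g.h ^ 2 + g.ε) * (Real.sqrt C₀ / Real.sqrt g.h)
      ≤ (D₁ + D₂) * Real.sqrt C₀ * (g.τ ^ 2 + g.h ^ 2 + g.ε) / Real.sqrt g.h := by
    rw [mul_div_assoc', div_le_div_iff_of_pos_right hsqrt]
    have : 0 ≤ D₂ * Real.sqrt C₀ * (g.τ ^ 2 + g.h ^ 2 + g.ε) := by positivity
    linarith
  have hres : ∀ k, k + 2 ≤ N →
      ‖g.resid lam (s (k + 2)) (s (k + 1)) (s k)‖
        ≤ D₁ * (g.τ ^ 2 + g.h ^ 2 + g.ε) * (Real.sqrt C₀ / Real.sqrt g.h) ∧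
      ‖fwd g.h (g.resid lam (s (k + 2)) (s (k + 1)) (s k))‖
        ≤ D₁ * (g.τ ^ 2 + g.h ^ 2 + g.ε) * (Real.sqrt C₀ / Real.sqrt g.h) := by
    intro k hk
    have e1 : ((k + 1 : ℕ) : ℝ) * g.τ - g.τ = k * g.τ := by push_cast; ring
    have e2 : ((k + 1 : ℕ) : ℝ) * g.τ + g.τ = (k + 2 : ℕ) * g.τ := by push_cast; ring
    refine norm_le_of_boundedC1 hh (by positivity) hC₀0 hΓs (x₀ := x₀)
      (f := fun ξ => g.linRes (stripJet T a) 0 ((k + 1 : ℕ) * g.τ) ξ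
        + (lam : ℂ) * (cubic g.σ (a ((k + 1 : ℕ) * g.τ + g.τ) ξ) (a ((k + 1 : ℕ) * g.τ) ξ)
          (a ((k + 1 : ℕ) * g.τ - g.τ) ξ) - cubic.tril (a ((k + 1 : ℕ) * g.τ) ξ)
            (a ((k + 1 : ℕ) * g.τ) ξ) (a ((k + 1 : ℕ) * g.τ) ξ))) ?_ ?_
    · intro j
      rw [Disc.resid, ← g.stepFn_eq]
      refine Disc.stepFn_exact hT ha (by norm_num) hs (hmem (k + 1) (by omega)) ?_ ?_ ?_ j
      · intro j; rw [e2]; exact hs' _ hk j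
      · exact hs' _ (by omega)
      · intro j; rw [e1]; exact hs' _ (by omega) j
    · intro j
      exact Disc.boundedC1_resid hT ha (by norm_num) (by rw [e1]; exact hmem k (by omega))
        (by rw [e2]; exact hmem _ hk) (c := x₀ + (j - 5) * g.h) (d := x₀ + (j + 5) * g.h)
        (by nlinarith) (by nlinarith) (fun i l hil t ht ξ hξ => hΓ i l hil t ht j ξ hξ)
  refine ⟨s, fun n hn => hs' n hn, ⟨?_, ?_, fun k hk => (hres k hk).1.trans hη,
    fun k hk => (hres k hk).2.trans hη⟩, ?_⟩
  · intro n hn j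
    rw [hs' n hn]
    exact hb.bound 0 0 (by omega) _ (hmem n hn) _
  · intro n hn j
    rw [hs' n hn, hs' n hn]
    have := norm_sub_le_of_family (f := fun l x => stripJet T a 0 l (n * g.τ) x)
      (p := x₀ + j * g.h) (q := x₀ + j * g.h + g.h) (C := M) (c := x₀ + j * g.h) (δ := g.h)
      (fun x _ => (hb.dx 0 0 (by omega) _ (hmem n hn) x).hasDerivWithinAt)
      (fun x _ => hb.bound 0 1 (by omega) _ (hmem n hn) x) hh.le ⟨le_rfl, by linarith⟩
      ⟨by linarith, le_rfl⟩
    push_cast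
    rw [show x₀ + ((j : ℝ) + 1) * g.h = x₀ + j * g.h + g.h by ring]
    exact this
  · intro hN1 u₁ hu₁
    have hτT : g.τ ∈ Icc 0 T := by simpa using hmem 1 hN1
    have hs0 : ∀ j : ℤ, s 0 j = a 0 (x₀ + j * g.h) := fun j => by simpa using hs' 0 (by omega) j
    have hs1 : ∀ j : ℤ, s 1 j = a g.τ (x₀ + j * g.h) := fun j => by simpa using hs' 1 hN1 j
    set r : ℝ → ℂ := g.startRes (stripJet T a) 0 with hr
    have hz := Disc.startCoeff_ne_zero (g := g)
    -- The starting step is diagonal in the new level and both sequences share level 0, so their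
    -- difference is a multiple of the defect. Applying A to it yields the function treated in
    -- `boundedC1_start`.
    have he : ∀ j : ℤ, (u₁ - s 1) j = -(1 / (2 * g.startCoeff)) * r (x₀ + j * g.h) := by
      intro j
      have h1 := Disc.startFn_exact hT ha (by norm_num) hs hs1 hs0 j
      have h2 := hu₁ j
      rw [← hr] at h1
      rw [sub_apply, ← h1, Disc.startFn]
      rw [Disc.startFn] at h2
      have h3 : (g.μ - Complex.I * (g.w / g.τ : ℝ) : ℂ) = g.startCoeff := rfl
      rw [h3] at h2 ⊢
      field_simp
      linear_combination h2
    obtain ⟨h1, h2⟩ := norm_le_of_boundedC1 hh (by positivity) hC₀0 hΓs (x₀ := x₀)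
      (x := g.A (u₁ - s 1)) (D := (1 + g.τ) * ((2 + 2 * |g.w|) * (g.ε ^ 2 / g.τ + g.τ + g.h ^ 2)))
      (f := fun ξ => -(1 / 2) * r ξ + 1 / (2 * g.startCoeff)
      * (((g.σ * g.s : ℝ) : ℂ) * (r (ξ + g.h) - 2 * r ξ + r (ξ - g.h))
        + (g.q : ℂ) * (r (ξ + g.h) - r (ξ - g.h)))) (fun j => by
          rw [Disc.A_apply, he, he, he]
          push_cast
          rw [show x₀ + ((j : ℝ) + 1) * g.h = x₀ + j * g.h + g.h by ring,
            show x₀ + ((j : ℝ) - 1) * g.h = x₀ + j * g.h - g.h by ring]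
          field_simp
          ring) (fun j => (Disc.boundedC1_start hb (by norm_num) hτT
            (c := x₀ + (j - 5) * g.h) (d := x₀ + (j + 5) * g.h) (by nlinarith) (by nlinarith)
            (fun i l hil t ht ξ hξ => hΓ i l hil t ht j ξ hξ)).mono (le_of_eq (by ring)))
    have h3 : g.energy₁ (u₁ - s 1) 0 = ‖g.A (u₁ - s 1)‖ + ‖fwd g.h (g.A (u₁ - s 1))‖ := by
      rw [Disc.energy₁, Disc.energy, Disc.energy, map_zero, TwoStepOps.energy_zero_right,
        TwoStepOps.energy_zero_right, Disc.fwd_A]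
    rw [h3]
    set Q := Real.sqrt C₀ / Real.sqrt g.h with hQ
    have hQ0 : 0 ≤ Q := by positivity
    -- Multiplication by τ removes the singular term ε²/τ of the starting defect.
    have h4 : g.τ * (g.ε ^ 2 / g.τ + g.τ + g.h ^ 2) ≤ (1 + T) * (g.τ ^ 2 + g.h ^ 2 + g.ε) := by
      have e1 : g.τ * (g.ε ^ 2 / g.τ + g.τ + g.h ^ 2) = g.ε ^ 2 + g.τ ^ 2 + g.τ * g.h ^ 2 := by
        field_simp
      have e2 : g.ε ^ 2 ≤ g.ε := by nlinarith [g.ε_le]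
      have e3 : g.τ * g.h ^ 2 ≤ T * g.h ^ 2 := by have := hτT.2; gcongr
      have e4 : 0 ≤ T * (g.τ ^ 2 + g.ε) := by positivity
      rw [e1]
      linarith [sq_nonneg g.h]
    have h5 : (1 + g.τ) ≤ 1 + T := by linarith [hτT.2]
    calc g.τ * (‖g.A (u₁ - s 1)‖ + ‖fwd g.h (g.A (u₁ - s 1))‖)
        ≤ g.τ * ((1 + g.τ) * ((2 + 2 * |g.w|) * (g.ε ^ 2 / g.τ + g.τ + g.h ^ 2)) * Q
          + (1 + g.τ) * ((2 + 2 * |g.w|) * (g.ε ^ 2 / g.τ + g.τ + g.h ^ 2)) * Q) := by gcongr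
      _ = 2 * ((1 + g.τ) * (2 + 2 * |g.w|) * (g.τ * (g.ε ^ 2 / g.τ + g.τ + g.h ^ 2)) * Q) := by ring
      _ ≤ 2 * ((1 + T) * (2 + 2 * |g.w|) * ((1 + T) * (g.τ ^ 2 + g.h ^ 2 + g.ε)) * Q) := by gcongr
      _ = D₂ * (g.τ ^ 2 + g.h ^ 2 + g.ε) * Q := by rw [hD₂]; ring
      _ ≤ (D₁ + D₂) * (g.τ ^ 2 + g.h ^ 2 + g.ε) * Q := by
          have : 0 ≤ D₁ * (g.τ ^ 2 + g.h ^ 2 + g.ε) * Q := by positivity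
          linarith
      _ = _ := by rw [hQ]; ring

end Consistency


/-! ### Bounded solutions are square summable -/

section Membership

open SeqSpace

namespace Disc

variable {g : Disc} {lam : ℝ}

/-- The implicit operator on arbitrary grid functions. -/
noncomputable def opFn (g : Disc) (x : ℤ → ℂ) (j : ℤ) : ℂ := g.startCoeff * x j
    - ((g.σ * g.s : ℝ) : ℂ) * (x (j + 1) - 2 * x j + x (j - 1))
    - (g.q : ℂ) * (x (j + 1) - x (j - 1))

lemma A_apply_eq (x : SeqSpace) (j : ℤ) : g.A x j = g.opFn x j := A_apply x j

lemma stepFn_eq_opFn (x : ℤ → ℂ) (y z : SeqSpace) (j : ℤ) : g.stepFn lam x y z j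
    = g.opFn x j - g.b y j + g.A' z j + (lam : ℂ) * cubic g.σ (x j) (y j) (z j) := by
  simp only [A', b, tri_apply, stepFn, opFn, startCoeff]
  push_cast
  ring

/-- A bounded grid function whose image under the implicit operator is square summable is
square summable. -/
lemma exists_seq_of_bounded (hg : g.CFL) {x : ℤ → ℂ} {B θ : ℝ} (f : SeqSpace)
    (hB : ∀ j, ‖x j‖ ≤ B) (hθ0 : 0 ≤ θ) (hθ : θ < g.m)
    (hA : ∀ j, ‖g.opFn x j‖ ≤ θ * ‖x j‖ + ‖f j‖) : ∃ x' : SeqSpace, ∀ j, x' j = x j := by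
  have hB0 : 0 ≤ B := (norm_nonneg _).trans (hB 0)
  set D : ℝ := 2 * (|g.σ * g.s| + |g.q|) with hD
  have hD0 : 0 ≤ D := by positivity
  set L : ℝ := (‖f‖ + 3 * (D * B)) / (g.m - θ) with hL
  have hmθ : 0 < g.m - θ := sub_pos.2 hθ
  have hL0 : 0 ≤ L := by positivity
  have key : ∀ J : ℕ, 1 ≤ J → ∀ F : Finset ℤ, (∀ j ∈ F, 2 * |(j : ℝ)| ≤ J) →
      ∑ j ∈ F, ‖x j‖ ^ 2 ≤ (2 * L) ^ 2 := by
    intro J hJ F hF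
    have hJ1 : (1 : ℝ) ≤ J := by exact_mod_cast hJ
    have hJ0 : (0 : ℝ) < J := by linarith
    -- A tent of slope 1/J. Its commutator with the implicit operator is at most DB/J, carried by 2J
    -- + 3 points, so its ℓ² norm is bounded uniformly in J. Coercivity then bounds the truncated
    -- sequence uniformly in J.
    set ω : ℤ → ℝ := fun j => max (1 - |(j : ℝ)| / J) 0 with hω
    have hω0 : ∀ j, 0 ≤ ω j := fun j => le_max_right _ _
    have hω1 : ∀ j, ω j ≤ 1 := fun j => max_le (by
      have : 0 ≤ |(j : ℝ)| / J := by positivity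
      linarith) zero_le_one
    have hωz : ∀ j : ℤ, (J : ℝ) ≤ |(j : ℝ)| → ω j = 0 := fun j h => by
      refine max_eq_right ?_
      rw [sub_nonpos, le_div_iff₀ hJ0]; linarith
    have hωl : ∀ j k : ℤ, |(j : ℝ) - k| ≤ 1 → |ω j - ω k| ≤ 1 / J := fun j k h => by
      refine (abs_max_sub_max_le_abs _ _ _).trans ?_
      rw [show 1 - |(j : ℝ)| / J - (1 - |(k : ℝ)| / J) = (|(k : ℝ)| - |(j : ℝ)|) / J by ring, abs_div,
        abs_of_pos hJ0]
      gcongr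
      refine (abs_abs_sub_abs_le _ _).trans ?_
      rwa [abs_sub_comm]
    have hmem : Memℓp (fun j => (ω j : ℂ) * x j) 2 := by
      refine memℓp_gen (summable_of_hasFiniteSupport ((Finset.Icc (-(J : ℤ)) J).finite_toSet.subset ?_))
      intro j hj
      by_contra hc
      refine hj ?_
      have : (J : ℝ) ≤ |(j : ℝ)| := by
        have : (J : ℤ) ≤ |j| := by
          rw [Finset.mem_coe, Finset.mem_Icc] at hc
          by_contra h
          push Not at h
          exact hc ⟨by linarith [(abs_lt.1 h).1], by linarith [(abs_lt.1 h).2]⟩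
        exact_mod_cast this
      simp [hωz j this]
    set y : SeqSpace := ⟨_, hmem⟩ with hy
    have hyj : ∀ j, y j = (ω j : ℂ) * x j := fun j => rfl
    obtain ⟨c, hc, hcn⟩ := exists_of_sum_le (B := 3 * (D * B))
      (f := fun j => if j ∈ Finset.Icc (-(J + 1) : ℤ) (J + 1) then ((D * B / J : ℝ) : ℂ) else 0)
      (by positivity) (fun F => by
        calc ∑ j ∈ F, ‖(if j ∈ Finset.Icc (-(J + 1) : ℤ) (J + 1) then ((D * B / J : ℝ) : ℂ) else 0)‖ ^ 2
            = ∑ j ∈ F, if j ∈ Finset.Icc (-(J + 1) : ℤ) (J + 1) then (D * B / J) ^ 2 else 0 := by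
              refine Finset.sum_congr rfl fun j _ => ?_
              split_ifs
              · rw [Complex.norm_real, Real.norm_eq_abs, sq_abs]
              · simp
          _ = ∑ j ∈ F with j ∈ Finset.Icc (-(J + 1) : ℤ) (J + 1), (D * B / J) ^ 2 :=
              (Finset.sum_filter _ _).symm
          _ ≤ ∑ j ∈ Finset.Icc (-(J + 1) : ℤ) (J + 1), (D * B / J) ^ 2 := by
              refine Finset.sum_le_sum_of_subset_of_nonneg ?_ fun _ _ _ => sq_nonneg _
              intro j hj
              exact (Finset.mem_filter.1 hj).2
          _ = (2 * J + 3) * (D * B / J) ^ 2 := by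
              rw [Finset.sum_const, Int.card_Icc, nsmul_eq_mul]
              congr 1
              have : ((J : ℤ) + 1 + 1 - -(J + 1)).toNat = 2 * J + 3 := by omega
              rw [this]; push_cast; ring
          _ = (2 * J + 3) / J ^ 2 * (D * B) ^ 2 := by field_simp
          _ ≤ 9 * (D * B) ^ 2 := by
              gcongr
              rw [div_le_iff₀ (by positivity)]
              nlinarith
          _ = _ := by ring)
    have hpt : ∀ j, ‖g.A y j‖ ≤ 1 * (‖((θ : ℂ) • y) j‖ + ‖f j‖ + ‖c j‖) := by
      intro j
      rw [A_apply_eq, one_mul]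
      have e1 : g.opFn y j = (ω j : ℂ) * g.opFn x j
          + (-((g.σ * g.s : ℝ) : ℂ) * (((ω (j + 1) - ω j : ℝ) : ℂ) * x (j + 1)
              + ((ω (j - 1) - ω j : ℝ) : ℂ) * x (j - 1))
            - (g.q : ℂ) * (((ω (j + 1) - ω j : ℝ) : ℂ) * x (j + 1)
              - ((ω (j - 1) - ω j : ℝ) : ℂ) * x (j - 1))) := by
        simp only [opFn, hyj]
        push_cast
        ring
      have e2 : ‖(ω j : ℂ) * g.opFn x j‖ ≤ ‖((θ : ℂ) • y) j‖ + ‖f j‖ := by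
        rw [norm_mul, smul_apply, hyj, norm_mul, norm_mul, Complex.norm_real, Complex.norm_real,
          Real.norm_eq_abs, Real.norm_eq_abs, abs_of_nonneg (hω0 j), abs_of_nonneg hθ0]
        calc ω j * ‖g.opFn x j‖ ≤ ω j * (θ * ‖x j‖ + ‖f j‖) :=
              mul_le_mul_of_nonneg_left (hA j) (hω0 j)
          _ = θ * (ω j * ‖x j‖) + ω j * ‖f j‖ := by ring
          _ ≤ θ * (ω j * ‖x j‖) + 1 * ‖f j‖ := by gcongr; exact hω1 j
          _ = _ := by rw [one_mul]
      by_cases hj : j ∈ Finset.Icc (-(J + 1) : ℤ) (J + 1)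
      · have e3 : ‖c j‖ = D * B / J := by
          rw [hc, if_pos hj, Complex.norm_real, Real.norm_eq_abs, abs_of_nonneg (by positivity)]
        have p1 : ‖((ω (j + 1) - ω j : ℝ) : ℂ) * x (j + 1)‖ ≤ 1 / J * B := by
          rw [norm_mul, Complex.norm_real, Real.norm_eq_abs]
          exact mul_le_mul (hωl _ _ (by push_cast; simp)) (hB _) (norm_nonneg _) (by positivity)
        have p2 : ‖((ω (j - 1) - ω j : ℝ) : ℂ) * x (j - 1)‖ ≤ 1 / J * B := by
          rw [norm_mul, Complex.norm_real, Real.norm_eq_abs]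
          exact mul_le_mul (hωl _ _ (by push_cast; simp)) (hB _) (norm_nonneg _) (by positivity)
        rw [e1, e3]
        refine (norm_add_le _ _).trans (add_le_add e2 ((norm_sub_le _ _).trans ?_))
        rw [norm_mul, norm_mul, norm_neg, Complex.norm_real, Complex.norm_real, Real.norm_eq_abs,
          Real.norm_eq_abs]
        calc _ ≤ |g.σ * g.s| * (1 / J * B + 1 / J * B) + |g.q| * (1 / J * B + 1 / J * B) := by
              gcongr
              · exact (norm_add_le _ _).trans (add_le_add p1 p2)
              · exact (norm_sub_le _ _).trans (add_le_add p1 p2)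
          _ = _ := by rw [hD]; ring
      · have hz : ∀ k : ℤ, |(j : ℝ) - k| ≤ 1 → ω k = 0 := by
          intro k hk
          refine hωz k ?_
          have h1 : (J : ℝ) + 1 ≤ |(j : ℝ)| := by
            have : (J : ℤ) + 1 ≤ |j| := by
              rw [Finset.mem_Icc] at hj
              by_contra h
              push Not at h
              exact hj ⟨by linarith [(abs_lt.1 h).1], by linarith [(abs_lt.1 h).2]⟩
            exact_mod_cast this
          have h2 := abs_sub_abs_le_abs_sub (j : ℝ) k
          linarith
        have z0 := hz j (by simp)
        have z1 := hz (j + 1) (by push_cast; simp)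
        have z2 := hz (j - 1) (by push_cast; simp)
        have e4 : g.opFn y j = 0 := by
          simp only [opFn, hyj, z0, z1, z2]; simp
        rw [e4, norm_zero]
        positivity
    have h1 := norm_le_three zero_le_one hpt
    have h2 := norm_A_ge hg y
    rw [norm_smul, Complex.norm_real, Real.norm_eq_abs, abs_of_nonneg hθ0] at h1
    have h3 : ‖y‖ ≤ L := by
      rw [hL, le_div_iff₀ hmθ]
      linarith
    calc ∑ j ∈ F, ‖x j‖ ^ 2 ≤ ∑ j ∈ F, 2 ^ 2 * ‖y j‖ ^ 2 := by
          refine Finset.sum_le_sum fun j hj => ?_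
          rw [← mul_pow]
          have h4 : 1 / 2 ≤ ω j := by
            refine le_trans ?_ (le_max_left _ _)
            have : |(j : ℝ)| / J ≤ 1 / 2 := by
              rw [div_le_iff₀ hJ0]; linarith [hF j hj]
            linarith
          have h5 : ‖x j‖ ≤ 2 * ‖y j‖ := by
            rw [hyj, norm_mul, Complex.norm_real, Real.norm_eq_abs, abs_of_nonneg (hω0 j)]
            nlinarith [norm_nonneg (x j)]
          gcongr
      _ = 2 ^ 2 * ∑ j ∈ F, ‖y j‖ ^ 2 := by rw [Finset.mul_sum]
      _ ≤ 2 ^ 2 * ‖y‖ ^ 2 := by gcongr; exact sum_norm_sq_le y F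
      _ ≤ 2 ^ 2 * L ^ 2 := by gcongr
      _ = _ := by ring
  obtain ⟨x', hx', -⟩ := exists_of_sum_le (f := x) (B := 2 * L) (by positivity) (fun F => by
    obtain ⟨J, hJ⟩ : ∃ J : ℕ, ∀ j ∈ F, j.natAbs ≤ J :=
      ⟨F.sup Int.natAbs, fun j hj => Finset.le_sup (f := Int.natAbs) hj⟩
    refine key (2 * J + 1) (by omega) F fun j hj => ?_
    have h1 : ((j.natAbs : ℕ) : ℝ) ≤ J := by exact_mod_cast hJ j hj
    rw [Nat.cast_natAbs, Int.cast_abs] at h1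
    push_cast
    linarith)
  exact ⟨x', hx'⟩

/-- A bounded new time level of the scheme is square summable if the old ones are. -/
lemma exists_seq_of_step (hg : g.CFL) {x : ℤ → ℂ} {B : ℝ} (y z : SeqSpace) (hx : ∀ j, ‖x j‖ ≤ B)
    (hstep : ∀ j, g.stepFn lam x y z j = 0)
    (hsmall : g.σ = 0 ∨ (∀ j, ‖z j‖ ≤ B) ∧ |lam| * B ^ 2 < g.m) : ∃ x' : SeqSpace, ∀ j, x' j = x j := by
  have hop : ∀ j, g.opFn x j = (g.b y - g.A' z) j - (lam : ℂ) * cubic g.σ (x j) (y j) (z j) := by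
    intro j
    have := hstep j
    rw [stepFn_eq_opFn] at this
    rw [sub_apply]
    linear_combination this
  have hm := g.m_pos
  -- For leapfrog the nonlinear term contains only known levels, so θ = 0. For Crank–Nicolson it is
  -- at most |λ|B²(|x_j| + |z_j|), and the part with the new level is absorbed since |λ|B² < m.
  rcases hsmall with hσ | ⟨hz, hB⟩
  · refine exists_seq_of_bounded hg (g.b y - g.A' z - (lam : ℂ) • g.G 0 y z) hx le_rfl hm ?_
    intro j
    rw [hop, zero_mul, zero_add, sub_apply _ ((lam : ℂ) • g.G 0 y z), smul_apply, G_apply]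
    simp [cubic, hσ]
  · rcases g.σ_cases with hσ | hσ
    · refine exists_seq_of_bounded hg (g.b y - g.A' z - (lam : ℂ) • g.G 0 y z) hx le_rfl hm ?_
      intro j
      rw [hop, zero_mul, zero_add, sub_apply _ ((lam : ℂ) • g.G 0 y z), smul_apply, G_apply]
      simp [cubic, hσ]
    · obtain ⟨f1, hf1, -⟩ := exists_abs (g.b y - g.A' z)
      obtain ⟨f2, hf2, -⟩ := exists_abs z
      refine exists_seq_of_bounded hg (f1 + ((|lam| * B ^ 2 : ℝ) : ℂ) • f2) hx
        (by positivity) hB ?_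
      intro j
      have h1 : ‖(f1 + ((|lam| * B ^ 2 : ℝ) : ℂ) • f2) j‖
          = ‖(g.b y - g.A' z) j‖ + |lam| * B ^ 2 * ‖z j‖ := by
        rw [add_apply, smul_apply, hf1, hf2, ← Complex.ofReal_mul, ← Complex.ofReal_add,
          Complex.norm_real, Real.norm_eq_abs, abs_of_nonneg (by positivity)]
      have h2 : ‖(lam : ℂ) * cubic g.σ (x j) (y j) (z j)‖ ≤ |lam| * (B ^ 2 * (‖x j‖ + ‖z j‖)) := by
        rw [norm_mul, Complex.norm_real, Real.norm_eq_abs]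
        gcongr
        have h3 : cubic g.σ (x j) (y j) (z j)
            = ((1 / 2 * (‖x j‖ ^ 2 + ‖z j‖ ^ 2) : ℝ) : ℂ) * ((x j + z j) / 2) := by
          rw [cubic, hσ]; norm_num
        rw [h3, norm_mul, Complex.norm_real, Real.norm_eq_abs, abs_of_nonneg (by positivity), norm_div,
          Complex.norm_two]
        have h4 : ‖x j‖ ^ 2 ≤ B ^ 2 := by gcongr; exact hx j
        have h5 : ‖z j‖ ^ 2 ≤ B ^ 2 := by gcongr; exact hz j
        have h6 : ‖x j + z j‖ / 2 ≤ ‖x j‖ + ‖z j‖ := by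
          have := norm_add_le (x j) (z j)
          have := norm_nonneg (x j + z j)
          linarith
        exact mul_le_mul (by linarith) h6 (by positivity) (by positivity)
      rw [hop, h1]
      refine (norm_sub_le _ _).trans ?_
      linarith

/-- The starting step is uniquely solvable in the space of square summable sequences. -/
lemma exists_start (g : Disc) (lam : ℝ) (y : SeqSpace) : ∃ x : SeqSpace,
    (∀ j, g.startFn lam y x j = 0) ∧ (∀ x' : ℤ → ℂ, (∀ j, g.startFn lam y x' j = 0) → ∀ j, x j = x' j) ∧
      ‖g.startCoeff‖ * ‖x - y‖ ≤ 1 / 2 * (4 * g.s * ‖y‖ + |lam| * ‖y‖ ^ 3) := by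
  have hz := startCoeff_ne_zero (g := g)
  have hs0 : 0 ≤ g.s := by unfold s; positivity
  obtain ⟨f, hf, hfn⟩ := exists_of_le (f := fun j => ((‖y j‖ ^ 2 : ℝ) : ℂ) * y j) (B := ‖y‖ ^ 2)
    (by positivity) y (fun j => by
      rw [norm_mul, Complex.norm_real, Real.norm_eq_abs, abs_of_nonneg (by positivity)]
      gcongr
      exact norm_apply_le y j)
  set v : SeqSpace := (g.s : ℂ) • tri (-2) 1 1 y - (lam : ℂ) • f with hv
  have hvj : ∀ j, v j = g.s * (y (j + 1) - 2 * y j + y (j - 1))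
      - lam * ((‖y j‖ ^ 2 : ℝ) : ℂ) * y j := fun j => by
    rw [hv, sub_apply, smul_apply, smul_apply, tri_apply, hf]; ring
  have hstart : ∀ (x' : ℤ → ℂ) (j : ℤ), g.startFn lam y x' j = 2 * g.startCoeff * (x' j - y j) - v j := by
    intro x' j
    rw [hvj, startFn, startCoeff]; ring
  have hsol : ∀ (x' : ℤ → ℂ) (j : ℤ), g.startFn lam y x' j = 0
      ↔ x' j = y j + 1 / (2 * g.startCoeff) * v j := by
    intro x' j
    rw [hstart]
    constructor
    · intro h
      field_simp
      linear_combination h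
    · intro h
      rw [h]
      field_simp
      ring
  refine ⟨y + (1 / (2 * g.startCoeff)) • v, fun j => ?_, fun x' hx' j => ?_, ?_⟩
  · rw [hsol, add_apply, smul_apply]
  · rw [(hsol x' j).1 (hx' j), add_apply, smul_apply]
  · rw [add_sub_cancel_left, norm_smul]
    have h1 : ‖v‖ ≤ 4 * g.s * ‖y‖ + |lam| * ‖y‖ ^ 3 := by
      refine (norm_sub_le _ _).trans ?_
      rw [norm_smul, norm_smul, Complex.norm_real, Complex.norm_real, Real.norm_eq_abs,
        Real.norm_eq_abs, abs_of_nonneg hs0]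
      have h2 := norm_tri_le (-2) 1 1 y
      have h3 : (‖(-2 : ℂ)‖ + ‖(1 : ℂ)‖ + ‖(1 : ℂ)‖) = 4 := by norm_num
      rw [h3] at h2
      have h4 : g.s * ‖tri (-2) 1 1 y‖ ≤ g.s * (4 * ‖y‖) := by gcongr
      have h5 : |lam| * ‖f‖ ≤ |lam| * (‖y‖ ^ 2 * ‖y‖) := by gcongr
      linarith
    have hz0 : ‖g.startCoeff‖ ≠ 0 := norm_ne_zero_iff.2 hz
    rw [norm_div, norm_one, norm_mul, Complex.norm_two, ← mul_assoc]
    have h6 : ‖g.startCoeff‖ * (1 / (2 * ‖g.startCoeff‖)) = 1 / 2 := by field_simp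
    rw [h6]
    gcongr

end Disc

end Membership


/-! ### Bounded solutions on coarse grids: increments and mass -/

section Coarse

open SeqSpace

namespace Disc

variable {g : Disc} {lam L : ℝ}

lemma s_pos : 0 < g.s := by
  have := g.w_ne
  have := g.h_pos
  unfold s; positivity

lemma σ_abs_s_le : |g.σ * g.s| ≤ 1 / 2 * g.s := by
  rw [abs_of_nonneg (mul_nonneg g.σ_nonneg s_pos.le)]
  exact mul_le_mul_of_nonneg_right g.σ_le s_pos.le

lemma norm_A_le (x : SeqSpace) :
    ‖g.A x‖ ≤ (‖g.startCoeff‖ + (2 * g.s + 2 * |g.q|)) * ‖x‖ := by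
  have h : g.A x = tri g.startCoeff 0 0 x + tri ((2 * (g.σ * g.s) : ℝ) : ℂ)
      (-(g.σ * g.s) - g.q : ℝ) (-(g.σ * g.s) + g.q : ℝ) x := by
    refine ext_apply fun j => ?_
    rw [A_apply, add_apply, tri_apply, tri_apply]
    push_cast
    ring
  rw [h, add_mul]
  refine (norm_add_le _ _).trans (add_le_add ?_ ?_)
  · refine (norm_tri_le _ _ _ _).trans (le_of_eq (by simp))
  · refine (norm_tri_le _ _ _ _).trans (mul_le_mul_of_nonneg_right ?_ (norm_nonneg _))
    simp only [Complex.norm_real, Real.norm_eq_abs]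
    have h1 := abs_sub (-(g.σ * g.s)) g.q
    have h2 := abs_add_le (-(g.σ * g.s)) g.q
    rw [abs_neg] at h1 h2
    rw [abs_mul, abs_two]
    linarith [σ_abs_s_le (g := g)]

/-- The second space difference, weighted. -/
noncomputable def lap (g : Disc) : SeqSpace →L[ℂ] SeqSpace := tri (2 * g.s : ℝ) (-g.s : ℝ) (-g.s : ℝ)

lemma norm_lap_le (x : SeqSpace) : ‖g.lap x‖ ≤ 4 * g.s * ‖x‖ := by
  refine (norm_tri_le _ _ _ _).trans (le_of_eq ?_)
  simp only [Complex.norm_real, Real.norm_eq_abs, abs_neg, abs_mul, abs_two, abs_of_pos s_pos]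
  ring

/-- Splitting off the space difference rewrites a step as an equation for consecutive time
increments, with a source that is bounded on a coarse grid. -/
lemma b_eq (x : SeqSpace) : g.b x = g.A x + g.A' x - g.lap x := by
  refine ext_apply fun j => ?_
  simp only [A, A', b, lap, sub_apply, add_apply, tri_apply]
  push_cast
  ring

lemma norm_b_le (x : SeqSpace) : ‖g.b x‖ ≤ 2 * ‖g.A x‖ + 4 * g.s * ‖x‖ := by
  rw [b_eq]
  refine (norm_sub_le _ _).trans (add_le_add ((norm_add_le _ _).trans ?_) (norm_lap_le x))
  rw [g.twoStepOps.norm_adj]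
  linarith

lemma A_sub_eq {x y z : SeqSpace} (h : g.resid lam x y z = 0) :
    g.A (x - y) = g.A' (y - z) - g.lap y - (lam : ℂ) • g.G x y z := by
  rw [resid, b_eq, ← sub_eq_zero] at h
  rw [map_sub, map_sub, ← sub_eq_zero, ← h]
  abel

lemma norm_G_le_of_norm_le {x y z : SeqSpace} (hx : ‖x‖ ≤ L) (hy : ‖y‖ ≤ L) (hz : ‖z‖ ≤ L) :
    ‖g.G x y z‖ ≤ 9 * L ^ 3 := by
  have := norm_G_le (g := g) (fun j => (norm_apply_le x j).trans hx)
    (fun j => (norm_apply_le y j).trans hy) (fun j => (norm_apply_le z j).trans hz)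
  refine this.trans ?_
  calc 3 * L ^ 2 * (‖x‖ + ‖y‖ + ‖z‖) ≤ 3 * L ^ 2 * (L + L + L) := by gcongr
    _ = _ := by ring

lemma norm_G_sub_le_of_norm_le {x y z x' y' z' : SeqSpace} (hx : ‖x‖ ≤ L) (hy : ‖y‖ ≤ L)
    (hz : ‖z‖ ≤ L) (hx' : ‖x'‖ ≤ L) (hy' : ‖y'‖ ≤ L) (hz' : ‖z'‖ ≤ L) :
    ‖g.G x y z - g.G x' y' z'‖ ≤ 3 * L ^ 2 * (‖x - x'‖ + ‖y - y'‖ + ‖z - z'‖) :=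
  norm_G_sub_le (fun j => (norm_apply_le x j).trans hx)
    (fun j => (norm_apply_le y j).trans hy) (fun j => (norm_apply_le z j).trans hz)
    (fun j => (norm_apply_le x' j).trans hx')
    (fun j => (norm_apply_le y' j).trans hy') (fun j => (norm_apply_le z' j).trans hz')

lemma norm_A_sub_le {x y z f : SeqSpace} (h : g.A (x - y) = g.A' (y - z) - g.lap y - (lam : ℂ) • f)
    (hy : ‖y‖ ≤ L) (hf : ‖f‖ ≤ 9 * L ^ 3) :
    ‖g.A (x - y)‖ ≤ ‖g.A (y - z)‖ + (4 * g.s * L + 9 * |lam| * L ^ 3) := by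
  rw [h, ← g.twoStepOps.norm_adj (y - z)]
  have h1 := norm_sub_le (g.A' (y - z) - g.lap y) ((lam : ℂ) • f)
  have h2 := norm_sub_le (g.A' (y - z)) (g.lap y)
  rw [norm_smul, Complex.norm_real, Real.norm_eq_abs] at h1
  have h3 := norm_lap_le (g := g) y
  have h4 : 4 * g.s * ‖y‖ ≤ 4 * g.s * L := by
    have := s_pos (g := g)
    gcongr
  have h5 : |lam| * ‖f‖ ≤ |lam| * (9 * L ^ 3) := by gcongr
  linarith

/-- Growth of the time differences of a solution of the scheme. -/
lemma norm_diff_le (hg : g.CFL) {N : ℕ} {u : ℕ → SeqSpace} (hu : g.Solves lam N u)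
    (huL : ∀ k ≤ N, ‖u k‖ ≤ L) (hθ : 6 * |lam| * L ^ 2 ≤ g.m / 2) {n : ℕ} (hn : n + 2 ≤ N) :
    g.m * ‖u (n + 2) - u (n + 1)‖
      ≤ Real.exp (24 * |lam| * L ^ 2 / g.m * n) * g.energy (u 2 - u 1) (u 1 - u 0) := by
  have hm := g.m_pos
  have key := le_exp_mul_of_two_sided_step (n := n) (η := 0)
    (Z := fun k => g.energy (u (k + 2) - u (k + 1)) (u (k + 1) - u k)) (θ := 6 * |lam| * L ^ 2 / g.m)
    (fun k => energy_nonneg _ _) (by positivity)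
    (by rw [div_le_iff₀ hm]; linarith) le_rfl (fun k hk => by
      have e1 := hu (k + 1) (by omega)
      have e0 := hu k (by omega)
      -- Subtracting two consecutive steps, the increments obey the same linear recursion. They are
      -- forced by differences of G, which are Lipschitz in the increments.
      have hstep : g.A (u (k + 3) - u (k + 2)) - g.b (u (k + 2) - u (k + 1)) + g.A' (u (k + 1) - u k)
          = -((lam : ℂ) • (g.G (u (k + 3)) (u (k + 2)) (u (k + 1))
            - g.G (u (k + 2)) (u (k + 1)) (u k))) := by
        rw [← sub_eq_zero, ← sub_zero (0 : SeqSpace)]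
        nth_rw 1 [← e1]
        rw [← e0]
        simp only [resid, map_sub, smul_sub]
        abel
      have h1 := energy_step hg hstep
      rw [norm_neg, norm_smul, Complex.norm_real, Real.norm_eq_abs] at h1
      have h2 := norm_G_sub_le_of_norm_le (g := g) (huL (k + 3) (by omega)) (huL (k + 2) (by omega))
        (huL (k + 1) (by omega)) (huL (k + 2) (by omega)) (huL (k + 1) (by omega)) (huL k (by omega))
      have h3 := norm_fst_le hg (u (k + 3) - u (k + 2)) (u (k + 2) - u (k + 1))
      have h4 := norm_snd_le hg (u (k + 3) - u (k + 2)) (u (k + 2) - u (k + 1))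
      have h5 := norm_snd_le hg (u (k + 2) - u (k + 1)) (u (k + 1) - u k)
      have h6 : 0 ≤ g.energy (u (k + 2) - u (k + 1)) (u (k + 1) - u k) := energy_nonneg _ _
      set Z1 := g.energy (u (k + 3) - u (k + 2)) (u (k + 2) - u (k + 1))
      set Z0 := g.energy (u (k + 2) - u (k + 1)) (u (k + 1) - u k)
      have h7 : ‖u (k + 3) - u (k + 2)‖ + ‖u (k + 2) - u (k + 1)‖ + ‖u (k + 1) - u k‖
          ≤ 2 * (Z1 + Z0) / g.m := by
        rw [le_div_iff₀ hm]; linarith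
      have h8 : |lam| * ‖g.G (u (k + 3)) (u (k + 2)) (u (k + 1)) - g.G (u (k + 2)) (u (k + 1)) (u k)‖
          ≤ 6 * |lam| * L ^ 2 / g.m * (Z1 + Z0) := by
        calc _ ≤ |lam| * (3 * L ^ 2 * (2 * (Z1 + Z0) / g.m)) := by gcongr; exact h2.trans (by gcongr)
          _ = _ := by ring
      show Z1 ≤ _
      linarith)
  simp only [mul_zero, add_zero, zero_add] at key
  refine (norm_fst_le hg _ (u (n + 1) - u n)).trans (key.trans (le_of_eq ?_))
  congr 2
  ring

/-- At three equal levels the nonlinearity is |x|²x, which is gauge invariant. The mass defect of a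
step is thus controlled by time increments. -/
lemma im_inner_cubic (x : SeqSpace) : (⟪x, g.G x x x⟫_ℂ).im = 0 := by
  rw [lp.inner_eq_tsum, Complex.im_tsum (lp.summable_inner x (g.G x x x))]
  refine (tsum_congr fun j => ?_).trans tsum_zero
  have h : g.G x x x j = ((‖x j‖ ^ 2 : ℝ) : ℂ) * x j := by
    rw [G_apply, cubic]
    push_cast
    ring
  have hc : ∀ z : ℂ, (⟪z, ((‖z‖ ^ 2 : ℝ) : ℂ) * z⟫_ℂ).im = 0 := fun z => by
    rw [RCLike.inner_apply, mul_assoc, Complex.mul_conj, ← Complex.ofReal_mul, Complex.ofReal_im]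
  rw [h]
  exact hc (x j)

/-- The discrete mass of a pair of consecutive time levels. -/
noncomputable def mass (g : Disc) (x y : SeqSpace) : ℝ := (⟪x, g.A y⟫_ℂ).im

/-- The imaginary part of the scheme tested with the middle level: b drops out by symmetry, and
adjointness of A and `A'` makes the other linear terms consecutive masses. -/
lemma mass_step {x y z : SeqSpace} (h : g.resid lam x y z = 0) :
    g.mass y x = g.mass z y - lam * (⟪y, g.G x y z⟫_ℂ).im := by
  have h1 := congrArg (fun v => (⟪y, v⟫_ℂ).im) h
  simp only [resid, inner_add_right, inner_sub_right, inner_zero_right, inner_smul_right,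
    Complex.add_im, Complex.sub_im, Complex.zero_im, Complex.im_ofReal_mul] at h1
  have h2 : (⟪y, g.b y⟫_ℂ).im = 0 := by
    have h3 := g.twoStepOps.symm y y
    rw [← inner_conj_symm] at h3
    have h4 := congrArg Complex.im h3
    rw [Complex.conj_im] at h4
    linarith
  have h5 : (⟪y, g.A' z⟫_ℂ).im = -g.mass z y := by
    rw [← g.twoStepOps.adj, ← inner_conj_symm, Complex.conj_im, mass]
  rw [h2, h5] at h1
  unfold mass at h1 ⊢
  linarith

/-- Apart from the mixed difference, the skew part of A is -iw/τ; therefore -τ · mass agrees with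
w‖x‖² up to a term of size |q|τ‖x‖². -/
lemma abs_mass_self_le (x : SeqSpace) :
    |g.mass x x + g.w / g.τ * ‖x‖ ^ 2| ≤ 2 * |g.q| * ‖x‖ ^ 2 := by
  have h1 : ⟪x, g.A x⟫_ℂ - ⟪x, g.A' x⟫_ℂ
      = -(2 * Complex.I * (g.w / g.τ : ℝ)) * ((‖x‖ ^ 2 : ℝ) : ℂ)
        + ⟪x, tri 0 (-2 * g.q : ℝ) (2 * g.q : ℝ) x⟫_ℂ := by
    have : g.A x - g.A' x = (-(2 * Complex.I * (g.w / g.τ : ℝ))) • x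
        + tri 0 (-2 * g.q : ℝ) (2 * g.q : ℝ) x := by
      refine ext_apply fun j => ?_
      simp only [A, A', sub_apply, add_apply, smul_apply, tri_apply]
      push_cast
      ring
    rw [← inner_sub_right, this, inner_add_right, inner_smul_right, inner_self_eq_norm_sq_to_K]
    norm_cast
  have h2 : ⟪x, g.A' x⟫_ℂ = conj ⟪x, g.A x⟫_ℂ := by
    rw [← g.twoStepOps.adj, inner_conj_symm]
  have h3 := congrArg Complex.im h1
  rw [h2, Complex.sub_im, Complex.conj_im, Complex.add_im] at h3
  have h4 : (-(2 * Complex.I * ((g.w / g.τ : ℝ) : ℂ)) * ((‖x‖ ^ 2 : ℝ) : ℂ)).im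
      = -(2 * (g.w / g.τ) * ‖x‖ ^ 2) := by
    rw [show -(2 * Complex.I * ((g.w / g.τ : ℝ) : ℂ)) * ((‖x‖ ^ 2 : ℝ) : ℂ)
      = ((-(2 * (g.w / g.τ) * ‖x‖ ^ 2) : ℝ) : ℂ) * Complex.I by push_cast; ring,
      Complex.im_ofReal_mul, Complex.I_im, mul_one]
  rw [h4] at h3
  have h5 := (Complex.abs_im_le_norm _).trans
    (norm_inner_le_norm (𝕜 := ℂ) x (tri 0 (-2 * g.q : ℝ) (2 * g.q : ℝ) x))
  have h6 := norm_tri_le 0 ((-2 * g.q : ℝ) : ℂ) ((2 * g.q : ℝ) : ℂ) x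
  simp only [Complex.norm_real, Real.norm_eq_abs, abs_neg, abs_mul, abs_two, norm_zero] at h6
  have h7 : ‖x‖ * ‖tri 0 ((-2 * g.q : ℝ) : ℂ) ((2 * g.q : ℝ) : ℂ) x‖ ≤ 4 * |g.q| * ‖x‖ ^ 2 := by
    calc _ ≤ ‖x‖ * ((0 + 2 * |g.q| + 2 * |g.q|) * ‖x‖) := by gcongr
      _ = _ := by ring
  have h8 : g.mass x x + g.w / g.τ * ‖x‖ ^ 2
      = 1 / 2 * (⟪x, tri 0 ((-2 * g.q : ℝ) : ℂ) ((2 * g.q : ℝ) : ℂ) x⟫_ℂ).im := by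
    unfold mass; linarith
  rw [h8, abs_mul, abs_of_pos (by norm_num : (0 : ℝ) < 1 / 2)]
  linarith

/-- A priori bounds for solutions on coarse grids with small time steps. -/
lemma coarse_apriori (hg : g.CFL) {N : ℕ} {u : ℕ → SeqSpace} {T D γ L₀ : ℝ} (hu : g.Solves lam N u)
    (huL : ∀ k ≤ N, ‖u k‖ ≤ L) (hNT : N * g.τ ≤ T) (hD0 : 0 ≤ D) (hγ : 0 ≤ γ)
    (hu0 : ‖u 0‖ ≤ L₀) (hd : ‖u 1 - u 0‖ ≤ D * g.τ)
    (hθ : 6 * |lam| * L ^ 2 ≤ g.m / 2)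
    (hD : Real.exp (24 * |lam| * L ^ 2 / g.m * N) * (4 * ‖g.A (u 1 - u 0)‖
      + 4 * g.s * ‖u 1 - u 0‖ + (4 * g.s * L + 9 * |lam| * L ^ 3)) ≤ g.m * (D * g.τ))
    (hA : ∀ x, g.τ ^ 2 * ‖g.A x‖ ≤ γ * ‖x‖)
    (hmass : 4 * (|g.q| * g.τ) * L ^ 2 + 2 * (L * D * γ) + 6 * |lam| * T * L ^ 3 * (D * g.τ) ≤ 1) :
    (∀ k, k + 1 ≤ N → ‖u (k + 1) - u k‖ ≤ D * g.τ) ∧ (∀ k, k + 1 ≤ N → ‖u k‖ ≤ L₀ + 1) := by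
  have hm := g.m_pos
  have hτ := g.τ_pos
  have hL : 0 ≤ L := (norm_nonneg _).trans (huL 0 (by omega))
  have hL0 : 0 ≤ L₀ := (norm_nonneg _).trans hu0
  have hdiff : ∀ k, k + 1 ≤ N → ‖u (k + 1) - u k‖ ≤ D * g.τ := by
    intro k hk
    obtain _ | n := k
    · exact hd
    · have h1 := norm_diff_le hg hu huL hθ hk
      have hres := hu 0 (by omega)
      have h2 := norm_A_sub_le (A_sub_eq hres) (huL 1 (by omega))
        (norm_G_le_of_norm_le (huL 2 (by omega)) (huL 1 (by omega)) (huL 0 (by omega)))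
      have h3 : g.energy (u 2 - u 1) (u 1 - u 0) ≤ _ := TwoStepOps.energy_le _ _
      have h4 := norm_b_le (g := g) (u 1 - u 0)
      refine le_of_mul_le_mul_left (h1.trans (le_trans ?_ hD)) hm
      refine mul_le_mul ?_ (by simp only [zero_add] at h2; linarith) (energy_nonneg _ _) (by positivity)
      gcongr
      omega
  refine ⟨hdiff, ?_⟩
  -- The drift per step is 6|λ|L³Dτ. Over at most T/τ steps, and after multiplication by τ, it
  -- amounts to 6|λ|TL³Dτ, small with τ.
  have hmstep : ∀ k, k + 1 ≤ N → |g.mass (u k) (u (k + 1)) - g.mass (u 0) (u 1)|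
      ≤ k * (|lam| * (6 * L ^ 3 * (D * g.τ))) := by
    intro k
    induction k with
    | zero => intro _; simp
    | succ k ih =>
      intro hk
      have ih := ih (by omega)
      have h1 := mass_step (hu k hk)
      have h2 : |(⟪u (k + 1), g.G (u (k + 2)) (u (k + 1)) (u k)⟫_ℂ).im| ≤ 6 * L ^ 3 * (D * g.τ) := by
        have h3 : (⟪u (k + 1), g.G (u (k + 2)) (u (k + 1)) (u k)⟫_ℂ).im
            = (⟪u (k + 1), g.G (u (k + 2)) (u (k + 1)) (u k)
              - g.G (u (k + 1)) (u (k + 1)) (u (k + 1))⟫_ℂ).im := by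
          rw [inner_sub_right, Complex.sub_im, im_inner_cubic, sub_zero]
        rw [h3]
        refine (Complex.abs_im_le_norm _).trans ((norm_inner_le_norm _ _).trans ?_)
        have h4 := norm_G_sub_le_of_norm_le (g := g) (huL (k + 2) hk) (huL (k + 1) (by omega))
          (huL k (by omega)) (huL (k + 1) (by omega)) (huL (k + 1) (by omega)) (huL (k + 1) (by omega))
        have h5 := hdiff (k + 1) hk
        have h6 := hdiff k (by omega)
        rw [norm_sub_rev] at h6
        rw [sub_self, norm_zero] at h4
        calc _ ≤ L * (3 * L ^ 2 * (D * g.τ + 0 + D * g.τ)) := by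
              gcongr
              · exact huL _ (by omega)
              · exact h4.trans (by gcongr)
          _ = _ := by ring
      have h7 : |lam * (⟪u (k + 1), g.G (u (k + 2)) (u (k + 1)) (u k)⟫_ℂ).im|
          ≤ |lam| * (6 * L ^ 3 * (D * g.τ)) := by rw [abs_mul]; gcongr
      have h8 := abs_sub (g.mass (u k) (u (k + 1)) - g.mass (u 0) (u 1))
        (lam * (⟪u (k + 1), g.G (u (k + 2)) (u (k + 1)) (u k)⟫_ℂ).im)
      rw [h1, sub_right_comm]
      push_cast
      linarith
  have hself : ∀ k, k + 1 ≤ N → |g.τ * g.mass (u k) (u (k + 1)) + g.w * ‖u k‖ ^ 2|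
      ≤ 2 * (|g.q| * g.τ) * L ^ 2 + L * D * γ := by
    intro k hk
    have h1 := abs_mass_self_le (g := g) (u k)
    have h2 : g.mass (u k) (u (k + 1)) = g.mass (u k) (u k) + (⟪u k, g.A (u (k + 1) - u k)⟫_ℂ).im := by
      simp only [mass, map_sub, inner_sub_right, Complex.sub_im]; ring
    have h3 : g.τ * |(⟪u k, g.A (u (k + 1) - u k)⟫_ℂ).im| ≤ L * D * γ := by
      refine le_of_mul_le_mul_left ?_ hτ
      calc g.τ * (g.τ * |(⟪u k, g.A (u (k + 1) - u k)⟫_ℂ).im|)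
          ≤ g.τ * (g.τ * (‖u k‖ * ‖g.A (u (k + 1) - u k)‖)) := by
            gcongr
            exact (Complex.abs_im_le_norm _).trans (norm_inner_le_norm _ _)
        _ = ‖u k‖ * (g.τ ^ 2 * ‖g.A (u (k + 1) - u k)‖) := by ring
        _ ≤ L * (γ * (D * g.τ)) := mul_le_mul (huL _ (by omega))
            ((hA _).trans (mul_le_mul_of_nonneg_left (hdiff k hk) hγ)) (by positivity) hL
        _ = _ := by ring
    have h4 : g.τ * |g.mass (u k) (u k) + g.w / g.τ * ‖u k‖ ^ 2| ≤ 2 * (|g.q| * g.τ) * L ^ 2 := by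
      calc _ ≤ g.τ * (2 * |g.q| * ‖u k‖ ^ 2) := by gcongr
        _ ≤ g.τ * (2 * |g.q| * L ^ 2) := by gcongr; exact huL _ (by omega)
        _ = _ := by ring
    have h5 : g.τ * g.mass (u k) (u (k + 1)) + g.w * ‖u k‖ ^ 2
        = g.τ * (g.mass (u k) (u k) + g.w / g.τ * ‖u k‖ ^ 2)
          + g.τ * (⟪u k, g.A (u (k + 1) - u k)⟫_ℂ).im := by
      rw [h2]; field_simp; ring
    rw [h5]
    refine (abs_add_le _ _).trans ?_
    rw [abs_mul, abs_mul, abs_of_pos hτ]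
    linarith
  intro k hk
  have h1 := hmstep k hk
  have h2 := hself k hk
  have h3 := hself 0 (by omega)
  have hk' : (k : ℝ) * g.τ ≤ T := by
    refine le_trans ?_ hNT
    gcongr
    omega
  have h4 : |g.τ * (g.mass (u k) (u (k + 1)) - g.mass (u 0) (u 1))|
      ≤ 6 * |lam| * T * L ^ 3 * (D * g.τ) := by
    rw [abs_mul, abs_of_pos hτ]
    calc _ ≤ g.τ * (k * (|lam| * (6 * L ^ 3 * (D * g.τ)))) := by gcongr
      _ = (k * g.τ) * (6 * |lam| * L ^ 3 * (D * g.τ)) := by ring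
      _ ≤ T * (6 * |lam| * L ^ 3 * (D * g.τ)) := by gcongr
      _ = _ := by ring
  have h5 : |g.w * (‖u k‖ ^ 2 - ‖u 0‖ ^ 2)| ≤ 1 := by
    have e : g.w * (‖u k‖ ^ 2 - ‖u 0‖ ^ 2) = (g.τ * g.mass (u k) (u (k + 1)) + g.w * ‖u k‖ ^ 2)
        - (g.τ * g.mass (u 0) (u 1) + g.w * ‖u 0‖ ^ 2)
        - g.τ * (g.mass (u k) (u (k + 1)) - g.mass (u 0) (u 1)) := by ring
    rw [e]
    simp only [zero_add] at h3
    refine (abs_sub _ _).trans (le_trans (add_le_add (abs_sub _ _) le_rfl) ?_)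
    linarith
  rw [abs_mul] at h5
  have h6 : ‖u k‖ ^ 2 - ‖u 0‖ ^ 2 ≤ 1 := by
    refine (le_abs_self _).trans (le_trans ?_ h5)
    exact le_mul_of_one_le_left (abs_nonneg _) one_le_abs_w
  have h7 : ‖u 0‖ ^ 2 ≤ L₀ ^ 2 := by gcongr
  refine abs_le_of_sq_le_sq' ?_ (by linarith) |>.2
  nlinarith

/-- Construction of solutions on coarse grids with small time steps. -/
lemma exists_coarse_solution_of (hg : g.CFL) {T D γ L₀ : ℝ} {u₀ u₁ : SeqSpace} (hD0 : 0 ≤ D) (hγ : 0 ≤ γ)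
    (hL : L = L₀ + 3)
    (hu0 : ‖u₀‖ ≤ L₀) (hd : ‖u₁ - u₀‖ ≤ D * g.τ)
    (hθ : 6 * |lam| * L ^ 2 ≤ g.m / 2)
    (hD : Real.exp (24 * |lam| * L ^ 2 / g.m * (T / g.τ)) * (4 * ‖g.A (u₁ - u₀)‖
      + 4 * g.s * ‖u₁ - u₀‖ + (4 * g.s * L + 9 * |lam| * L ^ 3)) ≤ g.m * (D * g.τ))
    (hA : ∀ x, g.τ ^ 2 * ‖g.A x‖ ≤ γ * ‖x‖)
    (hmass : 4 * (|g.q| * g.τ) * L ^ 2 + 2 * (L * D * γ) + 6 * |lam| * T * L ^ 3 * (D * g.τ) ≤ 1)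
    (hDτ : D * g.τ ≤ 1) (hstep : γ * D + (4 * g.s * L + 9 * |lam| * L ^ 3) * g.τ ≤ g.m * g.τ)
    (N : ℕ) (hNT : (N + 1 : ℕ) * g.τ ≤ T) :
    ∃ u : ℕ → SeqSpace, u 0 = u₀ ∧ u 1 = u₁ ∧ g.Solves lam (N + 1) u ∧ ∀ k ≤ N + 1, ‖u k‖ ≤ L₀ + 2 := by
  have hm := g.m_pos
  have hτ := g.τ_pos
  have hL0 : 0 ≤ L₀ := (norm_nonneg _).trans hu0
  have hL0' : 0 ≤ L := by linarith
  have hs := s_pos (g := g)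
  -- The mass bound L₀ + 1 stops one level before the last. The last level is one increment of size
  -- at most Dτ ≤ 1 away, hence L₀ + 2, and L = L₀ + 3 leaves room for the fixed point ball of the
  -- next step.
  have apriori : ∀ (N : ℕ) (u : ℕ → SeqSpace), N * g.τ ≤ T → u 0 = u₀ → u 1 = u₁ → g.Solves lam N u →
      (∀ k ≤ N, ‖u k‖ ≤ L) → (∀ k, k + 1 ≤ N → ‖u (k + 1) - u k‖ ≤ D * g.τ) ∧
        (∀ k, k + 1 ≤ N → ‖u k‖ ≤ L₀ + 1) := by
    intro N u hN h0 h1 hu huL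
    subst h0 h1
    refine coarse_apriori hg hu huL hN hD0 hγ hu0 hd hθ (le_trans ?_ hD) hA hmass
    have : (N : ℝ) ≤ T / g.τ := by rwa [le_div_iff₀ hτ]
    gcongr
  induction N with
  | zero =>
    refine ⟨fun k => if k = 0 then u₀ else u₁, rfl, rfl, fun k hk => by omega, fun k hk => ?_⟩
    have h1 : ‖u₁‖ ≤ ‖u₀‖ + ‖u₁ - u₀‖ := by
      calc ‖u₁‖ = ‖u₀ + (u₁ - u₀)‖ := by rw [add_sub_cancel]
        _ ≤ _ := norm_add_le _ _
    dsimp only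
    split_ifs <;> linarith
  | succ N ih =>
    have hN1 : ((N + 1 : ℕ) : ℝ) * g.τ ≤ T := by
      refine le_trans ?_ hNT
      gcongr
      omega
    obtain ⟨u, hu0', hu1', hu, huL⟩ := ih hN1
    have hap := (apriori (N + 1) u hN1 hu0' hu1' hu (fun k hk => (huL k hk).trans (by linarith))).1 N le_rfl
    have hyL := huL (N + 1) le_rfl
    have hzL := huL N (by omega)
    set y := u (N + 1)
    set z := u N
    have hball : ∀ x : SeqSpace, x ∈ Metric.closedBall (0 : SeqSpace) L ↔ ‖x‖ ≤ L := fun x => by simp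
    obtain ⟨v, hv, hAv⟩ := exists_implicit_step hg (s := Metric.closedBall (0 : SeqSpace) L)
      Metric.isClosed_closedBall ⟨0, by simpa using hL0'⟩
      (Φ := fun x => g.b y - g.A' z - (lam : ℂ) • g.G x y z) (by
        intro x hx v hv
        rw [hball] at hx ⊢
        have e1 : g.A (v - y) = g.A' (y - z) - g.lap y - (lam : ℂ) • g.G x y z := by
          rw [map_sub, map_sub, hv, b_eq]; abel
        have h1 := norm_A_sub_le e1 (hyL.trans (by linarith))
          (norm_G_le_of_norm_le hx (hyL.trans (by linarith)) (hzL.trans (by linarith)))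
        have h2 := norm_A_ge hg (v - y)
        have h3 : g.τ ^ 2 * ‖g.A (y - z)‖ ≤ γ * (D * g.τ) := (hA _).trans (by gcongr)
        have h4 : g.τ * ‖g.A (y - z)‖ ≤ γ * D := by
          refine le_of_mul_le_mul_left ?_ hτ
          linarith
        have h5 : ‖v - y‖ ≤ 1 := by
          refine le_of_mul_le_mul_left ?_ (mul_pos hm hτ)
          have := mul_le_mul_of_nonneg_left (h2.trans h1) hτ.le
          nlinarith
        calc ‖v‖ = ‖y + (v - y)‖ := by rw [add_sub_cancel]
          _ ≤ ‖y‖ + ‖v - y‖ := norm_add_le _ _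
          _ ≤ L := by linarith)
      (by
        intro x hx x' hx'
        rw [hball] at hx hx'
        rw [sub_sub_sub_cancel_left, ← smul_sub, norm_smul, Complex.norm_real, Real.norm_eq_abs]
        have h1 := norm_G_sub_le_of_norm_le (g := g) (y := y) (y' := y) (z := z) (z' := z) hx'
          (hyL.trans (by linarith)) (hzL.trans (by linarith)) hx
          (hyL.trans (by linarith)) (hzL.trans (by linarith))
        rw [sub_self, sub_self, norm_zero, add_zero, add_zero, norm_sub_rev x' x] at h1
        calc _ ≤ |lam| * (3 * L ^ 2 * ‖x - x'‖) := by gcongr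
          _ = (3 * |lam| * L ^ 2) * ‖x - x'‖ := by ring
          _ ≤ _ := by
            gcongr
            have : 0 ≤ |lam| * L ^ 2 := by positivity
            linarith)
    rw [hball] at hv
    refine ⟨fun k => if k ≤ N + 1 then u k else v, by simpa using hu0', by simpa using hu1', ?_, ?_⟩
    all_goals
      have hsolves : g.Solves lam (N + 1 + 1) (fun k => if k ≤ N + 1 then u k else v) := by
        intro k hk
        rcases Nat.lt_or_ge k N with h | h
        · simp only [if_pos (show k + 2 ≤ N + 1 by omega), if_pos (show k + 1 ≤ N + 1 by omega),
            if_pos (show k ≤ N + 1 by omega)]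
          exact hu k (by omega)
        · obtain rfl : k = N := by omega
          simp only [if_neg (show ¬ k + 2 ≤ k + 1 by omega), if_pos (show k + 1 ≤ k + 1 by omega),
            if_pos (show k ≤ k + 1 by omega)]
          rw [resid, hAv]
          abel
    · exact hsolves
    · have hfin := apriori (N + 1 + 1) (fun k => if k ≤ N + 1 then u k else v) hNT
        (by simpa using hu0') (by simpa using hu1') hsolves (fun k hk => by
          split_ifs with h
          · exact (huL k h).trans (by linarith)
          · exact hv)
      intro k hk
      rcases Nat.lt_or_ge k (N + 1 + 1) with h | h
      · dsimp only
        rw [if_pos (by omega)]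
        exact huL k (by omega)
      · obtain rfl : k = N + 1 + 1 := by omega
        have h1 := hfin.1 (N + 1) le_rfl
        have h2 := hfin.2 (N + 1) le_rfl
        set U : ℕ → SeqSpace := fun k => if k ≤ N + 1 then u k else v
        calc ‖U (N + 1 + 1)‖ = ‖U (N + 1) + (U (N + 1 + 1) - U (N + 1))‖ := by rw [add_sub_cancel]
          _ ≤ ‖U (N + 1)‖ + ‖U (N + 1 + 1) - U (N + 1)‖ := norm_add_le _ _
          _ ≤ _ := by linarith

end Disc

end Coarse


/-! ### Uniform constants on coarse grids -/

section CoarseConstants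

open SeqSpace

namespace Disc

variable {g : Disc} {lam h₀ : ℝ}

lemma s_le (hh : 0 < h₀) (h : h₀ ≤ g.h) : g.s ≤ 1 / h₀ ^ 2 := by
  unfold s
  have h1 : 1 ≤ g.w ^ 2 := by rw [g.w_sq]; linarith [sq_nonneg g.κ]
  have h2 : h₀ ^ 2 ≤ g.h ^ 2 := by gcongr
  refine one_div_le_one_div_of_le (by positivity) ?_
  nlinarith [sq_nonneg g.h]

lemma abs_q_mul_τ_le (hh : 0 < h₀) (h : h₀ ≤ g.h) : |g.q| * g.τ ≤ g.ε * (1 / h₀) := by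
  have hτ := g.τ_pos
  have hε := g.ε_pos
  have hg := g.h_pos
  have hw := g.w_ne
  have e : g.q * g.τ = g.ε * (g.κ / g.w * (1 / (2 * g.h))) := by unfold q; field_simp
  have e' : |g.q| * g.τ = |g.q * g.τ| := by rw [abs_mul, abs_of_pos hτ]
  rw [e', e, abs_mul, abs_of_pos hε, abs_mul,
    abs_of_pos (show 0 < 1 / (2 * g.h) by positivity)]
  have h1 : 1 / (2 * g.h) ≤ 1 / h₀ := one_div_le_one_div_of_le hh (by linarith)
  calc _ ≤ g.ε * (1 * (1 / h₀)) := by gcongr; exact abs_κ_div_w_le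
    _ = _ := by ring

lemma norm_startCoeff_le : ‖g.startCoeff‖ ≤ g.μ + |g.w| / g.τ := by
  have hτ := g.τ_pos
  refine (norm_sub_le _ _).trans (le_of_eq ?_)
  rw [norm_mul, Complex.norm_I, one_mul, Complex.norm_real, Complex.norm_real, Real.norm_eq_abs,
    Real.norm_eq_abs, abs_div, abs_of_pos hτ, abs_of_nonneg (by unfold μ; positivity)]

lemma one_div_τ_le : 1 / g.τ ≤ ‖g.startCoeff‖ := by
  have hτ := g.τ_pos
  exact (div_le_div_of_nonneg_right one_le_abs_w hτ.le).trans abs_w_div_τ_le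

/-- For fixed h₀ the factor tends to zero with ε and τ. It provides the small γ in the mass
argument. -/
lemma τ_sq_mul_norm_A_le (hh : 0 < h₀) (h : h₀ ≤ g.h) (x : SeqSpace) :
    g.τ ^ 2 * ‖g.A x‖
      ≤ (g.ε ^ 2 + |g.w| * g.τ + 2 / h₀ ^ 2 * g.τ ^ 2 + 2 * g.ε / h₀ * g.τ) * ‖x‖ := by
  have hτ := g.τ_pos
  have h1 := norm_A_le (g := g) x
  have h2 : g.τ ^ 2 * g.μ = g.ε ^ 2 := by unfold μ; field_simp
  have h3 := norm_startCoeff_le (g := g)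
  have h4 := s_le hh h
  have h5 := mul_le_mul_of_nonneg_right (abs_q_mul_τ_le hh h) hτ.le
  have h6 : g.τ ^ 2 * (|g.w| / g.τ) = |g.w| * g.τ := by field_simp
  have h7 := mul_le_mul_of_nonneg_left h3 (sq_nonneg g.τ)
  have h8 := mul_le_mul_of_nonneg_left h4 (sq_nonneg g.τ)
  have h9 : g.τ ^ 2 * (‖g.startCoeff‖ + (2 * g.s + 2 * |g.q|))
      ≤ g.ε ^ 2 + |g.w| * g.τ + 2 / h₀ ^ 2 * g.τ ^ 2 + 2 * g.ε / h₀ * g.τ := by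
    have e1 : 2 / h₀ ^ 2 * g.τ ^ 2 = 2 * (g.τ ^ 2 * (1 / h₀ ^ 2)) := by ring
    have e2 : 2 * g.ε / h₀ * g.τ = 2 * (g.ε * (1 / h₀) * g.τ) := by ring
    rw [e1, e2]
    rw [mul_add, h2, h6] at h7
    nlinarith
  calc _ ≤ g.τ ^ 2 * ((‖g.startCoeff‖ + (2 * g.s + 2 * |g.q|)) * ‖x‖) := by gcongr
    _ = g.τ ^ 2 * (‖g.startCoeff‖ + (2 * g.s + 2 * |g.q|)) * ‖x‖ := by ring
    _ ≤ _ := by gcongr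

/-- Uniformly bounded solutions on coarse grids with small time steps. -/
theorem exists_coarse_solution {κ w T L₀ : ℝ} (lam : ℝ) (hκ : κ ≠ 0) (hw : w ≠ 0) (hT : 0 < T)
    (hh : 0 < h₀) (hL₀ : 0 ≤ L₀) : ∃ δ > 0, ∀ g : Disc, g.κ = κ → g.w = w → h₀ ≤ g.h → g.τ ≤ δ →
      g.ε ≤ δ → g.CFL → ∀ u₀ u₁ : SeqSpace, ‖u₀‖ ≤ L₀ →
      ‖g.startCoeff‖ * ‖u₁ - u₀‖ ≤ 1 / 2 * (4 * g.s * ‖u₀‖ + |lam| * ‖u₀‖ ^ 3) →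
      ∀ N : ℕ, (N + 1 : ℕ) * g.τ ≤ T → ∃ u : ℕ → SeqSpace, u 0 = u₀ ∧ u 1 = u₁ ∧
        g.Solves lam (N + 1) u ∧ ∀ k ≤ N + 1, ‖u k‖ ≤ L₀ + 2 := by
  obtain ⟨c, hc⟩ : ∃ c, c = |κ / w| := ⟨_, rfl⟩
  have hc0 : 0 < c := by rw [hc]; positivity
  obtain ⟨L, hL⟩ : ∃ L, L = L₀ + 3 := ⟨_, rfl⟩
  have hL0 : 0 ≤ L := by linarith
  obtain ⟨s₁, hs₁⟩ : ∃ s₁, s₁ = 1 / h₀ ^ 2 := ⟨_, rfl⟩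
  have hs0 : 0 ≤ s₁ := by rw [hs₁]; positivity
  obtain ⟨Q, hQ⟩ : ∃ Q, Q = 1 / h₀ := ⟨_, rfl⟩
  have hQ0 : 0 ≤ Q := by rw [hQ]; positivity
  obtain ⟨V, hV⟩ : ∃ V, V = 4 * s₁ * L + |lam| * L ^ 3 := ⟨_, rfl⟩
  have hV0 : 0 ≤ V := by rw [hV]; positivity
  obtain ⟨E, hE⟩ : ∃ E, E = 4 * (V * (1 / 2 + s₁ + Q)) + 4 * s₁ * (V / 2)
    + (4 * s₁ * L + 9 * |lam| * L ^ 3) := ⟨_, rfl⟩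
  have hE0 : 0 ≤ E := by rw [hE]; positivity
  -- D bounds the increments divided by τ: the first term is the Gronwall bound, V covers the
  -- starting step. It is fixed before δ, and δ then makes all products with X₁, X₂, X₃ and D at
  -- most 1 and at most c = mτ.
  obtain ⟨D, hD⟩ : ∃ D, D = Real.exp (24 * |lam| * L ^ 2 * T / c) * E / c + V := ⟨_, rfl⟩
  have hD0 : 0 ≤ D := by rw [hD]; positivity
  have hDV : V ≤ D := by
    have : 0 ≤ Real.exp (24 * |lam| * L ^ 2 * T / c) * E / c := by positivity
    linarith
  have hDE : Real.exp (24 * |lam| * L ^ 2 * T / c) * E ≤ c * D := by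
    have : c * D = Real.exp (24 * |lam| * L ^ 2 * T / c) * E + c * V := by rw [hD]; field_simp
    rw [this]
    have := mul_nonneg hc0.le hV0
    linarith
  obtain ⟨Γ, hΓ⟩ : ∃ Γ, Γ = 1 + |w| + 2 * s₁ + 2 * Q := ⟨_, rfl⟩
  have hΓ0 : 0 ≤ Γ := by rw [hΓ]; positivity
  obtain ⟨X₁, hX₁⟩ : ∃ X, X = 12 * |lam| * L ^ 2 := ⟨_, rfl⟩
  obtain ⟨X₂, hX₂⟩ : ∃ X, X = 4 * Q * L ^ 2 + 2 * (L * D * Γ) + 6 * |lam| * T * L ^ 3 * D := ⟨_, rfl⟩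
  obtain ⟨X₃, hX₃⟩ : ∃ X, X = Γ * D + (4 * s₁ * L + 9 * |lam| * L ^ 3) := ⟨_, rfl⟩
  have hX₁0 : 0 ≤ X₁ := by rw [hX₁]; positivity
  have hX₂0 : 0 ≤ X₂ := by rw [hX₂]; positivity
  have hX₃0 : 0 ≤ X₃ := by rw [hX₃]; positivity
  obtain ⟨δ, hδ⟩ : ∃ δ, δ = min 1 c / (1 + X₁ + X₂ + X₃ + D) := ⟨_, rfl⟩
  have hden : 0 < 1 + X₁ + X₂ + X₃ + D := by positivity
  have hmin : 0 < min 1 c := lt_min one_pos hc0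
  have hδ0 : 0 < δ := by rw [hδ]; positivity
  have hδX : δ * (1 + X₁ + X₂ + X₃ + D) = min 1 c := by rw [hδ]; field_simp
  have hδ1 : ∀ Y, Y ≤ 1 + X₁ + X₂ + X₃ + D → δ * Y ≤ 1 ∧ δ * Y ≤ c := fun Y hY => by
    have := mul_le_mul_of_nonneg_left hY hδ0.le
    rw [hδX] at this
    exact ⟨this.trans (min_le_left _ _), this.trans (min_le_right _ _)⟩
  have hδle : δ ≤ 1 := by have := (hδ1 1 (by linarith)).1; linarith
  refine ⟨δ, hδ0, ?_⟩
  intro g hgκ hgw hgh hτδ hεδ hg u₀ u₁ hu₀ hu₁ N hN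
  have hτ := g.τ_pos
  have hε := g.ε_pos
  have hm := g.m_pos
  have hmτ : g.m * g.τ = c := by unfold m; rw [hgκ, hgw, ← hc]; field_simp
  have hs := s_le hh hgh
  rw [← hs₁] at hs
  have hq := abs_q_mul_τ_le hh hgh
  rw [← hQ] at hq
  have hτ1 := one_div_τ_le (g := g)
  have hspos := s_pos (g := g)
  have hu₀L : ‖u₀‖ ≤ L := by linarith
  have hu₁' : ‖g.startCoeff‖ * ‖u₁ - u₀‖ ≤ V / 2 := by
    refine hu₁.trans ?_
    rw [hV]
    calc _ ≤ 1 / 2 * (4 * s₁ * L + |lam| * L ^ 3) := by gcongr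
      _ = _ := by ring
  have hd0 : ‖u₁ - u₀‖ ≤ V / 2 * g.τ := by
    have := (mul_le_mul_of_nonneg_right hτ1 (norm_nonneg (u₁ - u₀))).trans hu₁'
    rw [one_div, ← div_eq_inv_mul, div_le_iff₀ hτ] at this
    exact this
  have hAd : ‖g.A (u₁ - u₀)‖ ≤ V * (1 / 2 + s₁ + Q) := by
    refine (norm_A_le _).trans ?_
    have h1 : (2 * g.s) * ‖u₁ - u₀‖ ≤ (2 * s₁) * (V / 2 * 1) := by
      gcongr
      exact hd0.trans (by gcongr; linarith)
    have h2 : (2 * |g.q|) * ‖u₁ - u₀‖ ≤ V * Q := by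
      calc _ ≤ (2 * |g.q|) * (V / 2 * g.τ) := by gcongr
        _ = V * (|g.q| * g.τ) := by ring
        _ ≤ V * (g.ε * Q) := by gcongr
        _ ≤ V * (1 * Q) := by gcongr; exact g.ε_le
        _ = _ := by ring
    linarith
  have hdd : ‖u₁ - u₀‖ ≤ D * g.τ := hd0.trans (by gcongr; linarith)
  refine exists_coarse_solution_of hg (γ := δ * Γ) hD0 (by positivity) hL hu₀ hdd ?_ ?_ ?_ ?_ ?_ ?_ N hN
  · refine le_of_mul_le_mul_right ?_ hτ
    have := (hδ1 X₁ (by linarith)).2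
    have h2 : g.τ * X₁ ≤ δ * X₁ := by gcongr
    rw [hX₁] at this h2
    linarith
  · have h1 : 24 * |lam| * L ^ 2 / g.m * (T / g.τ) = 24 * |lam| * L ^ 2 * T / c := by
      rw [← hmτ]; field_simp
    have h2 : g.m * (D * g.τ) = c * D := by rw [← hmτ]; ring
    rw [h1, h2]
    refine le_trans ?_ hDE
    gcongr
    rw [hE]
    gcongr
    refine hd0.trans ?_
    calc V / 2 * g.τ ≤ V / 2 * 1 := by gcongr; linarith
      _ = _ := by ring
  · intro x
    refine (τ_sq_mul_norm_A_le hh hgh x).trans (mul_le_mul_of_nonneg_right ?_ (norm_nonneg _))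
    rw [hΓ, hs₁, hQ, hgw]
    have hτ1 : g.τ ≤ 1 := hτδ.trans hδle
    have h1 : g.ε ^ 2 ≤ δ * 1 := by
      rw [sq]; exact mul_le_mul hεδ g.ε_le hε.le hδ0.le
    have h2 : |w| * g.τ ≤ δ * |w| := by rw [mul_comm]; gcongr
    have h3 : 2 / h₀ ^ 2 * g.τ ^ 2 ≤ 2 / h₀ ^ 2 * δ := by
      gcongr
      rw [sq]
      calc g.τ * g.τ ≤ δ * 1 := mul_le_mul hτδ hτ1 hτ.le hδ0.le
        _ = δ := mul_one _
    have h4 : 2 * g.ε / h₀ * g.τ ≤ 2 * δ / h₀ * 1 := by gcongr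
    calc _ ≤ δ * 1 + δ * |w| + 2 / h₀ ^ 2 * δ + 2 * δ / h₀ * 1 := by linarith
      _ = _ := by ring
  · have h1 := (hδ1 X₂ (by linarith)).1
    refine le_trans ?_ h1
    rw [hX₂]
    have h2 : |g.q| * g.τ ≤ δ * Q := hq.trans (by gcongr)
    calc _ ≤ 4 * (δ * Q) * L ^ 2 + 2 * (L * D * (δ * Γ)) + 6 * |lam| * T * L ^ 3 * (D * δ) := by gcongr
      _ = _ := by ring
  · have h1 := (hδ1 D (by linarith)).1
    calc D * g.τ ≤ D * δ := by gcongr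
      _ = δ * D := mul_comm _ _
      _ ≤ 1 := h1
  · rw [hmτ]
    refine le_trans ?_ (hδ1 X₃ (by linarith)).2
    rw [hX₃]
    calc _ ≤ δ * Γ * D + (4 * s₁ * L + 9 * |lam| * L ^ 3) * δ := by gcongr
      _ = _ := by ring

/-- Uniformly bounded solutions of the leapfrog scheme for a bounded number of steps. -/
lemma exists_leapfrog_solution_of_steps {κ w T L₀ τ₀ : ℝ} (lam : ℝ) (hκ : κ ≠ 0) (hw : w ≠ 0) (hT : 0 < T)
    (hh : 0 < h₀) (hτ₀ : 0 < τ₀) (hL₀ : 0 ≤ L₀) (n : ℕ) : ∃ L, 0 ≤ L ∧ ∀ g : Disc, g.κ = κ → g.w = w →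
      g.σ = 0 → h₀ ≤ g.h → τ₀ ≤ g.τ → g.τ ≤ T → g.CFL → ∀ u₀ u₁ : SeqSpace, ‖u₀‖ ≤ L₀ →
      ‖g.startCoeff‖ * ‖u₁ - u₀‖ ≤ 1 / 2 * (4 * g.s * ‖u₀‖ + |lam| * ‖u₀‖ ^ 3) →
      ∃ u : ℕ → SeqSpace, u 0 = u₀ ∧ u 1 = u₁ ∧
        g.Solves lam (n + 1) u ∧ ∀ k ≤ n + 1, ‖u k‖ ≤ L := by
  induction n with
  | zero =>
    refine ⟨L₀ + T * (1 / 2 * (4 * (1 / h₀ ^ 2) * L₀ + |lam| * L₀ ^ 3)), by positivity, ?_⟩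
    intro g _ _ _ hgh _ hτT _ u₀ u₁ hu₀ hu₁
    refine ⟨fun k => if k = 0 then u₀ else u₁, rfl, rfl, fun k hk => by omega, fun k hk => ?_⟩
    have hτ := g.τ_pos
    have hs := s_le hh hgh
    have h1 : ‖u₁‖ ≤ ‖u₀‖ + ‖u₁ - u₀‖ := by
      calc ‖u₁‖ = ‖u₀ + (u₁ - u₀)‖ := by rw [add_sub_cancel]
        _ ≤ _ := norm_add_le _ _
    have h2 : ‖u₁ - u₀‖ ≤ T * (1 / 2 * (4 * (1 / h₀ ^ 2) * L₀ + |lam| * L₀ ^ 3)) := by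
      have h3 := (mul_le_mul_of_nonneg_right (one_div_τ_le (g := g)) (norm_nonneg (u₁ - u₀))).trans hu₁
      rw [one_div, ← div_eq_inv_mul, div_le_iff₀ hτ] at h3
      refine h3.trans ?_
      rw [mul_comm]
      have := s_pos (g := g)
      gcongr
    have h3 := norm_nonneg (u₁ - u₀)
    dsimp only
    split_ifs <;> linarith
  | succ n ih =>
    obtain ⟨L, hL0, ih⟩ := ih
    obtain ⟨Γ, hΓ⟩ : ∃ Γ, Γ = (1 + |w| * T + 2 / h₀ ^ 2 * T ^ 2 + 2 / h₀ * T) / τ₀ ^ 2 := ⟨_, rfl⟩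
    have hΓ0 : 0 ≤ Γ := by rw [hΓ]; positivity
    obtain ⟨L', hL'⟩ : ∃ L', L' = T / |κ / w| * ((2 * (Γ * L) + 4 * (1 / h₀ ^ 2) * L) + Γ * L
      + |lam| * (9 * L ^ 3)) := ⟨_, rfl⟩
    have hL'0 : 0 ≤ L' := by rw [hL']; positivity
    refine ⟨L + L', by positivity, ?_⟩
    intro g hgκ hgw hσ hgh hgτ hτT hg u₀ u₁ hu₀ hu₁
    obtain ⟨u, hu0', hu1', hu, huL⟩ := ih g hgκ hgw hσ hgh hgτ hτT hg u₀ u₁ hu₀ hu₁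
    have hτ := g.τ_pos
    have hε := g.ε_pos
    have hm := g.m_pos
    have hs := s_le hh hgh
    have hyL := huL (n + 1) le_rfl
    have hzL := huL n (by omega)
    have hA : ∀ x : SeqSpace, ‖x‖ ≤ L → ‖g.A x‖ ≤ Γ * L := by
      intro x hx
      have h1 := τ_sq_mul_norm_A_le hh hgh x
      rw [hΓ, div_mul_eq_mul_div, le_div_iff₀ (by positivity), mul_comm]
      calc τ₀ ^ 2 * ‖g.A x‖ ≤ g.τ ^ 2 * ‖g.A x‖ := by gcongr
        _ ≤ _ := h1
        _ ≤ (1 ^ 2 + |w| * T + 2 / h₀ ^ 2 * T ^ 2 + 2 * 1 / h₀ * T) * L := by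
          rw [hgw]; gcongr <;> exact g.ε_le
        _ = _ := by ring
    obtain ⟨v, hv⟩ := surjective_A hg
      (g.b (u (n + 1)) - g.A' (u n) - (lam : ℂ) • g.G 0 (u (n + 1)) (u n))
    -- For σ = 0 the nonlinearity ignores the new level: the step is a linear solve and needs no
    -- smallness.
    have hG : g.G v (u (n + 1)) (u n) = g.G 0 (u (n + 1)) (u n) := by
      refine ext_apply fun j => ?_
      simp [G_apply, cubic, hσ]
    have hvL : ‖v‖ ≤ L' := by
      have h1 := norm_A_ge hg v
      have h2 : ‖g.A v‖ ≤ (2 * (Γ * L) + 4 * (1 / h₀ ^ 2) * L) + Γ * L + |lam| * (9 * L ^ 3) := by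
        rw [hv]
        refine (norm_sub_le _ _).trans (add_le_add ((norm_sub_le _ _).trans (add_le_add ?_ ?_)) ?_)
        · refine (norm_b_le _).trans (add_le_add ?_ ?_)
          · have := hA _ hyL; linarith
          · gcongr
        · rw [g.twoStepOps.norm_adj]; exact hA _ hzL
        · rw [norm_smul, Complex.norm_real, Real.norm_eq_abs]
          gcongr
          exact norm_G_le_of_norm_le (by simpa using hL0) hyL hzL
      have h3 : |κ / w| / T ≤ g.m := by
        unfold m; rw [hgκ, hgw]; gcongr
      have h4 : |κ / w| / T * ‖v‖ ≤ _ := (mul_le_mul_of_nonneg_right h3 (norm_nonneg v)).trans (h1.trans h2)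
      rw [hL', div_mul_eq_mul_div, le_div_iff₀ (by positivity)]
      rw [div_mul_eq_mul_div, div_le_iff₀ hT] at h4
      linarith
    refine ⟨fun k => if k ≤ n + 1 then u k else v, by simpa using hu0', by simpa using hu1', ?_, ?_⟩
    · intro k hk
      rcases Nat.lt_or_ge k n with h | h
      · simp only [if_pos (show k + 2 ≤ n + 1 by omega), if_pos (show k + 1 ≤ n + 1 by omega),
          if_pos (show k ≤ n + 1 by omega)]
        exact hu k (by omega)
      · obtain rfl : k = n := by omega
        simp only [if_neg (show ¬ k + 2 ≤ k + 1 by omega), if_pos (show k + 1 ≤ k + 1 by omega),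
          if_pos (show k ≤ k + 1 by omega)]
        rw [resid, hv, hG]
        abel
    · intro k hk
      dsimp only
      split_ifs with h
      · have := huL k h; linarith
      · linarith

/-- Uniformly bounded solutions of the leapfrog scheme on coarse grids. -/
theorem exists_coarse_leapfrog_solution {κ w T L₀ : ℝ} (lam : ℝ) (hκ : κ ≠ 0) (hw : w ≠ 0) (hT : 0 < T)
    (hh : 0 < h₀) (hL₀ : 0 ≤ L₀) : ∃ δ > 0, ∃ L, ∀ g : Disc, g.κ = κ → g.w = w → g.σ = 0 → h₀ ≤ g.h →
      g.ε ≤ δ → g.CFL → ∀ u₀ u₁ : SeqSpace, ‖u₀‖ ≤ L₀ →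
      ‖g.startCoeff‖ * ‖u₁ - u₀‖ ≤ 1 / 2 * (4 * g.s * ‖u₀‖ + |lam| * ‖u₀‖ ^ 3) →
      ∀ N : ℕ, (N + 1 : ℕ) * g.τ ≤ T → ∃ u : ℕ → SeqSpace, u 0 = u₀ ∧ u 1 = u₁ ∧
        g.Solves lam (N + 1) u ∧ ∀ k ≤ N + 1, ‖u k‖ ≤ L := by
  obtain ⟨δ, hδ, hsmall⟩ := exists_coarse_solution lam hκ hw hT hh hL₀
  obtain ⟨L, -, hL⟩ := exists_leapfrog_solution_of_steps lam hκ hw hT hh hδ hL₀ ⌊T / δ⌋₊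
  refine ⟨δ, hδ, max L (L₀ + 2), ?_⟩
  intro g hgκ hgw hσ hgh hgε hg u₀ u₁ hu₀ hu₁ N hN
  -- Time steps of size at least δ number at most T/δ, and boundedly many linear solves give a
  -- bound.
  rcases le_total g.τ δ with h | h
  · obtain ⟨u, h0, h1, h2, h3⟩ := hsmall g hgκ hgw hgh h hgε hg u₀ u₁ hu₀ hu₁ N hN
    exact ⟨u, h0, h1, h2, fun k hk => (h3 k hk).trans (le_max_right _ _)⟩
  · have hτ := g.τ_pos
    have hτT : g.τ ≤ T := by
      refine le_trans ?_ hN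
      push_cast
      nlinarith [Nat.cast_nonneg (α := ℝ) N]
    obtain ⟨u, h0, h1, h2, h3⟩ := hL g hgκ hgw hσ hgh h hτT hg u₀ u₁ hu₀ hu₁
    have hNn : N ≤ ⌊T / δ⌋₊ := by
      refine Nat.le_floor ?_
      rw [le_div_iff₀ hδ]
      refine le_trans ?_ hN
      push_cast
      nlinarith [Nat.cast_nonneg (α := ℝ) N]
    exact ⟨u, h0, h1, fun k hk => h2 k (by omega),
      fun k hk => (h3 k (by omega)).trans (le_max_left _ _)⟩

end Disc

end CoarseConstants


/-! ### Numerical solutions in slowly varying variables -/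

section Gauge

open SeqSpace

namespace Disc

variable {g : Disc} {lam T : ℝ}

/-- The oscillatory phase at time level `n` and grid point `x₀ + j h`. -/
noncomputable def phase (g : Disc) (x₀ : ℝ) (n : ℕ) (j : ℤ) : ℂ :=
  cis (g.κ * (x₀ + j * g.h) / g.ε) * cis (n * alphaPar g.κ g.w g.ε g.τ)

variable {x₀ : ℝ}

lemma norm_phase (n : ℕ) (j : ℤ) : ‖g.phase x₀ n j‖ = 1 := by
  rw [phase, norm_mul, norm_cis, norm_cis, one_mul]

lemma phase_ne_zero (n : ℕ) (j : ℤ) : g.phase x₀ n j ≠ 0 := by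
  rw [← norm_ne_zero_iff, norm_phase]; exact one_ne_zero

lemma phase_add_one (n : ℕ) (j : ℤ) :
    g.phase x₀ n (j + 1) = g.phase x₀ n j * cis (betaPar g.κ g.ε g.h) := by
  simp only [phase, ← cis_add]
  congr 1
  unfold betaPar
  push_cast
  ring

lemma phase_succ (n : ℕ) (j : ℤ) :
    g.phase x₀ (n + 1) j = g.phase x₀ n j * cis (alphaPar g.κ g.w g.ε g.τ) := by
  simp only [phase, ← cis_add]
  congr 1
  push_cast
  ring

lemma phase_eq_succ (n : ℕ) (j : ℤ) :
    g.phase x₀ n j = g.phase x₀ (n + 1) j * cis (-alphaPar g.κ g.w g.ε g.τ) := by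
  rw [phase_succ, mul_assoc, mul_comm (cis _), cis_neg_mul, mul_one]

lemma phase_zero (j : ℤ) : g.phase x₀ 0 j = cis (g.κ * (x₀ + j * g.h) / g.ε) := by
  rw [phase]; simp [cis]

lemma dominantTerm_eq (a : ℝ → ℝ → ℂ) (n : ℕ) (j : ℤ) :
    dominantTerm g.κ (vartheta g.κ g.w) g.ε a (n * g.τ) (x₀ + j * g.h)
      = a (n * g.τ) (x₀ + j * g.h) * g.phase x₀ n j := by
  rw [dominantTerm, phase, mul_assoc]
  congr 3
  unfold alphaPar
  ring

/-- The numerical scheme after elimination of the oscillatory phase. -/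
structure IsGridSolution (g : Disc) (lam T : ℝ) (f : ℤ → ℂ) (u : ℕ → ℤ → ℂ) : Prop where
  init : u 0 = f
  start : ∀ j, g.startFn lam (u 0) (u 1) j = 0
  steps : ∀ n : ℕ, ((n + 2 : ℕ) : ℝ) * g.τ ≤ T → ∀ j, g.stepFn lam (u (n + 2)) (u (n + 1)) (u n) j = 0
  bounded : ∀ n : ℕ, (n : ℝ) * g.τ ≤ T → ∃ B : ℝ, ∀ j, ‖u n j‖ ≤ B

/-- The phase has modulus one, so moduli and boundedness are unchanged. Existence and error bounds
can be proved for u alone. -/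
lemma isNumericalSolution_iff
    {step : ℝ → ℝ → ℝ → ℝ → ℝ → ℝ → (ℤ → ℂ) → (ℤ → ℂ) → (ℤ → ℂ) → Prop}
    (hstep : (step = LeapfrogStep ∧ g.σ = 0) ∨ (step = CrankNicolsonStep ∧ g.σ = 1 / 2))
    {p u : ℕ → ℤ → ℂ} (hp : ∀ n j, p n j = u n j * g.phase x₀ n j) (A : ℝ → ℂ) :
    IsNumericalSolution step g.κ lam g.w T g.ε g.τ g.h x₀ A p
      ↔ g.IsGridSolution lam T (fun j => A (x₀ + j * g.h)) u := by
  have hnorm : ∀ n j, ‖p n j‖ = ‖u n j‖ := fun n j => by rw [hp, norm_mul, norm_phase, mul_one]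
  have hinit : (∀ j : ℤ, p 0 j = A (x₀ + j * g.h) * cis (g.κ * (x₀ + j * g.h) / g.ε))
      ↔ u 0 = fun j : ℤ => A (x₀ + j * g.h) := by
    rw [funext_iff]
    refine forall_congr' fun j => ?_
    rw [hp, ← phase_zero]
    exact mul_left_inj' (phase_ne_zero 0 j)
  have hstart : StartingStep g.κ lam g.w g.ε g.τ g.h (p 0) (p 1)
      ↔ ∀ j, g.startFn lam (u 0) (u 1) j = 0 :=
    startingStep_iff (P := g.phase x₀ 0) (norm_phase 0) (phase_add_one 0) (hp 0)
      (fun j => by rw [hp, phase_succ])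
  have hsteps : ∀ n, step g.κ lam g.w g.ε g.τ g.h (p n) (p (n + 1)) (p (n + 2))
      ↔ ∀ j, g.stepFn lam (u (n + 2)) (u (n + 1)) (u n) j = 0 := by
    intro n
    rcases hstep with ⟨rfl, hσ⟩ | ⟨rfl, hσ⟩
    · exact leapfrogStep_iff hσ (P := g.phase x₀ (n + 1)) (norm_phase _) (phase_add_one _)
        (fun j => by rw [hp, ← phase_eq_succ]) (hp _) (fun j => by rw [hp, phase_succ])
    · exact crankNicolsonStep_iff hσ (P := g.phase x₀ (n + 1)) (norm_phase _) (phase_add_one _)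
        (fun j => by rw [hp, ← phase_eq_succ]) (hp _) (fun j => by rw [hp, phase_succ])
  constructor
  · intro h
    refine ⟨hinit.1 h.init, hstart.1 h.start, fun n hn => (hsteps n).1 (h.steps n hn), fun n hn => ?_⟩
    obtain ⟨B, hB⟩ := h.bounded n hn
    exact ⟨B, fun j => by rw [← hnorm]; exact hB j⟩
  · intro h
    refine ⟨hinit.2 h.init, hstart.2 h.start, fun n hn => (hsteps n).2 (h.steps n hn), fun n hn => ?_⟩
    obtain ⟨B, hB⟩ := h.bounded n hn
    exact ⟨B, fun j => by rw [hnorm]; exact hB j⟩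

lemma resid_apply (x y z : SeqSpace) (j : ℤ) : g.resid lam x y z j = g.stepFn lam x y z j :=
  (g.stepFn_eq lam x y z j).symm

/-- Square summable solutions are grid solutions. -/
lemma isGridSolution_of_solves {N : ℕ} {U : ℕ → SeqSpace} {f : ℤ → ℂ} (h0 : ∀ j, U 0 j = f j)
    (hN : T < (N + 1 : ℕ) * g.τ) (hstart : ∀ j, g.startFn lam (U 0) (U 1) j = 0)
    (hU : g.Solves lam N U) : g.IsGridSolution lam T f (fun n j => U n j) where
  init := funext h0
  start := hstart
  steps n hn j := by
    have h1 : n + 2 ≤ N := by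
      have h2 : ((n + 2 : ℕ) : ℝ) < ((N + 1 : ℕ) : ℝ) :=
        lt_of_mul_lt_mul_right (hn.trans_lt hN) g.τ_pos.le
      have h3 : n + 2 < N + 1 := by exact_mod_cast h2
      omega
    have h2 := hU n h1
    rw [← resid_apply, h2]
    rfl
  bounded n _ := ⟨‖U n‖, fun j => norm_apply_le _ _⟩

/-- Grid solutions with square summable initial values are square summable. -/
lemma IsGridSolution.exists_solves (hg : g.CFL) {N : ℕ} {f : ℤ → ℂ} {u : ℕ → ℤ → ℂ}
    (hu : g.IsGridSolution lam T f u) (hN : N * g.τ ≤ T) (y : SeqSpace) (hy : ∀ j, y j = f j)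
    (hsmall : g.σ = 0 ∨ ∃ B, (∀ n ≤ N, ∀ j, ‖u n j‖ ≤ B) ∧ |lam| * B ^ 2 < g.m) :
    ∃ U : ℕ → SeqSpace, U 0 = y ∧ (∀ j, g.startFn lam (U 0) (U 1) j = 0) ∧
      (∀ n ≤ N, ∀ j, U n j = u n j) ∧ g.Solves lam N U := by
  have hy0 : (fun j => y j) = u 0 := by rw [hu.init]; exact funext hy
  have hτ := g.τ_pos
  have hle : ∀ n ≤ N, (n : ℝ) * g.τ ≤ T := fun n hn => by
    refine le_trans ?_ hN
    gcongr
  -- Level 1 is included even when N = 0, because the starting step is imposed regardless of T.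
  have hmem : ∀ n, n ≤ N ∨ n = 1 → ∃ x : SeqSpace, ∀ j, x j = u n j := by
    intro n
    induction n using Nat.strong_induction_on with
    | _ n ih =>
      intro hn
      obtain _ | _ | k := n
      · exact ⟨y, fun j => congrFun hy0 j⟩
      · obtain ⟨x, -, hx, -⟩ := exists_start g lam y
        refine ⟨x, hx (u 1) fun j => ?_⟩
        have := hu.start j
        rwa [← hy0] at this
      · have hn : k + 2 ≤ N := by omega
        obtain ⟨y1, hy1⟩ := ih (k + 1) (by omega) (by omega)
        obtain ⟨z1, hz1⟩ := ih k (by omega) (by omega)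
        have hst : ∀ j, g.stepFn lam (u (k + 2)) y1 z1 j = 0 := by
          have e1 : (fun j => y1 j) = u (k + 1) := funext hy1
          have e2 : (fun j => z1 j) = u k := funext hz1
          intro j
          have := hu.steps k (hle _ hn) j
          rwa [← e1, ← e2] at this
        rcases hsmall with hσ | ⟨B, hB, hBm⟩
        · obtain ⟨B, hB⟩ := hu.bounded (k + 2) (hle _ hn)
          exact exists_seq_of_step hg y1 z1 hB hst (Or.inl hσ)
        · exact exists_seq_of_step hg y1 z1 (hB (k + 2) hn) hst
            (Or.inr ⟨fun j => by rw [hz1]; exact hB k (by omega) j, hBm⟩)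
  have hmem' : ∀ n, ∃ x : SeqSpace, n ≤ N ∨ n = 1 → ∀ j, x j = u n j := by
    intro n
    by_cases h : n ≤ N ∨ n = 1
    · obtain ⟨x, hx⟩ := hmem n h
      exact ⟨x, fun _ => hx⟩
    · exact ⟨0, fun h' => absurd h' h⟩
  choose U hU using hmem'
  have hUf : ∀ n, n ≤ N ∨ n = 1 → (fun j => U n j) = u n := fun n hn => funext (hU n hn)
  refine ⟨U, ext_apply fun j => ?_, ?_, fun n hn => hU n (Or.inl hn), fun k hk => ext_apply fun j => ?_⟩
  · rw [hU 0 (Or.inl (by omega)), ← hy0]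
  · have := hu.start
    rwa [← hUf 0 (Or.inl (by omega)), ← hUf 1 (Or.inr rfl)] at this
  · rw [resid_apply]
    have := hu.steps k (hle _ hk) j
    rwa [← hUf (k + 2) (by omega), ← hUf (k + 1) (by omega), ← hUf k (by omega)] at this

/-- Uniqueness for the leapfrog scheme. -/
lemma solves_unique (hg : g.CFL) (hσ : g.σ = 0) {N : ℕ} {U U' : ℕ → SeqSpace} (h0 : U 0 = U' 0)
    (hs : ∀ j, g.startFn lam (U 0) (U 1) j = 0) (hs' : ∀ j, g.startFn lam (U' 0) (U' 1) j = 0)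
    (hU : g.Solves lam N U) (hU' : g.Solves lam N U') {n : ℕ} (hn : n ≤ N) : U n = U' n := by
  have h1 : U 1 = U' 1 := by
    obtain ⟨x, -, hx, -⟩ := exists_start g lam (U 0)
    rw [← h0] at hs'
    exact ext_apply fun j => (hx _ hs j).symm.trans (hx _ hs' j)
  induction n using Nat.strong_induction_on with
  | _ n ih =>
    obtain _ | _ | k := n
    · exact h0
    · exact h1
    · have e := hU k hn
      have e' := hU' k hn
      rw [← ih (k + 1) (by omega) (by omega), ← ih k (by omega) (by omega)] at e'
      have hG : g.G (U (k + 2)) (U (k + 1)) (U k) = g.G (U' (k + 2)) (U (k + 1)) (U k) :=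
        ext_apply fun j => by simp [G_apply, cubic, hσ]
      refine injective_A hg ?_
      unfold resid at e e'
      rw [hG, ← e', ← sub_eq_zero] at e
      rw [← sub_eq_zero, ← e]
      abel

lemma Approx.mono {M K η : ℝ} {N : ℕ} {a : ℕ → SeqSpace} (ha : g.Approx lam M η N a) (h : M ≤ K) :
    g.Approx lam K η N a where
  bound n hn j := (ha.bound n hn j).trans h
  diff n hn j := (ha.diff n hn j).trans (mul_le_mul_of_nonneg_right h g.h_pos.le)
  res := ha.res
  res_fwd := ha.res_fwd

/-- With |α| = τ/(|w|ε²) and |β| = |κ|h/ε, the two cases of the stability condition become 2τ ≤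
|w|h² and τ ≤ |w|εh. -/
lemma cfl_of_stability (hw : |g.w| = freq g.κ) (h : StabilityCondition g.κ g.ε g.τ g.h) :
    g.CFL := by
  have hε := g.ε_pos
  have hh := g.h_pos
  have hτ := g.τ_pos
  have hκ := g.κ_ne
  have hw0 : 0 < |g.w| := by have := one_le_abs_w (g := g); linarith
  have hα : |alphaPar g.κ (freq g.κ) g.ε g.τ| = g.τ / (|g.w| * g.ε ^ 2) := by
    have e : vartheta g.κ (freq g.κ) = -(1 / |g.w|) := by
      rw [← hw, vartheta, groupVel]
      have := g.w_sq
      have h2 := sq_abs g.w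
      field_simp
      linarith
    rw [alphaPar, e, abs_div, abs_mul, abs_neg, abs_of_pos (show 0 < 1 / |g.w| by positivity),
      abs_of_pos hτ, abs_of_pos (show 0 < g.ε ^ 2 by positivity)]
    field_simp
  have hβ : |betaPar g.κ g.ε g.h| = |g.κ| * g.h / g.ε := by
    rw [betaPar, abs_div, abs_mul, abs_of_pos hh, abs_of_pos hε]
  have hκ0 : 0 < |g.κ| := abs_pos.2 hκ
  right
  rcases le_or_gt 1 |betaPar g.κ g.ε g.h| with hb | hb
  · right
    have h1 := h.1 hb
    rw [hα, ← sq_abs (betaPar _ _ _), hβ, ← sq_abs g.κ] at h1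
    have e1 : 2 * |g.κ| ^ 2 * (g.τ / (|g.w| * g.ε ^ 2)) = |g.κ| ^ 2 / g.ε ^ 2 * (2 * g.τ / |g.w|) := by
      field_simp
    have e2 : (|g.κ| * g.h / g.ε) ^ 2 = |g.κ| ^ 2 / g.ε ^ 2 * g.h ^ 2 := by field_simp
    rw [e1, e2] at h1
    have h2 := le_of_mul_le_mul_left h1 (by positivity)
    rw [div_le_iff₀ hw0] at h2
    linarith
  · left
    have h1 := h.2 hb
    rw [hα, hβ] at h1
    have e1 : |g.κ| * (g.τ / (|g.w| * g.ε ^ 2)) = |g.κ| / g.ε * (g.τ / (|g.w| * g.ε)) := by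
      field_simp
    have e2 : |g.κ| * g.h / g.ε = |g.κ| / g.ε * g.h := by field_simp
    rw [e1, e2] at h1
    have h2 := le_of_mul_le_mul_left h1 (by positivity)
    rw [div_le_iff₀ (by positivity)] at h2
    linarith

end Disc

/-- Samples of a bounded compactly supported function form a square summable sequence. -/
lemma exists_samples {f : ℝ → ℂ} {M R h : ℝ} (hM : 0 ≤ M) (hh : 0 < h) (hf : ∀ ξ, ‖f ξ‖ ≤ M)
    (hR : Function.support f ⊆ Icc (-R) R) (x₀ : ℝ) : ∃ y : SeqSpace,
      (∀ j : ℤ, y j = f (x₀ + j * h)) ∧ ‖y‖ ≤ Real.sqrt (2 * |R| / h + 1) * M := by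
  refine exists_of_sum_le (by positivity) fun F => ?_
  rw [mul_pow, Real.sq_sqrt (by positivity)]
  -- The indices of the grid points in [-|R|, |R|]; there are at most 2|R|/h + 1 of them for every
  -- offset.
  set I := Finset.Icc ⌈(-|R| - x₀) / h⌉ ⌊(|R| - x₀) / h⌋ with hI
  have hcard : ((I.card : ℕ) : ℝ) ≤ 2 * |R| / h + 1 := by
    rw [hI, Int.card_Icc]
    have h1 := Int.floor_le ((|R| - x₀) / h)
    have h2 := Int.le_ceil ((-|R| - x₀) / h)
    have e : (|R| - x₀) / h - (-|R| - x₀) / h = 2 * |R| / h := by ring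
    have h3 : ((⌊(|R| - x₀) / h⌋ + 1 - ⌈(-|R| - x₀) / h⌉ : ℤ) : ℝ) ≤ 2 * |R| / h + 1 := by
      push_cast; linarith
    have h4 : (((⌊(|R| - x₀) / h⌋ + 1 - ⌈(-|R| - x₀) / h⌉).toNat : ℤ) : ℝ)
        = max ((⌊(|R| - x₀) / h⌋ + 1 - ⌈(-|R| - x₀) / h⌉ : ℤ) : ℝ) 0 := by
      rw [Int.toNat_eq_max]; push_cast; rfl
    rw [Int.cast_natCast] at h4
    rw [h4]
    exact max_le h3 (by positivity)
  calc ∑ j ∈ F, ‖f (x₀ + j * h)‖ ^ 2 ≤ ∑ j ∈ F, if j ∈ I then M ^ 2 else 0 := by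
        refine Finset.sum_le_sum fun j _ => ?_
        split_ifs with hj
        · have := hf (x₀ + j * h)
          gcongr
        · have : f (x₀ + j * h) = 0 := by
            by_contra hne
            have h1 := hR hne
            refine hj ?_
            rw [hI, Finset.mem_Icc, Int.ceil_le, Int.le_floor, div_le_iff₀ hh, le_div_iff₀ hh]
            have := le_abs_self R
            exact ⟨by linarith [h1.1], by linarith [h1.2]⟩
          rw [this]; simp
    _ = ∑ j ∈ F with j ∈ I, M ^ 2 := (Finset.sum_filter _ _).symm
    _ ≤ ∑ j ∈ I, M ^ 2 := by
        refine Finset.sum_le_sum_of_subset_of_nonneg ?_ fun _ _ _ => sq_nonneg _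
        intro j hj
        exact (Finset.mem_filter.1 hj).2
    _ = I.card * M ^ 2 := by rw [Finset.sum_const, nsmul_eq_mul]
    _ ≤ _ := by gcongr

end Gauge


/-! ### Convergence and existence for both schemes -/

section Convergence

open SeqSpace

/-- The data of one of the two nonlinear Schrödinger initial value problems. -/
structure IsAmplitude (κ lam w T M R : ℝ) (a₀ b₀ : ℝ → ℂ) (a : ℝ → ℝ → ℂ) : Prop where
  supp_a : Function.support a₀ ⊆ Icc (-R) R
  supp_b : Function.support b₀ ⊆ Icc (-R) R
  nls : IsNLSSolution κ lam w T a₀ b₀ a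
  bdd : HasBoundedDerivs 20 M T a

namespace IsAmplitude

variable {κ lam w T M R : ℝ} {a₀ b₀ : ℝ → ℂ} {a : ℝ → ℝ → ℂ}

lemma norm_le (ha : IsAmplitude κ lam w T M R a₀ b₀ a) {t : ℝ} (ht : t ∈ Icc 0 T) (ξ : ℝ) :
    ‖a t ξ‖ ≤ M := by
  have := ha.bdd.2 0 (by norm_num) (t, ξ) ⟨ht, mem_univ _⟩
  rwa [norm_iteratedFDerivWithin_zero] at this

lemma support_subset (ha : IsAmplitude κ lam w T M R a₀ b₀ a) : Function.support (a 0) ⊆ Icc (-R) R := by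
  intro ξ hξ
  by_contra hc
  refine hξ ?_
  have h1 : a₀ ξ = 0 := by
    by_contra h; exact hc (ha.supp_a h)
  have h2 : b₀ ξ = 0 := by
    by_contra h; exact hc (ha.supp_b h)
  rw [ha.nls.init, profile, h1, h2]
  simp

lemma exists_initial (ha : IsAmplitude κ lam w T M R a₀ b₀ a) (hT : 0 < T) (hM : 0 ≤ M) {h h₀ : ℝ}
    (hh₀ : 0 < h₀) (hh : h₀ ≤ h) (x₀ : ℝ) : ∃ y : SeqSpace,
      (∀ j : ℤ, y j = a 0 (x₀ + j * h)) ∧ ‖y‖ ≤ Real.sqrt (2 * |R| / h₀ + 1) * M := by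
  obtain ⟨y, hy, hy'⟩ := exists_samples hM (hh₀.trans_le hh) (ha.norm_le ⟨le_rfl, hT.le⟩)
    ha.support_subset x₀
  exact ⟨y, hy, hy'.trans (by gcongr)⟩

end IsAmplitude

namespace Disc

lemma m_mul_τ (g : Disc) : g.m * g.τ = |g.κ / g.w| := by
  have := g.τ_pos
  unfold m; field_simp

/-- Both the starting energy and the N accumulated defects are of size Cd/(τ√h), because Nτ ≤ T. The
factor 1/τ is later cancelled by m. -/
lemma energy₁_zero_le_of_start {g : Disc} {C d E T : ℝ} {N : ℕ} (hE : g.τ * E ≤ C * d / Real.sqrt g.h)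
    (hN : N * g.τ ≤ T) (hCd : 0 ≤ C * d / Real.sqrt g.h) :
    E + 4 * N * (C * d / Real.sqrt g.h) ≤ (1 + 4 * T) * (C * d) / (g.τ * Real.sqrt g.h) := by
  have hτ := g.τ_pos
  have hh : 0 < Real.sqrt g.h := Real.sqrt_pos.2 g.h_pos
  refine le_of_mul_le_mul_left ?_ hτ
  have e : g.τ * ((1 + 4 * T) * (C * d) / (g.τ * Real.sqrt g.h))
      = (1 + 4 * T) * (C * d / Real.sqrt g.h) := by field_simp
  rw [e]
  have := mul_le_mul_of_nonneg_right hN hCd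
  linarith

end Disc

/-- Second order convergence for uniformly bounded solutions. -/
theorem exists_error_bound {κ w T M K : ℝ} (lam R : ℝ) (hκ : κ ≠ 0) (hw : w ≠ 0) (hT : 0 < T) (hMK : M ≤ K) :
    ∃ C, 0 ≤ C ∧ ∀ (a₀ b₀ : ℝ → ℂ) (a : ℝ → ℝ → ℂ), IsAmplitude κ lam w T M R a₀ b₀ a →
      ∀ g : Disc, g.κ = κ → g.w = w → g.h ≤ 1 → g.CFL → 60 * |lam| * K ^ 2 * g.τ ≤ |κ / w| →
      ∀ (x₀ : ℝ) (N : ℕ) (U : ℕ → SeqSpace), N * g.τ ≤ T → (∀ j : ℤ, U 0 j = a 0 (x₀ + j * g.h)) →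
      (∀ j, g.startFn lam (U 0) (U 1) j = 0) → g.Solves lam N U → (∀ n ≤ N, ∀ j, ‖U n j‖ ≤ K) →
      ∀ n ≤ N, ∀ j : ℤ, ‖U n j - a (n * g.τ) (x₀ + j * g.h)‖ ≤ C * (g.τ ^ 2 + g.h ^ 2 + g.ε) := by
  obtain ⟨C₀, hC₀, happ⟩ := exists_approx κ lam w T M R hw hT
  obtain ⟨c, hc⟩ : ∃ c, c = |κ / w| := ⟨_, rfl⟩
  have hc0 : 0 < c := by rw [hc]; positivity
  obtain ⟨X, hX⟩ : ∃ X, X = Real.exp (120 * |lam| * K ^ 2 * T / c) := ⟨_, rfl⟩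
  have hX0 : 0 < X := by rw [hX]; positivity
  -- The Gronwall factor X times the starting and accumulated defects, divided by c = mτ.
  refine ⟨X * ((1 + 4 * T) * C₀) / c, by positivity, ?_⟩
  intro a₀ b₀ a ha g hgκ hgw hgh hg hτK x₀ N U hN h0 hstart hU hUK n hn j
  obtain ⟨s, hs, hsa, hs1⟩ := happ a₀ b₀ a ha.supp_a ha.supp_b ha.nls ha.bdd g hgκ hgw hgh x₀ N hN
  have hτ := g.τ_pos
  have hε := g.ε_pos
  have hh := g.h_pos
  have hm := g.m_pos
  have hsq : 0 < Real.sqrt g.h := Real.sqrt_pos.2 hh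
  have hmτ : g.m * g.τ = c := by rw [g.m_mul_τ, hgκ, hgw, hc]
  have hU0 : U 0 = s 0 := ext_apply fun j => by
    rw [h0, hs 0 (Nat.zero_le _)]; simp
  obtain ⟨d, hd⟩ : ∃ d, d = g.τ ^ 2 + g.h ^ 2 + g.ε := ⟨_, rfl⟩
  have hd0 : 0 ≤ d := by rw [hd]; positivity
  rw [← hd] at hsa hs1 ⊢
  obtain _ | k := n
  · rw [h0, Nat.cast_zero, zero_mul, sub_self, norm_zero]; positivity
  · have hk : k ≤ N := by omega
    have h1 := Disc.energy₁_le hg (by positivity) (hsa.mono hMK) hU hUK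
      (by
        refine le_of_mul_le_mul_right ?_ hτ
        rw [← hc] at hτK
        linarith) hn
    have h2 := hs1 (by omega) (U 1) (by rwa [← hU0])
    have hkT : (k : ℝ) * g.τ ≤ T := by
      refine le_trans ?_ hN
      gcongr
    have h3 := Disc.energy₁_zero_le_of_start h2 hkT (by positivity)
    rw [hU0, sub_self] at h1
    have h4 : Real.exp (120 * |lam| * K ^ 2 / g.m * k) ≤ X := by
      rw [hX]
      refine Real.exp_le_exp.2 ?_
      calc 120 * |lam| * K ^ 2 / g.m * k = 120 * |lam| * K ^ 2 * (k * g.τ) / c := by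
            rw [← hmτ]; field_simp
        _ ≤ _ := by gcongr
    have h5 := Disc.norm_add_fst_le hg (U (k + 1) - s (k + 1)) (U k - s k)
    have h6 : ‖U (k + 1) - s (k + 1)‖ + ‖fwd g.h (U (k + 1) - s (k + 1))‖
        ≤ X * ((1 + 4 * T) * C₀) / c * d / Real.sqrt g.h := by
      refine le_of_mul_le_mul_left ((h5.trans h1).trans ?_) hm
      have e : g.m * (X * ((1 + 4 * T) * C₀) / c * d / Real.sqrt g.h)
          = X * ((1 + 4 * T) * (C₀ * d) / (g.τ * Real.sqrt g.h)) := by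
        rw [← hmτ]; field_simp
      rw [e]
      exact mul_le_mul h4 h3 (by have := Disc.energy₁_nonneg (g := g) (U 1 - s 1) 0; positivity) hX0.le
    have h7 := Disc.apply_le_of_norm_le hh (by positivity) h6 j
    rw [sub_apply, hs (k + 1) hn] at h7
    refine h7.trans (le_of_eq ?_)
    field_simp

/-- Solutions close to the exact amplitude on fine grids. -/
theorem exists_fine_solution {κ w T M : ℝ} (lam R : ℝ) (hκ : κ ≠ 0) (hw : w ≠ 0) (hT : 0 < T) :
    ∃ δ, 0 < δ ∧ δ ≤ 1 ∧ 60 * |lam| * (M + 1) ^ 2 * δ ≤ |κ / w| ∧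
      ∀ (a₀ b₀ : ℝ → ℂ) (a : ℝ → ℝ → ℂ), IsAmplitude κ lam w T M R a₀ b₀ a →
      ∀ g : Disc, g.κ = κ → g.w = w → g.CFL → g.h ≤ δ → g.τ ≤ δ → g.ε ≤ δ →
      ∀ (x₀ : ℝ) (N : ℕ), 1 ≤ N → N * g.τ ≤ T → ∃ U : ℕ → SeqSpace,
      (∀ j : ℤ, U 0 j = a 0 (x₀ + j * g.h)) ∧ (∀ j, g.startFn lam (U 0) (U 1) j = 0) ∧
      g.Solves lam N U ∧ ∀ n ≤ N, ∀ j, ‖U n j‖ ≤ M + 1 := by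
  obtain ⟨C₀, hC₀, happ⟩ := exists_approx κ lam w T M R hw hT
  obtain ⟨c, hc⟩ : ∃ c, c = |κ / w| := ⟨_, rfl⟩
  have hc0 : 0 < c := by rw [hc]; positivity
  obtain ⟨X, hX⟩ : ∃ X, X = Real.exp (120 * |lam| * (M + 1) ^ 2 * T / c) := ⟨_, rfl⟩
  have hX0 : 0 < X := by rw [hX]; positivity
  -- Y₁ ensures 30|λ|(M+1)² ≤ m/4. Y₂ and Y₃ put the Gronwall bound and the defect below mρ/4 for ρ
  -- = 1/(2√h): there mρ/4 = c/(8τ√h) and d ≤ 3δ, whence 24 = 8 · 3.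
  obtain ⟨Y₁, hY₁⟩ : ∃ Y, Y = 120 * |lam| * (M + 1) ^ 2 := ⟨_, rfl⟩
  obtain ⟨Y₂, hY₂⟩ : ∃ Y, Y = 24 * (X * ((1 + 4 * T) * C₀)) := ⟨_, rfl⟩
  obtain ⟨Y₃, hY₃⟩ : ∃ Y, Y = 24 * C₀ := ⟨_, rfl⟩
  have hY₁0 : 0 ≤ Y₁ := by rw [hY₁]; positivity
  have hY₂0 : 0 ≤ Y₂ := by rw [hY₂]; positivity
  have hY₃0 : 0 ≤ Y₃ := by rw [hY₃]; positivity
  have hden : 0 < 1 + Y₁ + Y₂ + Y₃ := by positivity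
  have hmin : 0 < min 1 c := lt_min one_pos hc0
  obtain ⟨δ, hδ⟩ : ∃ δ, δ = min 1 c / (1 + Y₁ + Y₂ + Y₃) := ⟨_, rfl⟩
  have hδ0 : 0 < δ := by rw [hδ]; positivity
  have hδY : δ * (1 + Y₁ + Y₂ + Y₃) = min 1 c := by rw [hδ]; field_simp
  have hδc : ∀ Y, Y ≤ 1 + Y₁ + Y₂ + Y₃ → δ * Y ≤ c := fun Y hY => by
    have := mul_le_mul_of_nonneg_left hY hδ0.le
    rw [hδY] at this
    exact this.trans (min_le_right _ _)
  have hδ1 : δ ≤ 1 := by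
    have := mul_le_mul_of_nonneg_left (show 1 ≤ 1 + Y₁ + Y₂ + Y₃ by linarith) hδ0.le
    rw [hδY, mul_one] at this
    exact this.trans (min_le_left _ _)
  have hδ₁ := hδc Y₁ (by linarith)
  rw [hY₁] at hδ₁
  refine ⟨δ, hδ0, hδ1, ?_, ?_⟩
  · rw [← hc]
    have : 0 ≤ |lam| * (M + 1) ^ 2 * δ := by positivity
    linarith
  intro a₀ b₀ a ha g hgκ hgw hg hhδ hτδ hεδ x₀ N hN1 hN
  obtain ⟨s, hs, hsa, hs1⟩ := happ a₀ b₀ a ha.supp_a ha.supp_b ha.nls ha.bdd g hgκ hgw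
    (hhδ.trans hδ1) x₀ N hN
  have hτ := g.τ_pos
  have hε := g.ε_pos
  have hh := g.h_pos
  have hm := g.m_pos
  have hsq : 0 < Real.sqrt g.h := Real.sqrt_pos.2 hh
  have hmτ : g.m * g.τ = c := by rw [g.m_mul_τ, hgκ, hgw, hc]
  obtain ⟨d, hd⟩ : ∃ d, d = g.τ ^ 2 + g.h ^ 2 + g.ε := ⟨_, rfl⟩
  have hd0 : 0 ≤ d := by rw [hd]; positivity
  have hdδ : d ≤ 3 * δ := by
    have h1 : g.τ ^ 2 ≤ δ * 1 := by
      rw [sq]; exact mul_le_mul hτδ (hτδ.trans hδ1) hτ.le hδ0.le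
    have h2 : g.h ^ 2 ≤ δ * 1 := by
      rw [sq]; exact mul_le_mul hhδ (hhδ.trans hδ1) hh.le hδ0.le
    rw [hd]; linarith
  rw [← hd] at hsa hs1
  obtain ⟨u₁, hu₁, -, -⟩ := Disc.exists_start g lam (s 0)
  have h2 := hs1 hN1 u₁ hu₁
  have h3 := Disc.energy₁_zero_le_of_start h2 hN (by positivity)
  have h4 : Real.exp (120 * |lam| * (M + 1) ^ 2 / g.m * N) ≤ X := by
    rw [hX]
    refine Real.exp_le_exp.2 ?_
    calc 120 * |lam| * (M + 1) ^ 2 / g.m * N = 120 * |lam| * (M + 1) ^ 2 * (N * g.τ) / c := by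
          rw [← hmτ]; field_simp
      _ ≤ _ := by gcongr
  have hmρ : g.m * (1 / (2 * Real.sqrt g.h)) / 4 = c / 8 / (g.τ * Real.sqrt g.h) := by
    rw [← hmτ]; field_simp; norm_num
  obtain ⟨u, hu0, hu1, hu, huM⟩ := Disc.exists_solution_near hg u₁ (by positivity) hsa
    (by
      refine le_of_mul_le_mul_right ?_ hτ
      have : 120 * |lam| * (M + 1) ^ 2 * g.τ ≤ 120 * |lam| * (M + 1) ^ 2 * δ := by gcongr
      linarith)
    (mul_le_mul h4 h3 (by have := Disc.energy₁_nonneg (g := g) (u₁ - s 1) 0; positivity) hX0.le)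
    (ρ := 1 / (2 * Real.sqrt g.h)) (le_of_eq (by field_simp))
    (by
      rw [hmρ, mul_div_assoc', ]
      refine div_le_div_of_nonneg_right ?_ (by positivity)
      have h5 := hδc Y₂ (by linarith)
      rw [hY₂] at h5
      have h6 : X * ((1 + 4 * T) * (C₀ * d)) ≤ X * ((1 + 4 * T) * (C₀ * (3 * δ))) := by gcongr
      linarith)
    (by
      rw [hmρ, div_le_div_iff₀ hsq (by positivity)]
      have h5 := hδc Y₃ (by linarith)
      rw [hY₃] at h5
      have h6 : C₀ * d * g.τ ≤ C₀ * (3 * δ) * 1 := by gcongr; exact hτδ.trans hδ1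
      have h7 := mul_le_mul_of_nonneg_right (show C₀ * d * g.τ ≤ c / 8 by linarith) hsq.le
      linarith)
  refine ⟨u, fun j => ?_, ?_, hu, huM⟩
  · rw [hu0, hs 0 (Nat.zero_le _)]; simp
  · rw [hu0, hu1]; exact hu₁

namespace Disc

variable {g : Disc} {lam T x₀ : ℝ}

lemma exists_numericalSolution
    {step : ℝ → ℝ → ℝ → ℝ → ℝ → ℝ → (ℤ → ℂ) → (ℤ → ℂ) → (ℤ → ℂ) → Prop}
    (hstep : (step = LeapfrogStep ∧ g.σ = 0) ∨ (step = CrankNicolsonStep ∧ g.σ = 1 / 2))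
    {A : ℝ → ℂ} {U : ℕ → SeqSpace} (h0 : ∀ j : ℤ, U 0 j = A (x₀ + j * g.h))
    (hstart : ∀ j, g.startFn lam (U 0) (U 1) j = 0) (hU : g.Solves lam ⌊T / g.τ⌋₊ U) :
    ∃ p, IsNumericalSolution step g.κ lam g.w T g.ε g.τ g.h x₀ A p ∧ ∀ n j, ‖p n j‖ = ‖U n j‖ := by
  refine ⟨fun n j => U n j * g.phase x₀ n j, (isNumericalSolution_iff hstep (fun _ _ => rfl) A).2
    (isGridSolution_of_solves (f := fun j : ℤ => A (x₀ + j * g.h)) h0 ?_ hstart hU), fun n j => ?_⟩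
  · have := Nat.lt_floor_add_one (T / g.τ)
    rw [div_lt_iff₀ g.τ_pos] at this
    push_cast
    exact this
  · rw [norm_mul, norm_phase, mul_one]

/-- Elimination of the phase from a numerical solution. -/
lemma exists_gridSolution
    {step : ℝ → ℝ → ℝ → ℝ → ℝ → ℝ → (ℤ → ℂ) → (ℤ → ℂ) → (ℤ → ℂ) → Prop}
    (hstep : (step = LeapfrogStep ∧ g.σ = 0) ∨ (step = CrankNicolsonStep ∧ g.σ = 1 / 2))
    {A : ℝ → ℂ} {p : ℕ → ℤ → ℂ}
    (hp : IsNumericalSolution step g.κ lam g.w T g.ε g.τ g.h x₀ A p) (a : ℝ → ℝ → ℂ) : ∃ u : ℕ → ℤ → ℂ,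
    g.IsGridSolution lam T (fun j => A (x₀ + j * g.h)) u ∧ (∀ n j, ‖u n j‖ = ‖p n j‖) ∧
      ∀ n j, ‖p n j - dominantTerm g.κ (vartheta g.κ g.w) g.ε a (n * g.τ) (x₀ + j * g.h)‖
        = ‖u n j - a (n * g.τ) (x₀ + j * g.h)‖ := by
  have hpu : ∀ n j, p n j = p n j / g.phase x₀ n j * g.phase x₀ n j := fun n j =>
    (div_mul_cancel₀ _ (phase_ne_zero n j)).symm
  refine ⟨fun n j => p n j / g.phase x₀ n j, (isNumericalSolution_iff hstep hpu A).1 hp,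
    fun n j => ?_, fun n j => ?_⟩
  · rw [norm_div, norm_phase, div_one]
  · rw [dominantTerm_eq]
    nth_rw 1 [hpu]
    rw [← sub_mul, norm_mul, norm_phase, mul_one]

end Disc

/-- Existence and convergence for the weighted leapfrog scheme. -/
theorem leapfrog_convergence {κ w T M : ℝ} (lam R : ℝ) (hκ : κ ≠ 0) (hw2 : w ^ 2 = 1 + κ ^ 2) (hT : 0 < T)
    (hM : 0 ≤ M) : ∃ ε₀, 0 < ε₀ ∧ ε₀ ≤ 1 ∧ ∃ C,
      ∀ (a₀ b₀ : ℝ → ℂ) (a : ℝ → ℝ → ℂ), IsAmplitude κ lam w T M R a₀ b₀ a →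
      ∀ g : Disc, g.κ = κ → g.w = w → g.σ = 0 → g.CFL → g.ε ≤ ε₀ → ∀ x₀ : ℝ,
      (∃ p, IsNumericalSolution LeapfrogStep κ lam w T g.ε g.τ g.h x₀ (profile w a₀ b₀) p) ∧
      (∀ p, IsNumericalSolution LeapfrogStep κ lam w T g.ε g.τ g.h x₀ (profile w a₀ b₀) p →
        ∀ C', C ≤ C' → RemainderBound κ (vartheta κ w) T g.ε g.τ g.h x₀ C' a p) := by
  have hw1 : 1 ≤ |w| := by
    rw [← one_le_sq_iff_one_le_abs, hw2]; linarith [sq_nonneg κ]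
  have hw : w ≠ 0 := by rw [← abs_pos]; linarith
  obtain ⟨δ₁, hδ₁, hδ₁1, hδ₁K, hfine⟩ := exists_fine_solution (M := M) lam R hκ hw hT
  -- The step-size condition gives τ ≤ |w|h for ε, h ≤ 1. Hence h ≤ δ₁/|w| forces τ ≤ δ₁, and
  -- leapfrog needs no separate smallness of τ.
  obtain ⟨h₀, hh₀⟩ : ∃ h₀, h₀ = δ₁ / |w| := ⟨_, rfl⟩
  have hh₀0 : 0 < h₀ := by rw [hh₀]; positivity
  have hh₀1 : h₀ ≤ δ₁ := by rw [hh₀]; exact div_le_self hδ₁.le hw1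
  obtain ⟨L₀, hL₀⟩ : ∃ L₀, L₀ = Real.sqrt (2 * |R| / h₀ + 1) * M := ⟨_, rfl⟩
  have hL₀0 : 0 ≤ L₀ := by rw [hL₀]; positivity
  obtain ⟨δ₂, hδ₂, L, hcoarse⟩ := Disc.exists_coarse_leapfrog_solution lam hκ hw hT hh₀0 hL₀0
  obtain ⟨C₁, hC₁, herr⟩ := exists_error_bound (M := M) (K := M + 1) lam R hκ hw hT (by linarith)
  refine ⟨min δ₁ δ₂, lt_min hδ₁ hδ₂, (min_le_left _ _).trans hδ₁1, C₁ + (|L| + M) / h₀ ^ 2, ?_⟩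
  intro a₀ b₀ a ha g hgκ hgw hσ hg hgε x₀
  subst hgκ hgw
  have hτ := g.τ_pos
  have hε := g.ε_pos
  have hh := g.h_pos
  have hinit : ∀ ξ, a 0 ξ = profile g.w a₀ b₀ ξ := ha.nls.init
  obtain ⟨N, hN⟩ : ∃ N, N = ⌊T / g.τ⌋₊ := ⟨_, rfl⟩
  have hNT : N * g.τ ≤ T := by
    rw [← le_div_iff₀ hτ, hN]; exact Nat.floor_le (by positivity)
  have hd0 : 0 ≤ g.τ ^ 2 + g.h ^ 2 + g.ε := by positivity
  obtain ⟨C, hC⟩ : ∃ C, C = C₁ + (|L| + M) / h₀ ^ 2 := ⟨_, rfl⟩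
  have hC1 : C₁ ≤ C := by
    have : 0 ≤ (|L| + M) / h₀ ^ 2 := by positivity
    linarith
  have htime : ∀ n ≤ N, (n : ℝ) * g.τ ∈ Icc 0 T := fun n hn =>
    ⟨by positivity, le_trans (by gcongr) hNT⟩
  obtain ⟨U, hU0, hUs, hU, hUerr⟩ : ∃ U : ℕ → SeqSpace, (∀ j : ℤ, U 0 j = a 0 (x₀ + j * g.h)) ∧
      (∀ j, g.startFn lam (U 0) (U 1) j = 0) ∧ g.Solves lam N U ∧
      ∀ n ≤ N, ∀ j : ℤ, ‖U n j - a (n * g.τ) (x₀ + j * g.h)‖ ≤ C * (g.τ ^ 2 + g.h ^ 2 + g.ε) := by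
    -- If τ > T, only the initial level is compared, and it is exact.
    rcases Nat.eq_zero_or_pos N with hN0 | hN0
    · obtain ⟨y, hy, -⟩ := ha.exists_initial hT hM hh le_rfl x₀
      obtain ⟨u₁, hu₁, -, -⟩ := Disc.exists_start g lam y
      refine ⟨fun n => if n = 0 then y else u₁, hy, hu₁, fun k hk => by omega, fun n hn j => ?_⟩
      obtain rfl : n = 0 := by omega
      simp only [if_true]
      rw [hy, Nat.cast_zero, zero_mul, sub_self, norm_zero]
      exact mul_nonneg (hC₁.trans hC1) hd0
    rcases le_or_gt g.h h₀ with hhh | hhh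
    · have hτδ : g.τ ≤ δ₁ := by
        have hh1 : |g.w| * g.h ≤ δ₁ := by
          rw [hh₀, le_div_iff₀ (by positivity)] at hhh
          linarith
        rcases hg with h | h | h
        · rw [hσ] at h; norm_num at h
        · refine h.trans (le_trans ?_ hh1)
          rw [mul_right_comm]
          exact mul_le_of_le_one_right (by positivity) g.ε_le
        · have : |g.w| * g.h ^ 2 ≤ |g.w| * g.h := by
            gcongr
            exact pow_le_of_le_one hh.le ((hhh.trans hh₀1).trans hδ₁1) two_ne_zero
          linarith
      obtain ⟨U, h0, hs, hU, hUM⟩ := hfine a₀ b₀ a ha g rfl rfl hg (hhh.trans hh₀1) hτδ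
        (hgε.trans (min_le_left _ _)) x₀ N hN0 hNT
      refine ⟨U, h0, hs, hU, fun n hn j => ?_⟩
      refine (herr a₀ b₀ a ha g rfl rfl ((hhh.trans hh₀1).trans hδ₁1) hg (le_trans ?_ hδ₁K) x₀ N U hNT h0
        hs hU hUM n hn j).trans (by gcongr)
      gcongr
    -- On a coarse grid h² ≥ h₀², so a bound for the solution is already an error bound.
    · obtain ⟨y, hy, hyL⟩ := ha.exists_initial hT hM hh₀0 hhh.le x₀
      rw [← hL₀] at hyL
      obtain ⟨u₁, hu₁, -, hu₁'⟩ := Disc.exists_start g lam y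
      obtain ⟨k, rfl⟩ : ∃ k, N = k + 1 := ⟨N - 1, by omega⟩
      obtain ⟨U, h0, h1, hU, hUL⟩ := hcoarse g rfl rfl hσ hhh.le (hgε.trans (min_le_right _ _)) hg y u₁
        hyL hu₁' k hNT
      refine ⟨U, by rwa [h0], by rwa [h0, h1], hU, fun n hn j => ?_⟩
      have e1 : ‖U n j‖ ≤ |L| := (norm_apply_le _ _).trans ((hUL n hn).trans (le_abs_self _))
      have e2 := ha.norm_le (htime n hn) (x₀ + j * g.h)
      have e3 : h₀ ^ 2 ≤ g.τ ^ 2 + g.h ^ 2 + g.ε := by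
        have : h₀ ^ 2 ≤ g.h ^ 2 := by gcongr
        linarith [sq_nonneg g.τ]
      calc _ ≤ |L| + M := (norm_sub_le _ _).trans (add_le_add e1 e2)
        _ = (|L| + M) / h₀ ^ 2 * h₀ ^ 2 := by field_simp
        _ ≤ C * (g.τ ^ 2 + g.h ^ 2 + g.ε) :=
          mul_le_mul (by rw [hC]; linarith) e3 (by positivity) (hC₁.trans hC1)
  constructor
  · obtain ⟨p, hp, -⟩ := Disc.exists_numericalSolution (x₀ := x₀) (T := T) (Or.inl ⟨rfl, hσ⟩)
      (A := profile g.w a₀ b₀) (fun j => (hU0 j).trans (hinit _)) hUs (by rwa [← hN])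
    exact ⟨p, hp⟩
  · intro p hp C' hC' n hn j
    obtain ⟨u, hu, -, hpu⟩ := Disc.exists_gridSolution (Or.inl ⟨rfl, hσ⟩) hp a
    rw [hpu]
    obtain ⟨V, hV0, hVs, hVu, hV⟩ := hu.exists_solves hg hNT (U 0)
      (fun j => (hU0 j).trans (hinit _)) (Or.inl hσ)
    have hnN : n ≤ N := by
      rw [hN]; refine Nat.le_floor ?_
      rwa [le_div_iff₀ hτ]
    -- An arbitrary numerical solution is square summable and therefore coincides with the one
    -- constructed above.
    rw [← hVu n hnN, Disc.solves_unique hg hσ hV0 hVs hUs hV hU hnN]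
    refine (hUerr n hnN j).trans ?_
    rw [← hC] at hC'
    gcongr

/-- Existence of bounded solutions of the weighted Crank–Nicolson scheme. -/
theorem crankNicolson_exists {κ w T M : ℝ} (lam R : ℝ) (hκ : κ ≠ 0) (hw : w ≠ 0) (hT : 0 < T)
    (hM : 0 ≤ M) : ∃ ε₀, 0 < ε₀ ∧ ε₀ ≤ 1 ∧ ∃ K τ₀, 0 < τ₀ ∧
      ∀ (a₀ b₀ : ℝ → ℂ) (a : ℝ → ℝ → ℂ), IsAmplitude κ lam w T M R a₀ b₀ a →
      ∀ g : Disc, g.κ = κ → g.w = w → g.σ = 1 / 2 → g.ε ≤ ε₀ → g.τ ≤ τ₀ → ∀ x₀ : ℝ,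
      ∃ p, IsNumericalSolution CrankNicolsonStep κ lam w T g.ε g.τ g.h x₀ (profile w a₀ b₀) p ∧
        ∀ K', K ≤ K' → BoundedBy K' T g.τ p := by
  obtain ⟨δ₁, hδ₁, hδ₁1, -, hfine⟩ := exists_fine_solution (M := M) lam R hκ hw hT
  obtain ⟨L₀, hL₀⟩ : ∃ L₀, L₀ = Real.sqrt (2 * |R| / δ₁ + 1) * M := ⟨_, rfl⟩
  have hL₀0 : 0 ≤ L₀ := by rw [hL₀]; positivity
  obtain ⟨δ₂, hδ₂, hcoarse⟩ := Disc.exists_coarse_solution lam hκ hw hT hδ₁ hL₀0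
  have hmin : 0 < min δ₁ δ₂ := lt_min hδ₁ hδ₂
  -- Taking τ₀ ≤ T guarantees at least one time step, as both constructions require.
  refine ⟨min δ₁ δ₂, hmin, (min_le_left _ _).trans hδ₁1, max (M + 1) (L₀ + 2), min (min δ₁ δ₂) T,
    lt_min hmin hT, ?_⟩
  intro a₀ b₀ a ha g hgκ hgw hσ hgε hgτ x₀
  subst hgκ hgw
  have hg : g.CFL := Or.inl hσ
  have hτ := g.τ_pos
  have hh := g.h_pos
  have hinit : ∀ ξ, a 0 ξ = profile g.w a₀ b₀ ξ := ha.nls.init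
  obtain ⟨N, hN⟩ : ∃ N, N = ⌊T / g.τ⌋₊ := ⟨_, rfl⟩
  have hNT : N * g.τ ≤ T := by
    rw [← le_div_iff₀ hτ, hN]; exact Nat.floor_le (by positivity)
  have hN0 : 1 ≤ N := by
    rw [hN]; refine Nat.le_floor ?_
    rw [Nat.cast_one, one_le_div hτ]
    exact hgτ.trans (min_le_right _ _)
  have hτδ := hgτ.trans (min_le_left _ _)
  obtain ⟨U, hU0, hUs, hU, hUK⟩ : ∃ U : ℕ → SeqSpace, (∀ j : ℤ, U 0 j = a 0 (x₀ + j * g.h)) ∧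
      (∀ j, g.startFn lam (U 0) (U 1) j = 0) ∧ g.Solves lam N U ∧
      ∀ n ≤ N, ∀ j : ℤ, ‖U n j‖ ≤ max (M + 1) (L₀ + 2) := by
    rcases le_total g.h δ₁ with hhh | hhh
    · obtain ⟨U, h0, hs, hU, hUM⟩ := hfine a₀ b₀ a ha g rfl rfl hg hhh (hτδ.trans (min_le_left _ _))
        (hgε.trans (min_le_left _ _)) x₀ N hN0 hNT
      exact ⟨U, h0, hs, hU, fun n hn j => (hUM n hn j).trans (le_max_left _ _)⟩
    · obtain ⟨y, hy, hyL⟩ := ha.exists_initial hT hM hδ₁ hhh x₀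
      rw [← hL₀] at hyL
      obtain ⟨u₁, hu₁, -, hu₁'⟩ := Disc.exists_start g lam y
      obtain ⟨k, rfl⟩ : ∃ k, N = k + 1 := ⟨N - 1, by omega⟩
      obtain ⟨U, h0, h1, hU, hUL⟩ := hcoarse g rfl rfl hhh (hτδ.trans (min_le_right _ _))
        (hgε.trans (min_le_right _ _)) hg y u₁ hyL hu₁' k hNT
      exact ⟨U, by rwa [h0], by rwa [h0, h1], hU, fun n hn j =>
        ((norm_apply_le _ _).trans (hUL n hn)).trans (le_max_right _ _)⟩
  obtain ⟨p, hp, hpU⟩ := Disc.exists_numericalSolution (x₀ := x₀) (T := T) (Or.inr ⟨rfl, hσ⟩)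
    (A := profile g.w a₀ b₀) (fun j => (hU0 j).trans (hinit _)) hUs (by rwa [← hN])
  refine ⟨p, hp, fun K' hK' n hn j => ?_⟩
  rw [hpU]
  refine (hUK n ?_ j).trans hK'
  rw [hN]; refine Nat.le_floor ?_
  rwa [le_div_iff₀ hτ]

/-- Convergence of bounded solutions of the weighted Crank–Nicolson scheme. -/
theorem crankNicolson_convergence {κ w T M : ℝ} (lam R K : ℝ) (hκ : κ ≠ 0) (hw : w ≠ 0) (hT : 0 < T)
    (hM : 0 ≤ M) : ∃ C, ∀ (a₀ b₀ : ℝ → ℂ) (a : ℝ → ℝ → ℂ), IsAmplitude κ lam w T M R a₀ b₀ a →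
      ∀ g : Disc, g.κ = κ → g.w = w → g.σ = 1 / 2 → ∀ x₀ : ℝ,
      ∀ p, IsNumericalSolution CrankNicolsonStep κ lam w T g.ε g.τ g.h x₀ (profile w a₀ b₀) p →
        BoundedBy K T g.τ p → ∀ C', C ≤ C' → RemainderBound κ (vartheta κ w) T g.ε g.τ g.h x₀ C' a p := by
  -- B dominates the numerical solution, the amplitude and their difference.
  obtain ⟨B, hB⟩ : ∃ B, B = |K| + M := ⟨_, rfl⟩
  have hB0 : 0 ≤ B := by rw [hB]; positivity
  obtain ⟨C₁, hC₁, herr⟩ := exists_error_bound (M := M) (K := B) lam R hκ hw hT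
    (by rw [hB]; linarith [abs_nonneg K])
  obtain ⟨c, hc⟩ : ∃ c, c = |κ / w| := ⟨_, rfl⟩
  have hc0 : 0 < c := by rw [hc]; positivity
  -- For τ ≤ δ both 60|λ|B²τ ≤ c, as the error bound needs, and |λ|B² < m, as membership in ℓ²
  -- needs. The summand 1 makes the latter strict.
  obtain ⟨δ, hδ⟩ : ∃ δ, δ = c / (60 * |lam| * B ^ 2 + 1) := ⟨_, rfl⟩
  have hδ0 : 0 < δ := by rw [hδ]; positivity
  refine ⟨C₁ + B * (1 + 1 / δ ^ 2), ?_⟩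
  intro a₀ b₀ a ha g hgκ hgw hσ x₀ p hp hpK C' hC' n hn j
  subst hgκ hgw
  have hg : g.CFL := Or.inl hσ
  have hτ := g.τ_pos
  have hε := g.ε_pos
  have hh := g.h_pos
  have hinit : ∀ ξ, a 0 ξ = profile g.w a₀ b₀ ξ := ha.nls.init
  have hd0 : 0 ≤ g.τ ^ 2 + g.h ^ 2 + g.ε := by positivity
  obtain ⟨u, hu, hup, hpu⟩ := Disc.exists_gridSolution (Or.inr ⟨rfl, hσ⟩) hp a
  have huB : ∀ k : ℕ, (k : ℝ) * g.τ ≤ T → ∀ j, ‖u k j‖ ≤ |K| := fun k hk j => by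
    rw [hup]; exact (hpK k hk j).trans (le_abs_self K)
  have hKB : |K| ≤ B := by rw [hB]; linarith
  rw [hpu]
  -- Otherwise τ² + h² + ε is bounded below, and the bound B of the difference suffices.
  by_cases hcase : g.h ≤ 1 ∧ g.τ ≤ δ
  · obtain ⟨hh1, hτδ⟩ := hcase
    have hsmall : (60 * |lam| * B ^ 2 + 1) * g.τ ≤ c := by
      rw [hδ, le_div_iff₀ (by positivity)] at hτδ
      linarith
    obtain ⟨y, hy, -⟩ := ha.exists_initial hT hM hh le_rfl x₀
    have hle : ∀ k ≤ n, (k : ℝ) * g.τ ≤ T := fun k hk => by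
      refine le_trans ?_ hn
      gcongr
    obtain ⟨V, hV0, hVs, hVu, hV⟩ := hu.exists_solves hg hn y (fun j => (hy j).trans (hinit _))
      (Or.inr ⟨B, fun k hk j => (huB k (hle k hk) j).trans hKB, by
        refine lt_of_mul_lt_mul_right ?_ hτ.le
        rw [g.m_mul_τ, ← hc]
        have : 0 ≤ |lam| * B ^ 2 * g.τ := by positivity
        linarith⟩)
    rw [← hVu n le_rfl]
    refine (herr a₀ b₀ a ha g rfl rfl hh1 hg (by rw [← hc]; linarith) x₀ n V hn
      (fun j => by rw [hV0, hy]) hVs hV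
      (fun k hk j => by rw [hVu k hk]; exact (huB k (hle k hk) j).trans hKB) n le_rfl j).trans ?_
    gcongr
    have : 0 ≤ B * (1 + 1 / δ ^ 2) := by positivity
    linarith
  · have e1 : ‖u n j - a (n * g.τ) (x₀ + j * g.h)‖ ≤ B := by
      rw [hB]
      exact (norm_sub_le _ _).trans (add_le_add (huB n hn j) (ha.norm_le ⟨by positivity, hn⟩ _))
    have e2 : 1 ≤ (1 + 1 / δ ^ 2) * (g.τ ^ 2 + g.h ^ 2 + g.ε) := by
      have hx : 0 ≤ 1 / δ ^ 2 * (g.h ^ 2 + g.ε) := by positivity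
      rw [not_and_or, not_le, not_le] at hcase
      rcases hcase with h | h
      · have h1 : 1 ≤ g.h ^ 2 := one_le_pow₀ h.le
        have h2 : 0 ≤ 1 / δ ^ 2 * g.τ ^ 2 := by positivity
        linarith [sq_nonneg g.τ]
      · have h1 : 1 ≤ 1 / δ ^ 2 * g.τ ^ 2 := by
          rw [one_div_mul_eq_div, one_le_div (by positivity)]
          gcongr
        linarith [sq_nonneg g.τ, sq_nonneg g.h]
    calc _ ≤ B * 1 := by rw [mul_one]; exact e1
      _ ≤ B * ((1 + 1 / δ ^ 2) * (g.τ ^ 2 + g.h ^ 2 + g.ε)) := by gcongr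
      _ = B * (1 + 1 / δ ^ 2) * (g.τ ^ 2 + g.h ^ 2 + g.ε) := by ring
      _ ≤ _ := by gcongr; linarith

end Convergence


/-! ### The theorem for both signs of the frequency -/

lemma freq_sq (κ : ℝ) : freq κ ^ 2 = 1 + κ ^ 2 := Real.sq_sqrt (by positivity)

lemma freq_pos (κ : ℝ) : 0 < freq κ := Real.sqrt_pos.2 (by positivity)

lemma vartheta_neg (κ w : ℝ) : vartheta κ (-w) = -vartheta κ w := by
  unfold vartheta groupVel
  rw [div_neg]
  ring

lemma HasBoundedDerivs.mono {N : ℕ} {M M' T : ℝ} {a : ℝ → ℝ → ℂ} (ha : HasBoundedDerivs N M T a)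
    (h : M ≤ M') : HasBoundedDerivs N M' T a :=
  ⟨ha.1, fun k hk z hz => (ha.2 k hk z hz).trans h⟩

namespace IsData

variable {κ lam T M R : ℝ} {a₀ b₀ : ℝ → ℂ} {aplus aminus : ℝ → ℝ → ℂ}

lemma amplitude_plus (h : IsData κ lam T 20 M R a₀ b₀ aplus aminus) :
    IsAmplitude κ lam (freq κ) T |M| R a₀ b₀ aplus :=
  ⟨h.supp_a, h.supp_b, h.nls_plus, h.bdd_plus.mono (le_abs_self M)⟩

lemma amplitude_minus (h : IsData κ lam T 20 M R a₀ b₀ aplus aminus) :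
    IsAmplitude κ lam (-freq κ) T |M| R a₀ b₀ aminus :=
  ⟨h.supp_a, h.supp_b, h.nls_minus, h.bdd_minus.mono (le_abs_self M)⟩

end IsData

theorem theorem1 :
    ∃ N : ℕ, 2 ≤ N ∧ ∀ κ lam T M R : ℝ, κ ≠ 0 → lam ≠ 0 → 0 < T →
      ∃ ε₀ : ℝ, 0 < ε₀ ∧ ε₀ ≤ 1 ∧
      -- weighted leapfrog scheme
      (∃ C : ℝ, ∀ (a₀ b₀ : ℝ → ℂ) (aplus aminus : ℝ → ℝ → ℂ),
        IsData κ lam T N M R a₀ b₀ aplus aminus →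
        ∀ x₀ ε τ h : ℝ, 0 < ε → ε ≤ ε₀ → 0 < τ → 0 < h → StabilityCondition κ ε τ h →
          (∃ p, IsNumericalSolution LeapfrogStep κ lam (freq κ) T ε τ h x₀
            (profile (freq κ) a₀ b₀) p) ∧
          (∃ q, IsNumericalSolution LeapfrogStep κ lam (-freq κ) T ε τ h x₀
            (profile (-freq κ) a₀ b₀) q) ∧
          (∀ p, IsNumericalSolution LeapfrogStep κ lam (freq κ) T ε τ h x₀
              (profile (freq κ) a₀ b₀) p →
            RemainderBound κ (vartheta κ (freq κ)) T ε τ h x₀ C aplus p) ∧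
          (∀ q, IsNumericalSolution LeapfrogStep κ lam (-freq κ) T ε τ h x₀
              (profile (-freq κ) a₀ b₀) q →
            RemainderBound κ (-vartheta κ (freq κ)) T ε τ h x₀ C aminus q)) ∧
      -- weighted Crank–Nicolson scheme: existence of uniformly bounded numerical solutions
      (∃ K τ₀ : ℝ, 0 < τ₀ ∧ ∀ (a₀ b₀ : ℝ → ℂ) (aplus aminus : ℝ → ℝ → ℂ),
        IsData κ lam T N M R a₀ b₀ aplus aminus →
        ∀ x₀ ε τ h : ℝ, 0 < ε → ε ≤ ε₀ → 0 < τ → τ ≤ τ₀ → 0 < h →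
          (∃ p, IsNumericalSolution CrankNicolsonStep κ lam (freq κ) T ε τ h x₀
            (profile (freq κ) a₀ b₀) p ∧ BoundedBy K T τ p) ∧
          (∃ q, IsNumericalSolution CrankNicolsonStep κ lam (-freq κ) T ε τ h x₀
            (profile (-freq κ) a₀ b₀) q ∧ BoundedBy K T τ q)) ∧
      -- weighted Crank–Nicolson scheme: the error bound, without step-size restriction
      (∀ K : ℝ, ∃ C : ℝ, ∀ (a₀ b₀ : ℝ → ℂ) (aplus aminus : ℝ → ℝ → ℂ),
        IsData κ lam T N M R a₀ b₀ aplus aminus →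
        ∀ x₀ ε τ h : ℝ, 0 < ε → ε ≤ 1 → 0 < τ → 0 < h →
          (∀ p, IsNumericalSolution CrankNicolsonStep κ lam (freq κ) T ε τ h x₀
              (profile (freq κ) a₀ b₀) p → BoundedBy K T τ p →
            RemainderBound κ (vartheta κ (freq κ)) T ε τ h x₀ C aplus p) ∧
          (∀ q, IsNumericalSolution CrankNicolsonStep κ lam (-freq κ) T ε τ h x₀
              (profile (-freq κ) a₀ b₀) q → BoundedBy K T τ q →
            RemainderBound κ (-vartheta κ (freq κ)) T ε τ h x₀ C aminus q)) := by
  -- The order 20 is the one required by `exists_approx`. The bound M is replaced by |M| to make it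
  -- nonnegative, and the two signs of the frequency are two instances of the same results.
  refine ⟨20, by norm_num, fun κ lam T M R hκ _ hT => ?_⟩
  obtain ⟨εp, hεp, hεp1, Cp, hlfp⟩ := leapfrog_convergence lam R hκ (freq_sq κ) hT (abs_nonneg M)
  obtain ⟨εm, hεm, hεm1, Cm, hlfm⟩ := leapfrog_convergence (w := -freq κ) lam R hκ
    (by rw [neg_sq, freq_sq]) hT (abs_nonneg M)
  obtain ⟨δp, hδp, hδp1, Kp, τp, hτp, hcnp⟩ := crankNicolson_exists lam R hκ (freq_pos κ).ne' hT
    (abs_nonneg M)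
  obtain ⟨δm, hδm, hδm1, Km, τm, hτm, hcnm⟩ := crankNicolson_exists lam R hκ
    (neg_ne_zero.2 (freq_pos κ).ne') hT (abs_nonneg M)
  have hfreq : |freq κ| = freq κ := abs_of_pos (freq_pos κ)
  refine ⟨min (min εp εm) (min δp δm), by positivity,
    (min_le_left _ _).trans ((min_le_left _ _).trans hεp1), ?_, ?_, ?_⟩
  · refine ⟨max Cp Cm, fun a₀ b₀ aplus aminus hdata x₀ ε τ h hε hε₀ hτ hh hstab => ?_⟩
    have hε1 : ε ≤ 1 := hε₀.trans ((min_le_left _ _).trans ((min_le_left _ _).trans hεp1))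
    let gp : Disc := ⟨κ, freq κ, ε, τ, h, 0, hκ, freq_sq κ, hε, hε1, hτ, hh, Or.inl rfl⟩
    let gm : Disc := ⟨κ, -freq κ, ε, τ, h, 0, hκ, by rw [neg_sq, freq_sq], hε, hε1, hτ, hh, Or.inl rfl⟩
    have hp := hlfp a₀ b₀ aplus hdata.amplitude_plus gp rfl rfl rfl
      (Disc.cfl_of_stability hfreq hstab)
      (hε₀.trans ((min_le_left _ _).trans (min_le_left _ _))) x₀
    have hm := hlfm a₀ b₀ aminus hdata.amplitude_minus gm rfl rfl rfl
      (Disc.cfl_of_stability ((abs_neg _).trans hfreq) hstab)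
      (hε₀.trans ((min_le_left _ _).trans (min_le_right _ _))) x₀
    refine ⟨hp.1, hm.1, fun p h => hp.2 p h _ (le_max_left _ _), fun q h => ?_⟩
    rw [← vartheta_neg]
    exact hm.2 q h _ (le_max_right _ _)
  · refine ⟨max Kp Km, min τp τm, lt_min hτp hτm,
      fun a₀ b₀ aplus aminus hdata x₀ ε τ h hε hε₀ hτ hτ₀ hh => ?_⟩
    have hε1 : ε ≤ 1 := hε₀.trans ((min_le_left _ _).trans ((min_le_left _ _).trans hεp1))
    let gp : Disc := ⟨κ, freq κ, ε, τ, h, 1 / 2, hκ, freq_sq κ, hε, hε1, hτ, hh, Or.inr rfl⟩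
    let gm : Disc := ⟨κ, -freq κ, ε, τ, h, 1 / 2, hκ, by rw [neg_sq, freq_sq], hε, hε1, hτ, hh,
      Or.inr rfl⟩
    obtain ⟨p, hp, hpK⟩ := hcnp a₀ b₀ aplus hdata.amplitude_plus gp rfl rfl rfl
      (hε₀.trans ((min_le_right _ _).trans (min_le_left _ _))) (hτ₀.trans (min_le_left _ _)) x₀
    obtain ⟨q, hq, hqK⟩ := hcnm a₀ b₀ aminus hdata.amplitude_minus gm rfl rfl rfl
      (hε₀.trans ((min_le_right _ _).trans (min_le_right _ _))) (hτ₀.trans (min_le_right _ _)) x₀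
    exact ⟨⟨p, hp, hpK _ (le_max_left _ _)⟩, ⟨q, hq, hqK _ (le_max_right _ _)⟩⟩
  · intro K
    obtain ⟨Cp, hcp⟩ := crankNicolson_convergence lam R K hκ (freq_pos κ).ne' hT (abs_nonneg M)
    obtain ⟨Cm, hcm⟩ := crankNicolson_convergence lam R K hκ (neg_ne_zero.2 (freq_pos κ).ne') hT
      (abs_nonneg M)
    refine ⟨max Cp Cm, fun a₀ b₀ aplus aminus hdata x₀ ε τ h hε hε1 hτ hh => ?_⟩
    let gp : Disc := ⟨κ, freq κ, ε, τ, h, 1 / 2, hκ, freq_sq κ, hε, hε1, hτ, hh, Or.inr rfl⟩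
    let gm : Disc := ⟨κ, -freq κ, ε, τ, h, 1 / 2, hκ, by rw [neg_sq, freq_sq], hε, hε1, hτ, hh,
      Or.inr rfl⟩
    refine ⟨fun p hp hpK => hcp a₀ b₀ aplus hdata.amplitude_plus gp rfl rfl rfl x₀ p hp hpK _
      (le_max_left _ _), fun q hq hqK => ?_⟩
    rw [← vartheta_neg]
    exact hcm a₀ b₀ aminus hdata.amplitude_minus gm rfl rfl rfl x₀ q hq hqK _ (le_max_right _ _)
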